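/- Let $u\ge 1$. **Letters and weights.** Let ${\bf B}=\{\cdots<\overline 2<\overline 1<1<2<\cdots\}$ with $|\overline k|=0$, $|k|=1$ $(k\geq 1)$, and $I=\{\dots,\overline 2,\overline 1,0,1,2,\dots\}$. Let $\mathfrak g$ be the infinite rank Lie superalgebra with weight lattice $P=\mathbb Z\Lambda\oplus\bigoplus_{b\in{\bf B}}\mathbb Z\epsilon_b$, simple roots $\alpha_{\overline k}=\epsilon_{\overline{k+1}}-\epsilon_{\overline k}$, $\alpha_0=\epsilon_{\overline 1}-\epsilon_1$, $\alpha_k=\epsilon_k-\epsilon_{k+1}$ and simple coroots $h_{\overline k}=\epsilon_{\overline{k+1}}^\vee-\epsilon_{\overline k}^\vee$, $h_0=\Lambda^\vee+\epsilon_{\overline 1}^\vee+\epsilon_1^\vee$, $h_k=\epsilon_k^\vee-\epsilon_{k+1}^\vee$ (in the dual basis). Put ${\bf B}_u=\{\overline u<\cdots<\overline 1\}$, the letters of $\mathfrak{gl}_u$, whose simple roots are $\alpha_{\overline k}$, $1\le k<u$; ${\bf B}_u^\vee=\{-\overline 1<\cdots<-\overline u\}$ is the dual crystal of ${\bf B}_u$.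 **Crystals.** A crystal is a set $B$ with maps ${\rm wt}$, $\varepsilon_i,\varphi_i:B\to\mathbb Z_{\ge0}$, $e_i,f_i:B\to B\sqcup\{0\}$ such that: $\varphi_i(b)-\varepsilon_i(b)=\langle h_i,{\rm wt}(b)\rangle$ for $i\ne0$; $\langle h_0,{\rm wt}(b)\rangle\ge0$, and $\varphi_0(b)+\varepsilon_0(b)$ is $0$ or $1$ according to whether this number is $0$ or positive; $e_i$ (resp. $f_i$) changes $\varepsilon_i,\varphi_i,{\rm wt}$ by $-1,+1,+\alpha_i$ (resp. $+1,-1,-\alpha_i$) when its value is not $0$; and $f_ib=b'\Leftrightarrow e_ib'=b$. The letters form the crystals $\cdots\overline 2\xrightarrow{\overline 1}\overline 1\xrightarrow{0}1\xrightarrow{1}2\cdots$ and $\overline u\xrightarrow{\overline{u-1}}\cdots\xrightarrow{\overline1}\overline 1$. Words are tensor products of letters, under the following rule: $e_i(b_1\otimes b_2)=e_ib_1\otimes b_2$ iff $\varphi_i(b_1)\ge\varepsilon_i(b_2)$ for $i=\overline k$, iff $\varphi_i(b_2)<\varepsilon_i(b_1)$ for $i=k\geq 1$, iff $\langle h_0,{\rm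 wt}(b_1)\rangle>0$ for $i=0$, and otherwise $b_1\otimes e_ib_2$; $f_i(b_1\otimes b_2)=f_ib_1\otimes b_2$ iff $\varphi_i(b_1)>\varepsilon_i(b_2)$, resp. $\varphi_i(b_2)\le\varepsilon_i(b_1)$, resp. $\langle h_0,{\rm wt}(b_1)\rangle>0$, and otherwise $b_1\otimes f_ib_2$; weights add up, and $\varepsilon_i,\varphi_i$ are the largest numbers of times that $e_i,f_i$ can be applied without reaching $0$. A $(\mathfrak g,\mathfrak{gl}_u)$-bicrystal is a set that is a crystal for both algebras, the operators of one commuting with those of the other on the set together with $0$. Isomorphisms are bijections that commute with all $e_i,f_i$ and preserve ${\rm wt},\varepsilon_i,\varphi_i$. Two elements of crystals are equivalent if some isomorphism of their connected components sends one to the other. **The Fock crystal.** $\mathscr F$ is the set of semi-infinite words $w=\cdots w_3w_2w_1$ in ${\bf B}$ with $w_{i+1}\le w_i$, with $|w_i|=1$ if $w_{i+1}=w_i$, and with $w_i=\overline{i+c}$ for $i\gg1$ and some $c\in\mathbb Z$, the charge of $w$. The operators $e_i,f_i$ act on $w$ as on the finite words $w_M\cdots w_1$ for large $M$; ${\rm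 wt}(w)=\Lambda+\sum_b(\#\{k: w_k=b\}-\delta_{|b|0})\epsilon_b$, and $\varepsilon_i,\varphi_i$ are the largest exponents $k$ with $e_i^kw\ne0$, $f_i^kw\neq 0$. **The matrix model.** $\mathscr M^u$ is the set of matrices $A=(a_{bb'})_{b\in{\bf B},b'\in{\bf B}_u}$ with entries in $\mathbb Z_{\ge0}$, $a_{bb'}\le1$ if $|b|=0$, $a_{bb'}=1$ for $b\ll\overline 1$ and $a_{bb'}=0$ for $b\gg1$. For large $m,n$ read the entries of $A$ in the rows $\overline m,\dots,n$ in two ways, the position $(b,b')$ being repeated $a_{bb'}$ times. (i) Read the columns in increasing order of $b'$, each in increasing order of $b$; $e_i,f_i$ $(i\in I)$ act on the resulting word of row indices. (ii) Read the rows in decreasing order of $b$, each in increasing (decreasing) order of $b'$ if $|b|=0$ (if $|b|=1$); $e_j^*,f_j^*$ ($j=\overline{u-1},\dots,\overline 1$) act on the resulting word of column indices. Moreover ${\rm wt}(A)=u\Lambda+\sum_b\bigl(\sum_{b'}(a_{bb'}-\delta_{|b|0})\bigr)\epsilon_b$, ${\rm wt}^*(A)=\sum_{b'}\bigl(\sum_b(a_{bb'}-\delta_{|b|0})\bigr)\epsilon_{b'}$,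 and $\varepsilon,\varphi,\varepsilon^*,\varphi^*$ are the largest exponents as before. **Tableaux.** Let $\mathbb Z^u_+$ be the set of $\lambda\in\mathbb Z^u$ with $\lambda_1\ge\cdots\ge\lambda_u$, and $\lambda^*=(-\lambda_u,\dots,-\lambda_1)$. ${\bf B}(\lambda)\subset\mathscr F^{\otimes u}$ is the set of $w^{(1)}\otimes\cdots\otimes w^{(u)}$ where $w^{(i)}$ has charge $\lambda_i$, $w^{(i)}_k\ge w^{(i+1)}_{k+\lambda_i-\lambda_{i+1}}$ for all $i<u$ and $k\geq 1$, and equality holds only if $|w^{(i)}_k|=0$. $H^\lambda\in{\bf B}(\lambda)$ has the components $w^{(i)}=\cdots\overline{\lambda_i+2}\;\overline{\lambda_i+1}$ if $\lambda_i\ge0$, and $w^{(i)}=\cdots\overline2\,\overline1$ followed by $|\lambda_i|$ letters $u-i+1$ if $\lambda_i<0$. For $\mu\in\mathbb Z^u_+$, ${\bf B}_u(\mu)$ is the set of rational semistandard tableaux of shape $\mu$: row $k$ has boxes in the columns $1,\dots,\mu_k$ if $\mu_k\geq 0$ and in the columns $\mu_k,\dots,-1$ if $\mu_k<0$; entries in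 positive (negative) columns are in ${\bf B}_u$ (in ${\bf B}_u^\vee$); rows increase weakly from left to right and columns strictly from top to bottom; and if $b_1<\cdots<b_s$ and $-b_1'<\cdots<-b_t'$ are the entries of the columns $1$ and $-1$, and ${\bf B}_u\setminus\{b_1',\dots,b_t'\}=\{b_1''<\cdots<b_{u-t}''\}$, then $b_i''\le b_i$ for $1\le i\le s$. It is a subset of a tensor power of ${\bf B}_u\oplus{\bf B}_u^\vee$ by reading the columns from right to left, each from top to bottom. $H_u^\mu\in{\bf B}_u(\mu)$ has all entries $\overline{u-k+1}$ in row $k$ of the positive columns, and the entries $-\overline1,-\overline2,\dots$ from top to bottom in each negative column. **The matrices $\mathscr A_\lambda$.** Let $\mu_i$ be the number of letters $i$ in $H^\lambda$ $(1\le i\le u)$, $\mu_{u+1}=0$ and $\nu_i=\mu_i-\mu_{i+1}$. For $k\ge1$, $0\le l<u$ the matrix $\mathscr A_\lambda\in\mathscr M^u$ has $a_{\overline k\,\overline{u-l}}=1$ if $\overline k$ occurs in the component $w^{(u-l)}$ of $H^\lambda$ and $0$ otherwise, and $a_{k\,\overline{u-l}}=\nu_{k+l}$ if $k+l\le u$ and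 $0$ otherwise. **Theorem.** The subsets ${\bf B}(\lambda)$ and ${\bf B}_u(\mu)$ together with $0$ are stable under the operators $e_i,f_i$ of the crystals that contain them. $\mathscr M^u$ is a $(\mathfrak g,\mathfrak{gl}_u)$-bicrystal, and $w^{(1)}\otimes\cdots\otimes w^{(u)}\mapsto(a_{bb'})$, where $a_{b\,\overline k}$ is the number of letters $b$ in $w^{(u-k+1)}$, is an isomorphism of $\mathfrak g$-crystals $\mathscr F^{\otimes u}\to\mathscr M^u$. Each $A\in\mathscr M^u$ is $\mathfrak g$-equivalent to a unique element $\mathscr P_1(A)$ of $\bigsqcup_{\lambda\in\mathbb Z^u_+}{\bf B}(\lambda)$ and $\mathfrak{gl}_u$-equivalent to a unique element $\mathscr P_2(A)$ of $\bigsqcup_{\mu\in\mathbb Z^u_+}{\bf B}_u(\mu)$; let $\varpi(A)=(\mathscr P_1(A),\mathscr P_2(A))$. Then $$\{A\in\mathscr M^u:\varpi(A)=(H^\lambda,H_u^\mu)\text{ for some }\lambda,\mu\in\mathbb Z^u_+\}=\{\mathscr A_\lambda:\lambda\in\mathbb Z^u_+\},$$ and $\varpi$ is an isomorphism of $(\mathfrak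 g,\mathfrak{gl}_u)$-bicrystals $$\varpi:\mathscr M^u\longrightarrow\bigoplus_{\lambda\in\mathbb Z^u_+}{\bf B}(\lambda)\times{\bf B}_u(\lambda^*),$$ where $\mathfrak g$ acts on the first factor and $\mathfrak{gl}_u$ on the second. -/

import Mathlib

open Filter

/-! ### Abstract crystals -/

/-- Simple roots and simple coroots of a (super) Lie algebra, with index set `I` and weight
lattice `P`. The value of `kind` tells which version of the crystal axioms and of the tensor
product rule is used for a simple root: `-1` for the roots `α_{k̄}`, `0` for the odd root `α_0`,
and `1` for the roots `α_k` with `k ≥ 1`. -/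
structure CartanDatum (I P : Type) [AddCommGroup P] where
  root : I → P
  coroot : I → P →+ ℤ
  kind : I → SignType

/-- The maps of a crystal; `none` is the formal symbol `0`. The axioms are in
`CrystalData.IsCrystal`. -/
structure CrystalData {I P : Type} [AddCommGroup P] (D : CartanDatum I P) (X : Type) where
  wt : X → P
  ε : I → X → ℕ
  φ : I → X → ℕ
  e : I → X → Option X
  f : I → X → Option X

namespace CrystalData

variable {I P : Type} [AddCommGroup P] {D : CartanDatum I P} {X Y : Type}

/-- The axioms of a crystal graph. -/
structure IsCrystal (C : CrystalData D X) : Prop where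
  even : ∀ i b, D.kind i ≠ 0 → (C.φ i b : ℤ) - C.ε i b = D.coroot i (C.wt b)
  odd_nonneg : ∀ i b, D.kind i = 0 → 0 ≤ D.coroot i (C.wt b)
  odd_zero : ∀ i b, D.kind i = 0 → D.coroot i (C.wt b) = 0 → C.φ i b + C.ε i b = 0
  odd_pos : ∀ i b, D.kind i = 0 → 0 < D.coroot i (C.wt b) → C.φ i b + C.ε i b = 1
  e_spec : ∀ i b b', C.e i b = some b' →
    C.ε i b = C.ε i b' + 1 ∧ C.φ i b' = C.φ i b + 1 ∧ C.wt b' = C.wt b + D.root i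
  f_spec : ∀ i b b', C.f i b = some b' →
    C.ε i b' = C.ε i b + 1 ∧ C.φ i b = C.φ i b' + 1 ∧ C.wt b' = C.wt b - D.root i
  f_iff_e : ∀ i b b', C.f i b = some b' ↔ C.e i b' = some b

/-- `ψ` is an isomorphism of crystals. -/
structure IsIso (C : CrystalData D X) (C' : CrystalData D Y) (ψ : X ≃ Y) : Prop where
  wt : ∀ b, C'.wt (ψ b) = C.wt b
  ε : ∀ i b, C'.ε i (ψ b) = C.ε i b
  φ : ∀ i b, C'.φ i (ψ b) = C.φ i b
  e : ∀ i b, C'.e i (ψ b) = (C.e i b).map ψ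
  f : ∀ i b, C'.f i (ψ b) = (C.f i b).map ψ

/-- The structure that the crystal `C` induces on `X` through an embedding `r : X → Y`. -/
noncomputable def comap (C : CrystalData D Y) (r : X → Y) : CrystalData D X where
  wt x := C.wt (r x)
  ε i x := C.ε i (r x)
  φ i x := C.φ i (r x)
  e i x := (C.e i (r x)).bind (Function.partialInv r)
  f i x := (C.f i (r x)).bind (Function.partialInv r)

/-- The image of `r : X → Y`, together with `0`, is stable under all `e_i` and `f_i`. -/
def Stable (C : CrystalData D Y) (r : X → Y) : Prop :=
  ∀ i x y, (C.e i (r x) = some y ∨ C.f i (r x) = some y) → y ∈ Set.range r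

/-- The connected component of `b` in the coloured oriented graph of a crystal. -/
def component (C : CrystalData D X) (b : X) : Set X :=
  {b' | Relation.EqvGen (fun x y => ∃ i, C.f i x = some y) b b'}

/-- `b` and `b'` are equivalent: some isomorphism between their components maps `b` to `b'`. -/
def Equivalent (C : CrystalData D X) (C' : CrystalData D Y) (b : X) (b' : Y) : Prop :=
  ∃ ψ : C.component b ≃ C'.component b',
    ψ ⟨b, Relation.EqvGen.refl b⟩ = ⟨b', Relation.EqvGen.refl b'⟩ ∧
    IsIso (C.comap Subtype.val) (C'.comap Subtype.val) ψ

/-- Direct sum. -/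
def sigma {ι : Type} {Z : ι → Type} (C : ∀ a, CrystalData D (Z a)) :
    CrystalData D (Σ a, Z a) where
  wt x := (C x.1).wt x.2
  ε i x := (C x.1).ε i x.2
  φ i x := (C x.1).φ i x.2
  e i x := ((C x.1).e i x.2).map (Sigma.mk x.1)
  f i x := ((C x.1).f i x.2).map (Sigma.mk x.1)

/-- The structure on `X × Y` that acts on the first factor only. -/
def onFst (C : CrystalData D X) (Y : Type) : CrystalData D (X × Y) where
  wt p := C.wt p.1
  ε i p := C.ε i p.1
  φ i p := C.φ i p.1
  e i p := (C.e i p.1).map (fun x => (x, p.2))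
  f i p := (C.f i p.1).map (fun x => (x, p.2))

/-- The structure on `X × Y` that acts on the second factor only. -/
def onSnd (C : CrystalData D Y) (X : Type) : CrystalData D (X × Y) where
  wt p := C.wt p.2
  ε i p := C.ε i p.2
  φ i p := C.φ i p.2
  e i p := (C.e i p.2).map (fun y => (p.1, y))
  f i p := (C.f i p.2).map (fun y => (p.1, y))

/-! A word `[b₁, b₂, …, b_r]` is `b₁ ⊗ (b₂ ⊗ (⋯ ⊗ b_r))`, with the tensor product rule of
crystals for superalgebras; the empty word is the trivial crystal. -/

def wordWt (C : CrystalData D X) (l : List X) : P := (l.map C.wt).sum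

def wordε (C : CrystalData D X) (i : I) : List X → ℕ
  | [] => 0
  | b :: l =>
    match D.kind i with
    | .neg => (max (C.ε i b : ℤ) (C.wordε i l - D.coroot i (C.wt b))).toNat
    | .pos => (max ((C.ε i b : ℤ) - D.coroot i (C.wordWt l)) (C.wordε i l)).toNat
    | .zero => if 0 < D.coroot i (C.wt b) then C.ε i b else C.wordε i l

def wordφ (C : CrystalData D X) (i : I) : List X → ℕ
  | [] => 0
  | b :: l =>
    match D.kind i with
    | .neg => (max ((C.φ i b : ℤ) + D.coroot i (C.wordWt l)) (C.wordφ i l)).toNat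
    | .pos => (max (C.φ i b : ℤ) (C.wordφ i l + D.coroot i (C.wt b))).toNat
    | .zero => if 0 < D.coroot i (C.wt b) then C.φ i b else C.wordφ i l

def wordE (C : CrystalData D X) (i : I) : List X → Option (List X)
  | [] => none
  | b :: l =>
    let left := (C.e i b).map (fun b' => b' :: l)
    let right := (C.wordE i l).map (fun l' => b :: l')
    match D.kind i with
    | .neg => if C.wordε i l ≤ C.φ i b then left else right
    | .pos => if C.wordφ i l < C.ε i b then left else right
    | .zero => if 0 < D.coroot i (C.wt b) then left else right

def wordF (C : CrystalData D X) (i : I) : List X → Option (List X)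
  | [] => none
  | b :: l =>
    let left := (C.f i b).map (fun b' => b' :: l)
    let right := (C.wordF i l).map (fun l' => b :: l')
    match D.kind i with
    | .neg => if C.wordε i l < C.φ i b then left else right
    | .pos => if C.wordφ i l ≤ C.ε i b then left else right
    | .zero => if 0 < D.coroot i (C.wt b) then left else right

/-- All tensor powers of a crystal, as the crystal of words in its elements. -/
def words (C : CrystalData D X) : CrystalData D (List X) where
  wt := C.wordWt
  ε := C.wordε
  φ := C.wordφ
  e := C.wordE
  f := C.wordF

end CrystalData

/-- A set with the structures of a crystal for two algebras is a bicrystal: both structures are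
crystals and their operators commute on the set together with `0`. -/
structure IsBicrystal {I P J Q X : Type} [AddCommGroup P] [AddCommGroup Q]
    {D : CartanDatum I P} {D' : CartanDatum J Q}
    (C : CrystalData D X) (C' : CrystalData D' X) : Prop where
  left : C.IsCrystal
  right : C'.IsCrystal
  ee : ∀ i j b, (C'.e j b).bind (C.e i) = (C.e i b).bind (C'.e j)
  ef : ∀ i j b, (C'.f j b).bind (C.e i) = (C.e i b).bind (C'.f j)
  fe : ∀ i j b, (C'.e j b).bind (C.f i) = (C.f i b).bind (C'.e j)
  ff : ∀ i j b, (C'.f j b).bind (C.f i) = (C.f i b).bind (C'.f j)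

/-- `max {k | op^k x ≠ 0}`. -/
noncomputable def maxIter {X : Type} (op : X → Option X) (x : X) : ℕ :=
  sSup {k | (fun o : Option X => o.bind op)^[k] (some x) ≠ none}

/-- The element `z` of `X ∪ {0}` with `res p z = op (res p x)` for all sufficiently large `p`,
where `res p 0 = 0`. -/
noncomputable def stableOp {J X Y : Type} (F : Filter J) (res : J → X → Y)
    (op : Y → Option Y) (x : X) : Option X :=
  Classical.epsilon fun z : Option X => ∀ᶠ p in F, op (res p x) = z.map (res p)

/-! ### The algebra `𝔤` and the letters

The ordered set `⋯ < 2̄ < 1̄ < 1 < 2 < ⋯` of letters is `ℤ`: the letter `k̄` is `-k` and the letter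
`k` is `k - 1`, for `k ≥ 1`. So the letters of degree `0` are the negative integers. The index set
`⋯, 2̄, 1̄, 0, 1, 2, ⋯` of the simple roots is `ℤ` too, with `k̄` being `-k`. Then
`α_i = ε_{i-1} - ε_i` for all `i`, and the arrow of colour `i` goes from `i - 1` to `i`. -/

/-- The weight `kΛ + ∑ m_b ε_b` is `(k, m)`. -/
abbrev GWeight : Type := ℤ × (ℤ →₀ ℤ)

noncomputable def gDatum : CartanDatum ℤ GWeight where
  root i := (0, Finsupp.single (i - 1) 1 - Finsupp.single i 1)
  coroot i :=
    { toFun := fun p => if i = 0 then p.1 + p.2 (-1) + p.2 0 else p.2 (i - 1) - p.2 i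
      map_zero' := by simp
      map_add' := by
        intro p q
        split_ifs <;> simp <;> ring }
  kind i := SignType.sign i

/-- The crystal of the natural representation of `𝔤`. -/
noncomputable def gLetters : CrystalData gDatum ℤ where
  wt b := (0, Finsupp.single b 1)
  ε i b := if b = i then 1 else 0
  φ i b := if b = i - 1 then 1 else 0
  e i b := if b = i then some (i - 1) else none
  f i b := if b = i - 1 then some i else none

/-! ### Semi-infinite words -/

/-- A semi-infinite word `⋯ w₃ w₂ w₁`; the letter `w_{k+1}` is `letter k`. -/
@[ext]
structure FockWord where
  letter : ℕ → ℤ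
  mono : ∀ k, letter (k + 1) ≤ letter k
  degree_of_eq : ∀ k, letter (k + 1) = letter k → 0 ≤ letter k
  exists_charge : ∃ c : ℤ, ∀ᶠ k : ℕ in atTop, letter k = -((k : ℤ) + 1 + c)

namespace FockWord

/-- The charge of `w` is `c`, that is, `w_k` is the letter with bar `k + c` for large `k`. -/
def HasCharge (w : FockWord) (c : ℤ) : Prop :=
  ∀ᶠ k : ℕ in atTop, w.letter k = -((k : ℤ) + 1 + c)

/-- The number of occurrences of the letter `b`. -/
noncomputable def occ (w : FockWord) (b : ℤ) : ℕ := {k | w.letter k = b}.ncard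

theorem finite_support (w : FockWord) :
    (Function.support fun b : ℤ => (w.occ b : ℤ) - if b < 0 then 1 else 0).Finite := by
  obtain ⟨c, hc⟩ := w.exists_charge
  obtain ⟨N, hN⟩ := eventually_atTop.1 hc
  have hanti : Antitone w.letter := antitone_nat_of_succ_le w.mono
  refine (Set.finite_Icc (min (-((N : ℤ) + 1 + c)) 0) (max (w.letter 0) 0)).subset ?_
  intro b hb
  rw [Function.mem_support] at hb
  by_contra hout
  apply hb
  rw [Set.mem_Icc, not_and_or, not_le, not_le] at hout
  rcases hout with h | h
  · have h1 : b < -((N : ℤ) + 1 + c) := lt_of_lt_of_le h (min_le_left _ _)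
    have h2 : b < 0 := lt_of_lt_of_le h (min_le_right _ _)
    have hset : {k | w.letter k = b} = {(-b - 1 - c).toNat} := by
      ext k
      simp only [Set.mem_ofPred_eq, Set.mem_singleton_iff]
      constructor
      · intro hk
        rcases le_total N k with hNk | hNk
        · have := hN k hNk
          omega
        · have h3 := hanti hNk
          have h4 := hN N le_rfl
          omega
      · intro hk
        have := hN k (by omega)
        omega
    simp [occ, hset, h2]
  · have h1 : w.letter 0 < b := lt_of_le_of_lt (le_max_left _ _) h
    have h2 : 0 < b := lt_of_le_of_lt (le_max_right _ _) h
    have hset : {k | w.letter k = b} = ∅ := by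
      ext k
      simp only [Set.mem_ofPred_eq, Set.mem_empty_iff_false, iff_false]
      have := hanti (Nat.zero_le k)
      omega
    simp [occ, hset, h2.le]

noncomputable def wt (w : FockWord) : GWeight :=
  (1, Finsupp.ofSupportFinite _ w.finite_support)

/-- The finite word `w_M ⋯ w₂ w₁`. -/
def trunc (M : ℕ) (w : FockWord) : List ℤ := ((List.range M).map w.letter).reverse

noncomputable def e (i : ℤ) : FockWord → Option FockWord :=
  stableOp atTop trunc (gLetters.words.e i)

noncomputable def f (i : ℤ) : FockWord → Option FockWord :=
  stableOp atTop trunc (gLetters.words.f i)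

end FockWord

/-- The crystal `ℱ` of semi-infinite words. -/
noncomputable def fockCrystal : CrystalData gDatum FockWord where
  wt := FockWord.wt
  ε i := maxIter (FockWord.e i)
  φ i := maxIter (FockWord.f i)
  e := FockWord.e
  f := FockWord.f

/-- The tensor power `ℱ^{⊗u}`; the function `w` is `w 0 ⊗ w 1 ⊗ ⋯ ⊗ w (u-1)`. -/
noncomputable def fockPower (u : ℕ) : CrystalData gDatum (Fin u → FockWord) :=
  fockCrystal.words.comap List.ofFn

/-! ### Semi-infinite semistandard tableaux -/

/-- Generalized partitions of length `u`. The part with number `i + 1` has the index `i`. -/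
abbrev GenPartition (u : ℕ) : Type := {lam : Fin u → ℤ // Antitone lam}

/-- `λ* = (-λ_u, …, -λ_1)`. -/
def GenPartition.star {u : ℕ} (lam : GenPartition u) : GenPartition u :=
  ⟨fun i => -lam.1 i.rev, fun _ _ h => neg_le_neg (lam.2 (Fin.rev_le_rev.2 h))⟩

/-- The set `B(λ)` of semi-infinite semistandard tableaux of charge `λ`. -/
def semiInfTableaux {u : ℕ} (lam : GenPartition u) : Set (Fin u → FockWord) :=
  {w | (∀ i, (w i).HasCharge (lam.1 i)) ∧
    ∀ i j : Fin u, (j : ℕ) = i + 1 → ∀ k : ℕ,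
      (w j).letter (k + (lam.1 i - lam.1 j).toNat) ≤ (w i).letter k ∧
      ((w i).letter k = (w j).letter (k + (lam.1 i - lam.1 j).toNat) → (w i).letter k < 0)}

noncomputable def semiInfCrystal {u : ℕ} (lam : GenPartition u) :
    CrystalData gDatum (semiInfTableaux lam) :=
  (fockPower u).comap Subtype.val

/-- The component with index `i` of `H^λ`: it is `⋯ 2̄ 1̄` followed by `|λ_i|` letters
`u - i` if `λ_i < 0`, and the word `⋯ \overline{λ_i+2} \overline{λ_i+1}` otherwise. -/
def highestWord {u : ℕ} (lam : GenPartition u) (i : Fin u) : FockWord where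
  letter k := if (k : ℤ) + 1 + lam.1 i ≤ 0 then (u : ℤ) - 1 - i else -((k : ℤ) + 1 + lam.1 i)
  mono k := by
    have := i.2
    push_cast
    split_ifs <;> omega
  degree_of_eq k := by
    have := i.2
    push_cast
    split_ifs <;> omega
  exists_charge := by
    refine ⟨lam.1 i, eventually_atTop.2 ⟨(-lam.1 i).toNat, fun k hk => ?_⟩⟩
    rw [if_neg]
    omega

/-- The highest weight tableau `H^λ` in `B(λ)`. -/
def highestSemiInf {u : ℕ} (lam : GenPartition u) : semiInfTableaux lam :=
  ⟨highestWord lam, by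
    refine ⟨fun i => eventually_atTop.2 ⟨(-lam.1 i).toNat, fun k hk => ?_⟩, ?_⟩
    · simp only [highestWord]
      rw [if_neg]
      omega
    · intro i j hij k
      have hle : lam.1 j ≤ lam.1 i := lam.2 (Fin.le_def.2 (by omega))
      have h1 : ((lam.1 i - lam.1 j).toNat : ℤ) = lam.1 i - lam.1 j := by omega
      have hi := i.2
      have hj := j.2
      simp only [highestWord]
      push_cast
      rw [h1]
      split_ifs <;> constructor <;> omega⟩

/-! ### `𝔤𝔩_u` and rational semistandard tableaux

The ordered set `ū < ⋯ < 2̄ < 1̄` is `Fin u`: the index `c` is the letter with bar `u - c`. The index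
set of the simple roots is `Fin (u - 1)`: the index `j` is the root with bar `u - 1 - j`, and its
arrow goes from the letter `j` to the letter `j + 1`. -/

def glDatum (u : ℕ) : CartanDatum (Fin (u - 1)) (Fin u → ℤ) where
  root j := Pi.single ⟨j, by omega⟩ 1 - Pi.single ⟨j + 1, by omega⟩ 1
  coroot j :=
    { toFun := fun p => p ⟨j, by omega⟩ - p ⟨j + 1, by omega⟩
      map_zero' := by simp
      map_add' := by
        intro p q
        simp only [Pi.add_apply]
        ring }
  kind _ := -1

/-- The crystal of the natural representation of `𝔤𝔩_u`. -/
def glLetters (u : ℕ) : CrystalData (glDatum u) (Fin u) where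
  wt c := Pi.single c 1
  ε j c := if (c : ℕ) = j + 1 then 1 else 0
  φ j c := if (c : ℕ) = j then 1 else 0
  e j c := if (c : ℕ) = j + 1 then some ⟨j, by omega⟩ else none
  f j c := if (c : ℕ) = j then some ⟨j + 1, by omega⟩ else none

/-- `B_u ⊕ B_u^∨`: the element `Sum.inl c` is the letter `c`, and `Sum.inr c` is the dual letter
`-c`. The dual letters have the reverse order, weights and arrows. -/
def glRationalLetters (u : ℕ) : CrystalData (glDatum u) (Fin u ⊕ (Fin u)ᵒᵈ) where
  wt
    | .inl c => (glLetters u).wt c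
    | .inr c => -(glLetters u).wt (OrderDual.ofDual c)
  ε j
    | .inl c => (glLetters u).ε j c
    | .inr c => (glLetters u).φ j (OrderDual.ofDual c)
  φ j
    | .inl c => (glLetters u).φ j c
    | .inr c => (glLetters u).ε j (OrderDual.ofDual c)
  e j
    | .inl c => ((glLetters u).e j c).map Sum.inl
    | .inr c => ((glLetters u).f j (OrderDual.ofDual c)).map (fun d => Sum.inr (OrderDual.toDual d))
  f j
    | .inl c => ((glLetters u).f j c).map Sum.inl
    | .inr c => ((glLetters u).e j (OrderDual.ofDual c)).map (fun d => Sum.inr (OrderDual.toDual d))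

/-- The box in row `p.1` and column `p.2` belongs to the generalized Young diagram of `μ`. The
columns have the numbers `⋯, -2, -1, 1, 2, ⋯`. -/
def InDiagram {u : ℕ} (mu : GenPartition u) (p : Fin u × ℤ) : Prop :=
  (0 < p.2 ∧ p.2 ≤ mu.1 p.1) ∨ (mu.1 p.1 ≤ p.2 ∧ p.2 < 0)

instance {u : ℕ} (mu : GenPartition u) (p : Fin u × ℤ) : Decidable (InDiagram mu p) :=
  inferInstanceAs (Decidable (_ ∨ _))

/-- The set `B_u(μ)` of rational semistandard tableaux of shape `μ`. The order of the letters is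
that of `Fin u ⊕ (Fin u)ᵒᵈ`, where the elements of the two summands are not comparable. -/
@[ext]
structure RationalTableau {u : ℕ} (mu : GenPartition u) where
  entry : {p : Fin u × ℤ // InDiagram mu p} → Fin u ⊕ (Fin u)ᵒᵈ
  isLeft_iff : ∀ p, (entry p).isLeft = true ↔ 0 < p.1.2
  row_weak : ∀ p q, p.1.1 = q.1.1 → p.1.2 ≤ q.1.2 → entry p ≤ entry q
  col_strict : ∀ p q, p.1.2 = q.1.2 → p.1.1 < q.1.1 → entry p < entry q
  /-- If `b''_1 < b''_2 < ⋯` are the letters `x` such that `-x` is not in column `-1`, then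
  `b''_i ≤ b_i` for the entry `b_i` in row `i` of column `1`. -/
  first_columns : ∀ p, p.1.2 = 1 → ∀ b : Fin u, entry p = Sum.inl b →
    Nat.nth (fun x => ∃ h : x < u, ∀ q, q.1.2 = -1 →
      entry q ≠ Sum.inr (OrderDual.toDual ⟨x, h⟩)) p.1.1 ≤ b

/-- Column reading: the columns from right to left, each one from top to bottom. -/
def RationalTableau.reading {u : ℕ} {mu : GenPartition u} (T : RationalTableau mu) :
    List (Fin u ⊕ (Fin u)ᵒᵈ) :=
  let N : ℕ := ∑ i, (mu.1 i).natAbs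
  (List.range (2 * N + 1)).flatMap fun t =>
    (List.finRange u).filterMap fun k =>
      if h : InDiagram mu (k, (N : ℤ) - t) then some (T.entry ⟨(k, (N : ℤ) - t), h⟩) else none

noncomputable def rationalCrystal {u : ℕ} (mu : GenPartition u) :
    CrystalData (glDatum u) (RationalTableau mu) :=
  (glRationalLetters u).words.comap RationalTableau.reading

/-- The length of the column with number `j < 0` in the diagram of `μ`. -/
def negColLength {u : ℕ} (mu : GenPartition u) (j : ℤ) : ℕ :=
  (Finset.univ.filter fun k => mu.1 k ≤ j).card

theorem le_negColLength {u : ℕ} (mu : GenPartition u) {j : ℤ} {k : Fin u} (h : mu.1 k ≤ j) :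
    u ≤ k + negColLength mu j := by
  have hsub : Finset.Ici k ⊆ Finset.univ.filter fun k => mu.1 k ≤ j := by
    intro x hx
    rw [Finset.mem_Ici] at hx
    exact Finset.mem_filter.2 ⟨Finset.mem_univ _, (mu.2 hx).trans h⟩
  have := Finset.card_le_card hsub
  rw [Fin.card_Ici] at this
  unfold negColLength
  omega

theorem negColLength_lt {u : ℕ} (mu : GenPartition u) {j : ℤ} {k : Fin u} (h : j < mu.1 k) :
    k + negColLength mu j < u := by
  have hsub : (Finset.univ.filter fun k => mu.1 k ≤ j) ⊆ Finset.Ioi k := by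
    intro x hx
    have hx' := (Finset.mem_filter.1 hx).2
    rw [Finset.mem_Ioi]
    by_contra hxk
    exact absurd (mu.2 (not_lt.1 hxk)) (not_le.2 (lt_of_le_of_lt hx' h))
  have := Finset.card_le_card hsub
  rw [Fin.card_Ioi] at this
  have := k.2
  unfold negColLength
  omega

/-- The highest weight tableau `H_u^μ` in `B_u(μ)`: in the positive columns row `k` has the
`k`-th smallest letter, and a negative column has the entries `-1̄, -2̄, -3̄, …` from top to
bottom. -/
def highestRational {u : ℕ} (mu : GenPartition u) : RationalTableau mu where
  entry p :=
    if 0 < p.1.2 then Sum.inl p.1.1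
    else Sum.inr (OrderDual.toDual
      ⟨u - 1 - (p.1.1 + negColLength mu p.1.2 - u), by have := p.1.1.2; omega⟩)
  isLeft_iff p := by split_ifs with h <;> simp [h]
  row_weak := by
    rintro ⟨⟨k, j⟩, hp⟩ ⟨⟨k', j'⟩, hq⟩ hk hj
    simp only at hk hj ⊢
    subst hk
    simp only [InDiagram] at hp hq
    split_ifs with h1 h2 h2
    · exact le_rfl
    · omega
    · omega
    · rw [Sum.inr_le_inr_iff, OrderDual.toDual_le_toDual, Fin.mk_le_mk]
      have : negColLength mu j ≤ negColLength mu j' := by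
        refine Finset.card_le_card fun x hx => ?_
        exact Finset.mem_filter.2 ⟨Finset.mem_univ _, (Finset.mem_filter.1 hx).2.trans hj⟩
      omega
  col_strict := by
    rintro ⟨⟨k, j⟩, hp⟩ ⟨⟨k', j'⟩, hq⟩ hj hk
    simp only at hk hj ⊢
    subst hj
    simp only [InDiagram] at hp hq
    rw [Fin.lt_def] at hk
    split_ifs with h1
    · rw [Sum.inl_lt_inl_iff, Fin.lt_def]
      exact hk
    · rw [Sum.inr_lt_inr_iff, OrderDual.toDual_lt_toDual, Fin.mk_lt_mk]
      have h3 := le_negColLength mu (j := j) (k := k) (by omega)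
      have h4 : negColLength mu j ≤ u := by
        simpa [negColLength] using Finset.card_filter_le (Finset.univ : Finset (Fin u)) _
      have := k'.2
      omega
  first_columns := by
    rintro ⟨⟨k, j⟩, hp⟩ hj b hb
    simp only at hj hb ⊢
    subst hj
    simp only [InDiagram] at hp
    simp only [zero_lt_one, if_true, Sum.inl.injEq] at hb
    subst hb
    have hlt := negColLength_lt mu (j := -1) (k := k) (by omega)
    classical
    have key : ∀ x, x ≤ (k : ℕ) → ∃ h : x < u,
        ∀ q : {p : Fin u × ℤ // InDiagram mu p}, q.1.2 = -1 →
          (if 0 < q.1.2 then Sum.inl q.1.1 else Sum.inr (OrderDual.toDual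
            (⟨u - 1 - (q.1.1 + negColLength mu q.1.2 - u), by have := q.1.1.2; omega⟩ : Fin u)) :
            Fin u ⊕ (Fin u)ᵒᵈ) ≠ Sum.inr (OrderDual.toDual ⟨x, h⟩) := by
      intro x hx
      refine ⟨by omega, ?_⟩
      rintro ⟨⟨k', j'⟩, hq⟩ hj' heq
      simp only at hj' heq
      subst hj'
      rw [if_neg (by norm_num)] at heq
      simp only [Sum.inr.injEq, EmbeddingLike.apply_eq_iff_eq, Fin.mk.injEq] at heq
      have := k'.2
      simp only [InDiagram] at hq
      have := le_negColLength mu (j := -1) (k := k') (by omega)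
      omega
    have general : ∀ (p : ℕ → Prop) (n : ℕ), (∀ x, x ≤ n → p x) → Nat.nth p n ≤ n := by
      intro p n h
      have hcount := (Nat.count_iff_forall (p := p) (n := n)).2 fun x hx => h x (le_of_lt hx)
      have hnth := Nat.nth_count (h n le_rfl)
      rw [hcount] at hnth
      exact hnth.le
    exact general _ _ key

/-! ### The matrix model -/

/-- The set `ℳ^u`. The rows are indexed by the letters of `𝔤` and the columns by the letters of
`𝔤𝔩_u`. -/
@[ext]
structure FockMatrix (u : ℕ) where
  entry : ℤ → Fin u → ℕ
  le_one : ∀ b < 0, ∀ c, entry b c ≤ 1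
  eq_one : ∀ᶠ b in atBot, ∀ c, entry b c = 1
  eq_zero : ∀ᶠ b in atTop, ∀ c, entry b c = 0

namespace FockMatrix

variable {u : ℕ}

theorem finite_support (A : FockMatrix u) :
    (Function.support fun b : ℤ => ∑ c, ((A.entry b c : ℤ) - if b < 0 then 1 else 0)).Finite := by
  obtain ⟨m, hm⟩ := eventually_atBot.1 A.eq_one
  obtain ⟨n, hn⟩ := eventually_atTop.1 A.eq_zero
  refine (Set.finite_Icc (min m 0) (max n 0)).subset fun b hb => ?_
  rw [Function.mem_support] at hb
  by_contra hout
  apply hb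
  rw [Set.mem_Icc, not_and_or, not_le, not_le, lt_min_iff, max_lt_iff] at hout
  refine Finset.sum_eq_zero fun c _ => ?_
  rcases hout with h | h
  · simp [hm b h.1.le c, h.2]
  · simp [hn b h.1.le c, h.2.le]

/-- The weight of `A` for `𝔤`. -/
noncomputable def wt (A : FockMatrix u) : GWeight :=
  (u, Finsupp.ofSupportFinite _ A.finite_support)

/-- The weight of `A` for `𝔤𝔩_u`. -/
noncomputable def wtStar (A : FockMatrix u) : Fin u → ℤ :=
  fun c => ∑ᶠ b : ℤ, ((A.entry b c : ℤ) - if b < 0 then 1 else 0)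

/-- The letters `m̄ < ⋯ < 1̄ < 1 < ⋯ < n`. -/
def window (m n : ℕ) : List ℤ := (List.range (m + n)).map fun t => (t : ℤ) - m

/-- The biword `(𝐢, 𝐣)` of the restriction of `A` to the rows `m̄, …, 1̄, 1, …, n`: the columns are
read in increasing order, and each column has its row indices in increasing order. -/
def colBiword (p : ℕ × ℕ) (A : FockMatrix u) : List ℤ × List (Fin u) :=
  ((List.finRange u).flatMap fun c => (window p.1 p.2).flatMap fun b =>
    List.replicate (A.entry b c) (b, c)).unzip

/-- The biword `(𝐤, 𝐥)` of the same restriction: the rows are read in decreasing order, and a row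
of degree `0` (of degree `1`) has its column indices in increasing (decreasing) order. -/
def rowBiword (p : ℕ × ℕ) (A : FockMatrix u) : List ℤ × List (Fin u) :=
  ((window p.1 p.2).reverse.flatMap fun b =>
    (if b < 0 then List.finRange u else (List.finRange u).reverse).flatMap fun c =>
      List.replicate (A.entry b c) (b, c)).unzip

noncomputable def e (i : ℤ) : FockMatrix u → Option (FockMatrix u) :=
  stableOp atTop colBiword fun w => (gLetters.words.e i w.1).map fun x => (x, w.2)

noncomputable def f (i : ℤ) : FockMatrix u → Option (FockMatrix u) :=
  stableOp atTop colBiword fun w => (gLetters.words.f i w.1).map fun x => (x, w.2)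

noncomputable def eStar (j : Fin (u - 1)) : FockMatrix u → Option (FockMatrix u) :=
  stableOp atTop rowBiword fun w => ((glLetters u).words.e j w.2).map fun x => (w.1, x)

noncomputable def fStar (j : Fin (u - 1)) : FockMatrix u → Option (FockMatrix u) :=
  stableOp atTop rowBiword fun w => ((glLetters u).words.f j w.2).map fun x => (w.1, x)

/-- The structure of a `𝔤`-crystal on `ℳ^u`. -/
noncomputable def crystal (u : ℕ) : CrystalData gDatum (FockMatrix u) where
  wt := wt
  ε i := maxIter (e i)
  φ i := maxIter (f i)
  e := e
  f := f

/-- The structure of a `𝔤𝔩_u`-crystal on `ℳ^u`. -/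
noncomputable def crystalStar (u : ℕ) : CrystalData (glDatum u) (FockMatrix u) where
  wt := wtStar
  ε j := maxIter (eStar j)
  φ j := maxIter (fStar j)
  e := eStar
  f := fStar

/-- The number `μ_i` of occurrences of the letter `i ≥ 1` in `H^λ`. -/
noncomputable def muOf (lam : GenPartition u) (i : ℕ) : ℕ :=
  ∑ c, (highestWord lam c).occ ((i : ℤ) - 1)

/-- `ν_i = μ_i - μ_{i+1}`, with `μ_{u+1} = 0`. -/
noncomputable def nuOf (lam : GenPartition u) (i : ℕ) : ℕ :=
  muOf lam i - if i = u then 0 else muOf lam (i + 1)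

open Classical in
/-- The matrix `𝒜_λ`. The column with index `l` of the tableau `H^λ`, counted from the left, is
its component with index `u - 1 - l`. The row `b ≥ 0` belongs to the letter `k = b + 1`. -/
noncomputable def highest (lam : GenPartition u) : FockMatrix u where
  entry b l :=
    if b < 0 then
      if ∃ k, (highestWord lam l.rev).letter k = b then 1 else 0
    else if b.toNat + 1 + l ≤ u then nuOf lam (b.toNat + 1 + l) else 0
  le_one b hb c := by
    rw [if_pos hb]
    split_ifs <;> omega
  eq_one := by
    rw [eventually_all]
    intro c
    filter_upwards [eventually_lt_atBot (0 : ℤ),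
      eventually_lt_atBot (-(lam.1 c.rev) - 1)] with b hb hb'
    rw [if_pos hb, if_pos]
    refine ⟨(-b - 1 - lam.1 c.rev).toNat, ?_⟩
    simp only [highestWord]
    rw [if_neg] <;> omega
  eq_zero := by
    filter_upwards [eventually_ge_atTop (u : ℤ)] with b hb c
    rw [if_neg (by omega), if_neg (by omega)]

/-! ### The correspondence `ϖ` -/

instance : Nonempty (Σ lam : GenPartition u, semiInfTableaux lam) :=
  ⟨⟨⟨fun _ => 0, antitone_const⟩, highestSemiInf _⟩⟩

instance : Nonempty (Σ mu : GenPartition u, RationalTableau mu) :=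
  ⟨⟨⟨fun _ => 0, antitone_const⟩, highestRational _⟩⟩

/-- `t` is `𝔤`-equivalent to `A`. -/
def EquivSemiInf (A : FockMatrix u) (t : Σ lam : GenPartition u, semiInfTableaux lam) : Prop :=
  (crystal u).Equivalent (semiInfCrystal t.1) A t.2

/-- `T` is `𝔤𝔩_u`-equivalent to `A`. -/
def EquivRational (A : FockMatrix u) (T : Σ mu : GenPartition u, RationalTableau mu) : Prop :=
  (crystalStar u).Equivalent (rationalCrystal T.1) A T.2

/-- `ϖ(A) = (𝒫₁(A), 𝒫₂(A))`: the semi-infinite semistandard tableau that is `𝔤`-equivalent to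
`A`, and the rational semistandard tableau that is `𝔤𝔩_u`-equivalent to `A`. -/
noncomputable def varpi (A : FockMatrix u) :
    (Σ lam : GenPartition u, semiInfTableaux lam) × (Σ mu : GenPartition u, RationalTableau mu) :=
  (Classical.epsilon (EquivSemiInf A), Classical.epsilon (EquivRational A))

/-- The set of the highest weight elements of `ℳ^u`. -/
def highestWeightElements (u : ℕ) : Set (FockMatrix u) :=
  {A | ∃ lam mu : GenPartition u, varpi A = (⟨lam, highestSemiInf lam⟩, ⟨mu, highestRational mu⟩)}

end FockMatrix

/-- The set `⊕_λ B(λ) × B_u(λ*)`. -/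
abbrev CauchySum (u : ℕ) : Type :=
  Σ lam : GenPartition u, semiInfTableaux lam × RationalTableau lam.star

noncomputable def CauchySum.crystal (u : ℕ) : CrystalData gDatum (CauchySum u) :=
  CrystalData.sigma fun lam => (semiInfCrystal lam).onFst _

noncomputable def CauchySum.crystalStar (u : ℕ) : CrystalData (glDatum u) (CauchySum u) :=
  CrystalData.sigma fun lam : GenPartition u => (rationalCrystal lam.star).onSnd _

/-! An operator on a tensor product sees each factor only through its pair (ε, φ), and these pairs
multiply associatively. Cut the word of a matrix into its columns for 𝔤 and into its rows for 𝔤𝔩_u.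
Then e_i or f_i selects one column and moves a unit between the rows i − 1 and i, while e*_j or f*_j
selects one row and moves a unit between the columns j and j + 1. Two such moves interact only in
the 2 × 2 block where these rows and columns meet, so the bicrystal property reduces to a check of 2
× 2 blocks (`Signature.Block.comm`, `Grid.moves_comm`).

The decomposition rests on two dictionaries. In terms of the numbers of letters ≥ b in neighbouring
columns, the conditions that define B(λ) say that the matrix is killed by all f*_j and has
𝔤𝔩_u-weight −λ (`FockMatrix.mem_semiInfTableaux_iff`). In terms of partial sums of neighbouring
rows, the conditions that define rational tableaux say that a matrix without letters of degree 1 is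
killed by all e_i with i < 0 (`Encodes.isEvenTop`, `FockMatrix.exists_encodes`); the rows of the
matrix are the columns of the tableau, complemented when the column is negative. Commutation makes
both families stable, and makes every operator of one algebra a partial isomorphism for the other
one. Hence a matrix is 𝔤-equivalent to any lowest 𝔤𝔩_u-element of its component, which is a
semi-infinite tableau. It is 𝔤𝔩_u-equivalent to a rational tableau: write its row word into a new
matrix with one letter in each row of degree 0, and raise this matrix by the e_i with i < 0.

Uniqueness is rigidity. Two matrices killed by all f*_j that are 𝔤-equivalent are equal
(`FockMatrix.eq_of_linked`): lowering by the f_i empties the rows of degree 0 in a window, raising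
by the e_i with i > 0 then leaves only an antidiagonal, and this is known from the weight. Two
matrices that encode rational tableaux and are 𝔤𝔩_u-equivalent are equal
(`FockMatrix.IsEvenTop.eq_of_linked`): at a highest element the rows are initial segments, so their
lengths determine everything. The weight of a lowest 𝔤𝔩_u-element is −λ by the first dictionary and
μ reversed by the second one, whence μ = λ*.

The matrix 𝒜_λ has the 𝔤-weight of H^λ and the 𝔤𝔩_u-weight λ*, and it is killed by all e*_j. So its
rational tableau is the highest one of shape λ*. Its semi-infinite tableau has shape λ and the
weight of H^λ, and it equals H^λ because the letters of H^λ are the smallest ones possible in B(λ).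
As a matrix is determined by its two tableaux, there are no other highest weight elements. -/

/-! ### Signatures

The position where an operator acts on a tensor product depends only on the pairs `(ε, φ)` of the
factors. The flag `d` is `true` for the raising operators and `false` for the lowering ones. -/

namespace Signature

/-- The pair `(ε, φ)` of a tensor product of two elements. -/
def comb : SignType → ℕ × ℕ → ℕ × ℕ → ℕ × ℕ
  | .neg, s, t => (s.1 + (t.1 - s.2), t.2 + (s.2 - t.1))
  | .pos, s, t => (t.1 + (s.1 - t.2), s.2 + (t.2 - s.1))
  | .zero, s, t => if 0 < s.1 + s.2 then s else t

/-- Whether an operator acts on the left factor. -/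
def left : SignType → Bool → ℕ × ℕ → ℕ × ℕ → Prop
  | .neg, true, s, t => t.1 ≤ s.2
  | .neg, false, s, t => t.1 < s.2
  | .pos, true, s, t => t.2 < s.1
  | .pos, false, s, t => t.2 ≤ s.1
  | .zero, _, s, _ => 0 < s.1 + s.2

instance (κ : SignType) (d : Bool) (s t : ℕ × ℕ) : Decidable (left κ d s t) := by
  cases κ <;> cases d <;> unfold left <;> infer_instance

/-- The component `ε` or `φ` of a pair. -/
def sel (d : Bool) (t : ℕ × ℕ) : ℕ := if d then t.1 else t.2

@[simp] theorem sel_true (t : ℕ × ℕ) : sel true t = t.1 := rfl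
@[simp] theorem sel_false (t : ℕ × ℕ) : sel false t = t.2 := rfl

variable {K : Type}

/-- The pair `(ε, φ)` of a tensor product of factors with the pairs `s k`. -/
def tot (κ : SignType) (s : K → ℕ × ℕ) : List K → ℕ × ℕ
  | [] => (0, 0)
  | k :: L => comb κ (s k) (tot κ s L)

/-- The factor on which an operator acts. -/
def pos (κ : SignType) (d : Bool) (s : K → ℕ × ℕ) : List K → Option K
  | [] => none
  | k :: L =>
    if left κ d (s k) (tot κ s L) then (if sel d (s k) = 0 then none else some k)
    else pos κ d s L

variable {κ : SignType} {d : Bool} {s s' : K → ℕ × ℕ}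

theorem comb_zero_left (κ : SignType) (t : ℕ × ℕ) : comb κ (0, 0) t = t := by
  cases κ <;> simp [comb]

theorem comb_zero_right (κ : SignType) (s : ℕ × ℕ) : comb κ s (0, 0) = s := by
  obtain ⟨a, b⟩ := s
  cases κ <;> simp [comb]
  omega

/-- For `.neg` the pair (ε, φ) stands for ε closing brackets followed by φ opening ones, and `comb`
cancels matching brackets: this is the product of the bicyclic monoid. For `.pos` it is the opposite
product, and for `.zero` the first nontrivial factor wins. -/
theorem comb_assoc (κ : SignType) (r s t : ℕ × ℕ) :
    comb κ (comb κ r s) t = comb κ r (comb κ s t) := by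
  obtain ⟨a, b⟩ := r
  obtain ⟨a', b'⟩ := s
  obtain ⟨a'', b''⟩ := t
  cases κ <;> simp only [comb]
  · split_ifs <;> simp_all
  · ext <;> simp only <;> omega
  · ext <;> simp only <;> omega

theorem tot_append (κ : SignType) (s : K → ℕ × ℕ) (L L' : List K) :
    tot κ s (L ++ L') = comb κ (tot κ s L) (tot κ s L') := by
  induction L with
  | nil => simp [tot, comb_zero_left]
  | cons k L ih => simp only [List.cons_append, tot, ih, comb_assoc]

/-- This lets `pos` decide at the first factor: once the rule has chosen a side, the other side is
irrelevant for whether the operator gives 0. -/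
theorem sel_comb_eq_zero (κ : SignType) (d : Bool) (s t : ℕ × ℕ) :
    sel d (comb κ s t) = 0 ↔ if left κ d s t then sel d s = 0 else sel d t = 0 := by
  obtain ⟨a, b⟩ := s
  obtain ⟨a', b'⟩ := t
  split_ifs with h <;> cases κ <;> cases d <;>
    simp only [comb, left, sel_true, sel_false] at h ⊢ <;> (try split_ifs) <;> omega

theorem pos_eq_none (κ : SignType) (d : Bool) (s : K → ℕ × ℕ) (L : List K) :
    pos κ d s L = none ↔ sel d (tot κ s L) = 0 := by
  induction L with
  | nil => cases d <;> simp [pos, tot]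
  | cons k L ih =>
    rw [pos, tot, sel_comb_eq_zero]
    split_ifs <;> simp_all

/-- Associativity of the choice of the factor, in the form that rewrites nested conditionals. It
serves both for positions (`pos_append`) and for the action on concatenated words. -/
theorem left_comb (κ : SignType) (d : Bool) (r s t : ℕ × ℕ) {α : Type} (x y z : α) :
    (if left κ d (comb κ r s) t then (if left κ d r s then x else y) else z) =
      if left κ d r (comb κ s t) then x else if left κ d s t then y else z := by
  obtain ⟨a, b⟩ := r
  obtain ⟨a', b'⟩ := s
  obtain ⟨a'', b''⟩ := t
  split_ifs with h1 h2 h3 h3 h4 h5 h6 <;> first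
    | rfl
    | exfalso
      cases κ <;> cases d <;> simp only [comb, left] at * <;> (try split_ifs at *) <;> omega

theorem pos_append (κ : SignType) (d : Bool) (s : K → ℕ × ℕ) (L L' : List K) :
    pos κ d s (L ++ L') =
      if left κ d (tot κ s L) (tot κ s L') then pos κ d s L else pos κ d s L' := by
  induction L with
  | nil =>
    rw [List.nil_append]
    split_ifs with h
    · rw [pos, pos_eq_none]
      rw [tot] at h
      cases κ <;> cases d <;> simp_all [left]
    · rfl
  | cons k L ih =>
    rw [List.cons_append, pos, pos, tot, tot_append, ih, left_comb]

theorem mem_of_pos {L : List K} {k : K} (h : pos κ d s L = some k) : k ∈ L := by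
  induction L with
  | nil => simp [pos] at h
  | cons a L ih =>
    rw [pos] at h
    split_ifs at h with h1 h2
    · simp_all
    · exact List.mem_cons_of_mem _ (ih h)

theorem sel_ne_zero_of_pos {L : List K} {k : K} (h : pos κ d s L = some k) : sel d (s k) ≠ 0 := by
  induction L with
  | nil => simp [pos] at h
  | cons a L ih =>
    rw [pos] at h
    split_ifs at h with h1 h2
    · simp_all
    · exact ih h

theorem tot_congr {L : List K} (h : ∀ k ∈ L, s k = s' k) : tot κ s L = tot κ s' L := by
  induction L with
  | nil => rfl
  | cons a L ih => simp_all [tot]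

theorem pos_congr {L : List K} (h : ∀ k ∈ L, s k = s' k) : pos κ d s L = pos κ d s' L := by
  induction L with
  | nil => rfl
  | cons a L ih =>
    rw [pos, pos, h a (by simp), tot_congr (L := L) (s' := s') (fun k hk => h k (by simp [hk])),
      ih fun k hk => h k (by simp [hk])]

theorem tot_eq_zero {L : List K} (h : ∀ k ∈ L, s k = (0, 0)) : tot κ s L = (0, 0) := by
  induction L with
  | nil => rfl
  | cons a L ih => rw [tot, h a (by simp), comb_zero_left, ih fun k hk => h k (by simp [hk])]

theorem pos_eq_none_of_trivial {L : List K} (h : ∀ k ∈ L, s k = (0, 0)) : pos κ d s L = none := by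
  rw [pos_eq_none, tot_eq_zero h]
  cases d <;> rfl

/-- Together with the version for `pos`, this will show that the rows outside of a window, where a
matrix is constant, do not influence the operators of 𝔤𝔩_u. -/
theorem tot_trivial_ends {L L₁ L₂ : List K} (h₁ : ∀ k ∈ L₁, s k = (0, 0))
    (h₂ : ∀ k ∈ L₂, s k = (0, 0)) : tot κ s (L₁ ++ L ++ L₂) = tot κ s L := by
  rw [tot_append, tot_append, tot_eq_zero h₁, tot_eq_zero h₂, comb_zero_left, comb_zero_right]

theorem pos_trivial_ends {L L₁ L₂ : List K} (h₁ : ∀ k ∈ L₁, s k = (0, 0))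
    (h₂ : ∀ k ∈ L₂, s k = (0, 0)) : pos κ d s (L₁ ++ L ++ L₂) = pos κ d s L := by
  rw [pos_append, pos_append, tot_append, tot_eq_zero h₁, tot_eq_zero h₂, comb_zero_left,
    pos_eq_none_of_trivial h₁, pos_eq_none_of_trivial h₂]
  have := pos_eq_none κ d s L
  split_ifs with h h'
  · by_contra hne
    have : sel d (tot κ s L) ≠ 0 := fun h0 => hne (this.2 h0).symm
    cases κ <;> cases d <;> simp_all [left]
  · rfl
  all_goals
    by_contra hne
    have : sel d (tot κ s L) ≠ 0 := fun h0 => hne (this.2 h0).symm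
    cases κ <;> cases d <;> simp_all [left]

theorem left_congr_move {d : Bool} {s t t' : ℕ × ℕ} (h : ¬ left κ d s t)
    (h1 : sel d t = sel d t' + 1) (h2 : sel (!d) t' = sel (!d) t + 1)
    (hz : κ = 0 → t.1 + t.2 = 1) :
    sel d (comb κ s t) = sel d (comb κ s t') + 1 ∧
      sel (!d) (comb κ s t') = sel (!d) (comb κ s t) + 1 ∧ ¬ left κ (!d) s t' := by
  obtain ⟨a, b⟩ := s
  obtain ⟨a', b'⟩ := t
  obtain ⟨a'', b''⟩ := t'
  cases κ <;> cases d <;>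
    simp only [comb, left, sel_true, sel_false, Bool.not_true, Bool.not_false] at * <;>
    (try split_ifs) <;> omega

theorem left_congr_move' {d : Bool} {s s' t : ℕ × ℕ} (h : left κ d s t)
    (h1 : sel d s = sel d s' + 1) (h2 : sel (!d) s' = sel (!d) s + 1)
    (hz : κ = 0 → s.1 + s.2 = 1) :
    sel d (comb κ s t) = sel d (comb κ s' t) + 1 ∧
      sel (!d) (comb κ s' t) = sel (!d) (comb κ s t) + 1 ∧ left κ (!d) s' t := by
  obtain ⟨a, b⟩ := s
  obtain ⟨a', b'⟩ := s'
  obtain ⟨a'', b''⟩ := t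
  cases κ <;> cases d <;>
    simp only [comb, left, sel_true, sel_false, Bool.not_true, Bool.not_false] at * <;>
    (try split_ifs) <;> omega

theorem tot_zero_le {L : List K} (h : ∀ k ∈ L, (s k).1 + (s k).2 ≤ 1) :
    (tot 0 s L).1 + (tot 0 s L).2 ≤ 1 := by
  induction L with
  | nil => simp [tot]
  | cons a L ih =>
    have ih := ih fun k hk => h k (by simp [hk])
    have := h a (by simp)
    change (comb .zero _ _).1 + (comb .zero _ _).2 ≤ 1
    simp only [comb]
    split_ifs
    · exact this
    · exact ih

theorem tot_zero_eq_zero {L : List K} :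
    (tot 0 s L).1 + (tot 0 s L).2 = 0 ↔ ∀ k ∈ L, (s k).1 + (s k).2 = 0 := by
  induction L with
  | nil => simp [tot]
  | cons a L ih =>
    change (comb .zero _ _).1 + (comb .zero _ _).2 = 0 ↔ _
    simp only [comb, List.mem_cons, forall_eq_or_imp, ← ih]
    split_ifs with h
    · constructor <;> intro h' <;> omega
    · constructor
      · intro h'; exact ⟨by omega, h'⟩
      · intro hx; exact hx.2

/-- The effect of an operator on the signature. -/
theorem tot_move [DecidableEq K] {L : List K} (hL : L.Nodup) {k : K} (h : pos κ d s L = some k)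
    (hs : ∀ x ∈ L, x ≠ k → s' x = s x) (h1 : sel d (s k) = sel d (s' k) + 1)
    (h2 : sel (!d) (s' k) = sel (!d) (s k) + 1) (hz : κ = 0 → ∀ x ∈ L, (s x).1 + (s x).2 ≤ 1) :
    sel d (tot κ s L) = sel d (tot κ s' L) + 1 ∧
      sel (!d) (tot κ s' L) = sel (!d) (tot κ s L) + 1 ∧ pos κ (!d) s' L = some k := by
  induction L with
  | nil => simp [pos] at h
  | cons a L ih =>
    rw [List.nodup_cons] at hL
    rw [pos] at h
    split_ifs at h with hl h0
    · obtain rfl : a = k := by simpa using h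
      have htot : tot κ s' L = tot κ s L := tot_congr fun x hx => hs x (by simp [hx]) (by
        rintro rfl; exact hL.1 hx)
      have := left_congr_move' hl h1 h2 (by
        intro hκ
        have := hz hκ a (by simp)
        cases d <;> simp at h0 h1 <;> omega)
      rw [tot, tot, pos, htot, if_pos this.2.2, if_neg (by omega)]
      exact ⟨this.1, this.2.1, rfl⟩
    · have hak : a ≠ k := by rintro rfl; exact hL.1 (mem_of_pos h)
      have ih := ih hL.2 h (fun x hx => hs x (by simp [hx])) fun hκ x hx => hz hκ x (by simp [hx])
      have := left_congr_move hl ih.1 ih.2.1 (by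
        intro hκ
        subst hκ
        have := tot_zero_le fun x hx => hz rfl x (List.mem_cons_of_mem a hx)
        have := ih.1
        cases d <;> simp at this <;> omega)
      rw [tot, tot, pos, hs a (by simp) hak, if_neg this.2.2]
      exact ⟨this.1, this.2.1, ih.2.2⟩

theorem comb_diff (hκ : κ ≠ 0) (s t : ℕ × ℕ) :
    ((comb κ s t).2 : ℤ) - (comb κ s t).1 = ((s.2 : ℤ) - s.1) + ((t.2 : ℤ) - t.1) := by
  obtain ⟨a, b⟩ := s
  obtain ⟨a', b'⟩ := t
  cases κ
  · exact absurd rfl hκ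
  all_goals simp only [comb]; omega

theorem tot_diff (hκ : κ ≠ 0) (L : List K) :
    ((tot κ s L).2 : ℤ) - (tot κ s L).1 = (L.map fun k => ((s k).2 : ℤ) - (s k).1).sum := by
  induction L with
  | nil => simp [tot]
  | cons a L ih => rw [tot, comb_diff hκ, ih]; simp

/-- Replacing a block of factors by one with the same total signature. -/
theorem tot_block {L₁ Q L₂ : List K} (h₁ : ∀ k ∈ L₁, s' k = s k) (h₂ : ∀ k ∈ L₂, s' k = s k)
    (hQ : tot κ s' Q = tot κ s Q) : tot κ s' (L₁ ++ Q ++ L₂) = tot κ s (L₁ ++ Q ++ L₂) := by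
  simp only [tot_append, hQ, tot_congr h₁, tot_congr h₂]

/-- A block enters the choice among the other factors only through its total signature. When the
chosen factor lies in the block, the choice is made by the block alone, as the next lemma records.
-/
theorem pos_block_of_notMem {L₁ Q L₂ : List K} (h₁ : ∀ k ∈ L₁, s' k = s k)
    (h₂ : ∀ k ∈ L₂, s' k = s k) (hQ : tot κ s' Q = tot κ s Q) {k : K}
    (h : pos κ d s (L₁ ++ Q ++ L₂) = some k) (hk : k ∉ Q) :
    pos κ d s' (L₁ ++ Q ++ L₂) = some k := by
  simp only [pos_append, tot_append, hQ, tot_congr h₁, tot_congr h₂, pos_congr h₁,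
    pos_congr h₂] at h ⊢
  split_ifs at h ⊢ with h3 h4
  · exact h
  · exact absurd (mem_of_pos h) hk
  · exact h

theorem pos_block_of_mem {L₁ Q L₂ : List K} (h₁ : ∀ k ∈ L₁, s' k = s k)
    (h₂ : ∀ k ∈ L₂, s' k = s k) (hQ : tot κ s' Q = tot κ s Q) {k : K}
    (hL : (L₁ ++ Q ++ L₂).Nodup)
    (h : pos κ d s (L₁ ++ Q ++ L₂) = some k) (hk : k ∈ Q) :
    pos κ d s Q = some k ∧ pos κ d s' (L₁ ++ Q ++ L₂) = pos κ d s' Q := by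
  rw [List.nodup_append, List.nodup_append] at hL
  simp only [pos_append, tot_append, hQ, tot_congr h₁, tot_congr h₂, pos_congr h₁,
    pos_congr h₂] at h ⊢
  split_ifs at h ⊢ with h3 h4
  · exact absurd rfl (hL.1.2.2 _ (mem_of_pos h) _ hk)
  · exact ⟨h, rfl⟩
  · exact absurd rfl (hL.2.2 _ (List.mem_append_right _ hk) _ (mem_of_pos h))

end Signature

/-! ### Words and signatures -/

namespace CrystalData

open Signature

variable {I P : Type} [AddCommGroup P] {D : CartanDatum I P} {X Y K : Type}

/-- The operators `e_i` (for `true`) and `f_i` (for `false`). -/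
def op (C : CrystalData D X) (d : Bool) (i : I) : X → Option X := if d then C.e i else C.f i

@[simp] theorem op_true (C : CrystalData D X) (i : I) : C.op true i = C.e i := rfl
@[simp] theorem op_false (C : CrystalData D X) (i : I) : C.op false i = C.f i := rfl

def sig (C : CrystalData D X) (i : I) (b : X) : ℕ × ℕ := (C.ε i b, C.φ i b)

/-- The properties of the factors on which the signature rule for words depends. -/
structure Regular (C : CrystalData D X) (i : I) : Prop where
  even : D.kind i ≠ 0 → ∀ b, (C.φ i b : ℤ) - C.ε i b = D.coroot i (C.wt b)
  odd : D.kind i = 0 → ∀ b, 0 < D.coroot i (C.wt b) ↔ 0 < C.ε i b + C.φ i b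
  none : ∀ d b, sel d (C.sig i b) = 0 → C.op d i b = none

variable {C : CrystalData D X} {i : I}

/-- `wordε` and `wordφ` are defined by integers and coroots, `comb` by truncated differences. The
equality φ − ε = ⟨h_i, wt⟩ for words turns one into the other, so it has to be carried along in the
induction. -/
theorem words_sig_cons (h : C.Regular i) (b : X) (l : List X) :
    C.words.sig i (b :: l) = comb (D.kind i) (C.sig i b) (C.words.sig i l) ∧
    (D.kind i ≠ 0 → (C.wordφ i (b :: l) : ℤ) - C.wordε i (b :: l) =
      D.coroot i (C.wordWt (b :: l))) := by
  induction l generalizing b with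
  | nil =>
    have he := h.even
    have ho := h.odd
    have e0 : C.wordε i [] = 0 := rfl
    have f0 : C.wordφ i [] = 0 := rfl
    have w0 : C.wordWt ([] : List X) = 0 := rfl
    simp only [sig, words, wordε, wordφ, wordWt, List.map_cons, List.sum_cons, List.map_nil,
      List.sum_nil, map_zero, add_zero]
    cases hk : D.kind i <;> simp only [comb] <;> rw [hk] at he ho
    · refine ⟨?_, fun h => absurd rfl h⟩
      have := ho rfl b
      split_ifs <;> simp_all
    all_goals
      have := he (by decide) b
      rw [← this]
      constructor
      · ext <;> simp only <;> omega
      · intro _; omega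
  | cons a l ih =>
    have ih := (ih a).2
    have he := h.even
    have ho := h.odd
    generalize a :: l = l' at ih
    simp only [sig, words, wordε, wordφ]
    have hw : C.wordWt (b :: l') = C.wt b + C.wordWt l' := by simp [wordWt]
    rw [hw, map_add]
    cases hk : D.kind i <;> simp only [comb] <;> rw [hk] at he ho ih
    · refine ⟨?_, fun h => absurd rfl h⟩
      have := ho rfl b
      split_ifs <;> simp_all
    all_goals
      have := he (by decide) b
      have ih := ih (by decide)
      rw [← this, ← ih]
      constructor
      · ext <;> simp only <;> omega
      · intro _; omega

theorem words_sig (h : C.Regular i) (l : List X) :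
    C.words.sig i l = tot (D.kind i) (C.sig i) l := by
  induction l with
  | nil => rfl
  | cons b l ih => rw [(words_sig_cons h b l).1, ih, tot]

theorem words_sig_append (h : C.Regular i) (l l' : List X) :
    C.words.sig i (l ++ l') = comb (D.kind i) (C.words.sig i l) (C.words.sig i l') := by
  simp only [words_sig h, tot_append]

theorem words_op_cons (h : C.Regular i) (d : Bool) (b : X) (l : List X) :
    C.words.op d i (b :: l) =
      if left (D.kind i) d (C.sig i b) (C.words.sig i l) then (C.op d i b).map (fun b' => b' :: l)
      else (C.words.op d i l).map (fun l' => b :: l') := by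
  have ho := h.odd
  by_cases hl : left (D.kind i) d (C.sig i b) (C.words.sig i l)
  · rw [if_pos hl]
    cases d <;> simp only [op_true, op_false, words, wordE, wordF] <;>
      cases hk : D.kind i <;> rw [hk] at hl ho <;> simp only
    all_goals first
      | exact if_pos hl
      | exact if_pos ((ho rfl b).2 hl)
  · rw [if_neg hl]
    cases d <;> simp only [op_true, op_false, words, wordE, wordF] <;>
      cases hk : D.kind i <;> rw [hk] at hl ho <;> simp only
    all_goals first
      | exact if_neg hl
      | exact if_neg (mt (ho rfl b).1 hl)

theorem words_op_none (h : C.Regular i) (d : Bool) (l : List X)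
    (hl : sel d (C.words.sig i l) = 0) : C.words.op d i l = none := by
  induction l with
  | nil => cases d <;> rfl
  | cons b l ih =>
    rw [(words_sig_cons h b l).1, sel_comb_eq_zero] at hl
    rw [words_op_cons h]
    split_ifs at hl ⊢
    · rw [h.none d b hl]; rfl
    · rw [ih hl]; rfl

theorem words_op_append (h : C.Regular i) (d : Bool) (l l' : List X) :
    C.words.op d i (l ++ l') = if left (D.kind i) d (C.words.sig i l) (C.words.sig i l')
      then (C.words.op d i l).map (fun x => x ++ l')
      else (C.words.op d i l').map (fun x => l ++ x) := by
  induction l with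
  | nil =>
    rw [List.nil_append]
    split_ifs with hl
    · rw [words_op_none h d l' ?_, words_op_none h d []]
      · rfl
      · cases d <;> rfl
      · revert hl
        change left _ _ (0, 0) _ → _
        cases D.kind i <;> cases d <;> simp_all [left]
    · simp
  | cons b l ih =>
    rw [List.cons_append, words_op_cons h, words_op_cons h, ih, (words_sig_cons h b l).1,
      words_sig_append h]
    have := left_comb (D.kind i) d (C.sig i b) (C.words.sig i l) (C.words.sig i l')
      ((C.op d i b).map (fun b' => b' :: (l ++ l')))
      ((C.words.op d i l).map (fun x => b :: (x ++ l')))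
      ((C.words.op d i l').map (fun x => b :: (l ++ x)))
    -- These two facts only move `Option.map` into a conditional, to reach the shape of `left_comb`.
    have h3 : ∀ (p q : Prop) [Decidable p] [Decidable q] (x y z : Option (List X))
        (f : List X → List X),
        (if p then (if q then x else y).map f else z) =
          if p then (if q then x.map f else y.map f) else z := by
      intro p q _ _ x y z f; split_ifs <;> rfl
    have h4 : ∀ (p q : Prop) [Decidable p] [Decidable q] (x y z : Option (List X))
        (f : List X → List X),
        (if p then x else (if q then y else z).map f) =
          if p then x else (if q then y.map f else z.map f) := by
      intro p q _ _ x y z f; split_ifs <;> rfl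
    rw [h3, h4]
    simp only [Option.map_map, Function.comp_def, List.cons_append] at this ⊢
    exact this.symm

theorem flatMap_update [DecidableEq K] {L : List K} {r : K → List X} {k : K} {l : List X}
    (hk : k ∉ L) : L.flatMap (Function.update r k l) = L.flatMap r := by
  induction L with
  | nil => rfl
  | cons a L ih =>
    simp only [List.mem_cons, not_or] at hk
    simp only [List.flatMap_cons, ih hk.2, Function.update_of_ne (Ne.symm hk.1)]

theorem words_sig_flatMap (h : C.Regular i) (L : List K) (r : K → List X) :
    C.words.sig i (L.flatMap r) = tot (D.kind i) (fun k => C.words.sig i (r k)) L := by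
  induction L with
  | nil => rfl
  | cons a L ih => rw [List.flatMap_cons, words_sig_append h, ih, tot]

/-- The action on a concatenation of words. -/
theorem words_op_flatMap [DecidableEq K] (h : C.Regular i) (d : Bool) {L : List K} (hL : L.Nodup)
    (r : K → List X) :
    C.words.op d i (L.flatMap r) =
      (pos (D.kind i) d (fun k => C.words.sig i (r k)) L).bind fun k =>
        (C.words.op d i (r k)).map fun l => L.flatMap (Function.update r k l) := by
  induction L with
  | nil => cases d <;> rfl
  | cons a L ih =>
    rw [List.nodup_cons] at hL
    rw [List.flatMap_cons, words_op_append h, pos, words_sig_flatMap h]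
    split_ifs with h1 h2
    · rw [words_op_none h d _ h2]; rfl
    · simp only [Option.bind_some, List.flatMap_cons, Function.update_self, flatMap_update hL.1]
    · rw [ih hL.2]
      cases hp : pos (D.kind i) d (fun k => C.words.sig i (r k)) L with
      | none => rfl
      | some k =>
        have hka : a ≠ k := by rintro rfl; exact hL.1 (mem_of_pos hp)
        simp only [Option.bind_some, Option.map_map, Function.comp_def, List.flatMap_cons,
          Function.update_of_ne hka]

/-! ### Sorted words in two letters -/

/-- The local signature of a column or row with `x` lower and `y` upper letters. -/
def _root_.Signature.loc : SignType → ℕ → ℕ → ℕ × ℕ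
  | .neg, x, y => (y - x, x - y)
  | .pos, x, y => (y, x)
  | .zero, x, y => (if x = 0 then min y 1 else 0, min x 1)

/-- `lo → hi` is the only arrow of colour `i` at both letters. -/
structure Arrow (C : CrystalData D X) (i : I) (lo hi : X) : Prop where
  sig_lo : C.sig i lo = (0, 1)
  sig_hi : C.sig i hi = (1, 0)
  e_hi : C.e i hi = some lo
  f_lo : C.f i lo = some hi

/-- A letter that does not matter for the colour `i`. -/
def Inert (C : CrystalData D X) (i : I) (b : X) : Prop := C.sig i b = (0, 0)

theorem words_sig_inert (h : C.Regular i) {l : List X} (hl : ∀ b ∈ l, C.Inert i b) :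
    C.words.sig i l = (0, 0) := by
  rw [words_sig h, tot_eq_zero hl]

theorem words_inert_ends (h : C.Regular i) (d : Bool) {l₁ l l₂ : List X}
    (h₁ : ∀ b ∈ l₁, C.Inert i b) (h₂ : ∀ b ∈ l₂, C.Inert i b) :
    C.words.sig i (l₁ ++ l ++ l₂) = C.words.sig i l ∧
    C.words.op d i (l₁ ++ l ++ l₂) = (C.words.op d i l).map fun x => l₁ ++ x ++ l₂ := by
  constructor
  · rw [words_sig h, tot_trivial_ends h₁ h₂, words_sig h]
  have n₁ := words_op_none h d l₁ (by rw [words_sig_inert h h₁]; cases d <;> rfl)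
  have n₂ := words_op_none h d l₂ (by rw [words_sig_inert h h₂]; cases d <;> rfl)
  have hn := words_op_none h d l
  rw [words_op_append h, words_op_append h, words_sig_append h, words_sig_inert h h₁,
    words_sig_inert h h₂, comb_zero_left, n₁, n₂]
  by_cases hs : sel d (C.words.sig i l) = 0
  · rw [hn hs]
    split_ifs <;> rfl
  · have e1 : ¬ left (D.kind i) d (0, 0) (C.words.sig i l) := by
      cases D.kind i <;> cases d <;> simp_all [left]
    have e2 : left (D.kind i) d (C.words.sig i l) (0, 0) := by
      cases D.kind i <;> cases d <;> simp_all [left] <;> omega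
    rw [if_pos e2, if_neg e1]
    simp [Function.comp_def]

variable {lo hi : X}

theorem sig_replicate_lo (h : C.Regular i) (a : C.Arrow i lo hi) (x : ℕ) :
    C.words.sig i (List.replicate x lo) = (0, if D.kind i = 0 then min x 1 else x) := by
  induction x with
  | zero => simp [words_sig h, tot]
  | succ x ih =>
    rw [List.replicate_succ, (words_sig_cons h _ _).1, ih, a.sig_lo]
    cases D.kind i <;> simp [comb]; omega

theorem sig_replicate_hi (h : C.Regular i) (a : C.Arrow i lo hi) (y : ℕ) :
    C.words.sig i (List.replicate y hi) = (if D.kind i = 0 then min y 1 else y, 0) := by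
  induction y with
  | zero => simp [words_sig h, tot]
  | succ x ih =>
    rw [List.replicate_succ, (words_sig_cons h _ _).1, ih, a.sig_hi]
    cases D.kind i <;> simp [comb]; omega

theorem op_replicate_hi (h : C.Regular i) (a : C.Arrow i lo hi) (y : ℕ) :
    C.words.op true i (List.replicate (y + 1) hi) =
      some (if D.kind i = .neg then List.replicate y hi ++ [lo] else lo :: List.replicate y hi) := by
  induction y with
  | zero =>
    rw [List.replicate_succ, words_op_cons h, a.sig_hi, op_true, a.e_hi]
    have : C.words.sig i (List.replicate 0 hi) = (0, 0) := rfl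
    rw [this]
    cases D.kind i <;> simp [left]
  | succ y ih =>
    rw [List.replicate_succ, words_op_cons h, ih, sig_replicate_hi h a, a.sig_hi, op_true, a.e_hi]
    cases D.kind i <;> simp [left, List.replicate_succ]

theorem op_replicate_lo (h : C.Regular i) (a : C.Arrow i lo hi) (y : ℕ) :
    C.words.op false i (List.replicate (y + 1) lo) =
      some (if D.kind i = .pos then List.replicate y lo ++ [hi] else hi :: List.replicate y lo) := by
  induction y with
  | zero =>
    rw [List.replicate_succ, words_op_cons h, a.sig_lo, op_false, a.f_lo]
    have : C.words.sig i (List.replicate 0 lo) = (0, 0) := rfl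
    rw [this]
    cases D.kind i <;> simp [left]
  | succ y ih =>
    rw [List.replicate_succ, words_op_cons h, ih, sig_replicate_lo h a, a.sig_lo, op_false, a.f_lo]
    cases D.kind i <;> simp [left, List.replicate_succ]

/-- The multiplicities of two letters after an operator has acted. -/
def _root_.Signature.shift (d : Bool) (p : ℕ × ℕ) : ℕ × ℕ :=
  if d then (p.1 + 1, p.2 - 1) else (p.1 - 1, p.2 + 1)

theorem asc_sig (h : C.Regular i) (a : C.Arrow i lo hi) (x y : ℕ) :
    C.words.sig i (List.replicate x lo ++ List.replicate y hi) = loc (D.kind i) x y := by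
  rw [words_sig_append h, sig_replicate_lo h a, sig_replicate_hi h a]
  cases hk : D.kind i <;> simp [comb, loc]
  split_ifs <;> simp_all

/-- The bounds keep the word sorted. In lo lo hi the second and third letters cancel for a root of
kind `.neg`, so f would change the first letter; for the odd root f always changes the first lower
letter. -/
theorem asc_op (h : C.Regular i) (a : C.Arrow i lo hi) (d : Bool) (x y : ℕ)
    (hn : D.kind i = .neg → x ≤ 1 ∧ y ≤ 1) (hz : D.kind i = .zero → x ≤ 1) :
    C.words.op d i (List.replicate x lo ++ List.replicate y hi) =
      if sel d (loc (D.kind i) x y) = 0 then none else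
        some (List.replicate (shift d (x, y)).1 lo ++ List.replicate (shift d (x, y)).2 hi) := by
  have hs := asc_sig h a x y
  split_ifs with h0
  · exact words_op_none h _ _ (by rw [hs, h0])
  have hlo := sig_replicate_lo h a x
  have hhi := sig_replicate_hi h a y
  rw [words_op_append h, hlo, hhi]
  cases d
  · obtain ⟨x, rfl⟩ : ∃ x', x = x' + 1 := by
      cases x with
      | zero => exfalso; revert h0; cases D.kind i <;> simp [loc]
      | succ x => exact ⟨x, rfl⟩
    rw [op_replicate_lo h a]
    cases hk : D.kind i <;> rw [hk] at hn hz h0 <;> simp [left, loc, shift] at hn hz h0 ⊢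
    · subst hz; rfl
    · rw [if_pos (by omega)]
      obtain ⟨rfl, _⟩ := hn
      simp [List.replicate_succ]
    · rw [List.replicate_succ]
  · obtain ⟨y, rfl⟩ : ∃ y', y = y' + 1 := by
      cases y with
      | zero => exfalso; revert h0; cases D.kind i <;> simp [loc]
      | succ x => exact ⟨x, rfl⟩
    rw [op_replicate_hi h a]
    cases hk : D.kind i <;> rw [hk] at hn hz h0 <;> simp [left, loc, shift] at hn hz h0 ⊢
    · subst h0; rfl
    · rw [if_neg (by omega)]
      obtain ⟨_, rfl⟩ := hn
      simp [List.replicate_succ']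
    · rw [List.replicate_succ', List.append_assoc]; rfl

/-- In decreasing order no φ stands to the left of an ε, so nothing cancels, and the rule for `.neg`
produces the signature `loc .pos`. This is how the rows of degree 1 behave for 𝔤𝔩_u. -/
theorem desc_sig (h : C.Regular i) (a : C.Arrow i lo hi) (hk : D.kind i = .neg) (x y : ℕ) :
    C.words.sig i (List.replicate y hi ++ List.replicate x lo) = loc .pos x y := by
  rw [words_sig_append h, sig_replicate_lo h a, sig_replicate_hi h a, hk]
  simp [comb, loc]

theorem desc_op (h : C.Regular i) (a : C.Arrow i lo hi) (hk : D.kind i = .neg) (d : Bool)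
    (x y : ℕ) :
    C.words.op d i (List.replicate y hi ++ List.replicate x lo) =
      if sel d (loc .pos x y) = 0 then none else
        some (List.replicate (shift d (x, y)).2 hi ++ List.replicate (shift d (x, y)).1 lo) := by
  have hs := desc_sig h a hk x y
  split_ifs with h0
  · exact words_op_none h _ _ (by rw [hs, h0])
  have hlo := sig_replicate_lo h a x
  have hhi := sig_replicate_hi h a y
  rw [words_op_append h, hlo, hhi]
  cases d
  · obtain ⟨x, rfl⟩ : ∃ x', x = x' + 1 := by
      cases x with
      | zero => simp [loc] at h0
      | succ x => exact ⟨x, rfl⟩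
    rw [op_replicate_lo h a]
    simp [hk, left, shift, List.replicate_succ']
  · obtain ⟨y, rfl⟩ : ∃ y', y = y' + 1 := by
      cases y with
      | zero => simp [loc] at h0
      | succ x => exact ⟨x, rfl⟩
    rw [op_replicate_hi h a]
    simp [hk, left, shift, List.replicate_succ]

end CrystalData

namespace Signature

variable {K K' : Type} {κ : SignType} {d : Bool}

theorem tot_map (s : K' → ℕ × ℕ) (f : K → K') (L : List K) :
    tot κ s (L.map f) = tot κ (s ∘ f) L := by
  induction L with
  | nil => rfl
  | cons k L ih => simp [tot, ih]

theorem pos_map (s : K' → ℕ × ℕ) (f : K → K') (L : List K) :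
    pos κ d s (L.map f) = (pos κ d (s ∘ f) L).map f := by
  induction L with
  | nil => rfl
  | cons k L ih =>
    rw [List.map_cons, pos, pos, tot_map, ih]
    simp only [Function.comp_apply]
    split_ifs <;> rfl

/-! ### Two by two matrices -/

/-- A block of a matrix: the rows `i - 1`, `i` and the columns `j`, `j + 1`. -/
structure Block where
  x : ℕ
  y : ℕ
  z : ℕ
  w : ℕ
  deriving DecidableEq

/-- The signature of a row; `true` is the row `i`. -/
def Block.row (κ₁ κ₀ : SignType) (q : Block) (r : Bool) : ℕ × ℕ :=
  if r then loc κ₁ q.z q.w else loc κ₀ q.x q.y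

/-- The signature of a column; `true` is the column `j + 1`. -/
def Block.col (κ : SignType) (q : Block) (c : Bool) : ℕ × ℕ :=
  if c then loc κ q.y q.w else loc κ q.x q.z

def Block.hMove (d : Bool) (r : Bool) (q : Block) : Block :=
  if r then ⟨q.x, q.y, (shift d (q.z, q.w)).1, (shift d (q.z, q.w)).2⟩
  else ⟨(shift d (q.x, q.y)).1, (shift d (q.x, q.y)).2, q.z, q.w⟩

def Block.vMove (d : Bool) (c : Bool) (q : Block) : Block :=
  if c then ⟨q.x, (shift d (q.y, q.w)).1, q.z, (shift d (q.y, q.w)).2⟩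
  else ⟨(shift d (q.x, q.z)).1, q.y, (shift d (q.x, q.z)).2, q.w⟩

/-- The possible kinds of the row `i`, of the row `i - 1` and of the root `i`, and the bounds for
the entries. -/
def Block.Valid (κ₁ κ₀ κ : SignType) (q : Block) : Prop :=
  (κ₁ = .neg ∧ κ₀ = .neg ∧ κ = .neg ∧ q.x ≤ 1 ∧ q.y ≤ 1 ∧ q.z ≤ 1 ∧ q.w ≤ 1) ∨
  (κ₁ = .pos ∧ κ₀ = .neg ∧ κ = .zero ∧ q.x ≤ 1 ∧ q.y ≤ 1) ∨
  (κ₁ = .pos ∧ κ₀ = .pos ∧ κ = .pos)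

theorem Block.tot_col_hMove_neg : ∀ (x y z w : Fin 2) (d r : Bool),
    pos .neg d ((Block.mk x y z w).row .neg .neg) [true, false] = some r →
    tot .neg (((Block.mk x y z w).hMove d r).col .neg) [false, true] =
      tot .neg ((Block.mk x y z w).col .neg) [false, true] := by
  decide

/-- The signature rule picks the row in such a way that the two columns, read as a tensor product of
two factors, keep their total signature. If both rows have degree 0 there are only sixteen blocks;
otherwise the claim is a set of linear inequalities. -/
theorem Block.tot_col_hMove {κ₁ κ₀ κ : SignType} {q : Block} (hq : q.Valid κ₁ κ₀ κ) {d r : Bool}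
    (h : pos .neg d (q.row κ₁ κ₀) [true, false] = some r) :
    tot κ ((q.hMove d r).col κ) [false, true] = tot κ (q.col κ) [false, true] := by
  obtain ⟨x, y, z, w⟩ := q
  rcases hq with ⟨rfl, rfl, rfl, hx, hy, hz, hw⟩ | ⟨rfl, rfl, rfl, hx, hy⟩ | ⟨rfl, rfl, rfl⟩
  · exact tot_col_hMove_neg ⟨x, by simp at hx; omega⟩ ⟨y, by simp at hy; omega⟩
      ⟨z, by simp at hz; omega⟩ ⟨w, by simp at hw; omega⟩ d r h
  · have h0 := sel_ne_zero_of_pos h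
    simp only at hx hy
    simp only [pos, tot, comb_zero_right, row] at h h0 ⊢
    interval_cases x <;> interval_cases y <;> cases d <;> cases r <;>
    simp [left, loc, hMove, col, shift, comb, Prod.ext_iff] at h h0 ⊢ <;>
    grind
  · have h0 := sel_ne_zero_of_pos h
    simp only [pos, tot, comb_zero_right, row] at h h0 ⊢
    cases d <;> cases r <;>
    simp [left, loc, hMove, col, shift, comb, Prod.ext_iff] at h h0 ⊢ <;> grind

theorem Block.tot_row_vMove_neg : ∀ (x y z w : Fin 2) (d c : Bool),
    pos .neg d ((Block.mk x y z w).col .neg) [false, true] = some c →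
    tot .neg (((Block.mk x y z w).vMove d c).row .neg .neg) [true, false] =
      tot .neg ((Block.mk x y z w).row .neg .neg) [true, false] := by
  decide

theorem Block.tot_row_vMove {κ₁ κ₀ κ : SignType} {q : Block} (hq : q.Valid κ₁ κ₀ κ) {d c : Bool}
    (h : pos κ d (q.col κ) [false, true] = some c) :
    tot .neg ((q.vMove d c).row κ₁ κ₀) [true, false] = tot .neg (q.row κ₁ κ₀) [true, false] := by
  obtain ⟨x, y, z, w⟩ := q
  rcases hq with ⟨rfl, rfl, rfl, hx, hy, hz, hw⟩ | ⟨rfl, rfl, rfl, hx, hy⟩ | ⟨rfl, rfl, rfl⟩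
  · exact tot_row_vMove_neg ⟨x, by simp at hx; omega⟩ ⟨y, by simp at hy; omega⟩
      ⟨z, by simp at hz; omega⟩ ⟨w, by simp at hw; omega⟩ d c h
  · have h0 := sel_ne_zero_of_pos h
    simp only at hx hy
    simp only [pos, tot, comb_zero_right, col] at h h0 ⊢
    interval_cases x <;> interval_cases y <;> cases d <;> cases c <;>
    simp [left, loc, vMove, row, shift, comb, Prod.ext_iff] at h h0 ⊢ <;> grind
  · have h0 := sel_ne_zero_of_pos h
    simp only [pos, tot, comb_zero_right, col] at h h0 ⊢
    cases d <;> cases c <;>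
    simp [left, loc, vMove, row, shift, comb, Prod.ext_iff] at h h0 ⊢ <;> grind

theorem Block.vMove_hMove_neg : ∀ (x y z w : Fin 2) (d d' r c r' c' : Bool),
    pos .neg d' ((Block.mk x y z w).row .neg .neg) [true, false] = some r →
    pos .neg d ((Block.mk x y z w).col .neg) [false, true] = some c →
    pos .neg d' (((Block.mk x y z w).vMove d c).row .neg .neg) [true, false] = some r' →
    pos .neg d (((Block.mk x y z w).hMove d' r).col .neg) [false, true] = some c' →
    ((Block.mk x y z w).hMove d' r).vMove d c' = ((Block.mk x y z w).vMove d c).hMove d' r' := by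
  decide

-- Only the results of the two orders are compared here. That the second moves exist follows from
-- the invariance of the signatures and is added in `Block.comm`.
set_option maxHeartbeats 1000000 in
theorem Block.vMove_hMove {κ₁ κ₀ κ : SignType} {q : Block} (hq : q.Valid κ₁ κ₀ κ)
    {d d' r c r' c' : Bool} (hr : pos .neg d' (q.row κ₁ κ₀) [true, false] = some r)
    (hc : pos κ d (q.col κ) [false, true] = some c)
    (hr' : pos .neg d' ((q.vMove d c).row κ₁ κ₀) [true, false] = some r')
    (hc' : pos κ d ((q.hMove d' r).col κ) [false, true] = some c') :
    (q.hMove d' r).vMove d c' = (q.vMove d c).hMove d' r' := by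
  obtain ⟨x, y, z, w⟩ := q
  rcases hq with ⟨rfl, rfl, rfl, hx, hy, hz, hw⟩ | ⟨rfl, rfl, rfl, hx, hy⟩ | ⟨rfl, rfl, rfl⟩
  · exact vMove_hMove_neg ⟨x, by simp at hx; omega⟩ ⟨y, by simp at hy; omega⟩
      ⟨z, by simp at hz; omega⟩ ⟨w, by simp at hw; omega⟩ d d' r c r' c' hr hc hr' hc'
  · have h0 := sel_ne_zero_of_pos hr
    have h1 := sel_ne_zero_of_pos hc
    simp only at hx hy
    simp only [pos, tot, comb_zero_right, row, col] at hr hc h0 h1 hr' hc'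
    interval_cases x <;> interval_cases y <;> cases d <;> cases d' <;> cases r <;>
      simp [left, loc] at hr h0 <;> cases c <;>
      simp [left, loc] at hc h1 <;>
      simp [left, loc, vMove, hMove, shift] at hr' hc' ⊢ <;>
      cases r' <;> cases c' <;> simp at hr' hc' ⊢ <;> grind
  · have h0 := sel_ne_zero_of_pos hr
    have h1 := sel_ne_zero_of_pos hc
    simp only [pos, tot, comb_zero_right, row, col] at hr hc h0 h1 hr' hc'
    cases d <;> cases d' <;> cases r <;> simp [left, loc] at hr h0 <;> cases c <;>
      simp [left, loc] at hc h1 <;>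
      simp [left, loc, vMove, hMove, shift] at hr' hc' ⊢ <;>
      cases r' <;> cases c' <;> simp at hr' hc' ⊢ <;> grind

/-- The row and the column chosen after the other move may differ from the original ones, so new
positions r' and c' are needed. -/
theorem Block.comm {κ₁ κ₀ κ : SignType} {q : Block} (hq : q.Valid κ₁ κ₀ κ)
    {d d' r c : Bool} (hr : pos .neg d' (q.row κ₁ κ₀) [true, false] = some r)
    (hc : pos κ d (q.col κ) [false, true] = some c) :
    ∃ r' c', pos .neg d' ((q.vMove d c).row κ₁ κ₀) [true, false] = some r' ∧
      pos κ d ((q.hMove d' r).col κ) [false, true] = some c' ∧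
      (q.hMove d' r).vMove d c' = (q.vMove d c).hMove d' r' := by
  have e1 := tot_row_vMove hq hc
  have e2 := tot_col_hMove hq hr
  have n1 : pos .neg d' ((q.vMove d c).row κ₁ κ₀) [true, false] ≠ none := by
    rw [Ne, pos_eq_none, e1, ← pos_eq_none, hr]; simp
  have n2 : pos κ d ((q.hMove d' r).col κ) [false, true] ≠ none := by
    rw [Ne, pos_eq_none, e2, ← pos_eq_none, hc]; simp
  obtain ⟨r', hr'⟩ := Option.ne_none_iff_exists'.1 n1
  obtain ⟨c', hc'⟩ := Option.ne_none_iff_exists'.1 n2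
  exact ⟨r', c', hr', hc', vMove_hMove hq hr hc hr' hc'⟩

end Signature

/-! ### The operators on arrays of numbers -/

namespace Grid

open Signature

/-- The kind of the letters `b`. -/
def kindRow (b : ℤ) : SignType := if b < 0 then .neg else .pos

/-- The signature of the column `c` for the operators of `𝔤` with index `i`. -/
noncomputable def colSig (i : ℤ) (a : ℤ → ℕ → ℕ) (c : ℕ) : ℕ × ℕ :=
  loc (SignType.sign i) (a (i - 1) c) (a i c)

/-- The signature of the row `b` for the operators of `𝔤𝔩_u` with index `j`. -/
def rowSig (j : ℕ) (a : ℤ → ℕ → ℕ) (b : ℤ) : ℕ × ℕ := loc (kindRow b) (a b j) (a b (j + 1))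

/-- The effect of an operator of `𝔤` that acts on the column `c`. -/
def vMove (d : Bool) (i : ℤ) (c : ℕ) (a : ℤ → ℕ → ℕ) (x : ℤ) (y : ℕ) : ℕ :=
  if y = c then
    if x = i - 1 then (shift d (a (i - 1) c, a i c)).1
    else if x = i then (shift d (a (i - 1) c, a i c)).2 else a x y
  else a x y

/-- The effect of an operator of `𝔤𝔩_u` that acts on the row `b`. -/
def hMove (d : Bool) (j : ℕ) (b : ℤ) (a : ℤ → ℕ → ℕ) (x : ℤ) (y : ℕ) : ℕ :=
  if x = b then
    if y = j then (shift d (a b j, a b (j + 1))).1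
    else if y = j + 1 then (shift d (a b j, a b (j + 1))).2 else a x y
  else a x y

/-- The rows with negative index have entries `0` and `1`. -/
def Valid (a : ℤ → ℕ → ℕ) : Prop := ∀ b < 0, ∀ c, a b c ≤ 1

/-- The rows `i - 1`, `i` and columns `j`, `j + 1`. -/
def corner (i : ℤ) (j : ℕ) (a : ℤ → ℕ → ℕ) : Block :=
  ⟨a (i - 1) j, a (i - 1) (j + 1), a i j, a i (j + 1)⟩

variable {a : ℤ → ℕ → ℕ} {i : ℤ} {j : ℕ} {d d' : Bool}

def rowOf (i : ℤ) (r : Bool) : ℤ := if r then i else i - 1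

def colOf (j : ℕ) (c : Bool) : ℕ := if c then j + 1 else j

theorem corner_valid (ha : Valid a) (i : ℤ) (j : ℕ) :
    (corner i j a).Valid (kindRow i) (kindRow (i - 1)) (SignType.sign i) := by
  unfold Block.Valid corner kindRow
  rcases lt_trichotomy i 0 with h | rfl | h
  · refine Or.inl ⟨if_pos h, if_pos (by omega), sign_neg h, ?_⟩
    exact ⟨ha _ (by omega) _, ha _ (by omega) _, ha _ h _, ha _ h _⟩
  · refine Or.inr (Or.inl ⟨rfl, rfl, sign_zero, ?_⟩)
    exact ⟨ha _ (by omega) _, ha _ (by omega) _⟩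
  · exact Or.inr (Or.inr ⟨if_neg (by omega), if_neg (by omega), sign_pos h⟩)

theorem corner_row (i : ℤ) (j : ℕ) (a : ℤ → ℕ → ℕ) :
    (corner i j a).row (kindRow i) (kindRow (i - 1)) = rowSig j a ∘ rowOf i := by
  funext r
  cases r <;> rfl

theorem corner_col (i : ℤ) (j : ℕ) (a : ℤ → ℕ → ℕ) :
    (corner i j a).col (SignType.sign i) = colSig i a ∘ colOf j := by
  funext r
  cases r <;> rfl

theorem corner_hMove (i : ℤ) (j : ℕ) (a : ℤ → ℕ → ℕ) (r : Bool) :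
    corner i j (hMove d j (rowOf i r) a) = (corner i j a).hMove d r := by
  have h : i ≠ i - 1 := by omega
  cases r <;> simp [corner, hMove, rowOf, Block.hMove, h]

theorem corner_vMove (i : ℤ) (j : ℕ) (a : ℤ → ℕ → ℕ) (c : Bool) :
    corner i j (vMove d i (colOf j c) a) = (corner i j a).vMove d c := by
  have h : i ≠ i - 1 := by omega
  cases c <;> simp [corner, vMove, colOf, Block.vMove, h]

theorem colSig_hMove {b : ℤ} {c : ℕ} (h : (c ≠ j ∧ c ≠ j + 1) ∨ (b ≠ i ∧ b ≠ i - 1)) :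
    colSig i (hMove d j b a) c = colSig i a c := by
  rcases h with h | h
  · simp [colSig, hMove, h.1, h.2]
  · simp [colSig, hMove, h.1.symm, h.2.symm]

theorem rowSig_vMove {b : ℤ} {c : ℕ} (h : (c ≠ j ∧ c ≠ j + 1) ∨ (b ≠ i ∧ b ≠ i - 1)) :
    rowSig j (vMove d i c a) b = rowSig j a b := by
  rcases h with h | h
  · simp [rowSig, vMove, h.1.symm, h.2.symm]
  · simp [rowSig, vMove, h.1, h.2]

theorem pos_rows (κ : SignType) (s : ℤ → ℕ × ℕ) :
    pos κ d s [i, i - 1] = (pos κ d (s ∘ rowOf i) [true, false]).map (rowOf i) :=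
  pos_map s (rowOf i) [true, false]

theorem pos_cols (κ : SignType) (s : ℕ → ℕ × ℕ) :
    pos κ d s [j, j + 1] = (pos κ d (s ∘ colOf j) [false, true]).map (colOf j) :=
  pos_map s (colOf j) [false, true]

theorem tot_rows (κ : SignType) (s : ℤ → ℕ × ℕ) :
    tot κ s [i, i - 1] = tot κ (s ∘ rowOf i) [true, false] := tot_map s (rowOf i) [true, false]

theorem tot_cols (κ : SignType) (s : ℕ → ℕ × ℕ) :
    tot κ s [j, j + 1] = tot κ (s ∘ colOf j) [false, true] := tot_map s (colOf j) [false, true]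

theorem block_tot_col (ha : Valid a) {b : ℤ}
    (h : pos .neg d' (rowSig j a) [i, i - 1] = some b) :
    tot (SignType.sign i) (colSig i (hMove d' j b a)) [j, j + 1] =
      tot (SignType.sign i) (colSig i a) [j, j + 1] := by
  rw [pos_rows, ← corner_row, Option.map_eq_some_iff] at h
  obtain ⟨r, hr, rfl⟩ := h
  have := Block.tot_col_hMove (corner_valid ha i j) hr
  rwa [← corner_hMove, corner_col, corner_col, ← tot_cols, ← tot_cols] at this

theorem block_tot_row (ha : Valid a) {c : ℕ}
    (h : pos (SignType.sign i) d (colSig i a) [j, j + 1] = some c) :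
    tot .neg (rowSig j (vMove d i c a)) [i, i - 1] = tot .neg (rowSig j a) [i, i - 1] := by
  rw [pos_cols, ← corner_col, Option.map_eq_some_iff] at h
  obtain ⟨r, hr, rfl⟩ := h
  have := Block.tot_row_vMove (corner_valid ha i j) hr
  rwa [← corner_vMove, corner_row, corner_row, ← tot_rows, ← tot_rows] at this

/-- Outside of the corner both sides are the original array, so four entries decide. -/
theorem moves_ext {b b' : ℤ} {c c' : ℕ} (hb : b = i ∨ b = i - 1) (hb' : b' = i ∨ b' = i - 1)
    (hc : c = j ∨ c = j + 1) (hc' : c' = j ∨ c' = j + 1)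
    (h : corner i j (vMove d i c' (hMove d' j b a)) = corner i j (hMove d' j b' (vMove d i c a))) :
    vMove d i c' (hMove d' j b a) = hMove d' j b' (vMove d i c a) := by
  have hout : ∀ x y, ¬ ((x = i - 1 ∨ x = i) ∧ (y = j ∨ y = j + 1)) →
      vMove d i c' (hMove d' j b a) x y = hMove d' j b' (vMove d i c a) x y := by
    intro x y hxy
    simp only [vMove, hMove]
    grind
  simp only [corner, Block.mk.injEq] at h
  funext x y
  by_cases hxy : (x = i - 1 ∨ x = i) ∧ (y = j ∨ y = j + 1)
  · obtain ⟨rfl | rfl, rfl | rfl⟩ := hxy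
    exacts [h.1, h.2.1, h.2.2.1, h.2.2.2]
  · exact hout x y hxy

theorem block_comm (ha : Valid a) {b : ℤ} {c : ℕ}
    (hb : pos .neg d' (rowSig j a) [i, i - 1] = some b)
    (hc : pos (SignType.sign i) d (colSig i a) [j, j + 1] = some c) :
    ∃ b' c', pos .neg d' (rowSig j (vMove d i c a)) [i, i - 1] = some b' ∧
      pos (SignType.sign i) d (colSig i (hMove d' j b a)) [j, j + 1] = some c' ∧
      vMove d i c' (hMove d' j b a) = hMove d' j b' (vMove d i c a) := by
  have hb2 := mem_of_pos hb
  have hc2 := mem_of_pos hc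
  rw [pos_rows, ← corner_row, Option.map_eq_some_iff] at hb
  rw [pos_cols, ← corner_col, Option.map_eq_some_iff] at hc
  obtain ⟨r, hr, rfl⟩ := hb
  obtain ⟨s, hs, rfl⟩ := hc
  obtain ⟨r', s', hr', hs', h⟩ := Block.comm (corner_valid ha i j) hr hs
  refine ⟨rowOf i r', colOf j s', ?_, ?_, ?_⟩
  · rw [pos_rows, ← corner_row, corner_vMove, hr']; rfl
  · rw [pos_cols, ← corner_col, corner_hMove, hs']; rfl
  · refine moves_ext ?_ ?_ ?_ ?_ ?_
    · cases r <;> simp [rowOf]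
    · cases r' <;> simp [rowOf]
    · cases s <;> simp [colOf]
    · cases s' <;> simp [colOf]
    · rw [corner_vMove, corner_hMove, corner_hMove, corner_vMove, h]

theorem moves_comm_of_ne {b : ℤ} {c : ℕ} (h : (c ≠ j ∧ c ≠ j + 1) ∨ (b ≠ i ∧ b ≠ i - 1)) :
    vMove d i c (hMove d' j b a) = hMove d' j b (vMove d i c a) := by
  funext x y
  simp only [vMove, hMove]
  grind

variable {C₁ C₂ : List ℕ} {R₁ R₂ : List ℤ}

theorem notMem_of_nodup_append {K : Type} {L₁ Q L₂ : List K} (h : (L₁ ++ Q ++ L₂).Nodup) {k : K}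
    (hk : k ∈ Q) : k ∉ L₁ ∧ k ∉ L₂ := by
  rw [List.nodup_append, List.nodup_append] at h
  exact ⟨fun h' => h.1.2.2 _ h' _ hk rfl, fun h' => h.2.2 _ (List.mem_append_right _ hk) _ h' rfl⟩

/-- The columns j and j + 1 are adjacent in the reading order and form a block. A move in the row i
or i − 1 keeps the signature of this block by the 2 × 2 case, and a move in another row is not seen
by the root i. -/
theorem tot_col_hMove (ha : Valid a) (hC : (C₁ ++ [j, j + 1] ++ C₂).Nodup)
    (hR : (R₁ ++ [i, i - 1] ++ R₂).Nodup) {b : ℤ}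
    (hb : pos .neg d' (rowSig j a) (R₁ ++ [i, i - 1] ++ R₂) = some b) :
    tot (SignType.sign i) (colSig i (hMove d' j b a)) (C₁ ++ [j, j + 1] ++ C₂) =
      tot (SignType.sign i) (colSig i a) (C₁ ++ [j, j + 1] ++ C₂) := by
  have n1 := notMem_of_nodup_append hC (k := j) (by simp)
  have n2 := notMem_of_nodup_append hC (k := j + 1) (by simp)
  by_cases hbm : b ∈ [i, i - 1]
  · have h1 := (pos_block_of_mem (s' := rowSig j a) (fun _ _ => rfl) (fun _ _ => rfl) rfl
      hR hb hbm).1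
    refine tot_block (fun k hk => colSig_hMove (Or.inl ⟨?_, ?_⟩))
      (fun k hk => colSig_hMove (Or.inl ⟨?_, ?_⟩)) (block_tot_col ha h1)
    all_goals rintro rfl; simp_all
  · refine tot_congr fun k _ => colSig_hMove (Or.inr ?_)
    simpa using hbm

theorem tot_row_vMove (ha : Valid a) (hC : (C₁ ++ [j, j + 1] ++ C₂).Nodup)
    (hR : (R₁ ++ [i, i - 1] ++ R₂).Nodup) {c : ℕ}
    (hc : pos (SignType.sign i) d (colSig i a) (C₁ ++ [j, j + 1] ++ C₂) = some c) :
    tot .neg (rowSig j (vMove d i c a)) (R₁ ++ [i, i - 1] ++ R₂) =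
      tot .neg (rowSig j a) (R₁ ++ [i, i - 1] ++ R₂) := by
  have n1 := notMem_of_nodup_append hR (k := i) (by simp)
  have n2 := notMem_of_nodup_append hR (k := i - 1) (by simp)
  by_cases hcm : c ∈ [j, j + 1]
  · have h1 := (pos_block_of_mem (s' := colSig i a) (fun _ _ => rfl) (fun _ _ => rfl) rfl
      hC hc hcm).1
    refine tot_block (fun k hk => rowSig_vMove (Or.inr ⟨?_, ?_⟩))
      (fun k hk => rowSig_vMove (Or.inr ⟨?_, ?_⟩)) (block_tot_row ha h1)
    all_goals rintro rfl; simp_all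
  · refine tot_congr fun k _ => rowSig_vMove (Or.inl ?_)
    simpa using hcm

/-- The operators of `𝔤` and of `𝔤𝔩_u` commute. -/
theorem moves_comm (ha : Valid a) (hC : (C₁ ++ [j, j + 1] ++ C₂).Nodup)
    (hR : (R₁ ++ [i, i - 1] ++ R₂).Nodup) {b : ℤ} {c : ℕ}
    (hb : pos .neg d' (rowSig j a) (R₁ ++ [i, i - 1] ++ R₂) = some b)
    (hc : pos (SignType.sign i) d (colSig i a) (C₁ ++ [j, j + 1] ++ C₂) = some c) :
    ∃ b' c', pos .neg d' (rowSig j (vMove d i c a)) (R₁ ++ [i, i - 1] ++ R₂) = some b' ∧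
      pos (SignType.sign i) d (colSig i (hMove d' j b a)) (C₁ ++ [j, j + 1] ++ C₂) = some c' ∧
      vMove d i c' (hMove d' j b a) = hMove d' j b' (vMove d i c a) := by
  have n1 := notMem_of_nodup_append hC (k := j) (by simp)
  have n2 := notMem_of_nodup_append hC (k := j + 1) (by simp)
  have n3 := notMem_of_nodup_append hR (k := i) (by simp)
  have n4 := notMem_of_nodup_append hR (k := i - 1) (by simp)
  have row1 : ∀ k ∈ R₁, rowSig j (vMove d i c a) k = rowSig j a k := fun k hk =>
    rowSig_vMove (Or.inr ⟨by rintro rfl; exact n3.1 hk, by rintro rfl; exact n4.1 hk⟩)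
  have row2 : ∀ k ∈ R₂, rowSig j (vMove d i c a) k = rowSig j a k := fun k hk =>
    rowSig_vMove (Or.inr ⟨by rintro rfl; exact n3.2 hk, by rintro rfl; exact n4.2 hk⟩)
  have col1 : ∀ k ∈ C₁, colSig i (hMove d' j b a) k = colSig i a k := fun k hk =>
    colSig_hMove (Or.inl ⟨by rintro rfl; exact n1.1 hk, by rintro rfl; exact n2.1 hk⟩)
  have col2 : ∀ k ∈ C₂, colSig i (hMove d' j b a) k = colSig i a k := fun k hk =>
    colSig_hMove (Or.inl ⟨by rintro rfl; exact n1.2 hk, by rintro rfl; exact n2.2 hk⟩)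
  -- Only if both positions lie in the block do the moves share entries. In the other cases the
  -- positions persist, because the block keeps its total signature, and the moves change different
  -- entries.
  by_cases hbm : b ∈ [i, i - 1] <;> by_cases hcm : c ∈ [j, j + 1]
  · have h1 := (pos_block_of_mem (s' := rowSig j a) (fun _ _ => rfl) (fun _ _ => rfl) rfl
      hR hb hbm).1
    have h2 := (pos_block_of_mem (s' := colSig i a) (fun _ _ => rfl) (fun _ _ => rfl) rfl
      hC hc hcm).1
    obtain ⟨b', c', hb', hc', h⟩ := block_comm ha h1 h2
    refine ⟨b', c', ?_, ?_, h⟩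
    · rw [(pos_block_of_mem row1 row2 (block_tot_row ha h2) hR hb hbm).2, hb']
    · rw [(pos_block_of_mem col1 col2 (block_tot_col ha h1) hC hc hcm).2, hc']
  · have h1 := (pos_block_of_mem (s' := rowSig j a) (fun _ _ => rfl) (fun _ _ => rfl) rfl
      hR hb hbm).1
    have hcm' : c ≠ j ∧ c ≠ j + 1 := by simpa using hcm
    refine ⟨b, c, ?_, ?_, moves_comm_of_ne (Or.inl hcm')⟩
    · rw [← hb]
      exact pos_congr fun k _ => rowSig_vMove (Or.inl hcm')
    · exact pos_block_of_notMem col1 col2 (block_tot_col ha h1) hc hcm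
  · have h2 := (pos_block_of_mem (s' := colSig i a) (fun _ _ => rfl) (fun _ _ => rfl) rfl
      hC hc hcm).1
    have hbm' : b ≠ i ∧ b ≠ i - 1 := by simpa using hbm
    refine ⟨b, c, ?_, ?_, moves_comm_of_ne (Or.inr hbm')⟩
    · exact pos_block_of_notMem row1 row2 (block_tot_row ha h2) hb hbm
    · rw [← hc]
      exact pos_congr fun k _ => colSig_hMove (Or.inr hbm')
  · have hbm' : b ≠ i ∧ b ≠ i - 1 := by simpa using hbm
    have hcm' : c ≠ j ∧ c ≠ j + 1 := by simpa using hcm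
    refine ⟨b, c, ?_, ?_, moves_comm_of_ne (Or.inr hbm')⟩
    · rw [← hb]
      exact pos_congr fun k _ => rowSig_vMove (Or.inl hcm')
    · rw [← hc]
      exact pos_congr fun k _ => colSig_hMove (Or.inr hbm')

end Grid

/-! ### Reading words of arrays -/

theorem List.eq_take_append_two {α : Type} (l : List α) (t : ℕ) (h : t + 1 < l.length) :
    l = l.take t ++ [l[t], l[t + 1]] ++ l.drop (t + 2) := by
  conv_lhs => rw [← List.take_append_drop t l]
  rw [List.drop_eq_getElem_cons (by omega), List.drop_eq_getElem_cons h]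
  simp

theorem gLetters_regular (i : ℤ) : gLetters.Regular i where
  even hk b := by
    have hi : i ≠ 0 := by rintro rfl; exact hk sign_zero
    simp only [gLetters, gDatum, AddMonoidHom.coe_mk, ZeroHom.coe_mk, if_neg hi,
      Finsupp.single_apply]
    split_ifs <;> simp
  odd hk b := by
    have hi : i = 0 := sign_eq_zero_iff.1 hk
    subst hi
    simp only [gLetters, gDatum, AddMonoidHom.coe_mk, ZeroHom.coe_mk, if_true, Finsupp.single_apply]
    split_ifs <;> simp <;> omega
  none d b h := by
    cases d <;> simp only [CrystalData.op_true, CrystalData.op_false, CrystalData.sig,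
      Signature.sel_true, Signature.sel_false, gLetters] at h ⊢ <;> split_ifs at h ⊢ <;> simp_all

theorem gLetters_arrow (i : ℤ) : gLetters.Arrow i (i - 1) i where
  sig_lo := by simp [CrystalData.sig, gLetters]
  sig_hi := by
    have : i ≠ i - 1 := by omega
    simp [CrystalData.sig, gLetters, this]
  e_hi := by simp [gLetters]
  f_lo := by simp [gLetters]

theorem gLetters_inert {i b : ℤ} (h1 : b ≠ i - 1) (h2 : b ≠ i) : gLetters.Inert i b := by
  simp [CrystalData.Inert, CrystalData.sig, gLetters, h1, h2]

theorem glLetters_regular {u : ℕ} (j : Fin (u - 1)) : (glLetters u).Regular j where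
  even _ b := by
    simp only [glLetters, glDatum, AddMonoidHom.coe_mk, ZeroHom.coe_mk, Pi.single_apply,
      Fin.ext_iff]
    split_ifs <;> simp <;> omega
  odd hk := absurd hk (by change ¬ (-1 : SignType) = 0; decide)
  none d b h := by
    cases d <;> simp only [CrystalData.op_true, CrystalData.op_false, CrystalData.sig,
      Signature.sel_true, Signature.sel_false, glLetters] at h ⊢ <;> split_ifs at h ⊢ <;> simp_all

/-- The letters `j` and `j + 1`. -/
def glLo {u : ℕ} (j : Fin (u - 1)) : Fin u := ⟨j, by omega⟩
def glHi {u : ℕ} (j : Fin (u - 1)) : Fin u := ⟨j + 1, by omega⟩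

theorem glLetters_arrow {u : ℕ} (j : Fin (u - 1)) : (glLetters u).Arrow j (glLo j) (glHi j) where
  sig_lo := by simp [CrystalData.sig, glLetters, glLo]
  sig_hi := by simp [CrystalData.sig, glLetters, glHi]
  e_hi := by simp [glLetters, glHi, glLo]
  f_lo := by simp [glLetters, glHi, glLo]

theorem glLetters_inert {u : ℕ} {j : Fin (u - 1)} {b : Fin u} (h1 : b ≠ glLo j)
    (h2 : b ≠ glHi j) : (glLetters u).Inert j b := by
  simp only [ne_eq, Fin.ext_iff, glLo, glHi] at h1 h2
  simp [CrystalData.Inert, CrystalData.sig, glLetters, h1, h2]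

namespace CrystalData

open Signature

variable {I P : Type} [AddCommGroup P] {D : CartanDatum I P} {X : Type}
  {C : CrystalData D X} {i : I}

/-- A word in which every letter of `L` is repeated with a given multiplicity. -/
def multWord (L : List X) (x : X → ℕ) : List X := L.flatMap fun b => List.replicate (x b) b

theorem mem_multWord {L : List X} {x : X → ℕ} {b : X} (h : b ∈ multWord L x) : b ∈ L := by
  simp only [multWord, List.mem_flatMap, List.mem_replicate] at h
  obtain ⟨c, hc, _, rfl⟩ := h
  exact hc

theorem multWord_congr {L : List X} {x y : X → ℕ} (h : ∀ b ∈ L, x b = y b) :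
    multWord L x = multWord L y := by
  induction L with
  | nil => rfl
  | cons a L ih =>
    have := ih fun b hb => h b (by simp [hb])
    simp only [multWord, List.flatMap_cons] at this ⊢
    rw [this, h a (by simp)]

variable [DecidableEq X]

/-- The multiplicities after an operator has acted. -/
def multMove (d : Bool) (lo hi : X) (x : X → ℕ) (b : X) : ℕ :=
  if b = lo then (shift d (x lo, x hi)).1 else if b = hi then (shift d (x lo, x hi)).2 else x b

variable {L₁ L₂ : List X} {lo hi : X}

theorem multWord_asc (h : C.Regular i) (a : C.Arrow i lo hi) (hn : (L₁ ++ [lo, hi] ++ L₂).Nodup)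
    (hin : ∀ b ∈ L₁ ++ [lo, hi] ++ L₂, b ≠ lo → b ≠ hi → C.Inert i b) (x : X → ℕ) :
    C.words.sig i (multWord (L₁ ++ [lo, hi] ++ L₂) x) = loc (D.kind i) (x lo) (x hi) ∧
    ∀ d, (D.kind i = .neg → x lo ≤ 1 ∧ x hi ≤ 1) → (D.kind i = .zero → x lo ≤ 1) →
    C.words.op d i (multWord (L₁ ++ [lo, hi] ++ L₂) x) =
      if sel d (loc (D.kind i) (x lo) (x hi)) = 0 then none
      else some (multWord (L₁ ++ [lo, hi] ++ L₂) (multMove d lo hi x)) := by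
  have n1 := Grid.notMem_of_nodup_append hn (k := lo) (by simp)
  have n2 := Grid.notMem_of_nodup_append hn (k := hi) (by simp)
  have hne : hi ≠ lo := by
    rintro rfl
    simp [List.nodup_append] at hn
  have hw : ∀ y : X → ℕ, multWord (L₁ ++ [lo, hi] ++ L₂) y = multWord L₁ y ++
      (List.replicate (y lo) lo ++ List.replicate (y hi) hi) ++ multWord L₂ y := by
    intro y; simp [multWord]
  have i1 : ∀ b ∈ multWord L₁ x, C.Inert i b := fun b hb =>
    hin b (by simp [mem_multWord hb]) (by rintro rfl; exact n1.1 (mem_multWord hb))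
      (by rintro rfl; exact n2.1 (mem_multWord hb))
  have i2 : ∀ b ∈ multWord L₂ x, C.Inert i b := fun b hb =>
    hin b (by simp [mem_multWord hb]) (by rintro rfl; exact n1.2 (mem_multWord hb))
      (by rintro rfl; exact n2.2 (mem_multWord hb))
  refine ⟨?_, fun d hk hz => ?_⟩
  · rw [hw, (words_inert_ends h true i1 i2).1, asc_sig h a]
  · rw [hw, (words_inert_ends h d i1 i2).2, asc_op h a d _ _ hk hz, hw]
    have c1 : multWord L₁ (multMove d lo hi x) = multWord L₁ x := multWord_congr fun b hb => by
      rw [multMove, if_neg (by rintro rfl; exact n1.1 hb), if_neg (by rintro rfl; exact n2.1 hb)]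
    have c2 : multWord L₂ (multMove d lo hi x) = multWord L₂ x := multWord_congr fun b hb => by
      rw [multMove, if_neg (by rintro rfl; exact n1.2 hb), if_neg (by rintro rfl; exact n2.2 hb)]
    rw [c1, c2]
    split_ifs <;> simp [multMove, hne]

theorem multWord_desc (h : C.Regular i) (a : C.Arrow i lo hi) (hk : D.kind i = .neg)
    (hn : (L₁ ++ [hi, lo] ++ L₂).Nodup)
    (hin : ∀ b ∈ L₁ ++ [hi, lo] ++ L₂, b ≠ lo → b ≠ hi → C.Inert i b) (x : X → ℕ) :
    C.words.sig i (multWord (L₁ ++ [hi, lo] ++ L₂) x) = loc .pos (x lo) (x hi) ∧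
    ∀ d, C.words.op d i (multWord (L₁ ++ [hi, lo] ++ L₂) x) =
      if sel d (loc .pos (x lo) (x hi)) = 0 then none
      else some (multWord (L₁ ++ [hi, lo] ++ L₂) (multMove d lo hi x)) := by
  have n1 := Grid.notMem_of_nodup_append hn (k := lo) (by simp)
  have n2 := Grid.notMem_of_nodup_append hn (k := hi) (by simp)
  have hne : hi ≠ lo := by
    rintro rfl
    simp [List.nodup_append] at hn
  have hw : ∀ y : X → ℕ, multWord (L₁ ++ [hi, lo] ++ L₂) y = multWord L₁ y ++
      (List.replicate (y hi) hi ++ List.replicate (y lo) lo) ++ multWord L₂ y := by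
    intro y; simp [multWord]
  have i1 : ∀ b ∈ multWord L₁ x, C.Inert i b := fun b hb =>
    hin b (by simp [mem_multWord hb]) (by rintro rfl; exact n1.1 (mem_multWord hb))
      (by rintro rfl; exact n2.1 (mem_multWord hb))
  have i2 : ∀ b ∈ multWord L₂ x, C.Inert i b := fun b hb =>
    hin b (by simp [mem_multWord hb]) (by rintro rfl; exact n1.2 (mem_multWord hb))
      (by rintro rfl; exact n2.2 (mem_multWord hb))
  refine ⟨?_, fun d => ?_⟩
  · rw [hw, (words_inert_ends h true i1 i2).1, desc_sig h a hk]
  · rw [hw, (words_inert_ends h d i1 i2).2, desc_op h a hk, hw]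
    have c1 : multWord L₁ (multMove d lo hi x) = multWord L₁ x := multWord_congr fun b hb => by
      rw [multMove, if_neg (by rintro rfl; exact n1.1 hb), if_neg (by rintro rfl; exact n2.1 hb)]
    have c2 : multWord L₂ (multMove d lo hi x) = multWord L₂ x := multWord_congr fun b hb => by
      rw [multMove, if_neg (by rintro rfl; exact n1.2 hb), if_neg (by rintro rfl; exact n2.2 hb)]
    rw [c1, c2]
    split_ifs <;> simp [multMove, hne]

end CrystalData

namespace Grid

open Signature CrystalData FockMatrix

theorem window_eq (m n : ℕ) : window m n = (List.range (m + n)).map fun t : ℕ => (t : ℤ) - m := by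
  simp [window, Function.comp_def, ← List.map_eq_flatMap]

theorem mem_window {m n : ℕ} {b : ℤ} : b ∈ window m n ↔ -(m : ℤ) ≤ b ∧ b < n := by
  simp only [window_eq, List.mem_map, List.mem_range]
  constructor
  · rintro ⟨t, ht, rfl⟩; omega
  · intro h; exact ⟨(b + m).toNat, by omega, by omega⟩

theorem nodup_window (m n : ℕ) : (window m n).Nodup := by
  rw [window_eq]
  exact List.nodup_range.map fun x y h => by simpa using h

theorem split_of_getElem {α : Type} {l : List α} {t : ℕ} {x y : α} (h : t + 1 < l.length)
    (hx : l[t] = x) (hy : l[t + 1] = y) : ∃ L₁ L₂, l = L₁ ++ [x, y] ++ L₂ := by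
  refine ⟨l.take t, l.drop (t + 2), ?_⟩
  rw [← hx, ← hy]
  exact List.eq_take_append_two l t h

theorem window_split {m n : ℕ} {i : ℤ} (h1 : -(m : ℤ) ≤ i - 1) (h2 : i < n) :
    ∃ L₁ L₂, window m n = L₁ ++ [i - 1, i] ++ L₂ := by
  rw [window_eq]
  refine split_of_getElem (t := (i - 1 + m).toNat) (by simp; omega) ?_ ?_ <;>
    simp only [List.getElem_map, List.getElem_range] <;> omega

theorem finRange_split {u : ℕ} (j : Fin (u - 1)) :
    ∃ L₁ L₂, List.finRange u = L₁ ++ [glLo j, glHi j] ++ L₂ :=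
  split_of_getElem (t := j) (by simp; omega) (by simp [glLo]) (by simp [glHi])

theorem range_split {u j : ℕ} (h : j + 1 < u) :
    ∃ L₁ L₂, List.range u = L₁ ++ [j, j + 1] ++ L₂ :=
  split_of_getElem (t := j) (by simpa using h) (by simp) (by simp)

/-- The word of a column. -/
def colPart (p : ℕ × ℕ) (x : ℤ → ℕ) : List ℤ := multWord (window p.1 p.2) x

/-- The word of the columns `0, …, u - 1`. -/
def colWord (u : ℕ) (p : ℕ × ℕ) (a : ℤ → ℕ → ℕ) : List ℤ :=
  (List.range u).flatMap fun c => colPart p fun b => a b c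

/-- The word of a row. -/
def rowPart (u : ℕ) (b : ℤ) (x : ℕ → ℕ) : List (Fin u) :=
  multWord (if b < 0 then List.finRange u else (List.finRange u).reverse) fun c => x c

/-- The indices of the rows, in decreasing order. -/
def rows (p : ℕ × ℕ) : List ℤ := (window p.1 p.2).reverse

/-- The word of the rows. -/
def rowWord (u : ℕ) (p : ℕ × ℕ) (a : ℤ → ℕ → ℕ) : List (Fin u) :=
  (rows p).flatMap fun b => rowPart u b (a b)

variable {a : ℤ → ℕ → ℕ} {u : ℕ} {p : ℕ × ℕ} {i : ℤ} {d : Bool}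

theorem colPart_spec {x : ℤ → ℕ} (h1 : -(p.1 : ℤ) ≤ i - 1) (h2 : i < p.2) :
    gLetters.words.sig i (colPart p x) = loc (SignType.sign i) (x (i - 1)) (x i) ∧
    ∀ d, (∀ b < 0, x b ≤ 1) → gLetters.words.op d i (colPart p x) =
      if sel d (loc (SignType.sign i) (x (i - 1)) (x i)) = 0 then none
      else some (colPart p (multMove d (i - 1) i x)) := by
  obtain ⟨L₁, L₂, hL⟩ := window_split (m := p.1) (n := p.2) h1 h2
  have hn := nodup_window p.1 p.2
  rw [hL] at hn
  have := multWord_asc (gLetters_regular i) (gLetters_arrow i) hn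
    (fun b _ h1 h2 => gLetters_inert h1 h2) x
  rw [← hL] at this
  refine ⟨this.1, fun d hx => this.2 d (fun hk => ?_) fun hk => ?_⟩
  · have : i < 0 := sign_eq_neg_one_iff.1 hk
    exact ⟨hx _ (by omega), hx _ this⟩
  · have : i = 0 := sign_eq_zero_iff.1 hk
    exact hx _ (by omega)

theorem flatMap_congr' {α β : Type} {L : List α} {f g : α → List β} (h : ∀ x ∈ L, f x = g x) :
    L.flatMap f = L.flatMap g := by
  induction L with
  | nil => rfl
  | cons b L ih => simp_all

theorem colWord_op (ha : Valid a) (h1 : -(p.1 : ℤ) ≤ i - 1) (h2 : i < p.2) :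
    gLetters.words.op d i (colWord u p a) =
      (pos (SignType.sign i) d (colSig i a) (List.range u)).map fun c =>
        colWord u p (vMove d i c a) := by
  rw [colWord, words_op_flatMap (gLetters_regular i) d List.nodup_range]
  have hp : pos (gDatum.kind i) d (fun c => gLetters.words.sig i (colPart p fun b => a b c))
      (List.range u) = pos (SignType.sign i) d (colSig i a) (List.range u) :=
    pos_congr fun c _ => (colPart_spec h1 h2).1
  rw [hp]
  cases h : pos (SignType.sign i) d (colSig i a) (List.range u) with
  | none => rfl
  | some c =>
    have h0 : sel d (loc (SignType.sign i) (a (i - 1) c) (a i c)) ≠ 0 := by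
      have h0 := sel_ne_zero_of_pos h
      exact h0
    rw [Option.bind_some, (colPart_spec h1 h2).2 d fun b hb => ha b hb c, if_neg h0]
    simp only [Option.map_some, colWord, Option.some.injEq]
    refine flatMap_congr' fun x _ => ?_
    by_cases hx : x = c
    · subst hx
      rw [Function.update_self]
      refine multWord_congr fun b _ => ?_
      simp only [multMove, vMove, if_true]
    · rw [Function.update_of_ne hx]
      simp [vMove, hx]

variable {j : Fin (u - 1)}

/-- This is the point of the two reading directions: a row of degree 0 read upwards has the
cancelled signature, a row of degree 1 read downwards the uncancelled one, and in both cases the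
operator gives the word of a row again. -/
theorem rowPart_spec {b : ℤ} {x : ℕ → ℕ} :
    (glLetters u).words.sig j (rowPart u b x) = loc (kindRow b) (x j) (x (j + 1)) ∧
    ∀ d, (b < 0 → ∀ c, x c ≤ 1) → (glLetters u).words.op d j (rowPart u b x) =
      if sel d (loc (kindRow b) (x j) (x (j + 1))) = 0 then none
      else some (rowPart u b (multMove d (j : ℕ) (j + 1) x)) := by
  obtain ⟨L₁, L₂, hL⟩ := finRange_split j
  have hn := List.nodup_finRange u
  have hmv : ∀ d, (fun c : Fin u => multMove d (j : ℕ) (j + 1) x c) =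
      multMove d (glLo j) (glHi j) (fun c : Fin u => x c) := by
    intro d; funext c
    simp only [multMove, glLo, glHi, Fin.ext_iff]
  by_cases hb : b < 0
  · rw [hL] at hn
    have := multWord_asc (glLetters_regular j) (glLetters_arrow j) hn
      (fun b _ h1 h2 => glLetters_inert h1 h2) (fun c => x c)
    rw [← hL] at this
    simp only [rowPart, kindRow, hb, if_true, hmv]
    exact ⟨this.1, fun d hx => this.2 d (fun _ => ⟨hx trivial _, hx trivial _⟩)
      fun hk => absurd hk (by change ¬ (-1 : SignType) = 0; decide)⟩
  · have hL' : (List.finRange u).reverse = L₂.reverse ++ [glHi j, glLo j] ++ L₁.reverse := by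
      simp [hL]
    have hn := List.nodup_reverse.2 hn
    rw [hL'] at hn
    have := multWord_desc (glLetters_regular j) (glLetters_arrow j) rfl hn
      (fun b _ h1 h2 => glLetters_inert h1 h2) (fun c => x c)
    rw [← hL'] at this
    simp only [rowPart, kindRow, hb, if_false, hmv]
    exact ⟨this.1, fun d _ => this.2 d⟩

theorem rowWord_sig :
    (glLetters u).words.sig j (rowWord u p a) = tot .neg (rowSig j a) (rows p) := by
  rw [rowWord, words_sig_flatMap (glLetters_regular j)]
  exact tot_congr fun c _ => rowPart_spec.1

theorem nodup_rows (p : ℕ × ℕ) : (rows p).Nodup := List.nodup_reverse.2 (nodup_window _ _)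

theorem mem_rows {b : ℤ} : b ∈ rows p ↔ -(p.1 : ℤ) ≤ b ∧ b < p.2 := by simp [rows, mem_window]

theorem rowWord_op (ha : Valid a) :
    (glLetters u).words.op d j (rowWord u p a) =
      (pos .neg d (rowSig j a) (rows p)).map fun b => rowWord u p (hMove d j b a) := by
  rw [rowWord, words_op_flatMap (glLetters_regular j) d (nodup_rows p)]
  have hp : pos ((glDatum u).kind j) d
      (fun b => (glLetters u).words.sig j (rowPart u b (a b))) (rows p) =
      pos .neg d (rowSig j a) (rows p) := pos_congr fun c _ => rowPart_spec.1
  rw [hp]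
  cases h : pos .neg d (rowSig j a) (rows p) with
  | none => rfl
  | some b =>
    have h0 : sel d (loc (kindRow b) (a b j) (a b (j + 1))) ≠ 0 := by
      have h0 := sel_ne_zero_of_pos h
      exact h0
    rw [Option.bind_some, rowPart_spec.2 d fun hb c => ha b hb c, if_neg h0]
    simp only [Option.map_some, rowWord, Option.some.injEq]
    refine flatMap_congr' fun x _ => ?_
    by_cases hx : x = b
    · subst hx
      rw [Function.update_self]
      refine multWord_congr fun c _ => ?_
      simp only [multMove, hMove, if_true]
    · rw [Function.update_of_ne hx]
      congr 1
      funext c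
      simp [hMove, hx]

end Grid

/-! ### The operators of the matrix model -/

/-- `stableOp` is a choice. Elements are separated by their truncations, so the choice is unique and
any limit that can be exhibited computes it; properness of the filter excludes that `none` and
`some` are both limits. -/
theorem stableOp_eq {J X Y : Type} {F : Filter J} [F.NeBot] {res : J → X → Y}
    {op : Y → Option Y} {x : X} {z : Option X}
    (hsep : ∀ y y', (∀ᶠ p in F, res p y = res p y') → y = y')
    (hz : ∀ᶠ p in F, op (res p x) = z.map (res p)) : stableOp F res op x = z := by
  have h := Classical.epsilon_spec (p := fun z : Option X => ∀ᶠ p in F,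
    op (res p x) = z.map (res p)) ⟨z, hz⟩
  change ∀ᶠ p in F, op (res p x) = (stableOp F res op x).map (res p) at h
  have h2 := h.and hz
  revert h2
  generalize stableOp F res op x = z'
  intro h2
  cases z with
  | none =>
    obtain ⟨p, hp, hp'⟩ := h2.exists
    rw [hp'] at hp
    simpa using hp.symm
  | some y =>
    cases z' with
    | none =>
      obtain ⟨p, hp, hp'⟩ := h2.exists
      rw [hp'] at hp
      simp at hp
    | some y' =>
      rw [hsep y' y]
      filter_upwards [h2] with p hp
      have := hp.1.symm.trans hp.2
      simpa using this

/-- A natural number that drops by one at each application, and vanishes exactly where the operator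
gives 0, counts the applications. -/
theorem maxIter_eq {X : Type} {op : X → Option X} {n : X → ℕ} (h0 : ∀ x, op x = none ↔ n x = 0)
    (h1 : ∀ x y, op x = some y → n x = n y + 1) (x : X) : maxIter op x = n x := by
  have hnone : ∀ k, (fun o : Option X => o.bind op)^[k] none = none := by
    intro k
    induction k with
    | zero => rfl
    | succ k ih => rw [Function.iterate_succ_apply]; exact ih
  have key : ∀ k x, (fun o : Option X => o.bind op)^[k] (some x) ≠ none ↔ k ≤ n x := by
    intro k
    induction k with
    | zero => simp
    | succ k ih =>
      intro x
      rw [Function.iterate_succ_apply]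
      change _^[k] (op x) ≠ none ↔ _
      cases h : op x with
      | none =>
        have := (h0 x).1 h
        rw [hnone]
        simp only [ne_eq, not_true_eq_false, false_iff]
        omega
      | some y =>
        have := h1 x y h
        rw [ih]
        omega
  have hset : {k | (fun o : Option X => o.bind op)^[k] (some x) ≠ none} = Set.Iic (n x) := by
    ext k
    exact key k x
  rw [maxIter, hset]
  exact csSup_Iic

namespace FockMatrix

open Signature Grid CrystalData

variable {u : ℕ}

/-- The entries of a matrix, extended by zero to all columns. -/
def ent (A : FockMatrix u) (b : ℤ) (c : ℕ) : ℕ := if h : c < u then A.entry b ⟨c, h⟩ else 0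

theorem ent_fin (A : FockMatrix u) (b : ℤ) (c : Fin u) : A.ent b c = A.entry b c := by simp [ent]

theorem ent_of_le (A : FockMatrix u) (b : ℤ) {c : ℕ} (h : u ≤ c) : A.ent b c = 0 := by simp [ent, h]

theorem ent_injective : Function.Injective (ent : FockMatrix u → ℤ → ℕ → ℕ) := by
  intro A B h
  ext b c
  rw [← ent_fin, h, ent_fin]

theorem valid_ent (A : FockMatrix u) : Valid A.ent := by
  intro b hb c
  unfold ent
  split_ifs
  · exact A.le_one b hb _
  · exact zero_le_one

/-- The array `a` is trivial outside of the rows of a window. -/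
def _root_.Grid.Within (u : ℕ) (p : ℕ × ℕ) (a : ℤ → ℕ → ℕ) : Prop :=
  (∀ b < -(p.1 : ℤ), ∀ c < u, a b c = 1) ∧ (∀ b ≥ (p.2 : ℤ), ∀ c, a b c = 0) ∧
    ∀ b c, u ≤ c → a b c = 0

theorem _root_.Grid.Within.mono {p q : ℕ × ℕ} {a : ℤ → ℕ → ℕ} (h : Within u p a) (hpq : p ≤ q) :
    Within u q a := by
  obtain ⟨h1, h2⟩ := hpq
  exact ⟨fun b hb c hc => h.1 b (by omega) c hc, fun b hb c => h.2.1 b (by omega) c, h.2.2⟩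

theorem exists_within (A : FockMatrix u) : ∃ p, Within u p A.ent := by
  obtain ⟨m, hm⟩ := eventually_atBot.1 A.eq_one
  obtain ⟨n, hn⟩ := eventually_atTop.1 A.eq_zero
  refine ⟨(m.natAbs, n.natAbs), fun b hb c hc => ?_, fun b hb c => ?_, fun b c => A.ent_of_le b⟩
  · simp only at hb
    rw [ent, dif_pos hc]
    exact hm b (by omega) _
  · simp only at hb
    unfold ent
    split_ifs
    · exact hn b (by omega) _
    · rfl

theorem exists_ent {p : ℕ × ℕ} {a : ℤ → ℕ → ℕ} (h : Within u p a) (ha : Valid a) :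
    ∃ A : FockMatrix u, A.ent = a := by
  refine ⟨⟨fun b c => a b c, fun b hb c => ha b hb c, ?_, ?_⟩, ?_⟩
  · exact eventually_atBot.2 ⟨-(p.1 : ℤ) - 1, fun b hb c => h.1 b (by omega) c c.2⟩
  · exact eventually_atTop.2 ⟨p.2, fun b hb c => h.2.1 b hb c⟩
  · funext b c
    unfold ent
    split_ifs with hc
    · rfl
    · exact (h.2.2 b c (by omega)).symm

/-! Separation of matrices by their biwords. -/

theorem count_flatMap_single {α β : Type} [DecidableEq α] [BEq β] [LawfulBEq β] {L : List α}
    (hL : L.Nodup) (f : α → List β) (x : β) (k : α) (hk : k ∈ L)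
    (h : ∀ k' ∈ L, k' ≠ k → (f k').count x = 0) : (L.flatMap f).count x = (f k).count x := by
  induction L with
  | nil => simp at hk
  | cons a L ih =>
    rw [List.nodup_cons] at hL
    rw [List.flatMap_cons, List.count_append]
    by_cases hak : a = k
    · subst hak
      have : (L.flatMap f).count x = 0 := by
        rw [List.count_eq_zero]
        intro hx
        obtain ⟨k', hk', hx⟩ := List.mem_flatMap.1 hx
        exact List.count_eq_zero.1 (h k' (by simp [hk']) (by rintro rfl; exact hL.1 hk')) hx
      omega
    · rw [h a (by simp) hak, zero_add]
      refine ih hL.2 ?_ fun k' hk' => h k' (by simp [hk'])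
      simpa [Ne.symm hak] using hk

theorem unzip_injective {α β : Type} {l l' : List (α × β)} (h : l.unzip = l'.unzip) : l = l' := by
  have h1 := List.zip_unzip l
  rw [h, List.zip_unzip] at h1
  exact h1.symm

/-- A biword lists the positions themselves, so counting a position recovers the entry, which
neither of the two words alone would allow. -/
theorem entry_eq_count_col (A : FockMatrix u) {p : ℕ × ℕ} {b : ℤ} (hb : b ∈ window p.1 p.2)
    (c : Fin u) : A.entry b c = ((List.finRange u).flatMap fun c => (window p.1 p.2).flatMap fun b =>
      List.replicate (A.entry b c) (b, c)).count (b, c) := by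
  rw [count_flatMap_single (List.nodup_finRange u) _ _ c (List.mem_finRange c),
    count_flatMap_single (nodup_window _ _) _ _ b hb]
  · simp
  · intro k _ hk
    simp [List.count_replicate, hk]
  · intro k _ hk
    rw [List.count_eq_zero]
    simp only [List.mem_flatMap, List.mem_replicate, Prod.mk.injEq, not_exists, not_and]
    intro x _ _ _ h
    exact hk h.symm

theorem entry_eq_count_row (A : FockMatrix u) {p : ℕ × ℕ} {b : ℤ} (hb : b ∈ window p.1 p.2)
    (c : Fin u) : A.entry b c = ((window p.1 p.2).reverse.flatMap fun b =>
    (if b < 0 then List.finRange u else (List.finRange u).reverse).flatMap fun c =>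
      List.replicate (A.entry b c) (b, c)).count (b, c) := by
  rw [count_flatMap_single (L := (window p.1 p.2).reverse) (nodup_rows p) _ _ b (by simpa using hb),
    count_flatMap_single (k := c)]
  · simp
  · split_ifs
    · exact List.nodup_finRange u
    · exact List.nodup_reverse.2 (List.nodup_finRange u)
  · split_ifs <;> simp
  · intro k _ hk
    simp [List.count_replicate, hk]
  · intro k _ hk
    rw [List.count_eq_zero]
    simp only [List.mem_flatMap, List.mem_replicate, Prod.mk.injEq, not_exists, not_and]
    intro x _ _ h
    exact absurd h.symm hk

theorem colBiword_inj {A B : FockMatrix u} {p : ℕ × ℕ} (h : colBiword p A = colBiword p B) {b : ℤ}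
    (hb : b ∈ window p.1 p.2) (c : Fin u) : A.entry b c = B.entry b c := by
  rw [A.entry_eq_count_col hb, B.entry_eq_count_col hb, unzip_injective h]

theorem rowBiword_inj {A B : FockMatrix u} {p : ℕ × ℕ} (h : rowBiword p A = rowBiword p B) {b : ℤ}
    (hb : b ∈ window p.1 p.2) (c : Fin u) : A.entry b c = B.entry b c := by
  rw [A.entry_eq_count_row hb, B.entry_eq_count_row hb, unzip_injective h]

theorem eventually_mem_window (b : ℤ) : ∀ᶠ p : ℕ × ℕ in atTop, b ∈ window p.1 p.2 := by
  filter_upwards [eventually_ge_atTop (b.natAbs, b.natAbs + 1)] with p hp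
  obtain ⟨h1, h2⟩ := hp
  simp only at h1 h2
  rw [mem_window]
  omega

theorem colBiword_sep (A B : FockMatrix u) (h : ∀ᶠ p in atTop, colBiword p A = colBiword p B) :
    A = B := by
  ext b c
  obtain ⟨p, hp, hb⟩ := (h.and (eventually_mem_window b)).exists
  exact colBiword_inj hp hb c

theorem rowBiword_sep (A B : FockMatrix u) (h : ∀ᶠ p in atTop, rowBiword p A = rowBiword p B) :
    A = B := by
  ext b c
  obtain ⟨p, hp, hb⟩ := (h.and (eventually_mem_window b)).exists
  exact rowBiword_inj hp hb c

/-! The components of the biwords. -/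

theorem flatMap_finRange {β : Type} (f : ℕ → List β) :
    (List.finRange u).flatMap (fun c : Fin u => f c) = (List.range u).flatMap f := by
  rw [← List.map_coe_finRange_eq_range, List.flatMap_map]

theorem colBiword_fst (p : ℕ × ℕ) (A : FockMatrix u) : (colBiword p A).1 = colWord u p A.ent := by
  rw [colBiword, List.unzip_eq_map, colWord, ← flatMap_finRange]
  simp only [List.map_flatMap, List.map_replicate, colPart, multWord, ent_fin]

theorem flatMap_replicate {α β : Type} (L : List α) (f : α → ℕ) (x : β) :
    (L.flatMap fun k => List.replicate (f k) x) = List.replicate (L.map f).sum x := by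
  induction L with
  | nil => rfl
  | cons a L ih => rw [List.flatMap_cons, ih, List.map_cons, List.sum_cons, List.replicate_add]

theorem colBiword_snd (p : ℕ × ℕ) (A : FockMatrix u) : (colBiword p A).2 =
    (List.finRange u).flatMap fun c : Fin u =>
      List.replicate ((window p.1 p.2).map fun b => A.ent b c).sum c := by
  rw [colBiword, List.unzip_eq_map]
  simp only [List.map_flatMap, List.map_replicate, flatMap_replicate, ent_fin]

theorem rowBiword_snd (p : ℕ × ℕ) (A : FockMatrix u) : (rowBiword p A).2 = rowWord u p A.ent := by
  rw [rowBiword, List.unzip_eq_map, rowWord]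
  simp only [List.map_flatMap, List.map_replicate, rowPart, multWord, ent_fin, rows]

theorem rowBiword_fst (p : ℕ × ℕ) (A : FockMatrix u) : (rowBiword p A).1 =
    (rows p).flatMap fun b =>
      List.replicate ((List.range u).map fun c => A.ent b c).sum b := by
  rw [rowBiword, List.unzip_eq_map, rows]
  simp only [List.map_flatMap, List.map_replicate, flatMap_replicate]
  refine flatMap_congr' fun b _ => ?_
  rw [← List.map_coe_finRange_eq_range, List.map_map]
  simp only [Function.comp_def, ent_fin]
  split_ifs
  · rfl
  · rw [List.map_reverse, List.sum_reverse]

end FockMatrix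

/-! ### Elementary properties of the moves of arrays -/

namespace Signature

/-- The effect of an operator on the local signature. -/
theorem loc_shift {κ : SignType} {d : Bool} {x y : ℕ} (h : sel d (loc κ x y) ≠ 0)
    (hn : κ = .neg → x ≤ 1 ∧ y ≤ 1) (hz : κ = .zero → x ≤ 1) :
    sel d (loc κ x y) = sel d (loc κ (shift d (x, y)).1 (shift d (x, y)).2) + 1 ∧
    sel (!d) (loc κ (shift d (x, y)).1 (shift d (x, y)).2) = sel (!d) (loc κ x y) + 1 ∧
    shift (!d) (shift d (x, y)) = (x, y) ∧
    (shift d (x, y)).1 + (shift d (x, y)).2 = x + y ∧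
    (κ = .neg → (shift d (x, y)).1 ≤ 1 ∧ (shift d (x, y)).2 ≤ 1) ∧
    (κ = .zero → (shift d (x, y)).1 ≤ 1) := by
  cases κ <;> cases d <;> simp [loc, shift] at h hn hz ⊢ <;> grind

end Signature

namespace Grid

open Signature CrystalData FockMatrix

variable {a : ℤ → ℕ → ℕ} {u : ℕ} {p : ℕ × ℕ} {i : ℤ} {d : Bool} {c : ℕ} {b : ℤ} {j : ℕ}

theorem ne_pred (i : ℤ) : i ≠ i - 1 := by omega

theorem loc_col_valid (ha : Valid a) (i : ℤ) (c : ℕ) :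
    (SignType.sign i = .neg → a (i - 1) c ≤ 1 ∧ a i c ≤ 1) ∧
      (SignType.sign i = .zero → a (i - 1) c ≤ 1) := by
  refine ⟨fun h => ?_, fun h => ?_⟩
  · have : i < 0 := sign_eq_neg_one_iff.1 h
    exact ⟨ha _ (by omega) _, ha _ this _⟩
  · have : i = 0 := sign_eq_zero_iff.1 h
    exact ha _ (by omega) _

theorem loc_row_valid (ha : Valid a) (b : ℤ) (j : ℕ) :
    (kindRow b = .neg → a b j ≤ 1 ∧ a b (j + 1) ≤ 1) ∧ (kindRow b = .zero → a b j ≤ 1) := by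
  unfold kindRow
  split_ifs with h
  · exact ⟨fun _ => ⟨ha _ h _, ha _ h _⟩, fun h => nomatch h⟩
  · exact ⟨fun h => (nomatch h), fun h => (nomatch h)⟩

theorem colSig_vMove_self : colSig i (vMove d i c a) c =
    loc (SignType.sign i) (shift d (a (i - 1) c, a i c)).1 (shift d (a (i - 1) c, a i c)).2 := by
  simp [colSig, vMove, ne_pred]

theorem colSig_vMove_of_ne {c' : ℕ} (h : c' ≠ c) : colSig i (vMove d i c a) c' = colSig i a c' := by
  simp [colSig, vMove, h]

theorem rowSig_hMove_self : rowSig j (hMove d j b a) b =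
    loc (kindRow b) (shift d (a b j, a b (j + 1))).1 (shift d (a b j, a b (j + 1))).2 := by
  simp [rowSig, hMove]

theorem rowSig_hMove_of_ne {b' : ℤ} (h : b' ≠ b) : rowSig j (hMove d j b a) b' = rowSig j a b' := by
  simp [rowSig, hMove, h]

theorem vMove_inv (ha : Valid a) (h : sel d (colSig i a c) ≠ 0) :
    vMove (!d) i c (vMove d i c a) = a := by
  have := (loc_shift h (loc_col_valid ha i c).1 (loc_col_valid ha i c).2).2.2.1
  funext x y
  simp only [vMove]
  by_cases hy : y = c
  · subst hy
    by_cases hx : x = i - 1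
    · subst hx; simp [this, ne_pred]
    · by_cases hx' : x = i
      · subst hx'; simp [this, ne_pred]
      · simp [hx, hx']
  · simp [hy]

theorem hMove_inv (ha : Valid a) (h : sel d (rowSig j a b) ≠ 0) :
    hMove (!d) j b (hMove d j b a) = a := by
  have := (loc_shift h (loc_row_valid ha b j).1 (loc_row_valid ha b j).2).2.2.1
  funext x y
  simp only [hMove]
  by_cases hy : x = b
  · subst hy
    by_cases hx : y = j
    · subst hx; simp [this]
    · by_cases hx' : y = j + 1
      · subst hx'; simp [this]
      · simp [hx, hx']
  · simp [hy]

theorem valid_vMove (ha : Valid a) (h : sel d (colSig i a c) ≠ 0) : Valid (vMove d i c a) := by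
  have := (loc_shift h (loc_col_valid ha i c).1 (loc_col_valid ha i c).2).2.2.2.2
  intro x hx y
  simp only [vMove]
  split_ifs with h1 h2 h3
  · subst h2
    rcases lt_or_eq_of_le (show i ≤ 0 by omega) with h0 | h0
    · exact (this.1 (sign_eq_neg_one_iff.2 h0)).1
    · exact this.2 (sign_eq_zero_iff.2 h0)
  · subst h3
    exact (this.1 (sign_eq_neg_one_iff.2 hx)).2
  all_goals exact ha x hx y

theorem valid_hMove (ha : Valid a) (h : sel d (rowSig j a b) ≠ 0) : Valid (hMove d j b a) := by
  have := (loc_shift h (loc_row_valid ha b j).1 (loc_row_valid ha b j).2).2.2.2.2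
  intro x hx y
  simp only [hMove]
  split_ifs with h1 h2 h3
  · subst h1
    exact (this.1 (by simp [kindRow, hx])).1
  · subst h1
    exact (this.1 (by simp [kindRow, hx])).2
  all_goals exact ha x hx y

theorem within_vMove (h : Within u p a) (h1 : -(p.1 : ℤ) ≤ i - 1) (h2 : i < p.2) (hc : c < u) :
    Within u p (vMove d i c a) := by
  refine ⟨fun x hx y hy => ?_, fun x hx y => ?_, fun x y hy => ?_⟩
  · rw [vMove, if_neg (show x ≠ i - 1 by omega), if_neg (show x ≠ i by omega)]
    simp [h.1 x hx y hy]
  · rw [vMove, if_neg (show x ≠ i - 1 by omega), if_neg (show x ≠ i by omega)]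
    simp [h.2.1 x hx y]
  · rw [vMove, if_neg (by omega)]
    exact h.2.2 x y hy

theorem within_hMove (h : Within u p a) (h1 : -(p.1 : ℤ) ≤ b) (h2 : b < p.2) (hj : j + 1 < u) :
    Within u p (hMove d j b a) := by
  refine ⟨fun x hx y hy => ?_, fun x hx y => ?_, fun x y hy => ?_⟩
  · rw [hMove, if_neg (by omega)]
    exact h.1 x hx y hy
  · rw [hMove, if_neg (by omega)]
    exact h.2.1 x hx y
  · rw [hMove, if_neg (show y ≠ j by omega), if_neg (show y ≠ j + 1 by omega)]
    simp [h.2.2 x y hy]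

/-- The definition of `FockMatrix.e` keeps the word of column indices fixed. That word repeats a
column index as often as the column has letters in the window, so the truncations can match only
because a move preserves this number. -/
theorem sum_window_vMove (ha : Valid a) (h : sel d (colSig i a c) ≠ 0)
    (h1 : -(p.1 : ℤ) ≤ i - 1) (h2 : i < p.2) (c' : ℕ) :
    ((window p.1 p.2).map fun b => vMove d i c a b c').sum =
      ((window p.1 p.2).map fun b => a b c').sum := by
  by_cases hc : c' = c
  · subst hc
    have hs := (loc_shift h (loc_col_valid ha i c').1 (loc_col_valid ha i c').2).2.2.2.1
    obtain ⟨L₁, L₂, hL⟩ := window_split (m := p.1) (n := p.2) h1 h2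
    have hn := nodup_window p.1 p.2
    rw [hL] at hn ⊢
    have n1 := notMem_of_nodup_append hn (k := i - 1) (by simp)
    have n2 := notMem_of_nodup_append hn (k := i) (by simp)
    have e1 : (L₁.map fun b => vMove d i c' a b c') = L₁.map fun b => a b c' :=
      List.map_congr_left fun b hb => by
        rw [vMove, if_neg (show b ≠ i - 1 by rintro rfl; exact n1.1 hb),
          if_neg (show b ≠ i by rintro rfl; exact n2.1 hb), ite_self]
    have e2 : (L₂.map fun b => vMove d i c' a b c') = L₂.map fun b => a b c' :=
      List.map_congr_left fun b hb => by
        rw [vMove, if_neg (show b ≠ i - 1 by rintro rfl; exact n1.2 hb),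
          if_neg (show b ≠ i by rintro rfl; exact n2.2 hb), ite_self]
    simp only [List.map_append, List.sum_append, e1, e2]
    simp [vMove, hs, ne_pred]
  · simp [vMove, hc]

theorem sum_range_hMove (ha : Valid a) (h : sel d (rowSig j a b) ≠ 0) (hj : j + 1 < u) (b' : ℤ) :
    ((List.range u).map fun c => hMove d j b a b' c).sum =
      ((List.range u).map fun c => a b' c).sum := by
  by_cases hb : b' = b
  · subst hb
    have hs := (loc_shift h (loc_row_valid ha b' j).1 (loc_row_valid ha b' j).2).2.2.2.1
    obtain ⟨L₁, L₂, hL⟩ := range_split hj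
    have hn := List.nodup_range (n := u)
    rw [hL] at hn ⊢
    have n1 := notMem_of_nodup_append hn (k := j) (by simp)
    have n2 := notMem_of_nodup_append hn (k := j + 1) (by simp)
    have e1 : (L₁.map fun c => hMove d j b' a b' c) = L₁.map fun c => a b' c :=
      List.map_congr_left fun c hb => by
        rw [hMove, if_neg (show c ≠ j by rintro rfl; exact n1.1 hb),
          if_neg (show c ≠ j + 1 by rintro rfl; exact n2.1 hb), ite_self]
    have e2 : (L₂.map fun c => hMove d j b' a b' c) = L₂.map fun c => a b' c :=
      List.map_congr_left fun c hb => by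
        rw [hMove, if_neg (show c ≠ j by rintro rfl; exact n1.2 hb),
          if_neg (show c ≠ j + 1 by rintro rfl; exact n2.2 hb), ite_self]
    simp only [List.map_append, List.sum_append, e1, e2]
    simp [hMove, hs]
  · simp [hMove, hb]

theorem rows_decomp {p q : ℕ × ℕ} (h : p ≤ q) : ∃ L₁ L₂, rows q = L₁ ++ rows p ++ L₂ ∧
    (∀ b ∈ L₁, (p.2 : ℤ) ≤ b) ∧ ∀ b ∈ L₂, b < -(p.1 : ℤ) := by
  obtain ⟨h1, h2⟩ := h
  obtain ⟨m, hm⟩ := Nat.exists_eq_add_of_le h1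
  obtain ⟨n, hn⟩ := Nat.exists_eq_add_of_le h2
  refine ⟨((List.range n).map fun t : ℕ => (p.2 : ℤ) + t).reverse,
    ((List.range m).map fun t : ℕ => (t : ℤ) - q.1).reverse, ?_, ?_, ?_⟩
  · rw [rows, rows, ← List.reverse_append, ← List.reverse_append, window_eq, window_eq, hm, hn,
      show p.1 + m + (p.2 + n) = m + (p.1 + p.2) + n by omega, List.range_add, List.range_add]
    simp only [List.map_append, List.map_map, Function.comp_def, List.append_assoc]
    congr 2
    · congr 1
      · refine List.map_congr_left fun t _ => ?_
        push_cast; ring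
      · refine List.map_congr_left fun t _ => ?_
        push_cast; ring
  · intro b hb
    simp only [List.mem_reverse, List.mem_map, List.mem_range] at hb
    obtain ⟨t, _, rfl⟩ := hb
    omega
  · intro b hb
    simp only [List.mem_reverse, List.mem_map, List.mem_range] at hb
    obtain ⟨t, _, rfl⟩ := hb
    omega

/-- Below the window both entries are 1 in a row of degree 0 and cancel; above the window both are
0. -/
theorem rowSig_trivial (h : Within u p a) (hj : j + 1 < u) (hb : b < -(p.1 : ℤ) ∨ (p.2 : ℤ) ≤ b) :
    rowSig j a b = (0, 0) := by
  rcases hb with hb | hb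
  · rw [rowSig, h.1 b hb j (by omega), h.1 b hb (j + 1) hj, kindRow, if_pos (by omega)]
    rfl
  · rw [rowSig, h.2.1 b hb j, h.2.1 b hb (j + 1)]
    unfold kindRow
    split_ifs <;> rfl

theorem tot_rows_eq {p q : ℕ × ℕ} (h : Within u p a) (hj : j + 1 < u) (hpq : p ≤ q) :
    tot .neg (rowSig j a) (rows q) = tot .neg (rowSig j a) (rows p) := by
  obtain ⟨L₁, L₂, hL, h₁, h₂⟩ := rows_decomp hpq
  rw [hL]
  exact tot_trivial_ends (fun b hb => rowSig_trivial h hj (Or.inr (h₁ b hb)))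
    fun b hb => rowSig_trivial h hj (Or.inl (h₂ b hb))

theorem pos_rows_eq {p q : ℕ × ℕ} (h : Within u p a) (hj : j + 1 < u) (hpq : p ≤ q) :
    pos .neg d (rowSig j a) (rows q) = pos .neg d (rowSig j a) (rows p) := by
  obtain ⟨L₁, L₂, hL, h₁, h₂⟩ := rows_decomp hpq
  rw [hL]
  exact pos_trivial_ends (fun b hb => rowSig_trivial h hj (Or.inr (h₁ b hb)))
    fun b hb => rowSig_trivial h hj (Or.inl (h₂ b hb))

end Grid

namespace FockMatrix

open Signature Grid CrystalData

variable {u : ℕ}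

/-- The operators of `𝔤` act on a single column. -/
theorem op_ent (d : Bool) (i : ℤ) (A : FockMatrix u) :
    ((crystal u).op d i A).map ent =
      (pos (SignType.sign i) d (colSig i A.ent) (List.range u)).map fun c => vMove d i c A.ent := by
  have hop : (crystal u).op d i = stableOp atTop colBiword
      fun w => (gLetters.words.op d i w.1).map fun x => (x, w.2) := by
    cases d <;> rfl
  obtain ⟨q, hq⟩ := A.exists_within
  have hlarge : ∀ p : ℕ × ℕ, (i.natAbs + 1, i.natAbs + 1) ≤ p → -(p.1 : ℤ) ≤ i - 1 ∧ i < p.2 := by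
    rintro ⟨m, n⟩ ⟨h1, h2⟩
    simp only at h1 h2 ⊢
    omega
  cases h : pos (SignType.sign i) d (colSig i A.ent) (List.range u) with
  | none =>
    rw [hop, stableOp_eq (z := none) colBiword_sep]
    · rfl
    filter_upwards [eventually_ge_atTop (i.natAbs + 1, i.natAbs + 1)] with p hp
    rw [colBiword_fst, colWord_op A.valid_ent (hlarge p hp).1 (hlarge p hp).2, h]
    rfl
  | some c =>
    have hc : c < u := List.mem_range.1 (mem_of_pos h)
    have hs := sel_ne_zero_of_pos h
    -- The window is enlarged so that it contains the rows i − 1 and i, the only ones that change.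
    have hw : Within u (q ⊔ (i.natAbs + 1, i.natAbs + 1)) (vMove d i c A.ent) :=
      within_vMove (hq.mono le_sup_left) (hlarge _ le_sup_right).1 (hlarge _ le_sup_right).2 hc
    obtain ⟨A', hA'⟩ := exists_ent hw (valid_vMove A.valid_ent hs)
    rw [hop, stableOp_eq (z := some A') colBiword_sep]
    · simp [hA']
    filter_upwards [eventually_ge_atTop (i.natAbs + 1, i.natAbs + 1)] with p hp
    obtain ⟨h1, h2⟩ := hlarge p hp
    rw [colBiword_fst, colWord_op A.valid_ent h1 h2, h]
    simp only [Option.map_some, Option.some.injEq]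
    refine Prod.ext ?_ ?_
    · rw [colBiword_fst, hA']
    · rw [colBiword_snd, colBiword_snd, hA']
      simp only [sum_window_vMove A.valid_ent hs h1 h2]

/-- The operators of `𝔤𝔩_u` act on a single row. -/
theorem opStar_ent (d : Bool) (j : Fin (u - 1)) {A : FockMatrix u} {p : ℕ × ℕ}
    (hp : Within u p A.ent) :
    ((crystalStar u).op d j A).map ent =
      (pos .neg d (rowSig j A.ent) (rows p)).map fun b => hMove d j b A.ent := by
  have hop : (crystalStar u).op d j = stableOp atTop rowBiword
      fun w => ((glLetters u).words.op d j w.2).map fun x => (w.1, x) := by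
    cases d <;> rfl
  have hj : (j : ℕ) + 1 < u := by omega
  cases h : pos .neg d (rowSig j A.ent) (rows p) with
  | none =>
    rw [hop, stableOp_eq (z := none) rowBiword_sep]
    · rfl
    filter_upwards [eventually_ge_atTop p] with q hq
    rw [rowBiword_snd, rowWord_op A.valid_ent, pos_rows_eq hp hj hq, h]
    rfl
  | some b =>
    have hb := mem_rows.1 (mem_of_pos h)
    have hs := sel_ne_zero_of_pos h
    obtain ⟨A', hA'⟩ := exists_ent (within_hMove (d := d) hp hb.1 hb.2 hj) (valid_hMove A.valid_ent hs)
    rw [hop, stableOp_eq (z := some A') rowBiword_sep]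
    · simp [hA']
    filter_upwards [eventually_ge_atTop p] with q hq
    rw [rowBiword_snd, rowWord_op A.valid_ent, pos_rows_eq hp hj hq, h]
    simp only [Option.map_some, Option.some.injEq]
    refine Prod.ext ?_ ?_
    · rw [rowBiword_fst, rowBiword_fst, hA']
      simp only [sum_range_hMove A.valid_ent hs hj]
    · rw [rowBiword_snd, hA']

end FockMatrix

/-! ### The crystal axioms for the matrix model -/

namespace CrystalData

open Signature

variable {I P : Type} [AddCommGroup P] {D : CartanDatum I P} {X : Type}

/-- The operators of `C` change the signature `S` as they should. -/
structure HasSig (C : CrystalData D X) (S : I → X → ℕ × ℕ) : Prop where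
  none_iff : ∀ d i x, C.op d i x = none ↔ sel d (S i x) = 0
  some_spec : ∀ d i x y, C.op d i x = some y → sel d (S i x) = sel d (S i y) + 1 ∧
    sel (!d) (S i y) = sel (!d) (S i x) + 1 ∧ C.op (!d) i y = some x

theorem HasSig.maxIter_eq {C : CrystalData D X} {S : I → X → ℕ × ℕ} (h : C.HasSig S) (i : I) (x : X) :
    (maxIter (C.e i) x, maxIter (C.f i) x) = S i x := by
  rw [_root_.maxIter_eq (op := C.e i) (n := fun x => (S i x).1) (h.none_iff true i)
    fun x y hxy => (h.some_spec true i x y hxy).1,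
    _root_.maxIter_eq (op := C.f i) (n := fun x => (S i x).2) (h.none_iff false i)
    fun x y hxy => (h.some_spec false i x y hxy).1]

theorem HasSig.isCrystal {C : CrystalData D X} {S : I → X → ℕ × ℕ} (h : C.HasSig S)
    (hS : ∀ i x, C.sig i x = S i x)
    (even : ∀ i x, D.kind i ≠ 0 → ((S i x).2 : ℤ) - (S i x).1 = D.coroot i (C.wt x))
    (odd : ∀ i x, D.kind i = 0 → 0 ≤ D.coroot i (C.wt x) ∧
      (S i x).2 + (S i x).1 = if 0 < D.coroot i (C.wt x) then 1 else 0)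
    (wt : ∀ i x y, C.e i x = some y → C.wt y = C.wt x + D.root i) : C.IsCrystal := by
  have hε : ∀ i x, C.ε i x = (S i x).1 := fun i x => by rw [← hS]; rfl
  have hφ : ∀ i x, C.φ i x = (S i x).2 := fun i x => by rw [← hS]; rfl
  have hef : ∀ i b b', C.f i b = some b' ↔ C.e i b' = some b := fun i b b' =>
    ⟨fun hf => (h.some_spec false i b b' hf).2.2, fun he => (h.some_spec true i b' b he).2.2⟩
  refine ⟨fun i b hk => ?_, fun i b hk => (odd i b hk).1, fun i b hk h0 => ?_,
    fun i b hk h0 => ?_, fun i b b' he => ?_, fun i b b' hf => ?_, hef⟩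
  · rw [hε, hφ, even i b hk]
  · rw [hε, hφ, (odd i b hk).2, if_neg (by omega)]
  · rw [hε, hφ, (odd i b hk).2, if_pos h0]
  · have := h.some_spec true i b b' he
    rw [hε, hφ, hε, hφ]
    exact ⟨this.1, this.2.1, wt i b b' he⟩
  · have := h.some_spec false i b b' hf
    rw [hε, hφ, hε, hφ]
    refine ⟨this.2.1, this.1, ?_⟩
    rw [wt i b' b ((hef i b b').1 hf), add_sub_cancel_right]

end CrystalData

namespace FockMatrix

open Signature Grid CrystalData

variable {u : ℕ} {d d' : Bool} {i : ℤ} {j : Fin (u - 1)} {A A' : FockMatrix u} {p : ℕ × ℕ}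

theorem op_eq_none :
    (crystal u).op d i A = none ↔ sel d (tot (SignType.sign i) (colSig i A.ent) (List.range u)) = 0 := by
  rw [← pos_eq_none, ← Option.map_eq_none_iff (f := ent), op_ent, Option.map_eq_none_iff]

theorem op_eq_some : (crystal u).op d i A = some A' ↔
    ∃ c, pos (SignType.sign i) d (colSig i A.ent) (List.range u) = some c ∧
      A'.ent = vMove d i c A.ent := by
  have h := op_ent d i A
  constructor
  · intro h'
    rw [h'] at h
    obtain ⟨c, hc, hc'⟩ := Option.map_eq_some_iff.1 h.symm
    exact ⟨c, hc, hc'.symm⟩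
  · rintro ⟨c, hc, hc'⟩
    rw [hc] at h
    obtain ⟨B, hB, hB'⟩ := Option.map_eq_some_iff.1 h
    rw [hB, ent_injective (hB'.trans hc'.symm)]

theorem opStar_eq_none (hp : Within u p A.ent) :
    (crystalStar u).op d j A = none ↔ sel d (tot .neg (rowSig j A.ent) (rows p)) = 0 := by
  rw [← pos_eq_none, ← Option.map_eq_none_iff (f := ent), opStar_ent d j hp, Option.map_eq_none_iff]

theorem opStar_eq_some (hp : Within u p A.ent) : (crystalStar u).op d j A = some A' ↔
    ∃ b, pos .neg d (rowSig j A.ent) (rows p) = some b ∧ A'.ent = hMove d j b A.ent := by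
  have h := opStar_ent d j hp
  constructor
  · intro h'
    rw [h'] at h
    obtain ⟨c, hc, hc'⟩ := Option.map_eq_some_iff.1 h.symm
    exact ⟨c, hc, hc'.symm⟩
  · rintro ⟨c, hc, hc'⟩
    rw [hc] at h
    obtain ⟨B, hB, hB'⟩ := Option.map_eq_some_iff.1 h
    rw [hB, ent_injective (hB'.trans hc'.symm)]

theorem within_opStar (hp : Within u p A.ent) (h : (crystalStar u).op d j A = some A') :
    Within u p A'.ent := by
  obtain ⟨b, hb, hA'⟩ := (opStar_eq_some hp).1 h
  have hb' := mem_rows.1 (mem_of_pos hb)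
  rw [hA']
  exact within_hMove hp hb'.1 hb'.2 (by omega)

theorem within_op (hp : Within u p A.ent) (h1 : -(p.1 : ℤ) ≤ i - 1) (h2 : i < p.2)
    (h : (crystal u).op d i A = some A') : Within u p A'.ent := by
  obtain ⟨c, hc, hA'⟩ := op_eq_some.1 h
  rw [hA']
  exact within_vMove hp h1 h2 (List.mem_range.1 (mem_of_pos hc))

theorem exists_within_ge (A : FockMatrix u) (i : ℤ) :
    ∃ p, Within u p A.ent ∧ -(p.1 : ℤ) ≤ i - 1 ∧ i < p.2 := by
  obtain ⟨q, hq⟩ := A.exists_within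
  refine ⟨(q.1 + (i.natAbs + 1), q.2 + (i.natAbs + 1)), hq.mono ⟨?_, ?_⟩, ?_, ?_⟩ <;>
    simp only <;> omega

theorem tot_rows_indep {p q : ℕ × ℕ} (hp : Within u p A.ent) (hq : Within u q A.ent) :
    tot .neg (rowSig j A.ent) (rows p) = tot .neg (rowSig j A.ent) (rows q) := by
  rw [← tot_rows_eq hp (by omega) (le_sup_left (a := p) (b := q)),
    ← tot_rows_eq hq (by omega) (le_sup_right (a := p) (b := q))]

theorem colSig_zero_le (A : FockMatrix u) (c : ℕ) (hi : SignType.sign i = 0) :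
    (colSig i A.ent c).1 + (colSig i A.ent c).2 ≤ 1 := by
  have h1 : i = 0 := sign_eq_zero_iff.1 hi
  have h2 := A.valid_ent (i - 1) (by omega) c
  rw [colSig, hi]
  change (loc .zero _ _).1 + (loc .zero _ _).2 ≤ 1
  simp only [loc]
  split_ifs <;> omega

theorem hasSig : (crystal u).HasSig
    fun i A => tot (SignType.sign i) (colSig i A.ent) (List.range u) := by
  refine ⟨fun d i A => op_eq_none, fun d i A A' h => ?_⟩
  obtain ⟨c, hc, hA'⟩ := op_eq_some.1 h
  have hs := sel_ne_zero_of_pos hc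
  have hl := loc_shift hs (loc_col_valid A.valid_ent i c).1 (loc_col_valid A.valid_ent i c).2
  have := tot_move (s' := colSig i A'.ent) List.nodup_range hc
    (fun x _ hx => by rw [hA', colSig_vMove_of_ne hx])
    (by rw [hA', colSig_vMove_self]; exact hl.1) (by rw [hA', colSig_vMove_self]; exact hl.2.1)
    fun hk c _ => A.colSig_zero_le c hk
  refine ⟨this.1, this.2.1, op_eq_some.2 ⟨c, this.2.2, ?_⟩⟩
  rw [hA', vMove_inv A.valid_ent hs]

/-- The window is chosen separately for each matrix. This is harmless, because all windows outside
of which the matrix is trivial give the same signature. -/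
theorem hasSigStar : (crystalStar u).HasSig
    fun j A => tot .neg (rowSig j A.ent) (rows A.exists_within.choose) := by
  refine ⟨fun d i A => opStar_eq_none A.exists_within.choose_spec, fun d j A A' h => ?_⟩
  have hp := A.exists_within.choose_spec
  revert hp
  generalize A.exists_within.choose = p
  intro hp
  have hp' := within_opStar hp h
  obtain ⟨c, hc, hA'⟩ := (opStar_eq_some hp).1 h
  have hs := sel_ne_zero_of_pos hc
  have hl := loc_shift hs (loc_row_valid A.valid_ent c j).1 (loc_row_valid A.valid_ent c j).2
  have := tot_move (s' := rowSig j A'.ent) (nodup_rows p) hc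
    (fun x _ hx => by rw [hA', rowSig_hMove_of_ne hx])
    (by rw [hA', rowSig_hMove_self]; exact hl.1) (by rw [hA', rowSig_hMove_self]; exact hl.2.1)
    fun hk => nomatch hk
  rw [tot_rows_indep A'.exists_within.choose_spec hp']
  refine ⟨this.1, this.2.1, (opStar_eq_some hp').2 ⟨c, this.2.2, ?_⟩⟩
  rw [hA', hMove_inv A.valid_ent hs]

theorem sig_eq (i : ℤ) (A : FockMatrix u) :
    (crystal u).sig i A = tot (SignType.sign i) (colSig i A.ent) (List.range u) :=
  hasSig.maxIter_eq i A

theorem sigStar_eq (hp : Within u p A.ent) :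
    (crystalStar u).sig j A = tot .neg (rowSig j A.ent) (rows p) :=
  (hasSigStar.maxIter_eq j A).trans (tot_rows_indep A.exists_within.choose_spec hp)

/-- The value of the vacuum at the row `b`. -/
def vac (b : ℤ) : ℤ := if b < 0 then 1 else 0

theorem wt_fst (A : FockMatrix u) : ((crystal u).wt A).1 = u := rfl

theorem wt_snd (A : FockMatrix u) (b : ℤ) :
    ((crystal u).wt A).2 b = ∑ c ∈ Finset.range u, ((A.ent b c : ℤ) - vac b) := by
  rw [Finset.sum_range]
  simp only [ent_fin]
  rfl

theorem wtStar_eq (hp : Within u p A.ent) (c : Fin u) :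
    (crystalStar u).wt A c = ∑ b ∈ Finset.Ico (-(p.1 : ℤ)) p.2, ((A.ent b c : ℤ) - vac b) := by
  change ∑ᶠ b : ℤ, ((A.entry b c : ℤ) - vac b) = _
  simp only [ent_fin]
  refine finsum_eq_sum_of_support_subset _ fun b hb => ?_
  rw [Function.mem_support] at hb
  rw [Finset.coe_Ico, Set.mem_Ico]
  by_contra hout
  apply hb
  rw [← ent_fin, vac]
  rw [not_and_or, not_le, not_lt] at hout
  rcases hout with h | h
  · rw [hp.1 b h c c.2, if_pos (by omega)]; rfl
  · rw [hp.2.1 b h c, if_neg (by omega)]; rfl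

theorem sum_map_range (f : ℕ → ℤ) : ((List.range u).map f).sum = ∑ c ∈ Finset.range u, f c := by
  rw [← List.sum_toFinset f List.nodup_range, List.toFinset_range]

theorem sum_map_rows (f : ℤ → ℤ) :
    ((rows p).map f).sum = ∑ b ∈ Finset.Ico (-(p.1 : ℤ)) p.2, f b := by
  rw [← List.sum_toFinset f (nodup_rows p)]
  congr 1
  ext b
  simp [mem_rows]

theorem loc_diff {κ : SignType} (hκ : κ ≠ 0) (x y : ℕ) :
    ((loc κ x y).2 : ℤ) - (loc κ x y).1 = x - y := by
  cases κ
  · exact absurd rfl hκ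
  all_goals simp only [loc] <;> omega

theorem vMove_sub {c : ℕ} (h : sel true (colSig i A.ent c) ≠ 0) (b : ℤ) (c' : ℕ) :
    (vMove true i c A.ent b c' : ℤ) = A.ent b c' +
      if c' = c then (Finsupp.single (i - 1) 1 - Finsupp.single i 1 : ℤ →₀ ℤ) b else 0 := by
  -- A column on which e_i acts contains the letter i, so the truncated subtraction in `shift` is an
  -- honest one.
  have h1 : A.ent i c ≠ 0 := by
    intro h0
    apply h
    rw [colSig, h0]
    cases SignType.sign i <;> simp [loc]
  simp only [vMove, shift, Finsupp.sub_apply, Finsupp.single_apply]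
  by_cases hc : c' = c
  · subst hc
    by_cases hb : b = i - 1
    · subst hb
      simp [ne_pred]
    · by_cases hb' : b = i
      · subst hb'
        simp [hb, Ne.symm (ne_pred b)]
        omega
      · simp [hb, hb', Ne.symm hb, Ne.symm hb']
  · simp [hc]

theorem hMove_sub {b : ℤ} (h : sel true (rowSig j A.ent b) ≠ 0) (b' : ℤ) (c : Fin u) :
    (hMove true j b A.ent b' c : ℤ) = A.ent b' c + if b' = b then (glDatum u).root j c else 0 := by
  have h1 : A.ent b (j + 1) ≠ 0 := by
    intro h0
    apply h
    rw [rowSig, h0]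
    cases kindRow b <;> simp [loc]
  simp only [hMove, shift, glDatum, Pi.sub_apply, Pi.single_apply, Fin.ext_iff, if_true]
  split_ifs with h1 h2 h3 <;> subst_vars <;> simp_all; omega

theorem isCrystal (u : ℕ) : (crystal u).IsCrystal := by
  refine hasSig.isCrystal sig_eq (fun i A hi => ?_) (fun i A hi => ?_) fun i A A' h => ?_
  · change SignType.sign i ≠ 0 at hi
    rw [tot_diff hi, sum_map_range]
    have hi' : i ≠ 0 := fun h => hi (by rw [h]; rfl)
    change _ = if i = 0 then _ else ((crystal u).wt A).2 (i - 1) - ((crystal u).wt A).2 i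
    rw [if_neg hi', wt_snd, wt_snd, ← Finset.sum_sub_distrib]
    refine Finset.sum_congr rfl fun c _ => ?_
    rw [colSig, loc_diff hi]
    unfold vac
    split_ifs <;> omega
  · change SignType.sign i = 0 at hi
    have hi' : i = 0 := sign_eq_zero_iff.1 hi
    subst hi'
    -- The coefficient u of Λ cancels the vacuum of the row −1, so what remains is the number of
    -- letters in the rows −1 and 0. In particular it is nonnegative.
    have hwt : gDatum.coroot 0 ((crystal u).wt A) =
        ∑ c ∈ Finset.range u, ((A.ent (-1) c : ℤ) + A.ent 0 c) := by
      change (if (0 : ℤ) = 0 then ((crystal u).wt A).1 + ((crystal u).wt A).2 (-1) +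
        ((crystal u).wt A).2 0 else ((crystal u).wt A).2 (0 - 1) - ((crystal u).wt A).2 0) = _
      rw [if_pos rfl, wt_snd, wt_snd, wt_fst]
      simp [Finset.sum_sub_distrib, Finset.sum_add_distrib, vac]
    have h0 : (0 : ℤ) ≤ ∑ c ∈ Finset.range u, ((A.ent (-1) c : ℤ) + A.ent 0 c) :=
      Finset.sum_nonneg fun c _ => by omega
    rw [hwt]
    refine ⟨h0, ?_⟩
    rw [hi]
    have hle := tot_zero_le (s := colSig 0 A.ent) (L := List.range u) fun c _ =>
      A.colSig_zero_le c hi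
    have hz := tot_zero_eq_zero (s := colSig 0 A.ent) (L := List.range u)
    have hz' : (∀ c ∈ List.range u, (colSig 0 A.ent c).1 + (colSig 0 A.ent c).2 = 0) ↔
        ∑ c ∈ Finset.range u, ((A.ent (-1) c : ℤ) + A.ent 0 c) = 0 := by
      rw [Finset.sum_eq_zero_iff_of_nonneg fun c _ => by omega]
      simp only [List.mem_range, Finset.mem_range]
      refine forall₂_congr fun c _ => ?_
      rw [colSig, hi]
      change (loc .zero (A.ent (-1) c) (A.ent 0 c)).1 + (loc .zero (A.ent (-1) c) (A.ent 0 c)).2 = 0 ↔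
        _
      simp only [loc]
      split_ifs <;> omega
    rw [hz'] at hz
    split_ifs <;> omega
  · obtain ⟨c, hc, hA'⟩ := op_eq_some.1 (show (crystal u).op true i A = some A' from h)
    have hc' : c < u := List.mem_range.1 (mem_of_pos hc)
    refine Prod.ext (by simp [wt_fst, gDatum]) (Finsupp.ext fun b => ?_)
    rw [Prod.snd_add, Finsupp.add_apply, wt_snd, wt_snd, hA']
    simp only [vMove_sub (sel_ne_zero_of_pos hc)]
    simp only [add_sub_right_comm]
    rw [Finset.sum_add_distrib, Finset.sum_ite_eq' , if_pos (Finset.mem_range.2 hc')]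
    rfl

theorem isCrystalStar (u : ℕ) : (crystalStar u).IsCrystal := by
  refine hasSigStar.isCrystal (fun j A => hasSigStar.maxIter_eq j A) (fun j A hi => ?_)
    (fun i A hi => ?_) fun j A A' h => ?_
  · have hp := A.exists_within.choose_spec
    rw [tot_diff (by decide), sum_map_rows]
    change _ = (crystalStar u).wt A _ - (crystalStar u).wt A _
    rw [wtStar_eq hp, wtStar_eq hp, ← Finset.sum_sub_distrib]
    refine Finset.sum_congr rfl fun b _ => ?_
    rw [rowSig, loc_diff (by unfold kindRow; split_ifs <;> decide)]
    simp
  · exact absurd hi (by change ¬ (-1 : SignType) = 0; decide)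
  · obtain ⟨p, hp⟩ := A.exists_within
    obtain ⟨b, hb, hA'⟩ := (opStar_eq_some hp).1 (show (crystalStar u).op true j A = some A' from h)
    have hb' := mem_rows.1 (mem_of_pos hb)
    funext c
    rw [Pi.add_apply, wtStar_eq hp, wtStar_eq (within_opStar hp (d := true) h), hA']
    simp only [hMove_sub (sel_ne_zero_of_pos hb), add_sub_right_comm]
    rw [Finset.sum_add_distrib, Finset.sum_ite_eq', if_pos (Finset.mem_Ico.2 hb')]

/-! ### The two structures commute -/

theorem rows_split (h1 : -(p.1 : ℤ) ≤ i - 1) (h2 : i < p.2) :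
    ∃ R₁ R₂, rows p = R₁ ++ [i, i - 1] ++ R₂ := by
  obtain ⟨L₁, L₂, h⟩ := window_split (m := p.1) (n := p.2) h1 h2
  exact ⟨L₂.reverse, L₁.reverse, by simp [rows, h]⟩

theorem sig_opStar (h : (crystalStar u).op d' j A = some A') (i : ℤ) :
    (crystal u).sig i A' = (crystal u).sig i A := by
  obtain ⟨p, hp, h1, h2⟩ := A.exists_within_ge i
  obtain ⟨b, hb, hA'⟩ := (opStar_eq_some hp).1 h
  obtain ⟨R₁, R₂, hR⟩ := rows_split h1 h2
  obtain ⟨C₁, C₂, hC⟩ := range_split (u := u) (j := j) (by omega)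
  have n1 := nodup_rows p
  have n2 := List.nodup_range (n := u)
  rw [sig_eq, sig_eq, hA']
  rw [hC] at n2 ⊢
  rw [hR] at n1 hb
  exact tot_col_hMove A.valid_ent n2 n1 hb

theorem sigStar_op (h : (crystal u).op d i A = some A') (j : Fin (u - 1)) :
    (crystalStar u).sig j A' = (crystalStar u).sig j A := by
  obtain ⟨p, hp, h1, h2⟩ := A.exists_within_ge i
  obtain ⟨c, hc, hA'⟩ := op_eq_some.1 h
  obtain ⟨R₁, R₂, hR⟩ := rows_split h1 h2
  obtain ⟨C₁, C₂, hC⟩ := range_split (u := u) (j := j) (by omega)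
  have n1 := nodup_rows p
  have n2 := List.nodup_range (n := u)
  rw [sigStar_eq hp, sigStar_eq (within_op hp h1 h2 h), hA']
  rw [hC] at n2 hc
  rw [hR] at n1 ⊢
  exact tot_row_vMove A.valid_ent n2 n1 hc

theorem op_opStar {B C : FockMatrix u} (hB : (crystalStar u).op d' j A = some B)
    (hC : (crystal u).op d i A = some C) :
    ∃ E, (crystal u).op d i B = some E ∧ (crystalStar u).op d' j C = some E := by
  obtain ⟨p, hp, h1, h2⟩ := A.exists_within_ge i
  obtain ⟨c, hc, hC'⟩ := op_eq_some.1 hC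
  obtain ⟨b, hb, hB'⟩ := (opStar_eq_some hp).1 hB
  obtain ⟨R₁, R₂, hR⟩ := rows_split h1 h2
  obtain ⟨C₁, C₂, hCC⟩ := range_split (u := u) (j := j) (by omega)
  have n1 := nodup_rows p
  have n2 := List.nodup_range (n := u)
  rw [hCC] at n2 hc
  rw [hR] at n1 hb
  obtain ⟨b', c', hb', hc', hbc⟩ := moves_comm A.valid_ent n2 n1 hb hc
  rw [← hC', ← hR] at hb'
  rw [← hB', ← hCC] at hc'
  have hE : (crystal u).op d i B ≠ none := by
    rw [Ne, op_eq_none, ← pos_eq_none, hc']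
    simp
  obtain ⟨E, hE⟩ := Option.ne_none_iff_exists'.1 hE
  refine ⟨E, hE, (opStar_eq_some (within_op hp h1 h2 hC)).2 ⟨b', hb', ?_⟩⟩
  obtain ⟨c'', hc'', hE'⟩ := op_eq_some.1 hE
  obtain rfl : c'' = c' := by rw [hc'] at hc''; simpa using hc''.symm
  rw [hE', hC', hB', hbc]

theorem op_eq_none_iff : (crystal u).op d i A = none ↔ sel d ((crystal u).sig i A) = 0 := by
  rw [op_eq_none, sig_eq]

theorem opStar_eq_none_iff :
    (crystalStar u).op d j A = none ↔ sel d ((crystalStar u).sig j A) = 0 := by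
  obtain ⟨p, hp⟩ := A.exists_within
  rw [opStar_eq_none hp, sigStar_eq hp]

/-- If one of the two operators gives 0, it still gives 0 after the other one has acted, since the
signature is unchanged. If neither does, the moves commute. -/
theorem op_comm (d d' : Bool) (i : ℤ) (j : Fin (u - 1)) (A : FockMatrix u) :
    ((crystalStar u).op d' j A).bind ((crystal u).op d i) =
      ((crystal u).op d i A).bind ((crystalStar u).op d' j) := by
  cases hB : (crystalStar u).op d' j A with
  | none =>
    cases hC : (crystal u).op d i A with
    | none => rfl
    | some C =>
      refine Eq.symm (opStar_eq_none_iff.2 ?_)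
      rw [sigStar_op hC, ← opStar_eq_none_iff, hB]
  | some B =>
    cases hC : (crystal u).op d i A with
    | none =>
      refine op_eq_none_iff.2 ?_
      rw [sig_opStar hB, ← op_eq_none_iff, hC]
    | some C =>
      obtain ⟨E, h1, h2⟩ := op_opStar hB hC
      exact h1.trans h2.symm

theorem isBicrystal (u : ℕ) : IsBicrystal (crystal u) (crystalStar u) where
  left := isCrystal u
  right := isCrystalStar u
  ee := op_comm true true
  ef := op_comm true false
  fe := op_comm false true
  ff := op_comm false false

theorem wt_opStar (h : (crystalStar u).op d j A = some A') :
    (crystal u).wt A' = (crystal u).wt A := by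
  obtain ⟨p, hp⟩ := A.exists_within
  obtain ⟨b, hb, hA'⟩ := (opStar_eq_some hp).1 h
  refine Prod.ext rfl (Finsupp.ext fun x => ?_)
  have := sum_range_hMove A.valid_ent (sel_ne_zero_of_pos hb) (u := u) (by omega) x
  rw [← hA'] at this
  rw [wt_snd, wt_snd, Finset.sum_sub_distrib, Finset.sum_sub_distrib, ← sum_map_range,
    ← sum_map_range (fun c => (A.ent x c : ℤ))]
  have h2 := congrArg (Nat.cast (R := ℤ)) this
  simp only [Nat.cast_list_sum, List.map_map, Function.comp_def] at h2
  rw [h2]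

theorem wtStar_op (h : (crystal u).op d i A = some A') :
    (crystalStar u).wt A' = (crystalStar u).wt A := by
  obtain ⟨p, hp, h1, h2⟩ := A.exists_within_ge i
  obtain ⟨c, hc, hA'⟩ := op_eq_some.1 h
  funext x
  have := sum_window_vMove (p := p) A.valid_ent (sel_ne_zero_of_pos hc) h1 h2 x
  rw [← hA', ← List.sum_reverse, ← List.map_reverse,
    ← List.sum_reverse (List.map (fun b => A.ent b x) _), ← List.map_reverse] at this
  rw [wtStar_eq hp, wtStar_eq (within_op hp h1 h2 h), Finset.sum_sub_distrib,
    Finset.sum_sub_distrib, ← sum_map_rows, ← sum_map_rows (f := fun b => (A.ent b x : ℤ))]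
  have h2 := congrArg (Nat.cast (R := ℤ)) this
  simp only [Nat.cast_list_sum, List.map_map, Function.comp_def] at h2
  rw [rows, h2]

end FockMatrix

/-! ### Semi-infinite words and columns -/

namespace Grid

open FockMatrix Signature CrystalData

/-- The column `x` is trivial outside of a window. -/
structure IsColumn (p : ℕ × ℕ) (x : ℤ → ℕ) : Prop where
  le_one : ∀ b < 0, x b ≤ 1
  eq_one : ∀ b < -(p.1 : ℤ), x b = 1
  eq_zero : ∀ b ≥ (p.2 : ℤ), x b = 0

/-- The number of letters `≥ b`. -/
noncomputable def colTail (n : ℕ) (x : ℤ → ℕ) (b : ℤ) : ℕ := ∑ y ∈ Finset.Ico b n, x y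

/-- The excess of a column over the vacuum. -/
noncomputable def colSum (p : ℕ × ℕ) (x : ℤ → ℕ) : ℤ := ∑ b ∈ Finset.Ico (-(p.1 : ℤ)) p.2, ((x b : ℤ) - vac b)

variable {p q : ℕ × ℕ} {x : ℤ → ℕ} {b : ℤ}

theorem IsColumn.mono (h : IsColumn p x) (hpq : p ≤ q) : IsColumn q x := by
  obtain ⟨h1, h2⟩ := hpq
  exact ⟨h.1, fun b hb => h.2 b (by omega), fun b hb => h.3 b (by omega)⟩

theorem colTail_of_le {n : ℕ} (h : (n : ℤ) ≤ b) : colTail n x b = 0 := by simp [colTail, h]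

theorem colTail_eq (h : IsColumn p x) (b : ℤ) : colTail p.2 x b = x b + colTail p.2 x (b + 1) := by
  rcases lt_or_ge b (p.2 : ℤ) with hb | hb
  · rw [colTail, ← Finset.insert_Ico_add_one_left_eq_Ico hb, Finset.sum_insert (by simp)]
    rfl
  · rw [h.eq_zero b hb, colTail_of_le hb, colTail_of_le (by omega)]

theorem sum_vac (p : ℕ × ℕ) : ∑ b ∈ Finset.Ico (-(p.1 : ℤ)) p.2, vac b = p.1 := by
  have : ∑ b ∈ Finset.Ico (-(p.1 : ℤ)) p.2, vac b = ∑ b ∈ Finset.Ico (-(p.1 : ℤ)) 0, (1 : ℤ) := by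
    refine (Finset.sum_subset_zero_on_sdiff (Finset.Ico_subset_Ico_right (by omega)) ?_ ?_).symm
    · intro b hb
      simp only [Finset.mem_sdiff, Finset.mem_Ico] at hb
      rw [vac, if_neg (by omega)]
    · intro b hb
      rw [Finset.mem_Ico] at hb
      rw [vac, if_pos (by omega)]
  rw [this]
  simp

theorem colSum_eq (p : ℕ × ℕ) (x : ℤ → ℕ) : colSum p x = colTail p.2 x (-(p.1 : ℤ)) - p.1 := by
  rw [colSum, Finset.sum_sub_distrib, sum_vac, colTail]
  push_cast
  rfl

/-- Below the window every letter occurs exactly once, so the tail grows by one with each step down.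
-/
theorem colTail_of_le_neg (h : IsColumn p x) (hb : b ≤ -(p.1 : ℤ)) :
    (colTail p.2 x b : ℤ) = colSum p x - b := by
  induction b, hb using Int.leInductionDown with
  | base => rw [colSum_eq]; ring
  | pred b hb ih =>
    rw [colTail_eq h, h.eq_one _ (by omega), sub_add_cancel]
    push_cast
    rw [ih]
    ring

theorem isColumn_ent {u : ℕ} {A : FockMatrix u} (h : Within u p A.ent) (c : Fin u) :
    IsColumn p fun b => A.ent b c :=
  ⟨fun b hb => A.valid_ent b hb c, fun b hb => h.1 b hb c c.2, fun b hb => h.2.1 b hb c⟩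

end Grid

namespace FockWord

open Grid FockMatrix Signature CrystalData

variable {p : ℕ × ℕ} {w : FockWord} {b : ℤ} {k : ℕ}

theorem antitone (w : FockWord) : Antitone w.letter := antitone_nat_of_succ_le w.mono

theorem finite_le (w : FockWord) (b : ℤ) : {k | b ≤ w.letter k}.Finite := by
  obtain ⟨c, hc⟩ := w.exists_charge
  obtain ⟨N, hN⟩ := eventually_atTop.1 hc
  refine (Set.finite_Iio (max N (-b - c).toNat)).subset fun k hk => ?_
  by_contra hout
  simp only [Set.mem_Iio, not_lt, max_le_iff] at hout
  have h1 := hN k hout.1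
  have h2 : b ≤ w.letter k := hk
  omega

theorem finite_eq (w : FockWord) (b : ℤ) : {k | w.letter k = b}.Finite :=
  (w.finite_le b).subset fun _ hk => (show w.letter _ = b from hk).ge

theorem exists_isColumn (w : FockWord) : ∃ p, IsColumn p w.occ := by
  have hf := w.finite_support
  obtain ⟨m, hm⟩ := hf.bddBelow
  obtain ⟨n, hn⟩ := hf.bddAbove
  refine ⟨(m.natAbs, n.natAbs + 1), ⟨fun b hb => ?_, fun b hb => ?_, fun b hb => ?_⟩⟩
  · rw [occ, Set.ncard_le_one (w.finite_eq b)]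
    intro k hk l hl
    have key : ∀ k l, w.letter k = b → w.letter l = b → k ≤ l → k = l := by
      intro k l hk hl hkl
      by_contra hne
      have h1 := w.antitone (show k + 1 ≤ l by omega)
      have h2 := w.mono k
      have := w.degree_of_eq k (by omega)
      omega
    rcases le_total k l with h | h
    · exact key k l hk hl h
    · exact (key l k hl hk h).symm
  · simp only at hb
    by_contra hne
    have := hm (show b ∈ _ by
      rw [Function.mem_support, if_pos (by omega)]
      omega)
    omega
  · simp only [ge_iff_le, Nat.cast_add, Nat.cast_one] at hb
    by_contra hne
    have := hn (show b ∈ _ by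
      rw [Function.mem_support, if_neg (by omega)]
      omega)
    omega

theorem mem_iff_lt_ncard {S : Set ℕ} (hf : S.Finite) (hS : IsLowerSet S) (k : ℕ) :
    k ∈ S ↔ k < S.ncard := by
  constructor
  · intro hk
    have : Set.Iic k ⊆ S := fun l hl => hS hl hk
    have := Set.ncard_le_ncard this hf
    rw [Set.ncard_eq_toFinset_card' (Set.Iic k)] at this
    simp at this
    omega
  · intro hk
    by_contra hkS
    have : S ⊆ Set.Iio k := fun l hl => by
      by_contra hlk
      exact hkS (hS (not_lt.1 hlk) hl)
    have := Set.ncard_le_ncard this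
    rw [Set.ncard_eq_toFinset_card' (Set.Iio k)] at this
    simp at this
    omega

theorem ncard_le (h : IsColumn p w.occ) (b : ℤ) :
    {k | b ≤ w.letter k}.ncard = colTail p.2 w.occ b := by
  rcases le_total (p.2 : ℤ) b with hb | hb
  · rw [colTail_of_le hb, Set.ncard_eq_zero (w.finite_le b), Set.eq_empty_iff_forall_notMem]
    intro k hk
    have h0 := h.eq_zero (w.letter k) (hb.trans hk)
    rw [occ, Set.ncard_eq_zero (w.finite_eq _), Set.eq_empty_iff_forall_notMem] at h0
    exact h0 k rfl
  · induction b, hb using Int.leInductionDown with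
    | base =>
      rw [colTail_of_le le_rfl, Set.ncard_eq_zero (w.finite_le _), Set.eq_empty_iff_forall_notMem]
      intro k hk
      have h0 := h.eq_zero (w.letter k) hk
      rw [occ, Set.ncard_eq_zero (w.finite_eq _), Set.eq_empty_iff_forall_notMem] at h0
      exact h0 k rfl
    | pred b hb ih =>
      rw [colTail_eq h, sub_add_cancel, ← ih, occ, ← Set.ncard_union_eq _ (w.finite_eq _)
        (w.finite_le _)]
      · congr 1
        ext k
        simp only [Set.mem_union]
        change b - 1 ≤ w.letter k ↔ w.letter k = b - 1 ∨ b ≤ w.letter k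
        omega
      · rw [Set.disjoint_left]
        intro k hk hk'
        change w.letter k = b - 1 at hk
        change b ≤ w.letter k at hk'
        omega

/-- The letters form a weakly decreasing sequence, and the tails are the conjugate sequence, as for
a partition and its transpose. All comparisons of semi-infinite words are made on tails through this
equivalence. -/
theorem le_letter_iff (h : IsColumn p w.occ) : b ≤ w.letter k ↔ k < colTail p.2 w.occ b := by
  rw [← ncard_le h]
  exact mem_iff_lt_ncard (w.finite_le b) (fun k l hkl hk => le_trans hk (w.antitone hkl)) k

theorem occ_injective : Function.Injective occ := by
  intro w w' h
  obtain ⟨p, hp⟩ := w.exists_isColumn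
  have hp' := hp
  rw [h] at hp'
  ext k
  refine le_antisymm ?_ ?_
  · rw [le_letter_iff hp', ← h, ← le_letter_iff hp]
  · rw [le_letter_iff hp, h, ← le_letter_iff hp']

theorem exists_occ {x : ℤ → ℕ} (h : IsColumn p x) : ∃ w : FockWord, w.occ = x := by
  have hanti : Antitone (colTail p.2 x) := antitone_int_of_succ_le fun b => by
    rw [colTail_eq h b]; omega
  -- The letter with index k has to be the greatest b such that more than k letters are ≥ b.
  have hex : ∀ k : ℕ, ∃ b : ℤ, k < colTail p.2 x b ∧ ∀ z, k < colTail p.2 x z → z ≤ b := by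
    intro k
    -- Below the window the tail at b is `colSum p x - b`, which exceeds k for the witness given
    -- here.
    refine Int.exists_greatest_of_bdd ⟨p.2, fun z hz => ?_⟩ ⟨min (-(p.1 : ℤ)) (colSum p x - k - 1), ?_⟩
    · by_contra hlt
      rw [colTail_of_le (by omega)] at hz
      omega
    · have := colTail_of_le_neg h (b := min (-(p.1 : ℤ)) (colSum p x - k - 1)) (min_le_left _ _)
      omega
  choose l hl hmax using hex
  have hiff : ∀ b k, b ≤ l k ↔ k < colTail p.2 x b := fun b k =>
    ⟨fun hb => lt_of_lt_of_le (hl k) (hanti hb), hmax k b⟩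
  refine ⟨⟨l, fun k => ?_, fun k hk => ?_, -colSum p x, ?_⟩, ?_⟩
  · rw [hiff]
    have := hl (k + 1)
    omega
  · by_contra hneg
    have h1 := hl (k + 1)
    have h2 := hiff (l k + 1) k
    have h3 := h.le_one (l k) (by omega)
    rw [hk, colTail_eq h] at h1
    omega
  · refine eventually_atTop.2 ⟨(colSum p x + p.1).toNat, fun k hk => ?_⟩
    have h1 := hiff (colSum p x - k - 1) k
    have h2 := hiff (colSum p x - k) k
    have h3 := colTail_of_le_neg h (b := colSum p x - k - 1) (by omega)
    have h4 := colTail_of_le_neg h (b := colSum p x - k) (by omega)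
    omega
  · funext b
    have hset : {k | l k = b} = Set.Ico (colTail p.2 x (b + 1)) (colTail p.2 x b) := by
      ext k
      have h1 := hiff b k
      have h2 := hiff (b + 1) k
      simp only [Set.mem_Ico]
      change l k = b ↔ _
      omega
    rw [occ]
    change {k | l k = b}.ncard = _
    rw [hset, Set.ncard_eq_toFinset_card', Set.toFinset_Ico, Nat.card_Ico]
    have := colTail_eq h b
    omega

/-- Additional letters shift the distant part of the word to smaller bars, which accounts for the
sign. -/
theorem hasCharge_iff (h : IsColumn p w.occ) {c : ℤ} : w.HasCharge c ↔ c = -colSum p w.occ := by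
  have key : w.HasCharge (-colSum p w.occ) := by
    refine eventually_atTop.2 ⟨(colSum p w.occ + p.1).toNat, fun k hk => ?_⟩
    have h1 := le_letter_iff h (b := colSum p w.occ - k - 1) (k := k)
    have h2 := le_letter_iff h (b := colSum p w.occ - k) (k := k)
    have h3 := colTail_of_le_neg h (b := colSum p w.occ - k - 1) (by omega)
    have h4 := colTail_of_le_neg h (b := colSum p w.occ - k) (by omega)
    omega
  constructor
  · intro hc
    obtain ⟨k, h1, h2⟩ := (hc.and key).exists
    omega
  · rintro rfl
    exact key

theorem count_colPart (x : ℤ → ℕ) (b : ℤ) :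
    (colPart p x).count b = if b ∈ window p.1 p.2 then x b else 0 := by
  split_ifs with hb
  · rw [colPart, multWord, count_flatMap_single (nodup_window _ _) _ _ b hb]
    · simp
    · intro k _ hk
      simp [List.count_replicate, hk]
  · rw [List.count_eq_zero]
    exact fun h => hb (mem_multWord h)

theorem colPart_pairwise (x : ℤ → ℕ) : (colPart p x).Pairwise (· ≤ ·) := by
  rw [colPart, multWord, List.pairwise_flatMap]
  refine ⟨fun b _ => List.pairwise_replicate.2 (Or.inr le_rfl), ?_⟩
  rw [window_eq, List.pairwise_map]
  refine List.pairwise_lt_range.imp fun {a b} hab x hx y hy => ?_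
  rw [List.mem_replicate] at hx hy
  omega

/-- A truncation of a word is a word of a column. -/
theorem trunc_eq (h : IsColumn p w.occ) {m M : ℕ} (hm : p.1 ≤ m) (hM : (M : ℤ) = m + colSum p w.occ) :
    w.trunc M = colPart (m, p.2) w.occ := by
  -- Exactly M letters are ≥ −m, so cutting after M letters is the same as cutting at the row −m.
  have hlt : ∀ k, -(m : ℤ) ≤ w.letter k ↔ k < M := by
    intro k
    rw [le_letter_iff h]
    have := colTail_of_le_neg h (b := -(m : ℤ)) (by omega)
    omega
  refine List.Perm.eq_of_pairwise' (r := (· ≤ ·)) ?_ (colPart_pairwise _) ?_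
  · rw [trunc, List.pairwise_reverse, List.pairwise_map]
    exact List.pairwise_lt_range.imp fun {a b} hab => w.antitone hab.le
  · rw [List.perm_iff_count]
    intro b
    rw [count_colPart, trunc, List.count_reverse, List.count_eq_countP, List.countP_map,
      List.countP_eq_length_filter]
    have : ((List.range M).filter ((fun x => x == b) ∘ w.letter)).length =
        {k | k < M ∧ w.letter k = b}.ncard := by
      rw [← List.toFinset_card_of_nodup (List.nodup_range.filter _), ← Set.ncard_coe_finset]
      congr 1
      ext k
      simp
    rw [this]
    split_ifs with hb
    · rw [mem_window] at hb
      rw [occ]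
      congr 1
      ext k
      change k < M ∧ w.letter k = b ↔ w.letter k = b
      have := hlt k
      simp only at hb
      omega
    · rw [mem_window] at hb
      rw [Set.ncard_eq_zero ((w.finite_eq b).subset fun k hk => hk.2),
        Set.eq_empty_iff_forall_notMem]
      rintro k ⟨hk, rfl⟩
      have h1 := (hlt k).2 hk
      have h2 := le_letter_iff h (b := p.2) (k := k)
      rw [colTail_of_le le_rfl] at h2
      simp only at hb
      omega

theorem trunc_sep (w w' : FockWord) (h : ∀ᶠ M in atTop, trunc M w = trunc M w') : w = w' := by
  ext k
  obtain ⟨M, hM, hk⟩ := (h.and (eventually_gt_atTop k)).exists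
  have h1 := List.map_inj_left.1 (List.reverse_injective hM)
  exact h1 k (List.mem_range.2 hk)

end FockWord

namespace FockWord

open Grid FockMatrix Signature CrystalData

variable {p : ℕ × ℕ} {w w' : FockWord} {d : Bool} {i : ℤ}

theorem isColumn_multMove {x : ℤ → ℕ} (h : IsColumn p x) (h1 : -(p.1 : ℤ) ≤ i - 1) (h2 : i < p.2)
    (hs : sel d (loc (SignType.sign i) (x (i - 1)) (x i)) ≠ 0) :
    IsColumn p (multMove d (i - 1) i x) := by
  -- A single column is viewed as an array with equal columns, so that the results on moves apply.
  have hv : Valid fun b (_ : ℕ) => x b := fun b hb _ => h.le_one b hb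
  refine ⟨fun b hb => ?_, fun b hb => ?_, fun b hb => ?_⟩
  · have := valid_vMove (c := 0) hv hs b hb 0
    simpa only [vMove, multMove, if_true] using this
  · rw [multMove, if_neg (by omega), if_neg (by omega), h.eq_one b hb]
  · rw [multMove, if_neg (by omega), if_neg (by omega), h.eq_zero b hb]

theorem colSum_multMove {x : ℤ → ℕ} (h : IsColumn p x) (h1 : -(p.1 : ℤ) ≤ i - 1) (h2 : i < p.2)
    (hs : sel d (loc (SignType.sign i) (x (i - 1)) (x i)) ≠ 0) :
    colSum p (multMove d (i - 1) i x) = colSum p x := by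
  have hv : Valid fun b (_ : ℕ) => x b := fun b hb _ => h.le_one b hb
  have := sum_window_vMove (p := p) (c := 0) hv hs h1 h2 0
  have h3 := congrArg (Nat.cast (R := ℤ)) this
  simp only [Nat.cast_list_sum, List.map_map, Function.comp_def] at h3
  rw [← List.sum_reverse, ← List.map_reverse,
    ← List.sum_reverse (List.map (fun b => (x b : ℤ)) _), ← List.map_reverse] at h3
  have h4 := (sum_map_rows (p := p) _).symm.trans (h3.trans (sum_map_rows (p := p) _))
  rw [colSum, colSum, Finset.sum_sub_distrib, Finset.sum_sub_distrib]
  exact congrArg (fun z : ℤ => z - _) h4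

theorem exists_isColumn_ge (w : FockWord) (i : ℤ) :
    ∃ p, IsColumn p w.occ ∧ -(p.1 : ℤ) ≤ i - 1 ∧ i < p.2 := by
  obtain ⟨q, hq⟩ := w.exists_isColumn
  refine ⟨(q.1 + (i.natAbs + 1), q.2 + (i.natAbs + 1)), hq.mono ⟨?_, ?_⟩, ?_, ?_⟩ <;>
    simp only <;> omega

/-- All large truncations are column words with the same multiplicities of i − 1 and i, so the
operator acts on each of them by the same local rule, and the results are truncations of a single
word. -/
theorem op_spec (d : Bool) (i : ℤ) (w : FockWord) :
    (sel d (loc (SignType.sign i) (w.occ (i - 1)) (w.occ i)) = 0 ∧ fockCrystal.op d i w = none) ∨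
    (sel d (loc (SignType.sign i) (w.occ (i - 1)) (w.occ i)) ≠ 0 ∧
      ∃ w', fockCrystal.op d i w = some w' ∧ w'.occ = multMove d (i - 1) i w.occ) := by
  have hop : fockCrystal.op d i = stableOp atTop trunc (gLetters.words.op d i) := by cases d <;> rfl
  obtain ⟨p, hp, h1, h2⟩ := w.exists_isColumn_ge i
  have hlarge : ∀ M : ℕ, (p.1 + colSum p w.occ).toNat ≤ M →
      ∃ m : ℕ, p.1 ≤ m ∧ (M : ℤ) = m + colSum p w.occ ∧ -(m : ℤ) ≤ i - 1 := by
    intro M hM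
    exact ⟨(M - colSum p w.occ).toNat, by omega, by omega, by omega⟩
  by_cases hs : sel d (loc (SignType.sign i) (w.occ (i - 1)) (w.occ i)) = 0
  · refine Or.inl ⟨hs, ?_⟩
    rw [hop]
    refine stableOp_eq trunc_sep ?_
    filter_upwards [eventually_ge_atTop _] with M hM
    obtain ⟨m, hm, hmM, hmi⟩ := hlarge M hM
    rw [trunc_eq hp hm hmM, (colPart_spec (p := (m, p.2)) hmi h2).2 d hp.le_one, if_pos hs]
    rfl
  · refine Or.inr ⟨hs, ?_⟩
    have hp' := isColumn_multMove hp h1 h2 hs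
    obtain ⟨w', hw'⟩ := exists_occ hp'
    refine ⟨w', ?_, hw'⟩
    rw [hop]
    refine stableOp_eq trunc_sep ?_
    filter_upwards [eventually_ge_atTop _] with M hM
    obtain ⟨m, hm, hmM, hmi⟩ := hlarge M hM
    rw [trunc_eq hp hm hmM, (colPart_spec (p := (m, p.2)) hmi h2).2 d hp.le_one, if_neg hs,
      Option.map_some, trunc_eq (w := w') (by rw [hw']; exact hp') hm
        (by rw [hw', colSum_multMove hp h1 h2 hs, hmM]), hw']

theorem op_eq_some_iff : fockCrystal.op d i w = some w' ↔
    sel d (loc (SignType.sign i) (w.occ (i - 1)) (w.occ i)) ≠ 0 ∧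
      w'.occ = multMove d (i - 1) i w.occ := by
  rcases op_spec d i w with ⟨h1, h2⟩ | ⟨h1, w'', h2, h3⟩
  · simp [h1, h2]
  · rw [h2, Option.some.injEq]
    constructor
    · rintro rfl; exact ⟨h1, h3⟩
    · rintro ⟨_, h4⟩
      exact occ_injective (h3.trans h4.symm)

theorem op_eq_none_iff : fockCrystal.op d i w = none ↔
    sel d (loc (SignType.sign i) (w.occ (i - 1)) (w.occ i)) = 0 := by
  rcases op_spec d i w with ⟨h1, h2⟩ | ⟨h1, w'', h2, h3⟩
  · simp [h1, h2]
  · simp [h1, h2]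

theorem loc_occ_valid (w : FockWord) (i : ℤ) :
    (SignType.sign i = .neg → w.occ (i - 1) ≤ 1 ∧ w.occ i ≤ 1) ∧
      (SignType.sign i = .zero → w.occ (i - 1) ≤ 1) := by
  obtain ⟨p, hp⟩ := w.exists_isColumn
  exact loc_col_valid (a := fun b _ => w.occ b) (fun b hb _ => hp.le_one b hb) i 0

theorem hasSig : fockCrystal.HasSig
    fun i w => loc (SignType.sign i) (w.occ (i - 1)) (w.occ i) := by
  refine ⟨fun d i w => op_eq_none_iff, fun d i w w' h => ?_⟩
  obtain ⟨hs, hw'⟩ := op_eq_some_iff.1 h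
  have hl := loc_shift hs (w.loc_occ_valid i).1 (w.loc_occ_valid i).2
  have e1 : w'.occ (i - 1) = (shift d (w.occ (i - 1), w.occ i)).1 := by rw [hw', multMove, if_pos rfl]
  have e2 : w'.occ i = (shift d (w.occ (i - 1), w.occ i)).2 := by
    rw [hw', multMove, if_neg (ne_pred i), if_pos rfl]
  simp only [e1, e2]
  refine ⟨hl.1, hl.2.1, op_eq_some_iff.2 ⟨?_, ?_⟩⟩
  · rw [e1, e2, hl.2.1]; omega
  · funext b
    simp only [multMove, e1, e2, hl.2.2.1, Prod.mk.eta]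
    split_ifs with h1 h2
    · rw [h1]
    · rw [h2]
    · rw [hw', multMove, if_neg h1, if_neg h2]

theorem sig_eq (i : ℤ) (w : FockWord) :
    fockCrystal.sig i w = loc (SignType.sign i) (w.occ (i - 1)) (w.occ i) := hasSig.maxIter_eq i w

theorem wt_snd (w : FockWord) (b : ℤ) : (fockCrystal.wt w).2 b = (w.occ b : ℤ) - vac b := rfl

theorem regular (i : ℤ) : fockCrystal.Regular i := by
  refine ⟨fun hi w => ?_, fun hi w => ?_, fun d w h => ?_⟩
  · have h := congrArg (fun t : ℕ × ℕ => (t.2 : ℤ) - t.1) (sig_eq i w)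
    rw [loc_diff (show SignType.sign i ≠ 0 from hi)] at h
    refine h.trans ?_
    have hi' : i ≠ 0 := fun h => hi (by rw [h]; rfl)
    change _ = if i = 0 then _ else (fockCrystal.wt w).2 (i - 1) - (fockCrystal.wt w).2 i
    rw [if_neg hi', wt_snd, wt_snd, vac, vac]
    split_ifs <;> omega
  · have hi' : i = 0 := sign_eq_zero_iff.1 hi
    subst hi'
    have h := congrArg (fun t : ℕ × ℕ => t.1 + t.2) (sig_eq 0 w)
    change fockCrystal.ε 0 w + fockCrystal.φ 0 w = (loc .zero (w.occ (-1)) (w.occ 0)).1 +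
      (loc .zero (w.occ (-1)) (w.occ 0)).2 at h
    rw [h]
    change 0 < (if (0 : ℤ) = 0 then (fockCrystal.wt w).1 + (fockCrystal.wt w).2 (-1) +
        (fockCrystal.wt w).2 0 else (fockCrystal.wt w).2 (0 - 1) - (fockCrystal.wt w).2 0) ↔ _
    rw [if_pos rfl, wt_snd, wt_snd]
    change 0 < (1 : ℤ) + (w.occ (-1) - 1) + (w.occ 0 - 0) ↔ _
    simp only [loc]
    split_ifs <;> omega
  · rw [op_eq_none_iff, ← sig_eq, h]

end FockWord

/-! ### Tensor powers of the Fock crystal as matrices -/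

namespace FockMatrix

open Grid Signature CrystalData

variable {u : ℕ}

/-- The tensor powers of `ℱ` as matrices. -/
theorem exists_occEquiv (u : ℕ) : ∃ ψ : (Fin u → FockWord) ≃ FockMatrix u,
    ∀ w b c, (ψ w).entry b c = (w c).occ b := by
  have hmat : ∀ w : Fin u → FockWord, ∃ A : FockMatrix u, ∀ b c, A.entry b c = (w c).occ b := by
    intro w
    choose p hp using fun c => (w c).exists_isColumn
    refine ⟨⟨fun b c => (w c).occ b, fun b hb c => (hp c).le_one b hb, ?_, ?_⟩, fun _ _ => rfl⟩
    · rw [eventually_all]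
      intro c
      filter_upwards [eventually_lt_atBot (-((p c).1 : ℤ))] with b hb
      exact (hp c).eq_one b hb
    · rw [eventually_all]
      intro c
      filter_upwards [eventually_ge_atTop ((p c).2 : ℤ)] with b hb
      exact (hp c).eq_zero b hb
  choose ψ hψ using hmat
  refine ⟨Equiv.ofBijective ψ ⟨fun w w' h => ?_, fun A => ?_⟩, hψ⟩
  · funext c
    refine FockWord.occ_injective (funext fun b => ?_)
    rw [← hψ, ← hψ, h]
  · obtain ⟨p, hp⟩ := A.exists_within
    choose w hw using fun c => FockWord.exists_occ (isColumn_ent hp c)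
    refine ⟨w, ?_⟩
    ext b c
    rw [hψ, hw]
    exact A.ent_fin b c

/-- The bijection between tensor products of semi-infinite words and matrices. -/
noncomputable def occEquiv (u : ℕ) : (Fin u → FockWord) ≃ FockMatrix u := (exists_occEquiv u).choose

theorem occEquiv_entry (w : Fin u → FockWord) (b : ℤ) (c : Fin u) :
    (occEquiv u w).entry b c = (w c).occ b := (exists_occEquiv u).choose_spec w b c

theorem occEquiv_ent (w : Fin u → FockWord) (b : ℤ) (c : Fin u) :
    (occEquiv u w).ent b c = (w c).occ b := by
  rw [ent_fin, occEquiv_entry]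

theorem words_singleton {I P : Type} [AddCommGroup P] {D : CartanDatum I P} {X : Type}
    {C : CrystalData D X} {i : I} (h : C.Regular i) (d : Bool) (x : X) :
    C.words.sig i [x] = C.sig i x ∧ C.words.op d i [x] = (C.op d i x).map fun y => [y] := by
  constructor
  · rw [words_sig h]
    exact comb_zero_right _ _
  · rw [words_op_cons h, words_op_none h d [] (by cases d <;> rfl)]
    have hn := h.none d x
    split_ifs with hl
    · rfl
    · have : sel d (C.sig i x) = 0 := by
        change ¬ left (D.kind i) d (C.sig i x) (0, 0) at hl
        by_contra hne
        apply hl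
        cases D.kind i <;> cases d <;> simp [left] at hne ⊢ <;> omega
      rw [hn this]
      rfl

theorem colSig_occEquiv (w : Fin u → FockWord) (i : ℤ) (c : Fin u) :
    colSig i (occEquiv u w).ent c = fockCrystal.sig i (w c) := by
  rw [colSig, occEquiv_ent, occEquiv_ent, FockWord.sig_eq]

theorem range_eq_map (u : ℕ) : List.range u = (List.finRange u).map fun c : Fin u => (c : ℕ) :=
  (List.map_coe_finRange_eq_range).symm

theorem ofFn_eq_flatMap {X : Type} (w : Fin u → X) :
    List.ofFn w = (List.finRange u).flatMap fun c => [w c] := by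
  rw [List.ofFn_eq_map, List.map_eq_flatMap]

theorem sig_occEquiv (w : Fin u → FockWord) (i : ℤ) :
    (crystal u).sig i (occEquiv u w) = (fockPower u).sig i w := by
  change _ = fockCrystal.words.sig i (List.ofFn w)
  rw [sig_eq, range_eq_map, tot_map, ofFn_eq_flatMap, words_sig_flatMap (FockWord.regular i)]
  refine tot_congr fun c _ => ?_
  rw [Function.comp_apply, colSig_occEquiv, (words_singleton (FockWord.regular i) true _).1]

/-- The second part records that operators keep the length u of a word in ℱ, so that nothing is lost
when `comap` along `List.ofFn` discards values outside of the range. -/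
theorem op_occEquiv (d : Bool) (w : Fin u → FockWord) (i : ℤ) :
    (crystal u).op d i (occEquiv u w) = ((fockPower u).op d i w).map (occEquiv u) ∧
    fockCrystal.words.op d i (List.ofFn w) = ((fockPower u).op d i w).map List.ofFn := by
  have hinj : Function.Injective (List.ofFn : (Fin u → FockWord) → List FockWord) :=
    List.ofFn_injective
  have hop : (fockPower u).op d i w =
      (fockCrystal.words.op d i (List.ofFn w)).bind (Function.partialInv List.ofFn) := by
    cases d <;> rfl
  have hpos : pos (SignType.sign i) d (colSig i (occEquiv u w).ent) (List.range u) =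
      (pos (SignType.sign i) d (fun c => fockCrystal.words.sig i [w c])
        (List.finRange u)).map Fin.val := by
    rw [range_eq_map, pos_map]
    congr 1
    refine pos_congr fun c _ => ?_
    rw [Function.comp_apply, colSig_occEquiv, (words_singleton (FockWord.regular i) true _).1]
  have hwords := (congrArg (fockCrystal.words.op d i) (ofFn_eq_flatMap w)).trans
    (words_op_flatMap (FockWord.regular i) d (List.nodup_finRange u) _)
  change _ = (pos (SignType.sign i) d (fun c => fockCrystal.words.sig i [w c])
        (List.finRange u)).bind _ at hwords
  cases h : pos (SignType.sign i) d (fun c => fockCrystal.words.sig i [w c]) (List.finRange u) with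
  | none =>
    rw [h] at hwords hpos
    simp only [Option.bind_none, Option.map_none] at hwords hpos
    rw [hop, hwords]
    refine ⟨?_, rfl⟩
    exact op_eq_none.2 ((pos_eq_none _ _ _ _).1 hpos)
  | some c =>
    have hs := sel_ne_zero_of_pos h
    rw [h] at hwords hpos
    rw [(words_singleton (FockWord.regular i) true _).1] at hs
    have hne : fockCrystal.op d i (w c) ≠ none := by
      rw [Ne, FockWord.op_eq_none_iff, ← FockWord.sig_eq]
      exact hs
    obtain ⟨w', hw'⟩ := Option.ne_none_iff_exists'.1 hne
    have hfl : ((List.finRange u).flatMap (Function.update (fun c => [w c]) c [w'])) =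
        List.ofFn (Function.update w c w') := by
      rw [ofFn_eq_flatMap]
      refine flatMap_congr' fun x _ => ?_
      by_cases hx : x = c
      · subst hx; simp
      · simp [hx]
    rw [Option.bind_some, (words_singleton (FockWord.regular i) d _).2, hw', Option.map_some,
      Option.map_some, hfl] at hwords
    rw [hop, hwords, Option.bind_some, Function.partialInv_left hinj]
    refine ⟨op_eq_some.2 ⟨c, hpos, ?_⟩, rfl⟩
    have hocc := (FockWord.op_eq_some_iff.1 hw').2
    funext b y
    by_cases hy : y < u
    · obtain ⟨y, rfl⟩ : ∃ y' : Fin u, (y' : ℕ) = y := ⟨⟨y, hy⟩, rfl⟩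
      rw [occEquiv_ent]
      simp only [vMove, occEquiv_ent]
      by_cases hyc : y = c
      · subst hyc
        rw [Function.update_self, if_pos rfl, hocc]
        rfl
      · rw [Function.update_of_ne hyc, if_neg fun h => hyc (Fin.ext h)]
    · have := c.2
      rw [vMove, if_neg (by omega), ent_of_le _ _ (by omega), ent_of_le _ _ (by omega)]

theorem wt_occEquiv (w : Fin u → FockWord) :
    (crystal u).wt (occEquiv u w) = (fockPower u).wt w := by
  have hwt : (fockPower u).wt w = ∑ c, fockCrystal.wt (w c) := by
    change ((List.ofFn w).map fockCrystal.wt).sum = _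
    rw [List.map_ofFn, List.sum_ofFn]
    rfl
  rw [hwt]
  refine Prod.ext ?_ (Finsupp.ext fun b => ?_)
  · rw [Prod.fst_sum, wt_fst]
    simp [fockCrystal, FockWord.wt]
  · rw [Prod.snd_sum, Finsupp.finsetSum_apply, wt_snd, Finset.sum_range]
    refine Finset.sum_congr rfl fun c _ => ?_
    rw [occEquiv_ent, FockWord.wt_snd]

theorem isIso_occEquiv (u : ℕ) : (fockPower u).IsIso (crystal u) (occEquiv u) where
  wt := wt_occEquiv
  ε i w := congrArg Prod.fst (sig_occEquiv w i)
  φ i w := congrArg Prod.snd (sig_occEquiv w i)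
  e i w := (op_occEquiv true w i).1
  f i w := (op_occEquiv false w i).1

end FockMatrix

namespace CrystalData

variable {I P : Type} [AddCommGroup P] {D : CartanDatum I P} {X Y : Type}

/-- Stability matters because `comap` turns any value outside of the range into 0. -/
theorem comap_op {C : CrystalData D Y} {r : X → Y} (hr : Function.Injective r) (hs : C.Stable r)
    (d : Bool) (i : I) (x : X) : ((C.comap r).op d i x).map r = C.op d i (r x) := by
  have hop : (C.comap r).op d i x = (C.op d i (r x)).bind (Function.partialInv r) := by
    cases d <;> rfl
  rw [hop]
  cases h : C.op d i (r x) with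
  | none => rfl
  | some y =>
    obtain ⟨x', rfl⟩ := hs i x y (by cases d; exacts [Or.inr h, Or.inl h])
    rw [Option.bind_some, Function.partialInv_left hr, Option.map_some]

end CrystalData

/-! ### Semi-infinite tableaux as lowest weight elements for 𝔤𝔩_u -/

namespace Signature

variable {K : Type} {s : K → ℕ × ℕ}

/-- In terms of brackets: no opening bracket survives if and only if those of each factor are
absorbed by what stands to its right. -/
theorem tot_neg_snd_eq_zero {L : List K} : (tot .neg s L).2 = 0 ↔ ∀ L₁ k L₂, L = L₁ ++ k :: L₂ →
    ((s k).2 : ℤ) + (L₂.map fun k => ((s k).2 : ℤ) - (s k).1).sum ≤ 0 := by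
  induction L with
  | nil => simp [tot]
  | cons a L ih =>
    have hd := tot_diff (κ := .neg) (s := s) (by decide) L
    have hc : (tot .neg s (a :: L)).2 = 0 ↔ (tot .neg s L).2 = 0 ∧
        ((s a).2 : ℤ) + (L.map fun k => ((s k).2 : ℤ) - (s k).1).sum ≤ 0 := by
      rw [← hd, tot]
      simp only [comb]
      omega
    rw [hc, ih]
    constructor
    · rintro ⟨h1, h2⟩ L₁ k L₂ h
      rcases L₁ with _ | ⟨x, L₁⟩
      · simp only [List.nil_append, List.cons.injEq] at h
        rw [← h.1, ← h.2]
        exact h2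
      · simp only [List.cons_append, List.cons.injEq] at h
        exact h1 L₁ k L₂ h.2
    · intro h
      refine ⟨fun L₁ k L₂ hL => h (a :: L₁) k L₂ (by rw [hL]; rfl), h [] a L rfl⟩

end Signature

namespace Grid

open FockMatrix Signature CrystalData

variable {p : ℕ × ℕ}

theorem rows_pairwise (p : ℕ × ℕ) : (rows p).Pairwise (· > ·) := by
  rw [rows, List.pairwise_reverse, window_eq, List.pairwise_map]
  exact List.pairwise_lt_range.imp fun {a b} hab => by omega

theorem rows_suffix {L₁ L₂ : List ℤ} {b : ℤ} (h : rows p = L₁ ++ b :: L₂) (f : ℤ → ℤ) :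
    (L₂.map f).sum = ∑ b' ∈ Finset.Ico (-(p.1 : ℤ)) b, f b' := by
  have hp := rows_pairwise p
  have hn := nodup_rows p
  rw [h] at hp hn
  rw [List.pairwise_append, List.pairwise_cons] at hp
  have hn2 : L₂.Nodup := (List.nodup_cons.1 (List.nodup_append.1 hn).2.1).2
  rw [← List.sum_toFinset f hn2]
  congr 1
  ext x
  rw [List.mem_toFinset, Finset.mem_Ico]
  have hb : b ∈ rows p := by rw [h]; simp
  rw [mem_rows] at hb
  constructor
  · intro hx
    have h1 : x ∈ rows p := by rw [h]; simp [hx]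
    exact ⟨(mem_rows.1 h1).1, hp.2.1.1 x hx⟩
  · rintro ⟨h1, h2⟩
    have h3 : x ∈ rows p := mem_rows.2 ⟨h1, by omega⟩
    rw [h, List.mem_append, List.mem_cons] at h3
    rcases h3 with h3 | h3 | h3
    · have := hp.2.2 x h3 b (by simp)
      omega
    · omega
    · exact h3

theorem tot_rows_snd_eq_zero {s : ℤ → ℕ × ℕ} : (tot .neg s (rows p)).2 = 0 ↔
    ∀ b ∈ Finset.Ico (-(p.1 : ℤ)) p.2,
      ((s b).2 : ℤ) + ∑ b' ∈ Finset.Ico (-(p.1 : ℤ)) b, (((s b').2 : ℤ) - (s b').1) ≤ 0 := by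
  rw [tot_neg_snd_eq_zero]
  constructor
  · intro h b hb
    obtain ⟨L₁, L₂, hL⟩ := List.append_of_mem (mem_rows.2 (Finset.mem_Ico.1 hb))
    rw [← rows_suffix hL]
    exact h L₁ b L₂ hL
  · intro h L₁ b L₂ hL
    rw [rows_suffix hL]
    exact h b (Finset.mem_Ico.2 (mem_rows.1 (by rw [hL]; simp)))

theorem sum_Ico_eq_colTail (x : ℤ → ℕ) {b : ℤ} (h1 : -(p.1 : ℤ) ≤ b) (h2 : b ≤ p.2) :
    ∑ b' ∈ Finset.Ico (-(p.1 : ℤ)) b, (x b' : ℤ) =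
      colTail p.2 x (-(p.1 : ℤ)) - colTail p.2 x b := by
  rw [colTail, colTail, ← Finset.Ico_union_Ico_eq_Ico h1 h2,
    Finset.sum_union (Finset.Ico_disjoint_Ico_consecutive _ _ _)]
  push_cast
  ring

end Grid

namespace FockMatrix

open FockMatrix Grid Signature CrystalData

variable {u : ℕ} {p : ℕ × ℕ} {A : FockMatrix u}

theorem wtStar_eq_colSum (hp : Within u p A.ent) (c : Fin u) :
    (crystalStar u).wt A c = colSum p fun b => A.ent b c := wtStar_eq hp c

theorem isColumn_ent' (hp : Within u p A.ent) {c : ℕ} (hc : c < u) :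
    IsColumn p fun b => A.ent b c := isColumn_ent hp ⟨c, hc⟩

/-- The matrices that are killed by `f*_j`, in terms of the numbers of letters `≥ b`. -/
theorem fStar_eq_none_iff (hp : Within u p A.ent) (j : Fin (u - 1)) {δ : ℤ}
    (hδ : (crystalStar u).wt A (glHi j) - (crystalStar u).wt A (glLo j) = δ) :
    fStar j A = none ↔ ∀ b ∈ Finset.Ico (-(p.1 : ℤ)) p.2,
      ((rowSig j A.ent b).2 : ℤ) + colTail p.2 (fun b => A.ent b (j + 1)) b ≤
        colTail p.2 (fun b => A.ent b j) b + δ := by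
  have h0 : fStar j A = none ↔ (tot .neg (rowSig j A.ent) (rows p)).2 = 0 :=
    opStar_eq_none (d := false) hp
  rw [h0, tot_rows_snd_eq_zero]
  refine forall₂_congr fun b hb => ?_
  rw [Finset.mem_Ico] at hb
  have h1 : ∀ b', ((rowSig j A.ent b').2 : ℤ) - (rowSig j A.ent b').1 =
      A.ent b' j - A.ent b' (j + 1) := fun b' =>
    loc_diff (by unfold kindRow; split_ifs <;> decide) _ _
  simp only [h1]
  -- A sum over the rows below b is the whole column sum minus the tail at b. The whole sums of the
  -- two columns differ by δ.
  rw [Finset.sum_sub_distrib, sum_Ico_eq_colTail (fun b => A.ent b j) hb.1 hb.2.le,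
    sum_Ico_eq_colTail (fun b => A.ent b (j + 1)) hb.1 hb.2.le]
  rw [wtStar_eq_colSum hp, wtStar_eq_colSum hp, colSum_eq, colSum_eq] at hδ
  simp only [glHi, glLo] at hδ
  constructor <;> intro h <;> omega

theorem rowSig_snd (j : ℕ) (a : ℤ → ℕ → ℕ) (b : ℤ) :
    (rowSig j a b).2 = if b < 0 then a b j - a b (j + 1) else a b j := by
  unfold rowSig kindRow
  split_ifs <;> rfl

theorem rowSig_fst (j : ℕ) (a : ℤ → ℕ → ℕ) (b : ℤ) :
    (rowSig j a b).1 = if b < 0 then a b (j + 1) - a b j else a b (j + 1) := by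
  unfold rowSig kindRow
  split_ifs <;> rfl

/-- In a row b ≥ 0 the value φ is the full entry, and the tail at b minus this entry is the tail at
b + 1; this gives the second family. In a row b < 0 the value φ is a truncated difference, and the
condition at b amounts to the tail inequalities at b and b + 1. -/
theorem killed_iff_tails (hp : Within u p A.ent) (j : Fin (u - 1)) {δ : ℤ} (h0 : 0 ≤ δ)
    (hδ : (crystalStar u).wt A (glHi j) - (crystalStar u).wt A (glLo j) = δ) :
    fStar j A = none ↔ (∀ b, (colTail p.2 (fun b => A.ent b (j + 1)) b : ℤ) ≤
        colTail p.2 (fun b => A.ent b j) b + δ) ∧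
      ∀ b ≥ 0, (colTail p.2 (fun b => A.ent b (j + 1)) b : ℤ) ≤
        colTail p.2 (fun b => A.ent b j) (b + 1) + δ := by
  rw [fStar_eq_none_iff hp j hδ]
  have hc1 := isColumn_ent' hp (c := j) (by omega)
  have hc2 := isColumn_ent' hp (c := j + 1) (by omega)
  have e1 := colTail_eq hc1
  have e2 := colTail_eq hc2
  rw [wtStar_eq_colSum hp, wtStar_eq_colSum hp] at hδ
  simp only [glHi, glLo] at hδ
  simp only [rowSig_snd, Finset.mem_Ico]
  constructor
  · intro h
    constructor
    · intro b
      by_cases hb : -(p.1 : ℤ) ≤ b ∧ b < p.2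
      · have := h b hb
        omega
      · rw [not_and_or, not_le, not_lt] at hb
        rcases hb with hb | hb
        · have h1 := colTail_of_le_neg hc1 hb.le
          have h2 := colTail_of_le_neg hc2 hb.le
          omega
        · rw [colTail_of_le hb, colTail_of_le hb]
          omega
    · intro b hb0
      rcases lt_or_ge b (p.2 : ℤ) with hb | hb
      · have := h b ⟨by omega, hb⟩
        have := e1 b
        rw [if_neg (by omega)] at *
        omega
      · rw [colTail_of_le hb, colTail_of_le (by omega)]
        omega
  · rintro ⟨h1, h2⟩ b hb
    have := e1 b
    have := e2 b
    have := h1 b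
    split_ifs with hb0
    · have := h1 (b + 1)
      omega
    · have := h2 b (by omega)
      omega

/-- Letters and tails are conjugate, so comparing letters is comparing tails. The second family of
inequalities is the ban on equal letters of degree 1. -/
theorem _root_.FockWord.letter_le_iff_tails {w w' : FockWord} (h : IsColumn p w.occ)
    (h' : IsColumn p w'.occ) (δ : ℕ) :
    (∀ k : ℕ, w'.letter (k + δ) ≤ w.letter k ∧
      (w.letter k = w'.letter (k + δ) → w.letter k < 0)) ↔
    (∀ b, (colTail p.2 w'.occ b : ℤ) ≤ colTail p.2 w.occ b + δ) ∧
      ∀ b ≥ 0, (colTail p.2 w'.occ b : ℤ) ≤ colTail p.2 w.occ (b + 1) + δ := by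
  have l1 := fun b k => FockWord.le_letter_iff h (b := b) (k := k)
  have l2 := fun b k => FockWord.le_letter_iff h' (b := b) (k := k)
  constructor
  · intro hk
    constructor
    · intro b
      by_contra hlt
      -- This is the first index whose letter in w is smaller than b.
      have h1 := hk (colTail p.2 w.occ b)
      have h2 := l2 b (colTail p.2 w.occ b + δ)
      have h3 := l1 b (colTail p.2 w.occ b)
      omega
    · intro b hb
      by_contra hlt
      have h1 := hk (colTail p.2 w.occ (b + 1))
      have h2 := l2 b (colTail p.2 w.occ (b + 1) + δ)
      have h3 := l1 (b + 1) (colTail p.2 w.occ (b + 1))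
      omega
  · rintro ⟨h1, h2⟩ k
    have h3 := l2 (w'.letter (k + δ)) (k + δ)
    have h4 := l1 (w'.letter (k + δ)) k
    have h5 := h1 (w'.letter (k + δ))
    refine ⟨by omega, fun heq => ?_⟩
    by_contra hneg
    have h6 := h2 (w'.letter (k + δ)) (by omega)
    have h7 := l1 (w'.letter (k + δ) + 1) k
    omega

/-- Semi-infinite tableaux are lowest weight vectors for `𝔤𝔩_u`. -/
theorem mem_semiInfTableaux_iff {lam : GenPartition u} {w : Fin u → FockWord} :
    w ∈ semiInfTableaux lam ↔ (∀ c, (crystalStar u).wt (occEquiv u w) c = -lam.1 c) ∧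
      ∀ j, fStar j (occEquiv u w) = none := by
  obtain ⟨p, hp⟩ := (occEquiv u w).exists_within
  have hcol : ∀ c : Fin u, IsColumn p (w c).occ := fun c => by
    have := isColumn_ent hp c
    simpa only [occEquiv_ent] using this
  have hwt : ∀ c, (crystalStar u).wt (occEquiv u w) c = colSum p (w c).occ := fun c => by
    rw [wtStar_eq_colSum hp]
    simp only [occEquiv_ent]
  have hocc : ∀ c : Fin u, (w c).occ = fun b => (occEquiv u w).ent b c := fun c =>
    funext fun b => (occEquiv_ent w b c).symm
  have hcharge : (∀ c, (w c).HasCharge (lam.1 c)) ↔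
      ∀ c, (crystalStar u).wt (occEquiv u w) c = -lam.1 c := by
    refine forall_congr' fun c => ?_
    rw [FockWord.hasCharge_iff (hcol c), hwt]
    constructor <;> intro h <;> omega
  change (∀ c, _) ∧ _ ↔ _
  rw [hcharge]
  refine and_congr_right fun hw => ?_
  constructor
  · intro h j
    have hle : lam.1 (glHi j) ≤ lam.1 (glLo j) := lam.2 (Fin.le_def.2 (by simp [glLo, glHi]))
    rw [killed_iff_tails hp j (δ := lam.1 (glLo j) - lam.1 (glHi j)) (by omega)
      (by rw [hw, hw]; ring)]
    have := (FockWord.letter_le_iff_tails (hcol (glLo j)) (hcol (glHi j)) _).1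
      (h (glLo j) (glHi j) rfl)
    rw [Int.toNat_of_nonneg (by omega)] at this
    rw [hocc, hocc] at this
    exact this
  · intro h i j hij
    have hj := j.2
    have h1 := h ⟨i, by omega⟩
    have e1 : glLo (⟨i, by omega⟩ : Fin (u - 1)) = i := rfl
    have e2 : glHi (⟨i, by omega⟩ : Fin (u - 1)) = j := Fin.ext hij.symm
    have hle : lam.1 j ≤ lam.1 i := lam.2 (Fin.le_def.2 (by omega))
    rw [killed_iff_tails hp _ (δ := lam.1 i - lam.1 j) (by omega)
      (by rw [hw, hw, e1, e2]; ring)] at h1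
    refine (FockWord.letter_le_iff_tails (hcol i) (hcol j) _).2 ?_
    rw [Int.toNat_of_nonneg (by omega)]
    rw [hocc, hocc, hij]
    exact h1

theorem op_fockPower {d : Bool} {i : ℤ} {w w' : Fin u → FockWord}
    (h : (fockPower u).op d i w = some w') :
    (crystal u).op d i (occEquiv u w) = some (occEquiv u w') := by
  rw [(op_occEquiv d w i).1, h]
  rfl

theorem opStar_none_of_op {A' : FockMatrix u} {d d' : Bool} {i : ℤ} {j : Fin (u - 1)}
    (h : (crystal u).op d i A = some A') :
    (crystalStar u).op d' j A' = none ↔ (crystalStar u).op d' j A = none := by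
  rw [opStar_eq_none_iff, opStar_eq_none_iff, sigStar_op h]

theorem op_none_of_opStar {A' : FockMatrix u} {d d' : Bool} {i : ℤ} {j : Fin (u - 1)}
    (h : (crystalStar u).op d' j A = some A') :
    (crystal u).op d i A' = none ↔ (crystal u).op d i A = none := by
  rw [op_eq_none_iff, op_eq_none_iff, sig_opStar h]

/-- Membership in B(λ) is a condition on the 𝔤𝔩_u-weight and on being killed by the f*_j, and the
operators of 𝔤 affect neither. -/
theorem semiInf_stable (lam : GenPartition u) :
    (fockPower u).Stable (Subtype.val : semiInfTableaux lam → _) := by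
  have key : ∀ d i (x : semiInfTableaux lam) y, (fockPower u).op d i x.1 = some y →
      y ∈ semiInfTableaux lam := by
    intro d i x y h
    have hx := mem_semiInfTableaux_iff.1 x.2
    have h' := op_fockPower h
    refine mem_semiInfTableaux_iff.2 ⟨fun c => ?_, fun j => ?_⟩
    · rw [wtStar_op h', hx.1]
    · exact (opStar_none_of_op (d' := false) h').2 (hx.2 j)
  rintro i x y (h | h)
  · exact ⟨⟨y, key true i x y h⟩, rfl⟩
  · exact ⟨⟨y, key false i x y h⟩, rfl⟩

end FockMatrix

/-! ### Equivalence of elements of crystals -/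

namespace CrystalData

open Signature

variable {I P : Type} [AddCommGroup P] {D : CartanDatum I P} {X Y Z : Type}

/-- The operators `e_i` and `f_i` are inverse to each other. -/
def Reversible (C : CrystalData D X) : Prop :=
  ∀ d i x y, C.op d i x = some y → C.op (!d) i y = some x

/-- A partial bijection that is compatible with the structures of crystals, where weights are
shifted by `s`. -/
structure Link (C : CrystalData D X) (C' : CrystalData D Y) (s : P) (R : X → Y → Prop) : Prop where
  sig : ∀ x y, R x y → ∀ i, C.sig i x = C'.sig i y
  wt : ∀ x y, R x y → C.wt x = C'.wt y + s
  fwd : ∀ x y, R x y → ∀ d i x', C.op d i x = some x' → ∃ y', C'.op d i y = some y' ∧ R x' y'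
  bwd : ∀ x y, R x y → ∀ d i y', C'.op d i y = some y' → ∃ x', C.op d i x = some x' ∧ R x' y'
  left_unique : ∀ x x' y, R x y → R x' y → x = x'
  right_unique : ∀ x y z, R x y → R x z → y = z

/-- Elements related by some link. -/
def Linked (C : CrystalData D X) (C' : CrystalData D Y) (s : P) (x : X) (y : Y) : Prop :=
  ∃ R, Link C C' s R ∧ R x y

variable {C : CrystalData D X} {C' : CrystalData D Y} {C'' : CrystalData D Z} {s s' : P}

theorem Linked.refl (C : CrystalData D X) (x : X) : Linked C C 0 x x := by
  refine ⟨Eq, ⟨?_, ?_, ?_, ?_, ?_, ?_⟩, rfl⟩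
  · rintro x _ rfl i; rfl
  · rintro x _ rfl; rw [add_zero]
  · rintro x _ rfl d i x' h; exact ⟨x', h, rfl⟩
  · rintro x _ rfl d i x' h; exact ⟨x', h, rfl⟩
  · rintro x _ _ rfl rfl; rfl
  · rintro x _ _ rfl rfl; rfl

theorem Linked.symm {x : X} {y : Y} (h : Linked C C' s x y) : Linked C' C (-s) y x := by
  obtain ⟨R, hR, hxy⟩ := h
  refine ⟨fun y x => R x y, ⟨fun y x h i => (hR.sig x y h i).symm, fun y x h => ?_,
    fun y x h => hR.bwd x y h, fun y x h => hR.fwd x y h,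
    fun y y' x h h' => hR.right_unique x y y' h h',
    fun y x x' h h' => hR.left_unique x x' y h h'⟩, hxy⟩
  rw [hR.wt x y h]
  abel

theorem Linked.trans {x : X} {y : Y} {z : Z} (h : Linked C C' s x y) (h' : Linked C' C'' s' y z) :
    Linked C C'' (s' + s) x z := by
  obtain ⟨R, hR, hxy⟩ := h
  obtain ⟨S, hS, hyz⟩ := h'
  refine ⟨fun x z => ∃ y, R x y ∧ S y z, ⟨?_, ?_, ?_, ?_, ?_, ?_⟩, y, hxy, hyz⟩
  · rintro x z ⟨y, h1, h2⟩ i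
    rw [hR.sig x y h1, hS.sig y z h2]
  · rintro x z ⟨y, h1, h2⟩
    rw [hR.wt x y h1, hS.wt y z h2, add_assoc]
  · rintro x z ⟨y, h1, h2⟩ d i x' hx'
    obtain ⟨y', hy', h3⟩ := hR.fwd x y h1 d i x' hx'
    obtain ⟨z', hz', h4⟩ := hS.fwd y z h2 d i y' hy'
    exact ⟨z', hz', y', h3, h4⟩
  · rintro x z ⟨y, h1, h2⟩ d i z' hz'
    obtain ⟨y', hy', h3⟩ := hS.bwd y z h2 d i z' hz'
    obtain ⟨x', hx', h4⟩ := hR.bwd x y h1 d i y' hy'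
    exact ⟨x', hx', y', h4, h3⟩
  · rintro x x' z ⟨y, h1, h2⟩ ⟨y', h3, h4⟩
    obtain rfl := hS.left_unique y y' z h2 h4
    exact hR.left_unique x x' y h1 h3
  · rintro x z z' ⟨y, h1, h2⟩ ⟨y', h3, h4⟩
    obtain rfl := hR.right_unique x y y' h1 h3
    exact hS.right_unique y z z' h2 h4

/-- A structure preserving injection gives links. -/
theorem Linked.of_injective {r : X → Y} (hr : Function.Injective r)
    (sig : ∀ i x, C.sig i x = C'.sig i (r x)) (wt : ∀ x, C.wt x = C'.wt (r x) + s)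
    (op : ∀ d i x, (C.op d i x).map r = C'.op d i (r x)) (x : X) : Linked C C' s x (r x) := by
  refine ⟨fun x y => r x = y, ⟨?_, ?_, ?_, ?_, ?_, ?_⟩, rfl⟩
  · rintro x _ rfl i; exact sig i x
  · rintro x _ rfl; exact wt x
  · rintro x _ rfl d i x' h
    refine ⟨r x', ?_, rfl⟩
    rw [← op, h]; rfl
  · rintro x _ rfl d i y' h
    rw [← op, Option.map_eq_some_iff] at h
    exact h
  · rintro x x' _ rfl h; exact (hr h).symm
  · rintro x _ _ rfl rfl; rfl

theorem Reversible.mem_component (hC : C.Reversible) {b x y : X} (hx : x ∈ C.component b) {d : Bool}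
    {i : I} (h : C.op d i x = some y) : y ∈ C.component b := by
  refine Relation.EqvGen.trans _ _ _ hx ?_
  cases d
  · exact Relation.EqvGen.rel _ _ ⟨i, h⟩
  · exact Relation.EqvGen.symm _ _ (Relation.EqvGen.rel _ _ ⟨i, hC true i x y h⟩)

theorem Reversible.component_op (hC : C.Reversible) (b : X) (d : Bool) (i : I)
    (x : C.component b) :
    ((C.comap (Subtype.val : C.component b → X)).op d i x).map Subtype.val = C.op d i x.1 := by
  refine comap_op Subtype.val_injective (fun i x y h => ?_) d i x
  rw [Subtype.range_coe]
  rcases h with h | h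
  · exact hC.mem_component (d := true) x.2 h
  · exact hC.mem_component (d := false) x.2 h

/-- Every edge of the component can be carried across the link in both directions, because e_i and
f_i are mutually inverse. -/
theorem Link.mem_component {R : X → Y → Prop} (hR : Link C C' s R) {b : X} {b' : Y} (hb : R b b')
    (hC : C.Reversible) (hC' : C'.Reversible) {x : X} (hx : x ∈ C.component b) :
    ∃ y ∈ C'.component b', R x y := by
  have key : ∀ x y, Relation.EqvGen (fun x y => ∃ i, C.f i x = some y) x y →
      ((∃ x' ∈ C'.component b', R x x') ↔ ∃ y' ∈ C'.component b', R y y') := by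
    intro x y h
    induction h with
    | rel x y h =>
      obtain ⟨i, h⟩ := h
      constructor
      · rintro ⟨x', hx', hR'⟩
        obtain ⟨y', hy', h2⟩ := hR.fwd x x' hR' false i y h
        exact ⟨y', hC'.mem_component hx' hy', h2⟩
      · rintro ⟨x', hx', hR'⟩
        obtain ⟨y', hy', h2⟩ := hR.fwd y x' hR' true i x (hC false i x y h)
        exact ⟨y', hC'.mem_component hx' hy', h2⟩
    | refl x => exact Iff.rfl
    | symm x y _ ih => exact ih.symm
    | trans x y z _ _ ih1 ih2 => exact ih1.trans ih2
  exact (key b x hx).1 ⟨b', Relation.EqvGen.refl b', hb⟩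

/-- A link restricts to a bijection between the two components. Links are used instead of
isomorphisms of components because they involve no subtypes, compose freely, and allow a shift of
weights. -/
theorem Linked.equivalent {b : X} {b' : Y} (h : Linked C C' 0 b b') (hC : C.Reversible)
    (hC' : C'.Reversible) : C.Equivalent C' b b' := by
  obtain ⟨R, hR, hb⟩ := h
  obtain ⟨R', hR', hb'⟩ : ∃ R', Link C' C (-0) R' ∧ ∀ x y, R' y x ↔ R x y := by
    refine ⟨fun y x => R x y, ⟨fun y x h i => (hR.sig x y h i).symm, fun y x h => ?_,
      fun y x h => hR.bwd x y h, fun y x h => hR.fwd x y h,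
      fun y y' x h h' => hR.right_unique x y y' h h',
      fun y x x' h h' => hR.left_unique x x' y h h'⟩, fun _ _ => Iff.rfl⟩
    rw [hR.wt x y h]
    abel
  have h1 := fun x : C.component b => hR.mem_component hb hC hC' x.2
  have h2 := fun y : C'.component b' => hR'.mem_component ((hb' b b').2 hb) hC' hC y.2
  choose g hg hgR using h1
  choose g' hg' hgR' using h2
  have hψ : ∀ x, R x.1 (g x) := hgR
  let ψ : C.component b ≃ C'.component b' :=
    { toFun := fun x => ⟨g x, hg x⟩
      invFun := fun y => ⟨g' y, hg' y⟩
      left_inv := fun x => Subtype.ext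
        (hR.left_unique _ _ _ ((hb' _ _).1 (hgR' ⟨g x, hg x⟩)) (hgR x))
      right_inv := fun y => Subtype.ext
        (hR.right_unique _ _ _ (hgR ⟨g' y, hg' y⟩) ((hb' _ _).1 (hgR' y))) }
  have hop : ∀ d i x, (C'.comap Subtype.val).op d i (ψ x) =
      ((C.comap Subtype.val).op d i x).map ψ := by
    intro d i x
    have e1 := hC.component_op b d i x
    have e2 := hC'.component_op b' d i (ψ x)
    refine Option.map_injective Subtype.val_injective ?_
    rw [e2]
    cases h : (C.comap Subtype.val).op d i x with
    | none =>
      rw [h] at e1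
      simp only [Option.map_none] at e1 ⊢
      by_contra hne
      obtain ⟨y', hy'⟩ := Option.ne_none_iff_exists'.1 hne
      obtain ⟨x', hx', _⟩ := hR.bwd _ _ (hgR x) d i y' hy'
      rw [hx'] at e1
      cases e1
    | some x' =>
      rw [h] at e1
      obtain ⟨y', hy', h3⟩ := hR.fwd _ _ (hgR x) d i x' e1.symm
      change C'.op d i (g x) = some (g x')
      rw [hy', hR.right_unique _ _ _ h3 (hgR x')]
  refine ⟨ψ, Subtype.ext (hR.right_unique _ _ _ (hgR _) hb), ⟨fun x => ?_, fun i x => ?_,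
    fun i x => ?_, hop true, hop false⟩⟩
  · have := hR.wt _ _ (hgR x)
    rw [add_zero] at this
    exact this.symm
  · exact congrArg Prod.fst (hR.sig _ _ (hgR x) i).symm
  · exact congrArg Prod.snd (hR.sig _ _ (hgR x) i).symm

theorem Equivalent.linked {b : X} {b' : Y} (h : C.Equivalent C' b b') (hC : C.Reversible)
    (hC' : C'.Reversible) : Linked C C' 0 b b' := by
  obtain ⟨ψ, hb, hψ⟩ := h
  have hop : ∀ d i x, (C'.comap Subtype.val).op d i (ψ x) =
      ((C.comap Subtype.val).op d i x).map ψ := by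
    intro d i x
    cases d
    · exact hψ.f i x
    · exact hψ.e i x
  refine ⟨fun x y => ∃ hx : x ∈ C.component b, (ψ ⟨x, hx⟩).1 = y, ⟨?_, ?_, ?_, ?_, ?_, ?_⟩,
    Relation.EqvGen.refl b, by rw [hb]⟩
  · rintro x _ ⟨hx, rfl⟩ i
    exact Prod.ext (hψ.ε i ⟨x, hx⟩).symm (hψ.φ i ⟨x, hx⟩).symm
  · rintro x _ ⟨hx, rfl⟩
    rw [add_zero]
    exact (hψ.wt ⟨x, hx⟩).symm
  · rintro x _ ⟨hx, rfl⟩ d i x' h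
    have e1 := hC.component_op b d i ⟨x, hx⟩
    have e2 := hC'.component_op b' d i (ψ ⟨x, hx⟩)
    rw [h, Option.map_eq_some_iff] at e1
    obtain ⟨x'', h1, rfl⟩ := e1
    refine ⟨(ψ x'').1, ?_, x''.2, rfl⟩
    rw [← e2, hop, h1]
    rfl
  · rintro x _ ⟨hx, rfl⟩ d i y' h
    have e1 := hC.component_op b d i ⟨x, hx⟩
    have e2 := hC'.component_op b' d i (ψ ⟨x, hx⟩)
    rw [h, hop, Option.map_map, Option.map_eq_some_iff] at e2
    obtain ⟨x'', h1, rfl⟩ := e2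
    rw [h1] at e1
    exact ⟨x''.1, e1.symm, x''.2, rfl⟩
  · rintro x x' y ⟨hx, h⟩ ⟨hx', h'⟩
    have := ψ.injective (Subtype.ext (h.trans h'.symm))
    simpa using this
  · rintro x y y' ⟨hx, h⟩ ⟨hx', hy⟩
    exact h.symm.trans hy

/-! Paths. -/

/-- `y` is obtained from `x` by operators with indices in `S`. -/
def Reach (C : CrystalData D X) (d : Bool) (S : Set I) : X → X → Prop :=
  Relation.ReflTransGen fun x y => ∃ i ∈ S, C.op d i x = some y

theorem Reach.invariant {d : Bool} {S : Set I} {x y : X} (h : C.Reach d S x y) {Q : X → Prop}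
    (hQ : ∀ i ∈ S, ∀ x y, Q x → C.op d i x = some y → Q y) (hx : Q x) : Q y := by
  induction h with
  | refl => exact hx
  | tail _ h ih =>
    obtain ⟨i, hi, h⟩ := h
    exact hQ i hi _ _ ih h

theorem exists_reach {d : Bool} {S : Set I} {Q : X → Prop} (V : X → ℤ) (hV : ∀ x, Q x → 0 ≤ V x)
    (hQ : ∀ i ∈ S, ∀ x y, Q x → C.op d i x = some y → Q y ∧ V y < V x) {x : X} (hx : Q x) :
    ∃ y, C.Reach d S x y ∧ Q y ∧ ∀ i ∈ S, C.op d i y = none := by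
  have key : ∀ (n : ℕ) x, Q x → V x < n →
      ∃ y, C.Reach d S x y ∧ Q y ∧ ∀ i ∈ S, C.op d i y = none := by
    intro n
    induction n with
    | zero =>
      intro x hx hlt
      have := hV x hx
      push_cast at hlt
      omega
    | succ n ih =>
      intro x hx hlt
      by_cases h : ∀ i ∈ S, C.op d i x = none
      · exact ⟨x, Relation.ReflTransGen.refl, hx, h⟩
      · push Not at h
        obtain ⟨i, hi, h⟩ := h
        obtain ⟨y, hy⟩ := Option.ne_none_iff_exists'.1 h
        obtain ⟨h1, h2⟩ := hQ i hi x y hx hy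
        obtain ⟨z, hz, h3⟩ := ih y h1 (by push_cast at hlt; omega)
        exact ⟨z, Relation.ReflTransGen.head ⟨i, hi, hy⟩ hz, h3⟩
  exact key (V x + 1).toNat x hx (by have := hV x hx; omega)

/-- Paths can be transported by a link, also backwards. -/
theorem Linked.reach {d : Bool} {S : Set I} {x y : X} {x' : Y} (hx : Linked C C' s x x')
    (h : C.Reach d S x y) : ∃ y', C'.Reach d S x' y' ∧ Linked C C' s y y' := by
  induction h with
  | refl => exact ⟨x', Relation.ReflTransGen.refl, hx⟩
  | tail _ h ih =>
    obtain ⟨y', hy', R, hR, h'⟩ := ih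
    obtain ⟨i, hi, h⟩ := h
    obtain ⟨z, hz, hxz⟩ := hR.fwd _ _ h' d i _ h
    exact ⟨z, hy'.tail ⟨i, hi, hz⟩, R, hR, hxz⟩

/-- Linked elements are equal if paths lead from them to the same element. -/
theorem Linked.eq_of_reach (hC : C.Reversible) {d : Bool} {S : Set I} {x y x' : X}
    (hx : Linked C C s x x') (h : C.Reach d S x y)
    (hend : ∀ y', C.Reach d S x' y' → Linked C C s y y' → y' = y) : x' = x := by
  obtain ⟨R, hR, hxx⟩ := hx
  -- The claim carries along an implication from equality at the ends to equality at the starts: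
  -- each operator of the path is injective, so equality can be pulled back step by step.
  suffices key : ∃ y', C.Reach d S x' y' ∧ R y y' ∧ (y' = y → x' = x) by
    obtain ⟨y', h1, h2, h3⟩ := key
    exact h3 (hend y' h1 ⟨R, hR, h2⟩)
  clear hend
  induction h with
  | refl => exact ⟨x', Relation.ReflTransGen.refl, hxx, id⟩
  | @tail y z _ h ih =>
    obtain ⟨y', hy', h', heq⟩ := ih
    obtain ⟨i, hi, h⟩ := h
    obtain ⟨z', hz', h''⟩ := hR.fwd _ _ h' d i _ h
    refine ⟨z', hy'.tail ⟨i, hi, hz'⟩, h'', fun hz => heq ?_⟩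
    subst hz
    have e1 := hC d i y z' h
    have e2 := hC d i y' z' hz'
    rw [e1] at e2
    exact (Option.some.inj e2).symm

theorem Linked.op_none {x : X} {y : Y} (h : Linked C C' s x y) {d : Bool} {i : I} :
    C.op d i x = none ↔ C'.op d i y = none := by
  obtain ⟨R, hR, hxy⟩ := h
  constructor
  · intro h
    by_contra hne
    obtain ⟨y', hy'⟩ := Option.ne_none_iff_exists'.1 hne
    obtain ⟨x', hx', _⟩ := hR.bwd _ _ hxy d i y' hy'
    rw [hx'] at h
    cases h
  · intro h
    by_contra hne
    obtain ⟨y', hy'⟩ := Option.ne_none_iff_exists'.1 hne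
    obtain ⟨x', hx', _⟩ := hR.fwd _ _ hxy d i y' hy'
    rw [hx'] at h
    cases h

theorem Linked.wt_eq {x : X} {y : Y} (h : Linked C C' s x y) : C.wt x = C'.wt y + s := by
  obtain ⟨R, hR, hxy⟩ := h
  exact hR.wt x y hxy

theorem IsCrystal.reversible (h : C.IsCrystal) : C.Reversible := by
  intro d i x y hxy
  cases d
  · exact (h.f_iff_e i x y).1 hxy
  · exact (h.f_iff_e i y x).2 hxy

end CrystalData

namespace FockMatrix

open CrystalData

variable {u : ℕ} {A A' : FockMatrix u} {d : Bool}

/-- The graph of e*_j or f*_j is itself a link of 𝔤-crystals. This is commutation in the form in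
which it is used from here on. -/
theorem linked_of_opStar {j : Fin (u - 1)} (h : (crystalStar u).op d j A = some A') :
    Linked (crystal u) (crystal u) 0 A A' := by
  have hrev := (isCrystalStar u).reversible
  refine ⟨fun A A' => (crystalStar u).op d j A = some A', ⟨?_, ?_, ?_, ?_, ?_, ?_⟩, h⟩
  · intro A A' h i
    exact (sig_opStar h i).symm
  · intro A A' h
    rw [wt_opStar h, add_zero]
  · intro A A' h d' i B hB
    obtain ⟨E, h1, h2⟩ := op_opStar h hB
    exact ⟨E, h1, h2⟩
  · intro A A' h d' i B hB
    obtain ⟨E, h1, h2⟩ := op_opStar (hrev d j A A' h) hB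
    have := hrev (!d) j B E h2
    rw [Bool.not_not] at this
    exact ⟨E, h1, this⟩
  · intro A A' B h1 h2
    have e1 := hrev d j A B h1
    have e2 := hrev d j A' B h2
    rw [e1] at e2
    exact Option.some.inj e2
  · intro A B B' h1 h2
    rw [h1] at h2
    exact Option.some.inj h2

theorem linkedStar_of_op {i : ℤ} (h : (crystal u).op d i A = some A') :
    Linked (crystalStar u) (crystalStar u) 0 A A' := by
  have hrev := (isCrystal u).reversible
  refine ⟨fun A A' => (crystal u).op d i A = some A', ⟨?_, ?_, ?_, ?_, ?_, ?_⟩, h⟩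
  · intro A A' h j
    exact (sigStar_op h j).symm
  · intro A A' h
    rw [wtStar_op h, add_zero]
  · intro A A' h d' j B hB
    obtain ⟨E, h1, h2⟩ := op_opStar hB h
    exact ⟨E, h2, h1⟩
  · intro A A' h d' j B hB
    obtain ⟨E, h1, h2⟩ := op_opStar hB (hrev d i A A' h)
    have := hrev (!d) i B E h1
    rw [Bool.not_not] at this
    exact ⟨E, h2, this⟩
  · intro A A' B h1 h2
    have e1 := hrev d i A B h1
    have e2 := hrev d i A' B h2
    rw [e1] at e2
    exact Option.some.inj e2
  · intro A B B' h1 h2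
    rw [h1] at h2
    exact Option.some.inj h2

theorem linked_of_reachStar {S : Set (Fin (u - 1))} (h : (crystalStar u).Reach d S A A') :
    Linked (crystal u) (crystal u) 0 A A' := h.invariant (Q := Linked (crystal u) (crystal u) 0 A)
    (fun _ _ _ _ hx hxy => by simpa using hx.trans (linked_of_opStar hxy)) (Linked.refl _ A)

theorem linkedStar_of_reach {S : Set ℤ} (h : (crystal u).Reach d S A A') :
    Linked (crystalStar u) (crystalStar u) 0 A A' :=
  h.invariant (Q := Linked (crystalStar u) (crystalStar u) 0 A)
    (fun _ _ _ _ hx hxy => by simpa using hx.trans (linkedStar_of_op hxy)) (Linked.refl _ A)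

end FockMatrix

/-! ### Criteria for the vanishing of a signature -/

namespace Signature

variable {K : Type} {s : K → ℕ × ℕ}

/-- Reversing the order exchanges the rules for `.pos` and `.neg`; reversing it and swapping ε with
φ preserves the rule for `.neg`. With these two symmetries all criteria follow from
`tot_neg_snd_eq_zero`. -/
theorem comb_pos_eq (s t : ℕ × ℕ) : comb .pos s t = comb .neg t s := rfl

theorem comb_neg_swap (s t : ℕ × ℕ) : (comb .neg s t).swap = comb .neg t.swap s.swap := rfl

theorem tot_pos_eq_reverse (L : List K) : tot .pos s L = tot .neg s L.reverse := by
  induction L with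
  | nil => rfl
  | cons a L ih =>
    rw [List.reverse_cons, tot_append, tot, ih, comb_pos_eq, tot, tot, comb_zero_right]

theorem tot_neg_swap (L : List K) :
    (tot .neg s L).swap = tot .neg (fun k => (s k).swap) L.reverse := by
  induction L with
  | nil => rfl
  | cons a L ih =>
    rw [List.reverse_cons, tot_append, tot, comb_neg_swap, ih, tot, tot, comb_zero_right]

theorem tot_neg_fst_eq_zero {L : List K} : (tot .neg s L).1 = 0 ↔ ∀ L₁ k L₂, L = L₁ ++ k :: L₂ →
    ((s k).1 : ℤ) ≤ (L₁.map fun k => ((s k).2 : ℤ) - (s k).1).sum := by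
  have h1 : (tot .neg s L).1 = (tot .neg (fun k => (s k).swap) L.reverse).2 := by
    rw [← tot_neg_swap]; rfl
  have hneg : ∀ L' : List K, (L'.map fun k => ((s k).swap.2 : ℤ) - (s k).swap.1).sum =
      -(L'.reverse.map fun k => ((s k).2 : ℤ) - (s k).1).sum := by
    intro L'
    rw [List.map_reverse, List.sum_reverse]
    induction L' with
    | nil => rfl
    | cons a L' ih =>
      simp only [List.map_cons, List.sum_cons, Prod.fst_swap, Prod.snd_swap] at ih ⊢
      rw [ih]
      ring
  rw [h1, tot_neg_snd_eq_zero]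
  constructor
  · intro h L₁ k L₂ hL
    have := h L₂.reverse k L₁.reverse (by rw [hL]; simp)
    rw [hneg, List.reverse_reverse, Prod.snd_swap] at this
    omega
  · intro h L₁ k L₂ hL
    have := h L₂.reverse k L₁.reverse (by rw [← List.reverse_reverse L, hL]; simp)
    rw [hneg, Prod.snd_swap]
    omega

theorem tot_pos_snd_eq_zero {L : List K} : (tot .pos s L).2 = 0 ↔ ∀ L₁ k L₂, L = L₁ ++ k :: L₂ →
    ((s k).2 : ℤ) + (L₁.map fun k => ((s k).2 : ℤ) - (s k).1).sum ≤ 0 := by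
  rw [tot_pos_eq_reverse, tot_neg_snd_eq_zero]
  constructor
  · intro h L₁ k L₂ hL
    have := h L₂.reverse k L₁.reverse (by rw [hL]; simp)
    rwa [List.map_reverse, List.sum_reverse] at this
  · intro h L₁ k L₂ hL
    have := h L₂.reverse k L₁.reverse (by rw [← List.reverse_reverse L, hL]; simp)
    rwa [List.map_reverse, List.sum_reverse] at this

theorem tot_pos_fst_eq_zero {L : List K} : (tot .pos s L).1 = 0 ↔ ∀ L₁ k L₂, L = L₁ ++ k :: L₂ →
    ((s k).1 : ℤ) ≤ (L₂.map fun k => ((s k).2 : ℤ) - (s k).1).sum := by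
  rw [tot_pos_eq_reverse, tot_neg_fst_eq_zero]
  constructor
  · intro h L₁ k L₂ hL
    have := h L₂.reverse k L₁.reverse (by rw [hL]; simp)
    rwa [List.map_reverse, List.sum_reverse] at this
  · intro h L₁ k L₂ hL
    have := h L₂.reverse k L₁.reverse (by rw [← List.reverse_reverse L, hL]; simp)
    rwa [List.map_reverse, List.sum_reverse] at this

end Signature

namespace Grid

open FockMatrix Signature CrystalData

variable {p : ℕ × ℕ}

theorem rows_prefix {L₁ L₂ : List ℤ} {b : ℤ} (h : rows p = L₁ ++ b :: L₂) (f : ℤ → ℤ) :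
    (L₁.map f).sum = ∑ b' ∈ Finset.Ico (b + 1) p.2, f b' := by
  have hp := rows_pairwise p
  have hn := nodup_rows p
  rw [h] at hp hn
  rw [List.pairwise_append, List.pairwise_cons] at hp
  have hn2 : L₁.Nodup := (List.nodup_append.1 hn).1
  rw [← List.sum_toFinset f hn2]
  congr 1
  ext x
  rw [List.mem_toFinset, Finset.mem_Ico]
  have hb : b ∈ rows p := by rw [h]; simp
  rw [mem_rows] at hb
  constructor
  · intro hx
    have h1 : x ∈ rows p := by rw [h]; simp [hx]
    have := hp.2.2 x hx b (by simp)
    exact ⟨by omega, (mem_rows.1 h1).2⟩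
  · rintro ⟨h1, h2⟩
    have h3 : x ∈ rows p := mem_rows.2 ⟨by omega, h2⟩
    rw [h, List.mem_append, List.mem_cons] at h3
    rcases h3 with h3 | h3 | h3
    · exact h3
    · omega
    · have := hp.2.1.1 x h3
      omega

theorem tot_rows_fst_eq_zero {s : ℤ → ℕ × ℕ} : (tot .neg s (rows p)).1 = 0 ↔
    ∀ b ∈ Finset.Ico (-(p.1 : ℤ)) p.2,
      ((s b).1 : ℤ) ≤ ∑ b' ∈ Finset.Ico (b + 1) (p.2 : ℤ), (((s b').2 : ℤ) - (s b').1) := by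
  rw [tot_neg_fst_eq_zero]
  constructor
  · intro h b hb
    obtain ⟨L₁, L₂, hL⟩ := List.append_of_mem (mem_rows.2 (Finset.mem_Ico.1 hb))
    rw [← rows_prefix hL]
    exact h L₁ b L₂ hL
  · intro h L₁ b L₂ hL
    rw [rows_prefix hL]
    exact h b (Finset.mem_Ico.2 (mem_rows.1 (by rw [hL]; simp)))

theorem range_eq_append {u c : ℕ} (h : c < u) : List.range u =
    List.range c ++ c :: (List.range (u - c - 1)).map fun t => c + 1 + t := by
  obtain ⟨v, rfl⟩ := Nat.exists_eq_add_of_lt h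
  rw [show c + v + 1 = c + (1 + v) by omega, List.range_add, show c + (1 + v) - c - 1 = v by omega,
    List.range_add]
  simp [Function.comp_def, add_assoc]

theorem range_append_unique {u c : ℕ} {L₁ L₂ : List ℕ} (h : List.range u = L₁ ++ c :: L₂) :
    c < u ∧ L₁ = List.range c := by
  have h1 : L₁ = List.range L₁.length := by
    have h2 := congrArg (List.take L₁.length) h
    have h3 := congrArg List.length h
    simp only [List.length_range, List.length_append, List.length_cons] at h3
    rw [List.take_range, List.take_left', min_eq_left (by omega)] at h2
    · exact h2.symm
    · rfl
  have hc : c = L₁.length := by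
    have h3 := congrArg List.length h
    simp only [List.length_range, List.length_append, List.length_cons] at h3
    have h2 := congrArg (fun l => l[L₁.length]?) h
    simp only [List.getElem?_append_right le_rfl, Nat.sub_self, List.getElem?_cons_zero] at h2
    rw [List.getElem?_range (by omega)] at h2
    exact (Option.some.inj h2).symm
  refine ⟨List.mem_range.1 (by rw [h]; simp), ?_⟩
  rw [hc]
  exact h1

/-- The sum of the first `c` entries of a row. -/
def pre (a : ℤ → ℕ → ℕ) (b : ℤ) (c : ℕ) : ℕ := ∑ c' ∈ Finset.range c, a b c'

theorem pre_succ (a : ℤ → ℕ → ℕ) (b : ℤ) (c : ℕ) : pre a b (c + 1) = pre a b c + a b c :=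
  Finset.sum_range_succ _ _

theorem sum_map_range' (f : ℕ → ℤ) (c : ℕ) :
    ((List.range c).map f).sum = ∑ c' ∈ Finset.range c, f c' := sum_map_range f

end Grid

/-! ### Killed matrices and potentials -/

namespace FockMatrix

open Grid Signature CrystalData

variable {u : ℕ} {p : ℕ × ℕ} {A : FockMatrix u} {i : ℤ}

theorem colSig_diff (hi : i ≠ 0) (c : ℕ) :
    ((colSig i A.ent c).2 : ℤ) - (colSig i A.ent c).1 = A.ent (i - 1) c - A.ent i c :=
  loc_diff (fun h => hi (sign_eq_zero_iff.1 h)) _ _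

theorem rowSig_diff (j : ℕ) (b : ℤ) :
    ((rowSig j A.ent b).2 : ℤ) - (rowSig j A.ent b).1 = A.ent b j - A.ent b (j + 1) :=
  loc_diff (by unfold kindRow; split_ifs <;> decide) _ _

theorem colSig_of_neg (hi : i < 0) (c : ℕ) :
    colSig i A.ent c = (A.ent i c - A.ent (i - 1) c, A.ent (i - 1) c - A.ent i c) := by
  rw [colSig, sign_neg hi]; rfl

theorem colSig_of_pos (hi : 0 < i) (c : ℕ) : colSig i A.ent c = (A.ent i c, A.ent (i - 1) c) := by
  rw [colSig, sign_pos hi]; rfl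

/-- The matrices killed by `e_i` for an even simple root with `i < 0`. -/
theorem e_eq_none_iff (hi : i < 0) :
    (crystal u).op true i A = none ↔ ∀ c ≤ u, pre A.ent i c ≤ pre A.ent (i - 1) c := by
  rw [op_eq_none, sign_neg hi]
  change (tot .neg _ _).1 = 0 ↔ _
  rw [tot_neg_fst_eq_zero]
  constructor
  · intro h c
    induction c with
    | zero => intro _; exact le_rfl
    | succ c ih =>
      intro hc
      have h1 := h _ c _ (range_eq_append (by omega : c < u))
      simp only [colSig_diff hi.ne] at h1
      rw [sum_map_range', Finset.sum_sub_distrib, colSig_of_neg hi] at h1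
      have h2 := ih (by omega)
      rw [pre_succ, pre_succ]
      unfold pre at h2 ⊢
      zify at h2 ⊢
      omega
  · intro h L₁ c L₂ hL
    obtain ⟨hc, rfl⟩ := range_append_unique hL
    have h1 := h c hc.le
    have h2 := h (c + 1) hc
    rw [pre_succ, pre_succ] at h2
    simp only [colSig_diff hi.ne]
    rw [sum_map_range', Finset.sum_sub_distrib, colSig_of_neg hi]
    unfold pre at h1 h2
    zify at h1 h2
    simp only
    omega

/-- For i > 0 nothing cancels within a column, so the letters i − 1 of the column c have to be
absorbed by letters i in the columns strictly to the left of c. This causes the shift by one in the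
prefix sums. -/
theorem pre_le_of_f_killed (hi : 0 < i) (h : (crystal u).op false i A = none) {c : ℕ} (hc : c < u) :
    pre A.ent (i - 1) (c + 1) ≤ pre A.ent i c := by
  rw [op_eq_none, sign_pos hi] at h
  change (tot .pos _ _).2 = 0 at h
  rw [tot_pos_snd_eq_zero] at h
  have h1 := h _ c _ (range_eq_append hc)
  simp only [colSig_diff hi.ne'] at h1
  rw [sum_map_range', Finset.sum_sub_distrib, colSig_of_pos hi] at h1
  rw [pre_succ]
  unfold pre
  zify
  omega

/-- Without letters i there is no ε to absorb a φ, so any letter i − 1 would allow f_i to act. -/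
theorem row_eq_zero_of_f_killed (hi : i ≤ 0) (h : (crystal u).op false i A = none)
    (h0 : ∀ c, A.ent i c = 0) (c : ℕ) : A.ent (i - 1) c = 0 := by
  rcases lt_or_ge c u with hc | hc
  · rw [op_eq_none] at h
    rcases lt_or_eq_of_le hi with hi | hi
    · rw [sign_neg hi] at h
      change (tot .neg _ _).2 = 0 at h
      rw [tot_neg_snd_eq_zero] at h
      have h1 := h _ c _ (range_eq_append hc)
      simp only [colSig_diff hi.ne, h0] at h1
      rw [colSig_of_neg hi] at h1
      simp only [h0] at h1
      have h2 : ∀ L : List ℕ, (0 : ℤ) ≤ (L.map fun k => (A.ent (i - 1) k : ℤ) - (0 : ℕ)).sum := by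
        intro L
        refine List.sum_nonneg fun x hx => ?_
        obtain ⟨k, _, rfl⟩ := List.mem_map.1 hx
        omega
      have := h2 ((List.range (u - c - 1)).map fun t => c + 1 + t)
      omega
    · subst hi
      have hs : ∀ k, colSig 0 A.ent k = (0, min (A.ent (0 - 1) k) 1) := by
        intro k
        have : colSig 0 A.ent k = loc .zero (A.ent (0 - 1) k) (A.ent 0 k) := rfl
        rw [this, h0]
        simp [loc]
      have hz : ∀ L : List ℕ, (tot 0 (colSig 0 A.ent) L).1 = 0 := by
        intro L
        induction L with
        | nil => rfl
        | cons a L ih =>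
          change (comb .zero _ _).1 = 0
          simp only [comb]
          split_ifs
          · rw [hs]
          · exact ih
      have h' : (tot 0 (colSig 0 A.ent) (List.range u)).2 = 0 := by
        rw [sign_zero] at h
        exact h
      have := tot_zero_eq_zero.1 (by rw [hz, h'] : (tot 0 (colSig 0 A.ent) (List.range u)).1 +
        (tot 0 (colSig 0 A.ent) (List.range u)).2 = 0) c (List.mem_range.2 hc)
      rw [hs] at this
      simp only at this
      omega
  · exact A.ent_of_le _ hc

/-- For i > 0 the letters i of the column c can be absorbed only by letters i − 1 in columns further
to the right. -/
theorem ent_le_of_e_killed (hi : 0 < i) (h : (crystal u).op true i A = none) {c : ℕ} (hc : c < u)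
    (h0 : ∀ c', c < c' → A.ent (i - 1) c' = 0) : A.ent i c = 0 := by
  rw [op_eq_none, sign_pos hi] at h
  change (tot .pos _ _).1 = 0 at h
  rw [tot_pos_fst_eq_zero] at h
  have h1 := h _ c _ (range_eq_append hc)
  simp only [colSig_diff hi.ne'] at h1
  rw [colSig_of_pos hi] at h1
  have h2 : (((List.range (u - c - 1)).map fun t => c + 1 + t).map fun k =>
      (A.ent (i - 1) k : ℤ) - A.ent i k).sum ≤ 0 := by
    rw [List.map_map, sum_map_range']
    refine Finset.sum_nonpos fun t _ => ?_
    rw [Function.comp_apply, h0 _ (by omega)]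
    omega
  omega

/-- The sum of the row indices, with weights `g`. -/
noncomputable def rowPotential (g : ℤ → ℤ) (p : ℕ × ℕ) (A : FockMatrix u) : ℤ :=
  ∑ b ∈ Finset.Ico (-(p.1 : ℤ)) p.2, g b * (((crystal u).wt A).2 b + u * vac b)

theorem rowPotential_nonneg {g : ℤ → ℤ} (hg : ∀ b ∈ Finset.Ico (-(p.1 : ℤ)) p.2, 0 ≤ g b) :
    0 ≤ rowPotential g p A := by
  refine Finset.sum_nonneg fun b hb => mul_nonneg (hg b hb) ?_
  rw [wt_snd, Finset.sum_sub_distrib]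
  simp only [Finset.sum_const, Finset.card_range, nsmul_eq_mul, sub_add_cancel]
  exact Finset.sum_nonneg fun c _ => by omega

theorem rowPotential_op {g : ℤ → ℤ} {A' : FockMatrix u} (h1 : -(p.1 : ℤ) ≤ i - 1) (h2 : i < p.2)
    {d : Bool} (h : (crystal u).op d i A = some A') :
    rowPotential g p A' = rowPotential g p A + if d then g (i - 1) - g i else g i - g (i - 1) := by
  have key : ∀ A A' : FockMatrix u, (crystal u).op true i A = some A' →
      rowPotential g p A' = rowPotential g p A + (g (i - 1) - g i) := by
    intro A A' h
    have hw := ((isCrystal u).e_spec i A A' h).2.2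
    have hb : ∀ b, ((crystal u).wt A').2 b = ((crystal u).wt A).2 b +
        ((if b = i - 1 then 1 else 0) - if b = i then 1 else 0) := by
      intro b
      rw [hw]
      change _ + (Finsupp.single (i - 1) 1 - Finsupp.single i 1 : ℤ →₀ ℤ) b = _
      simp only [Finsupp.sub_apply, Finsupp.single_apply, eq_comm]
    have e : ∀ b, g b * (((crystal u).wt A').2 b + u * vac b) =
        g b * (((crystal u).wt A).2 b + u * vac b) +
          ((if b = i - 1 then g b else 0) - if b = i then g b else 0) := by
      intro b
      rw [hb]
      split_ifs <;> ring
    simp only [rowPotential, e]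
    rw [Finset.sum_add_distrib, Finset.sum_sub_distrib, Finset.sum_ite_eq', Finset.sum_ite_eq',
      if_pos (Finset.mem_Ico.2 ⟨h1, by omega⟩), if_pos (Finset.mem_Ico.2 ⟨by omega, h2⟩)]
  cases d
  · have h' := key A' A ((isCrystal u).reversible false i A A' h)
    simp only [Bool.false_eq_true, if_false]
    omega
  · exact key A _ h

/-- `e_i` or `f_i` can be applied until the matrix is killed. -/
theorem exists_reach_op (d : Bool) {S : Set ℤ} (hS : ∀ i ∈ S, -(p.1 : ℤ) ≤ i - 1 ∧ i < p.2)
    (hp : Within u p A.ent) : ∃ B, (crystal u).Reach d S A B ∧ Within u p B.ent ∧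
      ∀ i ∈ S, (crystal u).op d i B = none := by
  refine exists_reach (Q := fun B => Within u p B.ent)
    -- Raising decreases row indices and lowering increases them, so the potential measures the
    -- distance to that end of the window towards which the letters move.
    (rowPotential (fun b => if d then b + p.1 else p.2 - b) p) (fun B _ => ?_) ?_ hp
  · refine rowPotential_nonneg fun b hb => ?_
    rw [Finset.mem_Ico] at hb
    split_ifs <;> omega
  · intro i hi B B' hB h
    refine ⟨within_op hB (hS i hi).1 (hS i hi).2 h, ?_⟩
    rw [rowPotential_op (hS i hi).1 (hS i hi).2 h]
    split_ifs <;> omega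

/-- The same for the operators of `𝔤𝔩_u`. -/
theorem exists_reach_opStar (d : Bool) (A : FockMatrix u) :
    ∃ B, (crystalStar u).Reach d Set.univ A B ∧ ∀ j, (crystalStar u).op d j B = none := by
  obtain ⟨p, hp⟩ := A.exists_within
  have hrev := (isCrystalStar u).reversible
  -- Here column indices take the role of row indices. The summand `p.1` turns the weight into the
  -- number of letters of the column in the window, which is nonnegative.
  let V : FockMatrix u → ℤ := fun B =>
    ∑ c : Fin u, (if d then (c : ℤ) else u - c) * ((crystalStar u).wt B c + p.1)
  have hpos : ∀ B : FockMatrix u, Within u p B.ent → ∀ c, 0 ≤ (crystalStar u).wt B c + p.1 := by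
    intro B hB c
    rw [wtStar_eq_colSum hB, colSum_eq, sub_add_cancel]
    omega
  have hstep : ∀ (g : Fin u → ℤ) (j : Fin (u - 1)) (B B' : FockMatrix u),
      (crystalStar u).op true j B = some B' →
      ∑ c, g c * ((crystalStar u).wt B' c + p.1) =
        ∑ c, g c * ((crystalStar u).wt B c + p.1) + (g (glLo j) - g (glHi j)) := by
    intro g j B B' h
    have hw := ((isCrystalStar u).e_spec j B B' h).2.2
    have e : ∀ c, g c * ((crystalStar u).wt B' c + p.1) = g c * ((crystalStar u).wt B c + p.1) +
        ((if c = glLo j then g c else 0) - if c = glHi j then g c else 0) := by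
      intro c
      rw [hw]
      change g c * (_ + (Pi.single (glLo j) (1 : ℤ) - Pi.single (glHi j) 1 : Fin u → ℤ) c + _) = _
      simp only [Pi.sub_apply, Pi.single_apply]
      split_ifs <;> ring
    simp only [e]
    rw [Finset.sum_add_distrib, Finset.sum_sub_distrib, Finset.sum_ite_eq', Finset.sum_ite_eq',
      if_pos (Finset.mem_univ _), if_pos (Finset.mem_univ _)]
  suffices h : ∃ B, (crystalStar u).Reach d Set.univ A B ∧ Within u p B.ent ∧
      ∀ j ∈ Set.univ, (crystalStar u).op d j B = none by
    obtain ⟨B, h1, _, h2⟩ := h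
    exact ⟨B, h1, fun j => h2 j trivial⟩
  refine exists_reach V (fun B hB => ?_) ?_ hp
  · refine Finset.sum_nonneg fun c _ => mul_nonneg ?_ (hpos B hB c)
    have := c.2
    split_ifs <;> omega
  · intro j _ B B' hB h
    refine ⟨within_opStar hB h, ?_⟩
    cases d
    · have := hstep (fun c => (u : ℤ) - c) j B' B (hrev false j B B' h)
      simp only [V, Bool.false_eq_true, if_false]
      simp only [glLo, glHi] at this
      push_cast at this
      omega
    · have := hstep (fun c => (c : ℤ)) j B B' h
      simp only [V, if_true]
      simp only [glLo, glHi] at this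
      push_cast at this
      omega

end FockMatrix

/-! ### Rigidity -/

namespace FockMatrix

open Grid Signature CrystalData

variable {u : ℕ} {p : ℕ × ℕ} {A A' B : FockMatrix u} {i : ℤ}

/-- The f_i with i > 0 force the prefix sum of row r up to column c to be at most the sum of row r +
1 over the columns before c. So column 0 is empty except near the end of the window, then column 1,
and so on; each column costs one more row at the end. If the window has at least u + 1 rows of
degree 1, the row 0 is empty, and the emptiness spreads to the rows of degree 0 one by one. -/
theorem rows_zero_of_f_killed (hn : u + 1 ≤ p.2)
    (hf : ∀ i, -(p.1 : ℤ) < i → i < p.2 → (crystal u).op false i B = none) {b : ℤ}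
    (hb : -(p.1 : ℤ) ≤ b) (hb0 : b ≤ 0) : ∀ c, B.ent b c = 0 := by
  have odd : ∀ c : ℕ, c < u → ∀ r : ℤ, 0 ≤ r → r < p.2 - 1 - c → B.ent r c = 0 := by
    intro c
    induction c using Nat.strong_induction_on with
    | _ c ih =>
      intro hc r hr hlt
      have h1 := pre_le_of_f_killed (i := r + 1) (by omega) (hf _ (by omega) (by omega)) hc
      have h2 : pre B.ent (r + 1) c = 0 := Finset.sum_eq_zero fun c' hc' => by
        rw [Finset.mem_range] at hc'
        exact ih c' hc' (by omega) (r + 1) (by omega) (by omega)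
      rw [h2, add_sub_cancel_right, pre_succ] at h1
      omega
  induction b, hb0 using Int.leInductionDown with
  | base =>
    intro c
    rcases lt_or_ge c u with hc | hc
    · exact odd c hc 0 le_rfl (by omega)
    · exact B.ent_of_le _ hc
  | pred b hb' ih =>
    exact row_eq_zero_of_f_killed hb' (hf b (by omega) (by omega)) (ih (by omega))

/-- Only the antidiagonal r + c + 1 = u survives. On one side of it, f*_c clears the entry (r, c),
since the rows below r contribute nothing that could absorb it. On the other side, e_i with i = r +
1 clears row r + 1 at c, since row r has no letters to the right of c. -/
theorem ent_eq_zero_of_killed (hp : Within u p B.ent)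
    (h0 : ∀ b, -(p.1 : ℤ) ≤ b → b < 0 → ∀ c, B.ent b c = 0)
    (hf : ∀ j, (crystalStar u).op false j B = none)
    (he : ∀ i : ℤ, 0 < i → i < p.2 → (crystal u).op true i B = none) (r : ℕ) :
    ∀ c : ℕ, r + c + 1 ≠ u → B.ent r c = 0 := by
  have lower : ∀ r c : ℕ, r + c + 1 < u → B.ent r c = 0 := by
    intro r
    induction r using Nat.strong_induction_on with
    | _ r ih =>
      intro c hc
      rcases lt_or_ge (r : ℤ) (p.2 : ℤ) with hr | hr
      · have h1 := (opStar_eq_none hp).1 (hf ⟨c, by omega⟩)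
        have h2 := tot_rows_snd_eq_zero.1 h1 r (Finset.mem_Ico.2 ⟨by omega, hr⟩)
        rw [rowSig_snd, if_neg (by omega)] at h2
        simp only [rowSig_diff] at h2
        have h3 : ∑ b' ∈ Finset.Ico (-(p.1 : ℤ)) r, ((B.ent b' c : ℤ) - B.ent b' (c + 1)) = 0 := by
          refine Finset.sum_eq_zero fun b' hb' => ?_
          rw [Finset.mem_Ico] at hb'
          rcases lt_or_ge b' 0 with hb0 | hb0
          · rw [h0 b' hb'.1 hb0, h0 b' hb'.1 hb0, sub_self]
          · lift b' to ℕ using hb0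
            rw [ih b' (by omega) c (by omega), ih b' (by omega) (c + 1) (by omega), sub_self]
        omega
      · exact hp.2.1 _ hr c
  have upper : ∀ r c : ℕ, u < r + c + 1 → B.ent r c = 0 := by
    intro r
    induction r with
    | zero => intro c hc; exact B.ent_of_le _ (by omega)
    | succ r ih =>
      intro c hc
      rcases lt_or_ge ((r + 1 : ℕ) : ℤ) (p.2 : ℤ) with hr | hr
      · rcases lt_or_ge c u with hcu | hcu
        · refine ent_le_of_e_killed (by omega) (he _ (by omega) hr) hcu fun c' hc' => ?_
          rw [Nat.cast_add, Nat.cast_one, add_sub_cancel_right]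
          exact ih c' (by omega)
        · exact B.ent_of_le _ hcu
      · exact hp.2.1 _ hr c
  intro c hc
  rcases lt_or_gt_of_ne hc with h | h
  · exact lower r c h
  · exact upper r c h

/-- In every row of degree 1 just one entry may be nonzero, so it equals the coefficient of the
weight at that row. -/
theorem eq_of_killed (hA : Within u p A.ent) (hA' : Within u p A'.ent)
    (h0 : ∀ b, -(p.1 : ℤ) ≤ b → b < 0 → ∀ c, A.ent b c = 0)
    (h0' : ∀ b, -(p.1 : ℤ) ≤ b → b < 0 → ∀ c, A'.ent b c = 0)
    (hr : ∀ r c : ℕ, r + c + 1 ≠ u → A.ent r c = 0)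
    (hr' : ∀ r c : ℕ, r + c + 1 ≠ u → A'.ent r c = 0)
    (hwt : (crystal u).wt A = (crystal u).wt A') : A = A' := by
  have hsum : ∀ A : FockMatrix u, (∀ r c : ℕ, r + c + 1 ≠ u → A.ent r c = 0) →
      ∀ r c : ℕ, r + c + 1 = u → (A.ent r c : ℤ) = ((crystal u).wt A).2 r := by
    intro A hr r c hrc
    rw [wt_snd, Finset.sum_eq_single_of_mem c (Finset.mem_range.2 (by omega))]
    · rw [vac, if_neg (by omega), sub_zero]
    · intro c' _ hc'
      rw [hr r c' (by omega), vac, if_neg (by omega)]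
      rfl
  refine ent_injective (funext fun b => funext fun c => ?_)
  rcases lt_or_ge c u with hc | hc
  · rcases lt_or_ge b 0 with hb | hb
    · rcases lt_or_ge b (-(p.1 : ℤ)) with hb1 | hb1
      · rw [hA.1 b hb1 c hc, hA'.1 b hb1 c hc]
      · rw [h0 b hb1 hb, h0' b hb1 hb]
    · lift b to ℕ using hb
      by_cases hbc : b + c + 1 = u
      · have h1 := hsum A hr b c hbc
        have h2 := hsum A' hr' b c hbc
        rw [hwt, ← h2] at h1
        exact_mod_cast h1
      · rw [hr b c hbc, hr' b c hbc]
  · rw [A.ent_of_le _ hc, A'.ent_of_le _ hc]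

/-- Lowest weight elements for `𝔤𝔩_u` are determined by their class for `𝔤`. -/
theorem eq_of_linked (hA : ∀ j, (crystalStar u).op false j A = none)
    (hA' : ∀ j, (crystalStar u).op false j A' = none)
    (h : Linked (crystal u) (crystal u) 0 A A') : A' = A := by
  have hrev := (isCrystal u).reversible
  -- Both matrices are handled in a common window, with enough rows of degree 1 to receive all
  -- letters.
  obtain ⟨p, hp, hp', hn⟩ : ∃ p, Within u p A.ent ∧ Within u p A'.ent ∧ u + 1 ≤ p.2 := by
    obtain ⟨q, hq⟩ := A.exists_within
    obtain ⟨q', hq'⟩ := A'.exists_within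
    refine ⟨(q.1 + q'.1, q.2 + q'.2 + (u + 1)), hq.mono ⟨?_, ?_⟩, hq'.mono ⟨?_, ?_⟩, ?_⟩ <;>
      simp only <;> omega
  have inv : ∀ {d : Bool} {S : Set ℤ} {A B : FockMatrix u}, (crystal u).Reach d S A B →
      (∀ j, (crystalStar u).op false j A = none) → ∀ j, (crystalStar u).op false j B = none :=
    fun hAB h0 => hAB.invariant (Q := fun A => ∀ j, (crystalStar u).op false j A = none)
      (fun i _ X Y hX hXY j => (opStar_none_of_op hXY).2 (hX j)) h0
  have invW : ∀ {d : Bool} {S : Set ℤ} {A B : FockMatrix u},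
      (∀ i ∈ S, -(p.1 : ℤ) ≤ i - 1 ∧ i < p.2) → (crystal u).Reach d S A B →
      Within u p A.ent → Within u p B.ent :=
    fun hS hAB h0 => hAB.invariant (Q := fun A => Within u p A.ent)
      (fun i hi X Y hX hXY => within_op hX (hS i hi).1 (hS i hi).2 hXY) h0
  have hS1 : ∀ i ∈ {i : ℤ | -(p.1 : ℤ) < i ∧ i < p.2}, -(p.1 : ℤ) ≤ i - 1 ∧ i < p.2 :=
    fun i hi => ⟨by have := hi.1; omega, hi.2⟩
  have hS2 : ∀ i ∈ {i : ℤ | 0 < i ∧ i < p.2}, -(p.1 : ℤ) ≤ i - 1 ∧ i < p.2 :=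
    fun i hi => ⟨by have := hi.1; omega, hi.2⟩
  -- The two matrices are lowered along one and the same path, and later raised along another one.
  -- By injectivity of the operators it suffices that the ends coincide.
  obtain ⟨B, hAB, hpB, hB⟩ := exists_reach_op false hS1 hp
  refine h.eq_of_reach hrev hAB fun B' hAB' hBB' => ?_
  have hpB' := invW hS1 hAB' hp'
  have hB' : ∀ i ∈ {i : ℤ | -(p.1 : ℤ) < i ∧ i < p.2}, (crystal u).op false i B' = none :=
    fun i hi => hBB'.op_none.1 (hB i hi)
  have zero : ∀ E : FockMatrix u, (∀ i ∈ {i : ℤ | -(p.1 : ℤ) < i ∧ i < p.2},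
      (crystal u).op false i E = none) → ∀ b, -(p.1 : ℤ) ≤ b → b < 0 → ∀ c, E.ent b c = 0 :=
    fun E hE b hb hb0 => rows_zero_of_f_killed hn (fun i h1 h2 => hE i ⟨h1, h2⟩) hb hb0.le
  obtain ⟨E, hBE, hpE, hE⟩ := exists_reach_op true hS2 hpB
  refine hBB'.eq_of_reach hrev hBE fun E' hBE' hEE' => ?_
  have hpE' := invW hS2 hBE' hpB'
  -- For i > 0 the moves touch only rows of degree 1, so the rows that have been emptied stay empty.
  have invZ : ∀ {A B : FockMatrix u}, (crystal u).Reach true {i : ℤ | 0 < i ∧ i < p.2} A B →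
      (∀ b, -(p.1 : ℤ) ≤ b → b < 0 → ∀ c, A.ent b c = 0) →
      ∀ b, -(p.1 : ℤ) ≤ b → b < 0 → ∀ c, B.ent b c = 0 := by
    refine fun hAB h0 => hAB.invariant
      (Q := fun A => ∀ b, -(p.1 : ℤ) ≤ b → b < 0 → ∀ c, A.ent b c = 0) ?_ h0
    intro i hi X Y hX hXY b hb hb0 c
    obtain ⟨c', _, hY⟩ := op_eq_some.1 hXY
    have hi0 : 0 < i := hi.1
    rw [hY, vMove, if_neg (show b ≠ i - 1 by omega), if_neg (show b ≠ i by omega), ite_self]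
    exact hX b hb hb0 c
  have z1 := invZ hBE (zero B hB)
  have z2 := invZ hBE' (zero B' hB')
  refine (eq_of_killed hpE hpE' z1 z2 ?_ ?_ ?_).symm
  · exact ent_eq_zero_of_killed hpE z1 (inv hBE (inv hAB hA)) fun i h1 h2 => hE i ⟨h1, h2⟩
  · exact ent_eq_zero_of_killed hpE' z2 (inv hBE' (inv hAB' hA')) fun i h1 h2 =>
      hEE'.op_none.1 (hE i ⟨h1, h2⟩)
  · have := hEE'.wt_eq
    rwa [add_zero] at this

/-! Even matrices that are highest weight vectors for the even part of `𝔤`. -/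

/-- The rows with nonnegative index vanish and `e_i`, `i < 0`, kills the matrix. -/
structure IsEvenTop (A : FockMatrix u) : Prop where
  even : ∀ b ≥ 0, ∀ c, A.ent b c = 0
  top : ∀ i < 0, (crystal u).op true i A = none

theorem IsEvenTop.pre_le (h : IsEvenTop A) (hi : i < 0) {c : ℕ} (hc : c ≤ u) :
    pre A.ent i c ≤ pre A.ent (i - 1) c := (e_eq_none_iff hi).1 (h.top i hi) c hc

theorem IsEvenTop.within (h : IsEvenTop A) (hp : Within u p A.ent) : Within u (p.1, 0) A.ent :=
  ⟨hp.1, fun b hb c => h.even b hb c, hp.2.2⟩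

theorem IsEvenTop.opStar (h : IsEvenTop A) {d : Bool} {j : Fin (u - 1)}
    (hA : (crystalStar u).op d j A = some A') : IsEvenTop A' := by
  refine ⟨?_, fun i hi => (op_none_of_opStar hA).2 (h.top i hi)⟩
  obtain ⟨p, hp⟩ := A.exists_within
  have := within_opStar (h.within hp) hA
  exact fun b hb c => this.2.1 b hb c

theorem IsEvenTop.rows_le (h : IsEvenTop A) {b b' : ℤ} (hb : b < 0) (hbb : b' ≤ b) {c : ℕ}
    (hc : c ≤ u) : pre A.ent b c ≤ pre A.ent b' c := by
  induction b', hbb using Int.leInductionDown with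
  | base => exact le_rfl
  | pred b' h1 ih => exact ih.trans (h.pre_le (by omega) hc)

theorem ent_le_one_of_neg (A : FockMatrix u) {b : ℤ} (hb : b < 0) (c : ℕ) : A.ent b c ≤ 1 :=
  A.valid_ent b hb c

theorem pre_le_self (A : FockMatrix u) {b : ℤ} (hb : b < 0) (c : ℕ) : pre A.ent b c ≤ c := by
  have := Finset.sum_le_card_nsmul (Finset.range c) (fun c => A.ent b c) 1
    fun c _ => A.ent_le_one_of_neg hb c
  simpa [pre] using this

/-- If `c` is in a down-closed row, the rows below it contain `c`. -/
theorem IsEvenTop.ent_of_down (h : IsEvenTop A) {b b' : ℤ} (hb : b < 0) (hbb : b' ≤ b) {c : ℕ}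
    (hc : c < u) (hdown : ∀ c' ≤ c, A.ent b c' = 1) : A.ent b' c = 1 := by
  have h1 : pre A.ent b (c + 1) = c + 1 := by
    rw [pre, Finset.sum_congr rfl fun c' hc' => hdown c' (by
      rw [Finset.mem_range] at hc'; omega)]
    simp
  have h2 := h.rows_le hb hbb (c := c + 1) hc
  rw [h1, pre_succ] at h2
  have h3 := A.pre_le_self (b := b') (by omega) c
  have h4 := A.ent_le_one_of_neg (b := b') (by omega) c
  omega

/-- The rows of a highest weight element are down-closed. -/
theorem IsEvenTop.down_closed (h : IsEvenTop A) (he : ∀ j, (crystalStar u).op true j A = none)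
    {b : ℤ} (hb : b < 0) {c c' : ℕ} (hcc : c' ≤ c) (hc : A.ent b c = 1) : A.ent b c' = 1 := by
  obtain ⟨p, hp⟩ := A.exists_within
  have hp := h.within hp
  have hcu : ∀ {b c}, A.ent b c = 1 → c < u := fun {b c} h1 => by
    by_contra hge
    rw [A.ent_of_le b (by omega)] at h1
    omega
  -- Induction from the row −1 downwards: the rows above b are already known to be initial segments.
  suffices key : ∀ n : ℕ, ∀ b : ℤ, b < 0 → -(n : ℤ) ≤ b → ∀ c, A.ent b (c + 1) = 1 →
      A.ent b c = 1 by
    have step := key b.natAbs b hb (by omega)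
    induction hcc using Nat.decreasingInduction with
    | self => exact hc
    | of_succ k _ ih => exact step k ih
  intro n
  induction n with
  | zero => intro b hb hb'; omega
  | succ n ih =>
    intro b hb hbn c hc
    have hc1 := hcu hc
    rcases lt_or_ge b (-(p.1 : ℤ)) with hbp | hbp
    · exact hp.1 b hbp c (by omega)
    have h1 := (opStar_eq_none hp).1 (he ⟨c, by omega⟩)
    have h2 := tot_rows_fst_eq_zero.1 h1 b (Finset.mem_Ico.2 ⟨hbp, hb⟩)
    rw [rowSig_fst, if_pos hb] at h2
    simp only [rowSig_diff, hc] at h2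
    by_contra hne
    have h0 : A.ent b c = 0 := by
      have := A.ent_le_one_of_neg hb c
      omega
    -- If a row above b contained c, it would contain all of 0, …, c; then row b, whose prefix sums
    -- are at least as large, would contain c as well. So no row above b can absorb the letter c + 1
    -- of row b.
    have h3 : ∑ b' ∈ Finset.Ico (b + 1) ((0 : ℕ) : ℤ),
        ((A.ent b' c : ℤ) - A.ent b' (c + 1)) ≤ 0 := by
      refine Finset.sum_nonpos fun b' hb' => ?_
      rw [Finset.mem_Ico] at hb'
      have hb0 : b' < 0 := hb'.2
      have : A.ent b' c = 0 := by
        by_contra hne'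
        have h4 : A.ent b' c = 1 := by
          have := A.ent_le_one_of_neg hb0 c
          omega
        have hdown : ∀ c' ≤ c, A.ent b' c' = 1 := by
          intro c' hcc'
          induction hcc' using Nat.decreasingInduction with
          | self => exact h4
          | of_succ k _ ih' => exact ih b' hb0 (by omega) k ih'
        have := h.ent_of_down hb0 (b' := b) (by omega) (by omega) hdown
        omega
      omega
    omega

theorem propagate {f : ℕ → ℕ} (h : ∀ c, c + 1 < u → f c = 1 → f (c + 1) = 1) {c c' : ℕ}
    (hcc : c ≤ c') (hc' : c' < u) (hc : f c = 1) : f c' = 1 := by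
  induction hcc with
  | refl => exact hc
  | step _ ih => exact h _ hc' (ih (by omega))

/-- The rows of a lowest weight element are up-closed. -/
theorem IsEvenTop.up_closed (h : IsEvenTop A) (hf : ∀ j, (crystalStar u).op false j A = none)
    {b : ℤ} (hb : b < 0) {c c' : ℕ} (hcc : c ≤ c') (hc' : c' < u) (hc : A.ent b c = 1) :
    A.ent b c' = 1 := by
  obtain ⟨p, hp⟩ := A.exists_within
  have hp := h.within hp
  -- Induction upwards, starting from the full rows below the window.
  suffices key : ∀ n : ℕ, ∀ b : ℤ, b < 0 → b < -(p.1 : ℤ) + n → ∀ c, c + 1 < u → A.ent b c = 1 →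
      A.ent b (c + 1) = 1 by
    have step := key (b + p.1 + 1).toNat b hb (by omega)
    exact propagate step hcc hc' hc
  intro n
  induction n with
  | zero =>
    intro b hb hb' c hc _
    exact hp.1 b (by simpa using hb') _ hc
  | succ n ih =>
    intro b hb hbn c hc1 hc
    rcases lt_or_ge b (-(p.1 : ℤ)) with hbp | hbp
    · exact hp.1 b hbp _ hc1
    have h1 := (opStar_eq_none hp).1 (hf ⟨c, by omega⟩)
    have h2 := tot_rows_snd_eq_zero.1 h1 b (Finset.mem_Ico.2 ⟨hbp, hb⟩)
    rw [rowSig_snd, if_pos hb] at h2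
    simp only [rowSig_diff, hc] at h2
    by_contra hne
    have h0 : A.ent b (c + 1) = 0 := by
      have := A.ent_le_one_of_neg hb (c + 1)
      omega
    -- If a row below b missed c, then, being a final segment, it would contain none of 0, …, c. But
    -- its prefix sums are at least those of row b, which contains c.
    have h3 : 0 ≤ ∑ b' ∈ Finset.Ico (-(p.1 : ℤ)) b, ((A.ent b' c : ℤ) - A.ent b' (c + 1)) := by
      refine Finset.sum_nonneg fun b' hb' => ?_
      rw [Finset.mem_Ico] at hb'
      have hb0 : b' < 0 := by omega
      have hlow : A.ent b' c = 1 := by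
        by_contra hne'
        have h4 : pre A.ent b' (c + 1) = 0 := by
          refine Finset.sum_eq_zero fun k hk => ?_
          rw [Finset.mem_range] at hk
          by_contra hk0
          have h5 : A.ent b' k = 1 := by
            have := A.ent_le_one_of_neg hb0 k
            omega
          exact hne' (propagate (ih b' hb0 (by push_cast at hbn; omega)) (by omega) (by omega) h5)
        have h6 := h.rows_le hb (b' := b') (by omega) (c := c + 1) (by omega)
        rw [h4, pre_succ, hc] at h6
        omega
      have := A.ent_le_one_of_neg hb0 (c + 1)
      omega
    omega

end FockMatrix

/-! ### Half lines, and the shape of an even matrix -/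

namespace Grid

open FockMatrix

variable {m : ℕ} {x : ℤ → ℕ}

theorem colTail_add_le (hx : IsColumn (m, 0) x) {b b' : ℤ} (hb : b ≤ 0) (hbb : b' ≤ b) :
    (colTail 0 x b' : ℤ) + b' ≤ colTail 0 x b + b := by
  induction b', hbb using Int.leInductionDown with
  | base => exact le_rfl
  | pred b' h1 ih =>
    have h2 := colTail_eq hx (b' - 1)
    have h3 := hx.le_one (b' - 1) (by omega)
    rw [sub_add_cancel] at h2
    simp only at h2
    omega

theorem colTail_add_eq (hx : IsColumn (m, 0) x) {b b' : ℤ} (hbb : b' ≤ b)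
    (h1 : ∀ c < b, x c = 1) : (colTail 0 x b' : ℤ) + b' = colTail 0 x b + b := by
  induction b', hbb using Int.leInductionDown with
  | base => rfl
  | pred b' h2 ih =>
    have h3 := colTail_eq hx (b' - 1)
    rw [sub_add_cancel, h1 (b' - 1) (by omega)] at h3
    simp only at h3
    omega

theorem colSum_nonpos (hx : IsColumn (m, 0) x) : colSum (m, 0) x ≤ 0 := by
  have h1 := colTail_of_le_neg hx (b := -(m : ℤ)) le_rfl
  have h2 := colTail_add_le hx (b := 0) le_rfl (b' := -(m : ℤ)) (by omega)
  rw [colTail_of_le (b := 0) (by simp)] at h2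
  simp only at h1
  omega

/-- A column that is a half line. -/
theorem eq_one_iff_lt_colSum (hx : IsColumn (m, 0) x)
    (hn : ∀ b < 0, x b = 1 → ∀ b' ≤ b, x b' = 1) {b : ℤ} (hb : b < 0) :
    x b = 1 ↔ b < colSum (m, 0) x := by
  have h1 := colTail_of_le_neg hx (b := min (-(m : ℤ)) b) (min_le_left _ _)
  simp only at h1
  constructor
  · intro h
    have h2 := colTail_add_eq hx (b := b + 1) (b' := min (-(m : ℤ)) b) (by omega)
      fun c hc => hn b hb h c (by omega)
    omega
  · intro h
    by_contra hne
    have h0 : ∀ b' ≥ b, x b' = 0 := by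
      intro b' hb'
      rcases lt_or_ge b' 0 with hb0 | hb0
      · by_contra h0
        have := hx.le_one b' hb0
        exact hne (hn b' hb0 (by omega) b hb')
      · exact hx.eq_zero b' hb0
    have h2 : colTail 0 x b = 0 := Finset.sum_eq_zero fun b' hb' =>
      h0 b' (Finset.mem_Ico.1 hb').1
    have h3 := colTail_add_le hx hb.le (b' := min (-(m : ℤ)) b) (min_le_right _ _)
    omega

end Grid

namespace FockMatrix

open Grid Signature CrystalData

variable {u : ℕ} {p : ℕ × ℕ} {A A' B : FockMatrix u} {N : ℕ} {mu : GenPartition u}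

/-- The lengths of the rows of `A` are the lengths of the columns of the diagram of `μ`, where the
first row belongs to the column with number `N`. -/
structure HasShape (A : FockMatrix u) (N : ℕ) (mu : GenPartition u) : Prop where
  le : ∀ k, mu.1 k ≤ N
  lt_iff : ∀ b < 0, ∀ k : Fin u, (k : ℕ) < pre A.ent b u ↔ b < mu.1 k - N

theorem pre_mono (a : ℤ → ℕ → ℕ) (b : ℤ) {c c' : ℕ} (h : c ≤ c') : pre a b c ≤ pre a b c' :=
  Finset.sum_le_sum_of_subset (Finset.range_mono h)

/-- The rows get longer downwards, so for each k the rows with more than k letters form a half line.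
Its end point is the part of μ with index k, up to the shift by N. -/
theorem exists_shape (h : IsEvenTop A) (N : ℕ) : ∃ mu, HasShape A N mu := by
  obtain ⟨p, hp⟩ := A.exists_within
  have hcol : ∀ k : Fin u, IsColumn (p.1, 0)
      fun b => if b < 0 ∧ (k : ℕ) < pre A.ent b u then 1 else 0 := by
    intro k
    refine ⟨fun b _ => by split_ifs <;> omega, fun b hb => ?_, fun b hb => ?_⟩
    · simp only at hb
      refine if_pos ⟨by omega, ?_⟩
      rw [pre, Finset.sum_congr rfl fun c hc => hp.1 b hb c (Finset.mem_range.1 hc)]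
      simp
    · simp only [CharP.cast_eq_zero, ge_iff_le] at hb
      exact if_neg (by omega)
  have hiff : ∀ (k : Fin u) (b : ℤ), b < 0 → ((k : ℕ) < pre A.ent b u ↔
      b < colSum (p.1, 0) fun b => if b < 0 ∧ (k : ℕ) < pre A.ent b u then 1 else 0) := by
    intro k b hb
    rw [← eq_one_iff_lt_colSum (hcol k) _ hb]
    · simp only [hb, true_and]
      split_ifs <;> simp_all
    · intro b hb hk b' hb'
      simp only [ite_eq_left_iff, not_and, not_lt, zero_ne_one, imp_false, not_forall,
        not_le] at hk ⊢
      exact ⟨by omega, lt_of_lt_of_le hk.2 (h.rows_le hb hb' le_rfl)⟩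
  have hneg := fun k => colSum_nonpos (hcol k)
  refine ⟨⟨fun k => (colSum (p.1, 0) fun b => if b < 0 ∧ (k : ℕ) < pre A.ent b u then 1 else 0) + N,
    fun k k' hk => ?_⟩, fun k => ?_, fun b hb k => ?_⟩
  · by_contra hlt
    have h1 := hneg k'
    simp only [add_le_add_iff_right, not_le] at hlt
    have h2 := (hiff k' _ (lt_of_lt_of_le hlt h1)).2 hlt
    have h3 := (hiff k _ (lt_of_lt_of_le hlt h1)).1 (lt_of_le_of_lt hk h2)
    omega
  · have := hneg k
    simp only
    omega
  · rw [hiff k b hb]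
    simp

theorem pre_opStar {d : Bool} {j : Fin (u - 1)} (h : (crystalStar u).op d j A = some A') (b : ℤ) :
    pre A'.ent b u = pre A.ent b u := by
  have hw := congrArg (fun t : GWeight => t.2 b) (wt_opStar h)
  simp only [wt_snd, Finset.sum_sub_distrib] at hw
  unfold pre
  zify
  omega

theorem HasShape.opStar (hs : HasShape A N mu) {d : Bool} {j : Fin (u - 1)}
    (h : (crystalStar u).op d j A = some A') : HasShape A' N mu :=
  ⟨hs.le, fun b hb k => by rw [pre_opStar h, hs.lt_iff b hb]⟩

theorem isColumn_of_evenTop (h : IsEvenTop A) (hp : Within u p A.ent) (c : Fin u) :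
    IsColumn (p.1, 0) fun b => A.ent b c := isColumn_ent (h.within hp) c

/-- If the column c consists of the rows with more than k letters, it is a half line, and its weight
is the end point of that half line. -/
theorem lt_wtStar_iff (h : IsEvenTop A) (hs : HasShape A N mu) {c k : Fin u}
    (hrow : ∀ b < 0, A.ent b c = 1 ↔ (k : ℕ) < pre A.ent b u) :
    (crystalStar u).wt A c = mu.1 k - N := by
  obtain ⟨p, hp⟩ := A.exists_within
  have hcol := isColumn_of_evenTop h hp c
  have h1 : ∀ b < 0, A.ent b c = 1 ↔ b < colSum (p.1, 0) fun b => A.ent b c := by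
    intro b hb
    refine eq_one_iff_lt_colSum hcol (fun b hb hbc b' hb' => ?_) hb
    rw [hrow b' (by omega)]
    exact lt_of_lt_of_le ((hrow b hb).1 hbc) (h.rows_le hb hb' le_rfl)
  rw [wtStar_eq_colSum (h.within hp)]
  have h2 := colSum_nonpos hcol
  have h3 := hs.le k
  by_contra hne
  rcases lt_or_gt_of_ne hne with hlt | hlt
  · have h4 := h1 _ (lt_of_lt_of_le hlt (by omega))
    rw [hrow _ (by omega), hs.lt_iff _ (by omega)] at h4
    omega
  · have h4 := h1 (mu.1 k - N) (by omega)
    rw [hrow _ (by omega), hs.lt_iff _ (by omega)] at h4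
    omega

theorem IsEvenTop.mem_iff_of_down (h : IsEvenTop A)
    (he : ∀ j, (crystalStar u).op true j A = none) {b : ℤ} (hb : b < 0) {c : ℕ} (hc : c < u) :
    A.ent b c = 1 ↔ c < pre A.ent b u := by
  constructor
  · intro h1
    have h2 : pre A.ent b (c + 1) = c + 1 := by
      rw [pre, Finset.sum_congr rfl fun c' hc' => h.down_closed he hb
        (show c' ≤ c by rw [Finset.mem_range] at hc'; omega) h1]
      simp
    have := pre_mono A.ent b (show c + 1 ≤ u from hc)
    omega
  · intro h1
    by_contra hne
    have h2 : pre A.ent b u = pre A.ent b c := by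
      refine (Finset.sum_subset (Finset.range_mono hc.le) fun c' _ hc' => ?_).symm
      rw [Finset.mem_range, not_lt] at hc'
      by_contra h0
      have := A.ent_le_one_of_neg hb c'
      exact hne (h.down_closed he hb hc' (by omega))
    have := A.pre_le_self hb c
    omega

theorem IsEvenTop.mem_iff_of_up (h : IsEvenTop A)
    (hf : ∀ j, (crystalStar u).op false j A = none) {b : ℤ} (hb : b < 0) {c : ℕ} (hc : c < u) :
    A.ent b c = 1 ↔ u - 1 - c < pre A.ent b u := by
  have hsplit : pre A.ent b u = pre A.ent b c + ∑ c' ∈ Finset.Ico c u, A.ent b c' :=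
    (Finset.sum_range_add_sum_Ico _ hc.le).symm
  constructor
  · intro h1
    have h2 : ∑ c' ∈ Finset.Ico c u, A.ent b c' = u - c := by
      rw [Finset.sum_congr rfl fun c' hc' => h.up_closed hf hb (Finset.mem_Ico.1 hc').1
        (Finset.mem_Ico.1 hc').2 h1]
      simp
    omega
  · intro h1
    by_contra hne
    have h0 : ∀ c' ≤ c, A.ent b c' = 0 := by
      intro c' hc'
      by_contra h0
      have := A.ent_le_one_of_neg hb c'
      exact hne (h.up_closed hf hb hc' hc (by omega))
    have h2 : pre A.ent b c = 0 := Finset.sum_eq_zero fun c' hc' =>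
      h0 c' (by rw [Finset.mem_range] at hc'; omega)
    have h3 := Finset.sum_eq_sum_Ico_succ_bot hc (fun c' => A.ent b c')
    have h4 : ∑ c' ∈ Finset.Ico (c + 1) u, A.ent b c' ≤ u - (c + 1) := by
      have := Finset.sum_le_card_nsmul (Finset.Ico (c + 1) u) (fun c => A.ent b c) 1
        fun c _ => A.ent_le_one_of_neg hb c
      simpa using this
    have := h0 c le_rfl
    omega

theorem wtStar_of_top (h : IsEvenTop A) (hs : HasShape A N mu)
    (he : ∀ j, (crystalStar u).op true j A = none) (c : Fin u) :
    (crystalStar u).wt A c = mu.1 c - N :=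
  lt_wtStar_iff h hs fun _ hb => h.mem_iff_of_down he hb c.2

/-- The rows of a lowest element are final segments, so the column c plays the role that its mirror
image plays for a highest element. -/
theorem wtStar_of_bottom (h : IsEvenTop A) (hs : HasShape A N mu)
    (hf : ∀ j, (crystalStar u).op false j A = none) (c : Fin u) :
    (crystalStar u).wt A c = mu.1 c.rev - N := by
  refine lt_wtStar_iff h hs fun b hb => ?_
  rw [h.mem_iff_of_up hf hb c.2, Fin.val_rev]
  constructor <;> intro h <;> omega

theorem HasShape.pre_eq (hs : HasShape A N mu) (hs' : HasShape A' N mu) {b : ℤ} (hb : b < 0) :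
    pre A.ent b u = pre A'.ent b u := by
  have h1 := A.pre_le_self hb u
  have h2 := A'.pre_le_self hb u
  by_contra hne
  rcases lt_or_gt_of_ne hne with hlt | hlt
  · have h3 := hs.lt_iff b hb ⟨pre A.ent b u, by omega⟩
    have h4 := hs'.lt_iff b hb ⟨pre A.ent b u, by omega⟩
    simp only at h3 h4
    omega
  · have h3 := hs.lt_iff b hb ⟨pre A'.ent b u, by omega⟩
    have h4 := hs'.lt_iff b hb ⟨pre A'.ent b u, by omega⟩
    simp only at h3 h4
    omega

theorem IsEvenTop.eq_of_top (h : IsEvenTop A) (h' : IsEvenTop A')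
    (he : ∀ j, (crystalStar u).op true j A = none) (he' : ∀ j, (crystalStar u).op true j A' = none)
    (hs : HasShape A N mu) (hs' : HasShape A' N mu) : A = A' := by
  refine ent_injective (funext fun b => funext fun c => ?_)
  rcases lt_or_ge b 0 with hb | hb
  · rcases lt_or_ge c u with hc | hc
    · have h1 := h.mem_iff_of_down he hb hc
      have h2 := h'.mem_iff_of_down he' hb hc
      rw [← hs.pre_eq hs' hb] at h2
      have := A.ent_le_one_of_neg hb c
      have := A'.ent_le_one_of_neg hb c
      omega
    · rw [A.ent_of_le _ hc, A'.ent_of_le _ hc]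
  · rw [h.even b hb, h'.even b hb]

/-- Both matrices are raised along the same path to highest elements, where the weight displays the
shape. Operators of 𝔤𝔩_u do not change the lengths of the rows. -/
theorem HasShape.unique {mu' : GenPartition u} (h : IsEvenTop A) (h' : IsEvenTop A')
    (hl : Linked (crystalStar u) (crystalStar u) 0 A A') (hs : HasShape A N mu)
    (hs' : HasShape A' N mu') : mu = mu' := by
  obtain ⟨B, hAB, hB⟩ := exists_reach_opStar true A
  obtain ⟨B', hAB', hBB'⟩ := hl.reach hAB
  have inv : ∀ {A B : FockMatrix u} {mu : GenPartition u},
      (crystalStar u).Reach true Set.univ A B → IsEvenTop A ∧ HasShape A N mu →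
      IsEvenTop B ∧ HasShape B N mu := fun hAB h =>
    hAB.invariant (Q := fun A => IsEvenTop A ∧ HasShape A N _)
      (fun _ _ _ _ hX hXY => ⟨hX.1.opStar hXY, hX.2.opStar hXY⟩) h
  obtain ⟨h1, h2⟩ := inv hAB ⟨h, hs⟩
  obtain ⟨h3, h4⟩ := inv hAB' ⟨h', hs'⟩
  have e1 := wtStar_of_top h1 h2 hB
  have e2 := wtStar_of_top h3 h4 fun j => hBB'.op_none.1 (hB j)
  refine Subtype.ext (funext fun k => ?_)
  have e3 := congrFun hBB'.wt_eq k
  rw [add_zero, e1, e2] at e3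
  omega

/-- The even highest weight elements are determined by their class for `𝔤𝔩_u`. -/
theorem IsEvenTop.eq_of_linked (h : IsEvenTop A) (h' : IsEvenTop A')
    (hl : Linked (crystalStar u) (crystalStar u) 0 A A') : A' = A := by
  obtain ⟨mu, hs⟩ := exists_shape h 0
  obtain ⟨mu', hs'⟩ := exists_shape h' 0
  obtain rfl := hs.unique h h' hl hs'
  have inv : ∀ {A B : FockMatrix u},
      (crystalStar u).Reach true Set.univ A B → IsEvenTop A ∧ HasShape A 0 mu →
      IsEvenTop B ∧ HasShape B 0 mu := fun hAB h =>
    hAB.invariant (Q := fun A => IsEvenTop A ∧ HasShape A 0 mu)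
      (fun _ _ _ _ hX hXY => ⟨hX.1.opStar hXY, hX.2.opStar hXY⟩) h
  obtain ⟨B, hAB, hB⟩ := exists_reach_opStar true A
  refine hl.eq_of_reach (isCrystalStar u).reversible hAB fun B' hAB' hBB' => ?_
  obtain ⟨h1, h2⟩ := inv hAB ⟨h, hs⟩
  obtain ⟨h3, h4⟩ := inv hAB' ⟨h', hs'⟩
  exact h3.eq_of_top h1 (fun j => hBB'.op_none.1 (hB j)) hB h4 h2

end FockMatrix

/-! ### Words of rational columns -/

theorem glRationalLetters_regular {u : ℕ} (j : Fin (u - 1)) : (glRationalLetters u).Regular j where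
  even hk b := by
    rcases b with c | c
    · exact (glLetters_regular j).even hk c
    · have := (glLetters_regular j).even hk (OrderDual.ofDual c)
      simp only [glRationalLetters, map_neg]
      omega
  odd hk := absurd hk (by change ¬ (-1 : SignType) = 0; decide)
  none d b h := by
    rcases b with c | c
    · have := (glLetters_regular j).none d c h
      cases d <;> simp only [CrystalData.op_true, CrystalData.op_false] at this ⊢ <;>
        simp [glRationalLetters, this]
    · have := (glLetters_regular j).none (!d) (OrderDual.ofDual c) (by cases d <;> exact h)
      cases d <;> simp only [Bool.not_true, Bool.not_false, CrystalData.op_true,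
        CrystalData.op_false] at this ⊢ <;> simp [glRationalLetters, this]

theorem glRationalLetters_arrow_inl {u : ℕ} (j : Fin (u - 1)) :
    (glRationalLetters u).Arrow j (Sum.inl (glLo j)) (Sum.inl (glHi j)) where
  sig_lo := (glLetters_arrow j).sig_lo
  sig_hi := (glLetters_arrow j).sig_hi
  e_hi := by simp [glRationalLetters, (glLetters_arrow j).e_hi]
  f_lo := by simp [glRationalLetters, (glLetters_arrow j).f_lo]

theorem glRationalLetters_arrow_inr {u : ℕ} (j : Fin (u - 1)) :
    (glRationalLetters u).Arrow j (Sum.inr (OrderDual.toDual (glHi j)))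
      (Sum.inr (OrderDual.toDual (glLo j))) where
  sig_lo := congrArg Prod.swap (glLetters_arrow j).sig_hi
  sig_hi := congrArg Prod.swap (glLetters_arrow j).sig_lo
  e_hi := by simp [glRationalLetters, (glLetters_arrow j).f_lo]
  f_lo := by simp [glRationalLetters, (glLetters_arrow j).e_hi]

/-- The letter `c` or its dual. -/
def boxOf {u : ℕ} (s : Prop) [Decidable s] (c : Fin u) : Fin u ⊕ (Fin u)ᵒᵈ :=
  if s then Sum.inl c else Sum.inr (OrderDual.toDual c)

theorem boxOf_injective {u : ℕ} (s : Prop) [Decidable s] :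
    Function.Injective (boxOf (u := u) s) := by
  intro c c' h
  unfold boxOf at h
  split_ifs at h
  · exact Sum.inl_injective h
  · exact Sum.inr_injective h

theorem glRationalLetters_inert {u : ℕ} {j : Fin (u - 1)} {s : Prop} [Decidable s] {c : Fin u}
    (h1 : c ≠ glLo j) (h2 : c ≠ glHi j) : (glRationalLetters u).Inert j (boxOf s c) := by
  unfold boxOf
  split_ifs
  · exact glLetters_inert h1 h2
  · exact congrArg Prod.swap (glLetters_inert h1 h2)

namespace Grid

open Signature CrystalData FockMatrix

/-- The word of a column of a rational tableau. If `s` holds, the column has the letters `c` with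
`x c = 1`; otherwise, it has the duals of the letters with `x c = 0`. -/
def boxWord (u : ℕ) (s : Prop) [Decidable s] (x : ℕ → ℕ) : List (Fin u ⊕ (Fin u)ᵒᵈ) :=
  if s then multWord ((List.finRange u).map Sum.inl) (Sum.elim (fun c => x c) 0)
  else multWord ((List.finRange u).reverse.map fun c => Sum.inr (OrderDual.toDual c))
    (Sum.elim 0 fun c => 1 - x (OrderDual.ofDual c : Fin u))

variable {u : ℕ} {j : Fin (u - 1)} {p : ℕ × ℕ} {a : ℤ → ℕ → ℕ} {d : Bool}

/-- Taking complements and then duals exchanges the roles of j and j + 1 twice: the multiplicities x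
j and x (j + 1) are replaced by 1 − x (j + 1) and 1 − x j, which have the same cancelled signature.
So a negative column of a tableau behaves like the complementary row of a matrix. -/
theorem boxWord_spec {s : Prop} [Decidable s] {x : ℕ → ℕ} (hx : ∀ c, x c ≤ 1) :
    (glRationalLetters u).words.sig j (boxWord u s x) = loc .neg (x j) (x (j + 1)) ∧
    ∀ d, (glRationalLetters u).words.op d j (boxWord u s x) =
      if sel d (loc .neg (x j) (x (j + 1))) = 0 then none
      else some (boxWord u s (multMove d (j : ℕ) (j + 1) x)) := by
  obtain ⟨L₁, L₂, hL⟩ := finRange_split j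
  by_cases hs : s
  · have hL' : (List.finRange u).map (Sum.inl : Fin u → Fin u ⊕ (Fin u)ᵒᵈ) = L₁.map Sum.inl ++
        [Sum.inl (glLo j), Sum.inl (glHi j)] ++ L₂.map Sum.inl := by
      simp [hL]
    have hn := (List.nodup_finRange u).map (Sum.inl_injective (α := Fin u) (β := (Fin u)ᵒᵈ))
    rw [hL'] at hn
    have := multWord_asc (glRationalLetters_regular j) (glRationalLetters_arrow_inl j) hn
      (fun b hb h1 h2 => by
        rw [← hL'] at hb
        obtain ⟨c, _, rfl⟩ := List.mem_map.1 hb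
        exact glRationalLetters_inert (s := True) (fun h => h1 (by rw [h]))
          (fun h => h2 (by rw [h]))) (Sum.elim (fun c => x c) 0)
    rw [← hL'] at this
    simp only [boxWord, hs, if_true]
    refine ⟨this.1, fun d => (this.2 d (fun _ => ⟨hx _, hx _⟩)
      fun hk => absurd hk (by change ¬ (-1 : SignType) = 0; decide)).trans ?_⟩
    change (if sel d (loc .neg (x j) (x (j + 1))) = 0 then none else _) = _
    split_ifs
    · rfl
    · rw [Option.some.injEq]
      refine multWord_congr fun b hb => ?_
      obtain ⟨c, _, rfl⟩ := List.mem_map.1 hb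
      simp only [multMove, Sum.inl.injEq, Sum.elim_inl, glLo, glHi, Fin.ext_iff]
  · have hL' : (List.finRange u).reverse.map
        (fun c => (Sum.inr (OrderDual.toDual c) : Fin u ⊕ (Fin u)ᵒᵈ)) =
        L₂.reverse.map (fun c => Sum.inr (OrderDual.toDual c)) ++
        [Sum.inr (OrderDual.toDual (glHi j)), Sum.inr (OrderDual.toDual (glLo j))] ++
        L₁.reverse.map fun c => Sum.inr (OrderDual.toDual c) := by
      simp [hL]
    have hn := (List.nodup_reverse.2 (List.nodup_finRange u)).map
      (f := fun c => (Sum.inr (OrderDual.toDual c) : Fin u ⊕ (Fin u)ᵒᵈ))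
      fun c c' h => by simpa using h
    rw [hL'] at hn
    have := multWord_asc (glRationalLetters_regular j) (glRationalLetters_arrow_inr j) hn
      (fun b hb h1 h2 => by
        rw [← hL'] at hb
        obtain ⟨c, _, rfl⟩ := List.mem_map.1 hb
        exact glRationalLetters_inert (s := False) (fun h => h2 (by rw [h]))
          (fun h => h1 (by rw [h]))) (Sum.elim 0 fun c => 1 - x (OrderDual.ofDual c : Fin u))
    rw [← hL'] at this
    have hloc : loc .neg (1 - x (j + 1)) (1 - x j) = loc .neg (x j) (x (j + 1)) := by
      have := hx j
      have := hx (j + 1)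
      simp only [loc, Prod.mk.injEq]
      omega
    simp only [boxWord, hs, if_false]
    refine ⟨this.1.trans hloc, fun d => (this.2 d (fun _ => ⟨by simp, by simp⟩)
      fun hk => absurd hk (by change ¬ (-1 : SignType) = 0; decide)).trans ?_⟩
    change (if sel d (loc .neg (1 - x (j + 1)) (1 - x j)) = 0 then none else _) = _
    rw [hloc]
    split_ifs with h0
    · rfl
    · rw [Option.some.injEq]
      refine multWord_congr fun b hb => ?_
      obtain ⟨c, _, rfl⟩ := List.mem_map.1 hb
      have := hx j
      have := hx (j + 1)
      simp only [multMove, Sum.inr.injEq, Sum.elim_inr, glLo, glHi, Fin.ext_iff,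
        EmbeddingLike.apply_eq_iff_eq, OrderDual.ofDual_toDual]
      cases d <;> simp only [loc, sel_true, sel_false] at h0 <;> simp only [shift] <;>
        split_ifs <;> simp_all <;> omega

/-- The word of a rational tableau that is given by the columns of a matrix. The row with index
`b < 0` becomes a column with a positive number if and only if `0 ≤ b + N`. -/
def boxesWord (u N : ℕ) (p : ℕ × ℕ) (a : ℤ → ℕ → ℕ) : List (Fin u ⊕ (Fin u)ᵒᵈ) :=
  (rows p).flatMap fun b : ℤ => boxWord u (0 ≤ b + N) (a b)

variable {N m : ℕ}

theorem boxWord_sig (ha : Valid a) {b : ℤ} (hb : b ∈ rows (m, 0)) :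
    (glRationalLetters u).words.sig j (boxWord u (0 ≤ b + N) (a b)) = rowSig j a b := by
  have hb := (mem_rows.1 hb).2
  simp only [Nat.cast_zero] at hb
  rw [(boxWord_spec (ha b hb)).1, rowSig, kindRow, if_pos hb]

theorem boxesWord_sig (ha : Valid a) : (glRationalLetters u).words.sig j (boxesWord u N (m, 0) a) =
    tot .neg (rowSig j a) (rows (m, 0)) := by
  rw [boxesWord, words_sig_flatMap (glRationalLetters_regular j)]
  exact tot_congr fun b hb => boxWord_sig ha hb

theorem boxesWord_op (ha : Valid a) :
    (glRationalLetters u).words.op d j (boxesWord u N (m, 0) a) =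
      (pos .neg d (rowSig j a) (rows (m, 0))).map fun b =>
        boxesWord u N (m, 0) (hMove d j b a) := by
  rw [boxesWord, words_op_flatMap (glRationalLetters_regular j) d (nodup_rows _)]
  have hp : pos ((glDatum u).kind j) d
      (fun b : ℤ => (glRationalLetters u).words.sig j (boxWord u (0 ≤ b + N) (a b))) (rows (m, 0)) =
      pos .neg d (rowSig j a) (rows (m, 0)) := pos_congr fun b hb => boxWord_sig ha hb
  rw [hp]
  cases h : pos .neg d (rowSig j a) (rows (m, 0)) with
  | none => rfl
  | some b =>
    have hb := (mem_rows.1 (mem_of_pos h)).2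
    simp only [Nat.cast_zero] at hb
    have h0 : sel d (loc .neg (a b j) (a b (j + 1))) ≠ 0 := by
      have h0 := sel_ne_zero_of_pos h
      rwa [rowSig, kindRow, if_pos hb] at h0
    rw [Option.bind_some, (boxWord_spec (ha b hb)).2 d, if_neg h0]
    simp only [Option.map_some, boxesWord, Option.some.injEq]
    refine flatMap_congr' fun x _ => ?_
    by_cases hx : x = b
    · subst hx
      rw [Function.update_self]
      congr 1
      funext c
      simp only [multMove, hMove, if_true]
    · rw [Function.update_of_ne hx]
      congr 1
      funext c
      simp [hMove, hx]

end Grid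

namespace CrystalData

variable {I P : Type} [AddCommGroup P] {D : CartanDatum I P} {X K : Type} {C : CrystalData D X}

theorem wordWt_flatMap (L : List K) (r : K → List X) :
    C.wordWt (L.flatMap r) = (L.map fun k => C.wordWt (r k)).sum := by
  induction L with
  | nil => rfl
  | cons a L ih =>
    rw [List.flatMap_cons, List.map_cons, List.sum_cons, ← ih]
    simp [wordWt]

theorem wordWt_multWord (L : List X) (x : X → ℕ) :
    C.wordWt (multWord L x) = (L.map fun b => x b • C.wt b).sum := by
  rw [multWord, wordWt_flatMap]
  congr 1
  refine List.map_congr_left fun b _ => ?_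
  simp [wordWt]

end CrystalData

namespace Grid

open CrystalData FockMatrix

variable {u N m : ℕ} {a : ℤ → ℕ → ℕ}

theorem sum_finRange (f : Fin u → ℤ) : ((List.finRange u).map f).sum = ∑ c, f c := by
  rw [← List.sum_toFinset f (List.nodup_finRange u), List.toFinset_finRange]

theorem list_sum_apply {α : Type} (L : List (α → ℤ)) (c : α) :
    L.sum c = (L.map fun f => f c).sum := by
  induction L with
  | nil => rfl
  | cons a L ih => simp [ih]

theorem wordWt_boxWord (s : Prop) [Decidable s] {x : ℕ → ℕ} (hx : ∀ c, x c ≤ 1) (c : Fin u) :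
    (glRationalLetters u).wordWt (boxWord u s x) c = x c - if s then 0 else 1 := by
  unfold boxWord
  split_ifs
  · rw [wordWt_multWord, List.map_map, list_sum_apply, List.map_map]
    simp only [Function.comp_def]
    rw [sum_finRange]
    simp [glRationalLetters, glLetters, Pi.single_apply]
  · rw [wordWt_multWord, List.map_map, List.map_reverse, List.sum_reverse, list_sum_apply,
      List.map_map]
    simp only [Function.comp_def]
    rw [sum_finRange]
    have := hx c
    simp [glRationalLetters, glLetters, Pi.single_apply]
    omega

/-- A negative column contributes the entry minus 1, just as the matrix does after subtraction of
the vacuum. The N rows that become positive columns contribute the bare entry, which accounts for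
the shift by N. -/
theorem wordWt_boxesWord {A : FockMatrix u} (hA : Within u (m, 0) A.ent) (hm : N ≤ m) (c : Fin u) :
    (glRationalLetters u).wordWt (boxesWord u N (m, 0) A.ent) c = (crystalStar u).wt A c + N := by
  have hN : (N : ℤ) = ∑ b ∈ Finset.Ico (-(m : ℤ)) 0, if 0 ≤ b + (N : ℤ) then 1 else 0 := by
    rw [Finset.sum_boole]
    have : (Finset.Ico (-(m : ℤ)) 0).filter (fun b => 0 ≤ b + (N : ℤ)) =
        Finset.Ico (-(N : ℤ)) 0 := by
      ext b
      simp only [Finset.mem_filter, Finset.mem_Ico]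
      omega
    simp [this]
  rw [wtStar_eq hA, boxesWord, wordWt_flatMap, list_sum_apply, List.map_map, sum_map_rows]
  simp only [Nat.cast_zero]
  conv_rhs => rw [hN]
  rw [← Finset.sum_add_distrib]
  refine Finset.sum_congr rfl fun b hb => ?_
  have hb := (Finset.mem_Ico.1 hb).2
  rw [Function.comp_apply, wordWt_boxWord _ (A.valid_ent b hb), vac, if_pos hb]
  split_ifs <;> ring

end Grid

/-! ### Rational tableaux as matrices -/

namespace Grid

variable {x : ℕ → ℕ}

theorem exists_sum_range_eq (hx : ∀ c, x c ≤ 1) {k n : ℕ} (h : k < ∑ c ∈ Finset.range n, x c) :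
    ∃ a < n, x a = 1 ∧ ∑ c ∈ Finset.range a, x c = k := by
  induction n with
  | zero => simp at h
  | succ n ih =>
    rw [Finset.sum_range_succ] at h
    by_cases hk : k < ∑ c ∈ Finset.range n, x c
    · obtain ⟨a, ha, h1⟩ := ih hk
      exact ⟨a, by omega, h1⟩
    · have := hx n
      exact ⟨n, by omega, by omega, by omega⟩

theorem lt_sum_range_iff {a k : ℕ} (h1 : x a = 1) (hk : ∑ c ∈ Finset.range a, x c = k) {n : ℕ} :
    k < ∑ c ∈ Finset.range n, x c ↔ a < n := by
  constructor
  · intro h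
    by_contra hlt
    have := Finset.sum_le_sum_of_subset (f := x) (Finset.range_mono (not_lt.1 hlt))
    omega
  · intro h
    have := Finset.sum_le_sum_of_subset (f := x) (Finset.range_mono h)
    rw [Finset.sum_range_succ] at this
    omega

theorem eq_of_sum_range_eq {a a' : ℕ} (h1 : x a = 1) (h2 : x a' = 1)
    (h : ∑ c ∈ Finset.range a, x c = ∑ c ∈ Finset.range a', x c) : a = a' := by
  have h3 := (lt_sum_range_iff h1 rfl (n := a' + 1)).1
    ((lt_sum_range_iff h2 h.symm).2 (Nat.lt_succ_self a'))
  have h4 := (lt_sum_range_iff h2 rfl (n := a + 1)).1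
    ((lt_sum_range_iff h1 h).2 (Nat.lt_succ_self a))
  omega

/-- Prefix sums of a 0-1 sequence are ranks; this connects them with `Nat.nth` in the condition on
the first columns. -/
theorem nth_eq_of_sum_range {p : ℕ → Prop} {a n : ℕ} (hp : ∀ c < n, p c ↔ x c = 1)
    (hx : ∀ c, x c ≤ 1) (ha : a < n) (h1 : x a = 1) :
    Nat.nth p (∑ c ∈ Finset.range a, x c) = a := by
  classical
  have : ∑ c ∈ Finset.range a, x c = Nat.count p a := by
    rw [Nat.count_eq_card_filter_range, Finset.card_filter]
    refine Finset.sum_congr rfl fun c hc => ?_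
    rw [Finset.mem_range] at hc
    have := hx c
    have := hp c (by omega)
    split_ifs with h
    · exact this.1 h
    · have : x c ≠ 1 := fun h' => h (this.2 h')
      omega
  rw [this, Nat.nth_count ((hp a ha).2 h1)]

/-- The letters of a column of a rational tableau: the ones of the matrix for a positive column,
and the remaining ones for a negative column. -/
def content (s : Prop) [Decidable s] (x : ℕ → ℕ) (c : ℕ) : ℕ := if s then x c else 1 - x c

theorem content_le_one (s : Prop) [Decidable s] (hx : ∀ c, x c ≤ 1) (c : ℕ) :
    content s x c ≤ 1 := by
  unfold content
  have := hx c
  split_ifs <;> omega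

theorem sum_content (s : Prop) [Decidable s] (hx : ∀ c, x c ≤ 1) (n : ℕ) :
    ∑ c ∈ Finset.range n, content s x c =
      if s then ∑ c ∈ Finset.range n, x c else n - ∑ c ∈ Finset.range n, x c := by
  unfold content
  split_ifs
  · rfl
  · have h : ∑ c ∈ Finset.range n, (1 - x c) + ∑ c ∈ Finset.range n, x c = n := by
      rw [← Finset.sum_add_distrib, Finset.sum_congr rfl fun c _ => Nat.sub_add_cancel (hx c)]
      simp
    omega

theorem sum_range_le_self (hx : ∀ c, x c ≤ 1) (n : ℕ) : ∑ c ∈ Finset.range n, x c ≤ n := by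
  have := Finset.sum_le_card_nsmul (Finset.range n) x 1 fun c _ => hx c
  simpa using this

/-- The number of boxes that precede the box of row `k` in the order of the letters. -/
def depth {u : ℕ} (s : Prop) [Decidable s] (k : Fin u) : ℕ := if s then k else u - 1 - k

theorem depth_injective {u : ℕ} (s : Prop) [Decidable s] :
    Function.Injective (depth (u := u) s) := by
  intro k k' h
  unfold depth at h
  split_ifs at h <;> ext <;> omega

theorem depth_lt {u : ℕ} (s : Prop) [Decidable s] (k : Fin u) : depth s k < u := by
  unfold depth
  split_ifs <;> omega

theorem exists_depth {u : ℕ} (s : Prop) [Decidable s] {l : ℕ} (h : l < u) :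
    ∃ k : Fin u, depth s k = l := by
  unfold depth
  split_ifs
  · exact ⟨⟨l, h⟩, rfl⟩
  · exact ⟨⟨u - 1 - l, by omega⟩, by simp only; omega⟩

theorem card_depth_lt {u : ℕ} (s : Prop) [Decidable s] {l : ℕ} (h : l ≤ u) :
    (Finset.univ.filter fun k : Fin u => depth s k < l).card = l := by
  have : (Finset.univ.filter fun k : Fin u => depth s k < l).card = (Finset.range l).card := by
    refine Finset.card_bij (fun k _ => depth s k) ?_ ?_ ?_
    · intro k hk
      exact Finset.mem_range.2 (Finset.mem_filter.1 hk).2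
    · intro k _ k' _ h
      exact depth_injective s h
    · intro l' hl'
      have hl' := Finset.mem_range.1 hl'
      obtain ⟨k, hk⟩ := exists_depth (u := u) s (l := l') (by omega)
      exact ⟨k, Finset.mem_filter.2 ⟨Finset.mem_univ _, by omega⟩, hk⟩
  rw [this, Finset.card_range]

/-- The number of the column of a rational tableau that belongs to the row `b < 0`. -/
def colIndex (N : ℕ) (b : ℤ) : ℤ := if 0 ≤ b + N then b + N + 1 else b + N

theorem colIndex_pos {N : ℕ} {b : ℤ} : 0 < colIndex N b ↔ 0 ≤ b + N := by
  unfold colIndex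
  split_ifs <;> omega

end Grid

open Grid

variable {u : ℕ} {mu : GenPartition u} {N : ℕ} {b : ℤ}

theorem inDiagram_colIndex {k : Fin u} :
    InDiagram mu (k, colIndex N b) ↔ if 0 ≤ b + N then b + N < mu.1 k else mu.1 k ≤ b + N := by
  unfold InDiagram colIndex
  split_ifs <;> simp only <;> omega

theorem inDiagram_of_depth {k k' : Fin u} (h : InDiagram mu (k, colIndex N b))
    (hk : depth (0 ≤ b + N) k' ≤ depth (0 ≤ b + N) k) : InDiagram mu (k', colIndex N b) := by
  rw [inDiagram_colIndex] at h ⊢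
  unfold depth at hk
  split_ifs at h hk ⊢ with h0
  · exact lt_of_lt_of_le h (mu.2 (Fin.le_def.2 hk))
  · exact le_trans (mu.2 (Fin.le_def.2 (by omega))) h

namespace RationalTableau

variable (T : RationalTableau mu)

/-- The letter in a box, without its sign. -/
def letter (p : {p : Fin u × ℤ // InDiagram mu p}) : Fin u :=
  Sum.elim id OrderDual.ofDual (T.entry p)

theorem entry_eq (p : {p : Fin u × ℤ // InDiagram mu p}) :
    T.entry p = boxOf (0 < p.1.2) (T.letter p) := by
  have h := T.isLeft_iff p
  unfold letter boxOf
  cases hp : T.entry p with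
  | inl c =>
    rw [hp] at h
    rw [if_pos (h.1 rfl)]
    rfl
  | inr c =>
    rw [hp] at h
    rw [if_neg (fun h0 => by simpa using h.2 h0)]
    rfl

theorem _root_.boxOf_le {s : Prop} [Decidable s] {c c' : Fin u} :
    boxOf s c ≤ boxOf s c' ↔ if s then c ≤ c' else c' ≤ c := by
  unfold boxOf
  split_ifs <;> simp

theorem _root_.boxOf_lt {s : Prop} [Decidable s] {c c' : Fin u} :
    boxOf s c < boxOf s c' ↔ if s then c < c' else c' < c := by
  unfold boxOf
  split_ifs <;> simp

theorem letter_lt {p q : {p : Fin u × ℤ // InDiagram mu p}} (hp : p.1.2 = colIndex N b)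
    (hq : q.1.2 = colIndex N b) (h : depth (0 ≤ b + N) p.1.1 < depth (0 ≤ b + N) q.1.1) :
    T.letter p < T.letter q := by
  unfold depth at h
  by_cases h0 : 0 ≤ b + N
  · rw [if_pos h0, if_pos h0] at h
    have := T.col_strict p q (hp.trans hq.symm) (Fin.lt_def.2 h)
    rw [entry_eq, entry_eq] at this
    simp only [hp, hq] at this
    rwa [boxOf_lt, if_pos (colIndex_pos.2 h0)] at this
  · rw [if_neg h0, if_neg h0] at h
    have := T.col_strict q p (hq.trans hp.symm) (Fin.lt_def.2 (by omega))
    rw [entry_eq, entry_eq] at this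
    simp only [hp, hq] at this
    rwa [boxOf_lt, if_neg (fun h => h0 (colIndex_pos.1 h))] at this

/-- The letter `c` occurs in the column of the row `b`. -/
def Has (N : ℕ) (b : ℤ) (c : ℕ) : Prop := ∃ p, p.1.2 = colIndex N b ∧ (T.letter p : ℕ) = c

open Classical in
/-- The matrix of a rational tableau. -/
noncomputable def ent (N : ℕ) (b : ℤ) (c : ℕ) : ℕ :=
  if b < 0 ∧ c < u ∧ (T.Has N b c ↔ 0 ≤ b + N) then 1 else 0

theorem ent_le_one (N : ℕ) (b : ℤ) (c : ℕ) : T.ent N b c ≤ 1 := by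
  unfold ent
  split_ifs <;> omega

open Classical in
theorem content_ent (hb : b < 0) {c : ℕ} (hc : c < u) :
    content (0 ≤ b + N) (T.ent N b) c = if T.Has N b c then 1 else 0 := by
  unfold content ent
  simp only [hb, hc, true_and]
  by_cases h1 : T.Has N b c <;> by_cases h2 : 0 ≤ b + N <;> simp [h1, h2]

theorem content_ent_letter (hb : b < 0) {p : {p : Fin u × ℤ // InDiagram mu p}}
    (hp : p.1.2 = colIndex N b) : content (0 ≤ b + N) (T.ent N b) (T.letter p) = 1 := by
  rw [T.content_ent hb (T.letter p).2, if_pos ⟨p, hp, rfl⟩]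

/-- The column is strict, so the rank of a letter in it is the number of boxes before it in the
order of letters. All positions of smaller depth do belong to the diagram. -/
theorem sum_content_letter (hb : b < 0) {p : {p : Fin u × ℤ // InDiagram mu p}}
    (hp : p.1.2 = colIndex N b) :
    ∑ c ∈ Finset.range (T.letter p), content (0 ≤ b + N) (T.ent N b) c =
      depth (0 ≤ b + N) p.1.1 := by
  classical
  have hpd : InDiagram mu (p.1.1, colIndex N b) := by rw [← hp]; exact p.2
  rw [Finset.sum_congr rfl fun c hc => T.content_ent hb
    ((Finset.mem_range.1 hc).trans (T.letter p).2), ← Finset.card_filter,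
    ← card_depth_lt (u := u) (0 ≤ b + N) (depth_lt (0 ≤ b + N) p.1.1).le]
  have hin : ∀ k : Fin u, depth (0 ≤ b + N) k < depth (0 ≤ b + N) p.1.1 →
      InDiagram mu (k, colIndex N b) := fun k hk => inDiagram_of_depth hpd hk.le
  refine (Finset.card_bij (fun k hk => (T.letter ⟨(k, colIndex N b),
    hin k (Finset.mem_filter.1 hk).2⟩ : ℕ)) ?_ ?_ ?_).symm
  · intro k hk
    refine Finset.mem_filter.2 ⟨Finset.mem_range.2 ?_, _, rfl, rfl⟩
    exact T.letter_lt rfl hp (Finset.mem_filter.1 hk).2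
  · intro k hk k' hk' h
    by_contra hne
    rcases lt_or_gt_of_ne (fun h' => hne (depth_injective (0 ≤ b + (N : ℤ)) h')) with h' | h'
    · exact absurd h (Fin.lt_def.1 (T.letter_lt rfl rfl h')).ne
    · exact absurd h.symm (Fin.lt_def.1 (T.letter_lt rfl rfl h')).ne
  · intro c hc
    obtain ⟨hc1, ⟨⟨k, j⟩, hd⟩, hj, hq⟩ := Finset.mem_filter.1 hc
    simp only at hj
    subst hj
    refine ⟨k, Finset.mem_filter.2 ⟨Finset.mem_univ _, ?_⟩, hq⟩
    have hc1 := Finset.mem_range.1 hc1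
    by_contra hlt
    rcases lt_or_eq_of_le (not_lt.1 hlt) with h' | h'
    · have := Fin.lt_def.1 (T.letter_lt hp (q := ⟨(k, colIndex N b), hd⟩) rfl h')
      omega
    · have h1 := depth_injective _ h'
      have : p = ⟨(k, colIndex N b), hd⟩ := Subtype.ext (Prod.ext h1 hp)
      rw [this] at hc1
      omega

/-- The dictionary between prefix sums and boxes: the prefix of length n has more than `depth k`
elements exactly when the box of row k exists and has a letter below n. -/
theorem depth_lt_sum_content (hb : b < 0) {k : Fin u} {n : ℕ} (hn : n ≤ u) :
    depth (0 ≤ b + N) k < ∑ c ∈ Finset.range n, content (0 ≤ b + N) (T.ent N b) c ↔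
      ∃ h : InDiagram mu (k, colIndex N b), (T.letter ⟨_, h⟩ : ℕ) < n := by
  constructor
  · intro h
    obtain ⟨a, ha, h1, h2⟩ := exists_sum_range_eq (content_le_one _ (T.ent_le_one N b)) h
    rw [T.content_ent hb (by omega)] at h1
    have hHas : T.Has N b a := by
      by_contra h0
      rw [if_neg h0] at h1
      omega
    obtain ⟨⟨⟨k', j⟩, hd⟩, hj, rfl⟩ := hHas
    have h3 := T.sum_content_letter hb hj
    simp only at hj
    subst hj
    rw [h2] at h3
    obtain rfl := depth_injective _ h3
    exact ⟨hd, ha⟩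
  · rintro ⟨h, hlt⟩
    exact (lt_sum_range_iff (T.content_ent_letter hb rfl) (T.sum_content_letter hb rfl)).2 hlt

end RationalTableau

open Grid FockMatrix

variable {u : ℕ} {mu : GenPartition u} {N : ℕ} {b : ℤ}

namespace RationalTableau

variable (T : RationalTableau mu)

theorem letter_le {k : Fin u} {j j' : ℤ} (h : InDiagram mu (k, j)) (h' : InDiagram mu (k, j'))
    (hj : j ≤ j') : if 0 < j then T.letter ⟨_, h⟩ ≤ T.letter ⟨_, h'⟩
      else T.letter ⟨_, h'⟩ ≤ T.letter ⟨_, h⟩ := by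
  have := T.row_weak ⟨_, h⟩ ⟨_, h'⟩ rfl hj
  rw [entry_eq, entry_eq] at this
  simp only [InDiagram] at h h'
  have hs : 0 < j' ↔ 0 < j := by omega
  simp only [hs] at this
  rwa [boxOf_le] at this

theorem ent_column_neg_one (hN : b + N = -1) (hb : b < 0) {c : ℕ} (hc : c < u) :
    (∃ h : c < u, ∀ q, q.1.2 = -1 → T.entry q ≠ Sum.inr (OrderDual.toDual ⟨c, h⟩)) ↔
      T.ent N b c = 1 := by
  have hcol : colIndex N b = -1 := by
    rw [colIndex, if_neg (by omega)]
    omega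
  have h1 : T.ent N b c = 1 ↔ ¬ T.Has N b c := by
    unfold ent
    have : ¬ 0 ≤ b + (N : ℤ) := by omega
    simp [hb, hc, this]
  rw [h1, Has, not_exists]
  constructor
  · rintro ⟨_, h⟩ q ⟨hq, hqc⟩
    rw [hcol] at hq
    refine h q hq ?_
    rw [entry_eq, boxOf, if_neg (by omega)]
    exact congrArg (fun c => Sum.inr (OrderDual.toDual c)) (Fin.ext hqc)
  · intro h
    refine ⟨hc, fun q hq hqc => h q ⟨by rw [hcol, hq], ?_⟩⟩
    rw [letter, hqc]
    rfl

theorem sum_ent_eq (N : ℕ) (b : ℤ) (n : ℕ) :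
    ∑ c ∈ Finset.range n, content (0 ≤ b + N) (T.ent N b) c =
      if 0 ≤ b + N then pre (T.ent N) b n else n - pre (T.ent N) b n :=
  sum_content _ (T.ent_le_one N b) n

theorem pre_ent_le (N : ℕ) (b : ℤ) (n : ℕ) : pre (T.ent N) b n ≤ n :=
  sum_range_le_self (T.ent_le_one N b) n

/-- The lengths of the rows. -/
theorem lt_pre_ent (hb : b < 0) (k : Fin u) : (k : ℕ) < pre (T.ent N) b u ↔ b < mu.1 k - N := by
  have h1 := T.depth_lt_sum_content (N := N) hb (k := k) le_rfl
  have h2 : (∃ h : InDiagram mu (k, colIndex N b), (T.letter ⟨_, h⟩ : ℕ) < u) ↔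
      InDiagram mu (k, colIndex N b) := ⟨fun ⟨h, _⟩ => h, fun h => ⟨h, Fin.is_lt _⟩⟩
  rw [h2, inDiagram_colIndex, sum_ent_eq, depth] at h1
  have := T.pre_ent_le N b u
  have := k.2
  split_ifs at h1 <;> omega

/-- If the inequality failed at n, one box would have its letter on the wrong side of n. For two
negative or two positive columns this contradicts weak increase along a row. For b + N = 0 the
columns are 1 and −1, and it contradicts the condition on the first columns. -/
theorem pre_ent_anti (hb : b < 0) {n : ℕ} (hn : n ≤ u) :
    pre (T.ent N) b n ≤ pre (T.ent N) (b - 1) n := by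
  have h1 := fun k => T.depth_lt_sum_content (N := N) (k := k) hb hn
  have h2 := fun k => T.depth_lt_sum_content (N := N) (k := k) (show b - 1 < 0 by omega) hn
  have h3 := T.pre_ent_le N b n
  have h4 := T.pre_ent_le N (b - 1) n
  simp only [sum_ent_eq] at h1 h2
  by_contra hlt
  rw [not_le] at hlt
  rcases lt_trichotomy (b + N) 0 with h0 | h0 | h0
  · have h0' : ¬ 0 ≤ b + (N : ℤ) := by omega
    have h0'' : ¬ 0 ≤ b - 1 + (N : ℤ) := by omega
    simp only [h0', h0'', if_false, depth] at h1 h2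
    obtain ⟨hd, hl⟩ := (h2 ⟨u - 1 - (n - pre (T.ent N) b n), by omega⟩).1 (by simp only; omega)
    have hd' : InDiagram mu (⟨u - 1 - (n - pre (T.ent N) b n), by omega⟩, colIndex N b) := by
      rw [inDiagram_colIndex, if_neg (by omega)] at hd ⊢
      omega
    have hle := T.letter_le hd hd' (by rw [colIndex, colIndex, if_neg h0', if_neg h0'']; omega)
    rw [if_neg (by rw [colIndex_pos]; exact h0''), Fin.le_def] at hle
    have := (h1 _).2 ⟨hd', lt_of_le_of_lt hle hl⟩
    simp only at this
    omega
  · have h0' : 0 ≤ b + (N : ℤ) := by omega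
    simp only [h0', if_true, depth] at h1
    obtain ⟨hd, hl⟩ := (h1 ⟨pre (T.ent N) (b - 1) n, by omega⟩).1 hlt
    have hcol : colIndex N b = 1 := by rw [colIndex, if_pos h0']; omega
    have hfc := T.first_columns ⟨_, hd⟩ hcol (T.letter ⟨_, hd⟩) (by
      rw [entry_eq, boxOf, if_pos (colIndex_pos.2 h0')])
    have hsh := (T.lt_pre_ent (N := N) (b := b - 1) (by omega)
      ⟨pre (T.ent N) (b - 1) n, by omega⟩).2 (by
        rw [inDiagram_colIndex, if_pos h0'] at hd
        omega)
    obtain ⟨a, ha, ha1, ha2⟩ := exists_sum_range_eq (T.ent_le_one N (b - 1)) hsh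
    have hnth := nth_eq_of_sum_range (fun c hc => T.ent_column_neg_one (N := N) (b := b - 1)
      (by omega) (by omega) hc) (T.ent_le_one N (b - 1)) ha ha1
    rw [ha2] at hnth
    simp only at hfc hnth
    rw [hnth] at hfc
    have := (lt_sum_range_iff ha1 ha2 (n := n)).2 (by omega)
    simp only [pre] at this
    omega
  · have h0' : 0 ≤ b + (N : ℤ) := by omega
    have h0'' : 0 ≤ b - 1 + (N : ℤ) := by omega
    simp only [h0', h0'', if_true, depth] at h1 h2
    obtain ⟨hd, hl⟩ := (h1 ⟨pre (T.ent N) (b - 1) n, by omega⟩).1 hlt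
    have hd' : InDiagram mu (⟨pre (T.ent N) (b - 1) n, by omega⟩, colIndex N (b - 1)) := by
      rw [inDiagram_colIndex, if_pos h0''] 
      rw [inDiagram_colIndex, if_pos h0'] at hd
      omega
    have hle := T.letter_le hd' hd (by rw [colIndex, colIndex, if_pos h0', if_pos h0'']; omega)
    rw [if_pos (by rw [colIndex_pos]; exact h0''), Fin.le_def] at hle
    have := (h2 _).2 ⟨hd', lt_of_le_of_lt hle hl⟩
    simp only at this
    omega

theorem within_ent (N : ℕ) {m : ℕ} (hm : ∀ k, -mu.1 k ≤ m) : Within u (m + N, 0) (T.ent N) := by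
  refine ⟨fun b hb c hc => ?_, fun b hb c => ?_, fun b c hc => ?_⟩
  · push_cast at hb
    have h0 : ¬ 0 ≤ b + (N : ℤ) := by omega
    have : ¬ T.Has N b c := by
      rintro ⟨⟨⟨k, j⟩, hd⟩, hj, _⟩
      simp only at hj
      subst hj
      rw [inDiagram_colIndex, if_neg h0] at hd
      have := hm k
      omega
    rw [ent, if_pos ⟨by omega, hc, by simp [this, h0]⟩]
  · simp only [Nat.cast_zero] at hb
    rw [ent, if_neg (by omega)]
  · rw [ent, if_neg (by omega)]

theorem exists_matrix (N : ℕ) : ∃ A : FockMatrix u, A.ent = T.ent N := by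
  refine exists_ent (T.within_ent N (m := ∑ k, (mu.1 k).natAbs) fun k => ?_)
    fun b _ c => T.ent_le_one N b c
  have := Finset.single_le_sum (f := fun k => (mu.1 k).natAbs) (fun _ _ => Nat.zero_le _)
    (Finset.mem_univ k)
  omega

end RationalTableau

/-- The matrix `A` belongs to the rational tableau `T`. -/
def Encodes (N : ℕ) (T : RationalTableau mu) (A : FockMatrix u) : Prop :=
  (∀ k, mu.1 k ≤ N) ∧ A.ent = T.ent N

namespace Encodes

variable {T T' : RationalTableau mu} {A : FockMatrix u}

theorem isEvenTop (h : Encodes N T A) : IsEvenTop A := by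
  refine ⟨fun b hb c => ?_, fun i hi => ?_⟩
  · rw [h.2, RationalTableau.ent, if_neg (by omega)]
  · rw [e_eq_none_iff hi, h.2]
    exact fun c hc => T.pre_ent_anti hi hc

theorem hasShape (h : Encodes N T A) : HasShape A N mu :=
  ⟨h.1, fun b hb k => by rw [h.2]; exact T.lt_pre_ent hb k⟩

theorem within (h : Encodes N T A) {m : ℕ} (hm : ∀ k, -mu.1 k ≤ m) : Within u (m + N, 0) A.ent := by
  rw [h.2]
  exact T.within_ent N hm

/-- The letter of a box is the element of its column with a prescribed rank, and the column is
recorded in the matrix. -/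
theorem injective (h : Encodes N T A) (h' : Encodes N T' A) : T = T' := by
  ext p
  obtain ⟨⟨k, j⟩, hd⟩ := p
  have hj : j ≠ 0 := by
    simp only [InDiagram] at hd
    omega
  obtain ⟨b, hb, rfl⟩ : ∃ b < 0, colIndex N b = j := by
    have := h.1 k
    simp only [InDiagram] at hd
    refine ⟨if 0 < j then j - 1 - N else j - N, by split_ifs <;> omega, ?_⟩
    unfold colIndex
    split_ifs <;> omega
  rw [T.entry_eq, T'.entry_eq]
  congr 1
  have e1 := T.content_ent_letter (N := N) hb (p := ⟨_, hd⟩) rfl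
  have e2 := T'.content_ent_letter (N := N) hb (p := ⟨_, hd⟩) rfl
  have e3 := T.sum_content_letter (N := N) hb (p := ⟨_, hd⟩) rfl
  have e4 := T'.sum_content_letter (N := N) hb (p := ⟨_, hd⟩) rfl
  rw [← h.2] at e1 e3
  rw [← h'.2] at e2 e4
  exact Fin.ext (eq_of_sum_range_eq e1 e2 (e3.trans e4.symm))

end Encodes

open Grid FockMatrix

variable {u : ℕ} {mu : GenPartition u} {N : ℕ} {b : ℤ}

namespace FockMatrix

variable {A : FockMatrix u}

/-- The row that belongs to the column with number `j` of a rational tableau. -/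
def rowIndex (N : ℕ) (j : ℤ) : ℤ := if 0 < j then j - 1 - N else j - N

theorem rowIndex_colIndex (N : ℕ) (b : ℤ) : rowIndex N (colIndex N b) = b := by
  unfold rowIndex
  simp only [colIndex_pos]
  unfold colIndex
  split_ifs <;> omega

theorem colIndex_rowIndex {j : ℤ} (hj : j ≠ 0) : colIndex N (rowIndex N j) = j := by
  unfold rowIndex colIndex
  split_ifs <;> omega

theorem rowIndex_nonneg {j : ℤ} (hj : j ≠ 0) : 0 ≤ rowIndex N j + N ↔ 0 < j := by
  unfold rowIndex
  split_ifs <;> omega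

theorem rowIndex_le {j j' : ℤ} (h : j ≤ j') : rowIndex N j ≤ rowIndex N j' := by
  unfold rowIndex
  split_ifs <;> omega

theorem rowIndex_neg (hs : HasShape A N mu) {k : Fin u} {j : ℤ} (hd : InDiagram mu (k, j)) :
    j ≠ 0 ∧ rowIndex N j < 0 := by
  have := hs.le k
  simp only [InDiagram] at hd
  unfold rowIndex
  split_ifs <;> omega

theorem HasShape.depth_lt_iff (hs : HasShape A N mu) (hb : b < 0) {k : Fin u} :
    depth (0 ≤ b + N) k < ∑ c ∈ Finset.range u, content (0 ≤ b + N) (A.ent b) c ↔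
      InDiagram mu (k, colIndex N b) := by
  have h1 := hs.lt_iff b hb k
  have h2 := A.pre_le_self hb u
  rw [sum_content _ (A.valid_ent b hb), inDiagram_colIndex, depth]
  have := k.2
  simp only [pre] at h1 h2
  split_ifs <;> omega

theorem HasShape.exists_letter (hs : HasShape A N mu) {k : Fin u} {j : ℤ}
    (hd : InDiagram mu (k, j)) : ∃ a : Fin u, content (0 < j) (A.ent (rowIndex N j)) a = 1 ∧
      ∑ c ∈ Finset.range a, content (0 < j) (A.ent (rowIndex N j)) c = depth (0 < j) k := by
  obtain ⟨hj, hb⟩ := rowIndex_neg hs hd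
  have h := (hs.depth_lt_iff hb (k := k)).2 (by rwa [colIndex_rowIndex hj])
  simp only [rowIndex_nonneg hj] at h
  obtain ⟨a, ha, h1, h2⟩ := exists_sum_range_eq (content_le_one _ (A.valid_ent _ hb)) h
  exact ⟨⟨a, ha⟩, h1, h2⟩

theorem IsEvenTop.sum_content_le (h : IsEvenTop A) {j j' : ℤ}
    (hb : rowIndex N j' < 0) (hjj : j ≤ j') (hs : 0 < j ↔ 0 < j') {n : ℕ} (hn : n ≤ u) :
    if 0 < j then ∑ c ∈ Finset.range n, content (0 < j') (A.ent (rowIndex N j')) c ≤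
      ∑ c ∈ Finset.range n, content (0 < j) (A.ent (rowIndex N j)) c
    else ∑ c ∈ Finset.range n, content (0 < j) (A.ent (rowIndex N j)) c ≤
      ∑ c ∈ Finset.range n, content (0 < j') (A.ent (rowIndex N j')) c := by
  have h1 := rowIndex_le (N := N) hjj
  have h2 := h.rows_le hb h1 hn
  simp only [pre] at h2
  rw [sum_content _ (A.valid_ent _ hb), sum_content _ (A.valid_ent _ (by omega))]
  simp only [hs]
  split_ifs <;> omega

/-- Even highest weight matrices come from rational tableaux. -/
theorem exists_encodes (h : IsEvenTop A) (hs : HasShape A N mu) :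
    ∃ T : RationalTableau mu, Encodes N T A := by
  choose a ha1 ha2 using fun p : {p : Fin u × ℤ // InDiagram mu p} => hs.exists_letter p.2
  have hneg := fun p : {p : Fin u × ℤ // InDiagram mu p} => rowIndex_neg hs p.2
  -- The shape makes the number of boxes in a column equal to the number of letters that the row
  -- provides, so every letter of the row is used by some box.
  have mem : ∀ (j : ℤ), j ≠ 0 → rowIndex N j < 0 → ∀ c : ℕ, c < u →
      ((∃ q, q.1.2 = j ∧ (a q : ℕ) = c) ↔ content (0 < j) (A.ent (rowIndex N j)) c = 1) := by
    intro j hj hb c hc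
    constructor
    · rintro ⟨q, rfl, rfl⟩
      exact ha1 q
    · intro h1
      have h2 := (lt_sum_range_iff h1 rfl (n := u)).2 hc
      obtain ⟨k, hk⟩ := exists_depth (u := u) (0 < j) (lt_of_lt_of_le h2
        (sum_range_le_self (content_le_one _ (A.valid_ent _ hb)) u))
      rw [← hk] at h2
      have hd : InDiagram mu (k, j) := by
        have := hs.depth_lt_iff hb (k := k)
        rw [colIndex_rowIndex hj] at this
        simp only [rowIndex_nonneg hj] at this
        exact this.1 h2
      refine ⟨⟨(k, j), hd⟩, rfl, ?_⟩
      exact eq_of_sum_range_eq (ha1 ⟨(k, j), hd⟩) h1 ((ha2 ⟨(k, j), hd⟩).trans hk)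
  have hlt : ∀ p n, depth (0 < p.1.2) p.1.1 <
      ∑ c ∈ Finset.range n, content (0 < p.1.2) (A.ent (rowIndex N p.1.2)) c ↔ (a p : ℕ) < n :=
    fun p n => lt_sum_range_iff (ha1 p) (ha2 p)
  let T : RationalTableau mu :=
    { entry := fun p => boxOf (0 < p.1.2) (a p)
      isLeft_iff := fun p => by
        unfold boxOf
        split_ifs with h0 <;> simp [h0]
      row_weak := by
        intro p q hk hj
        have hs' : 0 < p.1.2 ↔ 0 < q.1.2 := by
          have hp := p.2
          have hq := q.2
          simp only [InDiagram, hk] at hp hq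
          omega
        have key := fun n hn => h.sum_content_le (N := N) (hneg q).2 hj hs' (n := n) hn
        have e1 := hlt p
        have e2 := hlt q
        simp only [hs', hk] at e1 e2 key ⊢
        rw [boxOf_le]
        split_ifs with h0
        · have := key (a q + 1) (by omega)
          rw [if_pos h0] at this
          have h3 := (e1 (a q + 1)).1 (lt_of_lt_of_le ((e2 (a q + 1)).2 (by omega)) this)
          exact Fin.le_def.2 (by omega)
        · have := key (a p + 1) (by omega)
          rw [if_neg h0] at this
          have h3 := (e2 (a p + 1)).1 (lt_of_lt_of_le ((e1 (a p + 1)).2 (by omega)) this)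
          exact Fin.le_def.2 (by omega)
      col_strict := by
        rintro ⟨⟨k, j⟩, hp⟩ ⟨⟨k', j'⟩, hq⟩ hj hk
        simp only at hj hk ⊢
        subst hj
        have e1 := hlt ⟨(k, j), hp⟩
        have e2 := ha2 ⟨(k, j), hp⟩
        have e3 := hlt ⟨(k', j), hq⟩
        have e4 := ha2 ⟨(k', j), hq⟩
        simp only at e1 e2 e3 e4
        rw [Fin.lt_def] at hk
        rw [boxOf_lt]
        split_ifs with h0
        · refine Fin.lt_def.2 ((e1 _).1 ?_)
          rw [e4]
          simp only [depth, h0, if_true]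
          exact hk
        · refine Fin.lt_def.2 ((e3 _).1 ?_)
          rw [e2]
          simp only [depth, h0, if_false]
          have := k'.2
          omega
      first_columns := by
        rintro ⟨⟨k, j⟩, hp⟩ hp1 c hc
        simp only at hp1 hc ⊢
        subst hp1
        have hcol : ∀ x < u, (∃ hx : x < u, ∀ q : {p : Fin u × ℤ // InDiagram mu p}, q.1.2 = -1 →
            boxOf (0 < q.1.2) (a q) ≠ Sum.inr (OrderDual.toDual ⟨x, hx⟩)) ↔
            A.ent (rowIndex N (-1)) x = 1 := by
          intro x hx
          have hb : rowIndex N (-1) < 0 := by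
            rw [rowIndex, if_neg (by norm_num)]
            omega
          have h1 := mem (-1) (by norm_num) hb x hx
          have h2 := A.valid_ent _ hb x
          have h3 : content (0 < (-1 : ℤ)) (A.ent (rowIndex N (-1))) x = 1 ↔
              ¬ A.ent (rowIndex N (-1)) x = 1 := by
            rw [content, if_neg (by norm_num)]
            omega
          rw [h3] at h1
          rw [← not_iff_not, ← h1]
          simp only [hx, exists_true_left, not_forall, not_not]
          constructor
          · rintro ⟨q, hq, hqx⟩
            refine ⟨q, hq, ?_⟩
            rw [boxOf, if_neg (by omega)] at hqx
            simpa [Fin.ext_iff] using hqx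
          · rintro ⟨q, hq, hqx⟩
            refine ⟨q, hq, ?_⟩
            rw [boxOf, if_neg (by omega)]
            simpa [Fin.ext_iff] using hqx
        have hc' : a ⟨(k, 1), hp⟩ = c := by
          rw [boxOf, if_pos (by norm_num)] at hc
          exact Sum.inl_injective hc
        have e1 := (hlt ⟨(k, 1), hp⟩ (c + 1)).2 (by omega)
        have hp0 := (hneg ⟨(k, 1), hp⟩).2
        simp only at e1 hp0
        have hrow : rowIndex N 1 - 1 = rowIndex N (-1) := by
          rw [rowIndex, rowIndex, if_pos (by norm_num), if_neg (by norm_num)]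
          omega
        have hcont : ∀ c, content (0 < (1 : ℤ)) (A.ent (rowIndex N 1)) c =
            A.ent (rowIndex N 1) c := fun c => if_pos (by norm_num)
        simp only [hcont] at e1
        rw [depth, if_pos (by norm_num)] at e1
        -- The rows of the columns 1 and −1 are adjacent. Comparing their prefix sums up to c gives
        -- a letter x ≤ c of rank k among those whose duals are missing from column −1.
        have h3 := h.pre_le hp0 (c := c + 1) (by omega)
        rw [hrow] at h3
        obtain ⟨x, hx, hx1, hx2⟩ := exists_sum_range_eq
          (A.valid_ent (rowIndex N (-1)) (by omega)) (lt_of_lt_of_le e1 h3)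
        have := nth_eq_of_sum_range hcol (A.valid_ent (rowIndex N (-1)) (by omega))
          (a := x) (by omega) hx1
        rw [hx2] at this
        rw [this]
        omega }
  have hT : ∀ p, T.letter p = a p := by
    intro p
    change Sum.elim id OrderDual.ofDual (boxOf (0 < p.1.2) (a p)) = _
    unfold boxOf
    split_ifs <;> rfl
  refine ⟨T, hs.le, funext fun b => funext fun c => ?_⟩
  by_cases hb : b < 0
  · by_cases hc : c < u
    · have h1 := mem (colIndex N b) (by unfold colIndex; split_ifs <;> omega)
        (by rwa [rowIndex_colIndex]) c hc
      rw [rowIndex_colIndex] at h1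
      have h2 : T.Has N b c ↔ content (0 < colIndex N b) (A.ent b) c = 1 := by
        rw [← h1, RationalTableau.Has]
        simp only [hT]
      rw [RationalTableau.ent]
      simp only [hb, hc, true_and, h2, colIndex_pos, content]
      have := A.valid_ent b hb c
      split_ifs <;> omega
    · rw [RationalTableau.ent, if_neg (by omega), A.ent_of_le _ (by omega)]
  · rw [RationalTableau.ent, if_neg (by omega), h.even b (by omega)]

end FockMatrix

/-! ### Reading words of rational tableaux -/

open Grid FockMatrix CrystalData

variable {u : ℕ} {mu : GenPartition u} {N : ℕ} {b : ℤ}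

theorem flatMap_filter_ne_nil {α β : Type} (f : α → List β) [DecidablePred fun x => f x ≠ []]
    (L : List α) : (L.filter fun x => f x ≠ []).flatMap f = L.flatMap f := by
  induction L with
  | nil => rfl
  | cons a L ih =>
    rw [List.filter_cons]
    split_ifs with h
    · rw [List.flatMap_cons, List.flatMap_cons, ih]
    · rw [List.flatMap_cons, ih]
      simp only [ne_eq, decide_not, Bool.not_eq_eq_eq_not, Bool.not_true, decide_eq_false_iff_not,
        not_not] at h
      rw [h, List.nil_append]

/-- Factors that are empty do not matter in a concatenation. -/
theorem flatMap_eq_of_pairwise {β : Type} {f : ℤ → List β} {L L' : List ℤ}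
    (h : L.Pairwise (· > ·)) (h' : L'.Pairwise (· > ·)) (hm : ∀ x, f x ≠ [] → (x ∈ L ↔ x ∈ L')) :
    L.flatMap f = L'.flatMap f := by
  classical
  rw [← flatMap_filter_ne_nil f L, ← flatMap_filter_ne_nil f L']
  congr 1
  refine List.Perm.eq_of_pairwise (le := fun x y : ℤ => x > y) ?_ (h.filter _) (h'.filter _) ?_
  · intro x y _ _ h1 h2
    omega
  · refine (List.perm_ext_iff_of_nodup ?_ ?_).2 fun x => ?_
    · exact (h.filter _).imp fun h => ne_of_gt h
    · exact (h'.filter _).imp fun h => ne_of_gt h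
    · simp only [List.mem_filter, ne_eq, decide_not, Bool.not_eq_eq_eq_not, Bool.not_true,
        decide_eq_false_iff_not]
      constructor
      · rintro ⟨h1, h2⟩; exact ⟨(hm x h2).1 h1, h2⟩
      · rintro ⟨h1, h2⟩; exact ⟨(hm x h2).2 h1, h2⟩

theorem multWord_eq_filter {α : Type} (L : List α) {x : α → ℕ} (hx : ∀ b, x b ≤ 1) :
    multWord L x = L.filter fun b => x b = 1 := by
  induction L with
  | nil => rfl
  | cons a L ih =>
    rw [multWord, List.flatMap_cons, ← multWord, ih, List.filter_cons]
    have := hx a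
    interval_cases h : x a <;> simp

theorem mem_boxWord {s : Prop} [Decidable s] {x : ℕ → ℕ} (hx : ∀ c, x c ≤ 1)
    {y : Fin u ⊕ (Fin u)ᵒᵈ} :
    y ∈ boxWord u s x ↔ ∃ c : Fin u, y = boxOf s c ∧ content s x c = 1 := by
  unfold boxWord boxOf content
  split_ifs
  · rw [multWord_eq_filter _ (by rintro (c | c) <;> simp [hx])]
    simp only [List.mem_filter, List.mem_map, List.mem_finRange, true_and, decide_eq_true_eq]
    constructor
    · rintro ⟨⟨c, rfl⟩, h⟩; exact ⟨c, rfl, h⟩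
    · rintro ⟨c, rfl, h⟩; exact ⟨⟨c, rfl⟩, h⟩
  · rw [multWord_eq_filter _ (by rintro (c | c) <;> simp)]
    simp only [List.mem_filter, List.mem_map, List.mem_reverse, List.mem_finRange, true_and,
      decide_eq_true_eq]
    constructor
    · rintro ⟨⟨c, rfl⟩, h⟩; exact ⟨c, rfl, h⟩
    · rintro ⟨c, rfl, h⟩; exact ⟨⟨c, rfl⟩, h⟩

theorem boxWord_pairwise {s : Prop} [Decidable s] {x : ℕ → ℕ} (hx : ∀ c, x c ≤ 1) :
    (boxWord u s x).Pairwise (· < ·) := by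
  have hfin : (List.finRange u).Pairwise (· < ·) := List.pairwise_lt_finRange u
  unfold boxWord
  split_ifs
  · rw [multWord_eq_filter _ (by rintro (c | c) <;> simp [hx])]
    refine List.Pairwise.filter _ (List.pairwise_map.2 (hfin.imp fun h => ?_))
    exact Sum.inl_lt_inl_iff.2 h
  · rw [multWord_eq_filter _ (by rintro (c | c) <;> simp)]
    refine List.Pairwise.filter _ (List.pairwise_map.2 (List.pairwise_reverse.2
      (hfin.imp fun h => ?_)))
    exact Sum.inr_lt_inr_iff.2 h

namespace RationalTableau

variable (T : RationalTableau mu)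

/-- The word of a column. -/
def colWord (j : ℤ) : List (Fin u ⊕ (Fin u)ᵒᵈ) :=
  (List.finRange u).filterMap fun k =>
    if h : InDiagram mu (k, j) then some (T.entry ⟨(k, j), h⟩) else none

theorem mem_colWord {j : ℤ} {y : Fin u ⊕ (Fin u)ᵒᵈ} :
    y ∈ T.colWord j ↔ ∃ p, p.1.2 = j ∧ T.entry p = y := by
  simp only [colWord, List.mem_filterMap, List.mem_finRange, true_and]
  constructor
  · rintro ⟨k, hk⟩
    split_ifs at hk with h
    exact ⟨_, rfl, Option.some.inj hk⟩
  · rintro ⟨⟨⟨k, j'⟩, h⟩, hj, hy⟩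
    simp only at hj
    subst hj
    exact ⟨k, by rw [dif_pos h, hy]⟩

theorem colWord_pairwise (j : ℤ) : (T.colWord j).Pairwise (· < ·) := by
  refine List.pairwise_filterMap.2 ((List.pairwise_lt_finRange u).imp ?_)
  intro k k' hk y hy y' hy'
  split_ifs at hy hy' with h h'
  rw [Option.some.injEq] at hy hy'
  rw [← hy, ← hy']
  exact T.col_strict _ _ rfl hk

theorem colWord_ne_nil {j : ℤ} (h : T.colWord j ≠ []) : ∃ k, InDiagram mu (k, j) := by
  obtain ⟨y, hy⟩ := List.exists_mem_of_ne_nil _ h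
  obtain ⟨⟨⟨k, j'⟩, hd⟩, rfl, _⟩ := T.mem_colWord.1 hy
  exact ⟨k, hd⟩

theorem colWord_eq (hb : b < 0) : T.colWord (colIndex N b) = boxWord u (0 ≤ b + N) (T.ent N b) := by
  have h1 := T.colWord_pairwise (colIndex N b)
  have h2 := boxWord_pairwise (u := u) (s := 0 ≤ b + N) (T.ent_le_one N b)
  refine List.Perm.eq_of_pairwise (le := (· < ·)) ?_ h1 h2 ?_
  · intro x y _ _ h3 h4
    exact absurd h3 h4.asymm
  · refine (List.perm_ext_iff_of_nodup (h1.imp fun h => ne_of_lt h)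
      (h2.imp fun h => ne_of_lt h)).2 fun y => ?_
    rw [mem_colWord, mem_boxWord (T.ent_le_one N b)]
    constructor
    · rintro ⟨p, hp, rfl⟩
      refine ⟨T.letter p, ?_, T.content_ent_letter hb hp⟩
      rw [entry_eq]
      simp only [hp, colIndex_pos]
    · rintro ⟨c, rfl, hc⟩
      rw [T.content_ent hb c.2] at hc
      have : T.Has N b c := by
        by_contra h0
        rw [if_neg h0] at hc
        omega
      obtain ⟨p, hp, hpc⟩ := this
      refine ⟨p, hp, ?_⟩
      rw [entry_eq, Fin.ext hpc]
      simp only [hp, colIndex_pos]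

theorem reading_eq : T.reading = (((List.range (2 * (∑ k, (mu.1 k).natAbs) + 1)).map
    fun t : ℕ => ((∑ k, (mu.1 k).natAbs : ℕ) : ℤ) - t)).flatMap T.colWord := by
  rw [List.flatMap_map]
  unfold reading colWord
  simp only [List.bind_eq_flatMap, List.flatMap_assoc, List.pure_def, List.flatMap_cons,
    List.flatMap_nil, List.append_nil]

/-- Decreasing rows of the matrix are the columns from right to left. The two words run through
different ranges of columns, but the additional columns are empty. -/
theorem reading_eq_boxesWord (hN : ∀ k, mu.1 k ≤ N) {m : ℕ} (hm : ∀ k, -mu.1 k ≤ m) :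
    T.reading = boxesWord u N (m + N, 0) (T.ent N) := by
  have h1 : boxesWord u N (m + N, 0) (T.ent N) =
      ((rows (m + N, 0)).map (colIndex N)).flatMap T.colWord := by
    rw [List.flatMap_map, boxesWord]
    refine flatMap_congr' fun b hb => ?_
    have hb := (mem_rows.1 hb).2
    simp only [Nat.cast_zero] at hb
    rw [T.colWord_eq hb]
  rw [h1, reading_eq]
  refine flatMap_eq_of_pairwise ?_ ?_ fun j hj => ?_
  · exact List.pairwise_map.2 (List.pairwise_lt_range.imp fun h => by omega)
  · refine List.pairwise_map.2 ((rows_pairwise _).imp fun {x y} h => ?_)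
    unfold colIndex
    split_ifs <;> omega
  · obtain ⟨k, hk⟩ := T.colWord_ne_nil hj
    have h2 := Finset.single_le_sum (f := fun k => (mu.1 k).natAbs) (fun _ _ => Nat.zero_le _)
      (Finset.mem_univ k)
    have h3 := hm k
    have h4 := hN k
    generalize (∑ k, (mu.1 k).natAbs) = M at *
    simp only [InDiagram] at hk
    simp only [List.mem_map, List.mem_range, mem_rows]
    constructor
    · intro _
      refine ⟨rowIndex N j, ?_, colIndex_rowIndex (by omega)⟩
      unfold rowIndex
      push_cast
      split_ifs <;> omega
    · intro _
      exact ⟨(M - j).toNat, by omega, by omega⟩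

theorem length_colWord (T T' : RationalTableau mu) (j : ℤ) :
    (T.colWord j).length = (T'.colWord j).length := by
  unfold colWord
  rw [List.length_filterMap_eq_countP, List.length_filterMap_eq_countP]
  congr 1
  funext k
  split_ifs <;> rfl

theorem _root_.List.eq_of_flatMap_eq {α β : Type} {L : List α} {f g : α → List β}
    (h : L.flatMap f = L.flatMap g) (hl : ∀ x, (f x).length = (g x).length) :
    ∀ x ∈ L, f x = g x := by
  induction L with
  | nil => simp
  | cons a L ih =>
    rw [List.flatMap_cons, List.flatMap_cons] at h
    obtain ⟨h1, h2⟩ := List.append_inj h (hl a)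
    intro x hx
    rcases List.mem_cons.1 hx with rfl | hx
    · exact h1
    · exact ih h2 x hx

theorem colWord_eq_of_reading {T T' : RationalTableau mu} (h : T.reading = T'.reading) (j : ℤ) :
    T.colWord j = T'.colWord j := by
  by_cases h0 : T.colWord j = []
  · have := length_colWord T T' j
    rw [h0, List.length_nil, eq_comm, List.length_eq_zero_iff] at this
    rw [h0, this]
  · rw [reading_eq, reading_eq] at h
    refine List.eq_of_flatMap_eq h (length_colWord T T') j ?_
    obtain ⟨k, hk⟩ := T.colWord_ne_nil h0
    have h2 := Finset.single_le_sum (f := fun k => (mu.1 k).natAbs) (fun _ _ => Nat.zero_le _)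
      (Finset.mem_univ k)
    generalize (∑ k, (mu.1 k).natAbs) = M at *
    simp only [InDiagram] at hk
    simp only [List.mem_map, List.mem_range]
    exact ⟨(M - j).toNat, by omega, by omega⟩

theorem has_iff {c : Fin u} : T.Has N b c ↔ boxOf (0 < colIndex N b) c ∈ T.colWord (colIndex N b) := by
  rw [mem_colWord, Has]
  refine exists_congr fun p => and_congr_right fun hp => ?_
  rw [entry_eq]
  simp only [hp]
  rw [(boxOf_injective _).eq_iff, Fin.ext_iff]

/-- The matrix of a rational tableau. -/
noncomputable def matrix (N : ℕ) : FockMatrix u := (T.exists_matrix N).choose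

theorem matrix_ent (N : ℕ) : (T.matrix N).ent = T.ent N := (T.exists_matrix N).choose_spec

theorem encodes (hN : ∀ k, mu.1 k ≤ N) : Encodes N T (T.matrix N) := ⟨hN, T.matrix_ent N⟩

theorem _root_.GenPartition.exists_bound (mu : GenPartition u) :
    ∃ N : ℕ, ∀ k, mu.1 k ≤ N ∧ -mu.1 k ≤ N := by
  refine ⟨∑ k, (mu.1 k).natAbs, fun k => ?_⟩
  have := Finset.single_le_sum (f := fun k => (mu.1 k).natAbs) (fun _ _ => Nat.zero_le _)
    (Finset.mem_univ k)
  omega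

/-- The shape prescribes the lengths of the columns, so the word can be cut into columns, and these
determine the matrix. -/
theorem reading_injective : Function.Injective (reading (mu := mu)) := by
  classical
  intro T T' h
  obtain ⟨N, hN⟩ := mu.exists_bound
  refine (T.encodes fun k => (hN k).1).injective ⟨fun k => (hN k).1, ?_⟩
  rw [matrix_ent]
  funext b c
  unfold ent
  by_cases hc : c < u
  · have h1 := T.has_iff (N := N) (b := b) (c := ⟨c, hc⟩)
    have h2 := T'.has_iff (N := N) (b := b) (c := ⟨c, hc⟩)
    rw [colWord_eq_of_reading h, ← h2] at h1
    exact if_congr (and_congr_right fun _ => and_congr_right fun _ => iff_congr h1 Iff.rfl) rfl rfl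
  · simp [hc]

end RationalTableau

/-! ### Transport of the crystal structure to rational tableaux -/

namespace Encodes

variable {T : RationalTableau mu} {A A' : FockMatrix u} {d : Bool} {j : Fin (u - 1)}

theorem reading_eq (h : Encodes N T A) {m : ℕ} (hm : ∀ k, -mu.1 k ≤ m) :
    T.reading = boxesWord u N (m + N, 0) A.ent := by
  rw [h.2]
  exact T.reading_eq_boxesWord h.1 hm

theorem sig_eq (h : Encodes N T A) : (rationalCrystal mu).sig j T = (crystalStar u).sig j A := by
  obtain ⟨m, hm⟩ := mu.exists_bound
  have hm := fun k => (hm k).2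
  rw [sigStar_eq (h.within hm), ← boxesWord_sig (N := N) A.valid_ent, ← h.reading_eq hm]
  rfl

theorem wt_eq (h : Encodes N T A) :
    (rationalCrystal mu).wt T = (crystalStar u).wt A + fun _ => (N : ℤ) := by
  obtain ⟨m, hm⟩ := mu.exists_bound
  have hm := fun k => (hm k).2
  funext c
  rw [Pi.add_apply, ← wordWt_boxesWord (h.within hm) (by omega), ← h.reading_eq hm]
  rfl

theorem op_reading (h : Encodes N T A) {m : ℕ} (hm : ∀ k, -mu.1 k ≤ m) :
    (glRationalLetters u).words.op d j T.reading =
      ((crystalStar u).op d j A).map fun A' => boxesWord u N (m + N, 0) A'.ent := by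
  have := opStar_ent d j (h.within hm)
  rw [h.reading_eq hm, boxesWord_op A.valid_ent]
  have h2 := congrArg (Option.map (boxesWord u N (m + N, 0))) this
  rw [Option.map_map, Option.map_map] at h2
  exact h2.symm

theorem opStar (h : Encodes N T A) (hA : (crystalStar u).op d j A = some A') :
    ∃ T' : RationalTableau mu, Encodes N T' A' :=
  exists_encodes (h.isEvenTop.opStar hA) (h.hasShape.opStar hA)

end Encodes

/-- The set of rational tableaux is stable. -/
theorem rational_stable (mu : GenPartition u) :
    (glRationalLetters u).words.Stable (RationalTableau.reading (mu := mu)) := by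
  intro j T y hy
  obtain ⟨N, hN⟩ := mu.exists_bound
  have hN' := fun k => (hN k).2
  have h := T.encodes fun k => (hN k).1
  obtain ⟨d, hd⟩ : ∃ d, (glRationalLetters u).words.op d j T.reading = some y := by
    rcases hy with hy | hy
    exacts [⟨true, hy⟩, ⟨false, hy⟩]
  rw [h.op_reading hN', Option.map_eq_some_iff] at hd
  obtain ⟨A', hA', rfl⟩ := hd
  obtain ⟨T', hT'⟩ := h.opStar hA'
  exact ⟨T', hT'.reading_eq hN'⟩

theorem Encodes.op_eq {T : RationalTableau mu} {A : FockMatrix u} (h : Encodes N T A) (d : Bool)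
    (j : Fin (u - 1)) : ((rationalCrystal mu).op d j T).map (fun T => T.matrix N) =
      (crystalStar u).op d j A := by
  obtain ⟨m, hm⟩ := mu.exists_bound
  have hm := fun k => (hm k).2
  have h1 := comap_op (C := (glRationalLetters u).words) RationalTableau.reading_injective
    (rational_stable mu) d j T
  rw [h.op_reading hm] at h1
  change ((rationalCrystal mu).op d j T).map _ = _ at h1
  cases hA : (crystalStar u).op d j A with
  | none =>
    rw [hA, Option.map_none, Option.map_eq_none_iff] at h1
    rw [h1]
    rfl
  | some A' =>
    obtain ⟨T', hT'⟩ := h.opStar hA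
    rw [hA, Option.map_some, ← hT'.reading_eq hm, Option.map_eq_some_iff] at h1
    obtain ⟨T'', h2, h3⟩ := h1
    obtain rfl := RationalTableau.reading_injective h3
    rw [h2, Option.map_some, Option.some.injEq]
    exact ent_injective ((T''.matrix_ent N).trans hT'.2.symm)

theorem RationalTableau.matrix_injective (hN : ∀ k, mu.1 k ≤ N) :
    Function.Injective fun T : RationalTableau mu => T.matrix N := fun T T' h =>
  (T.encodes hN).injective ⟨hN, by
    have h : T.matrix N = T'.matrix N := h
    rw [h, T'.matrix_ent]⟩

theorem Encodes.linked {T : RationalTableau mu} {A : FockMatrix u} (h : Encodes N T A) :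
    Linked (rationalCrystal mu) (crystalStar u) (fun _ => (N : ℤ)) T A := by
  have hA : A = T.matrix N := ent_injective (h.2.trans (T.matrix_ent N).symm)
  rw [hA]
  exact Linked.of_injective (RationalTableau.matrix_injective h.1)
    (fun j T => (T.encodes h.1).sig_eq) (fun T => (T.encodes h.1).wt_eq)
    (fun d j T => (T.encodes h.1).op_eq d j) T

namespace CrystalData

variable {I P X Y : Type} [AddCommGroup P] {D : CartanDatum I P} {C : CrystalData D X}
  {C' : CrystalData D Y} {s : P}

/-- The axioms of a crystal can be checked after an embedding that shifts the weights. -/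
theorem IsCrystal.of_injective (h : C'.IsCrystal) {r : X → Y} (hr : Function.Injective r)
    (hs : ∀ i, D.coroot i s = 0) (sig : ∀ i x, C.sig i x = C'.sig i (r x))
    (wt : ∀ x, C.wt x = C'.wt (r x) + s)
    (op : ∀ d i x, (C.op d i x).map r = C'.op d i (r x)) : C.IsCrystal := by
  have hε : ∀ i x, C.ε i x = C'.ε i (r x) := fun i x => congrArg Prod.fst (sig i x)
  have hφ : ∀ i x, C.φ i x = C'.φ i (r x) := fun i x => congrArg Prod.snd (sig i x)
  have hc : ∀ i x, D.coroot i (C.wt x) = D.coroot i (C'.wt (r x)) := fun i x => by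
    rw [wt, map_add, hs, add_zero]
  have ho : ∀ d i x y, C.op d i x = some y ↔ C'.op d i (r x) = some (r y) := fun d i x y => by
    rw [← op, Option.map_eq_some_iff]
    exact ⟨fun h => ⟨y, h, rfl⟩, fun ⟨z, h, hz⟩ => by rw [h, hr hz]⟩
  refine ⟨fun i x hk => ?_, fun i x hk => ?_, fun i x hk => ?_, fun i x hk => ?_,
    fun i x y hxy => ?_, fun i x y hxy => ?_, fun i x y => ?_⟩
  · rw [hε, hφ, hc]
    exact h.even i _ hk
  · rw [hc]
    exact h.odd_nonneg i _ hk
  · rw [hc, hε, hφ]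
    exact h.odd_zero i _ hk
  · rw [hc, hε, hφ]
    exact h.odd_pos i _ hk
  · obtain ⟨h1, h2, h3⟩ := h.e_spec i _ _ ((ho true i x y).1 hxy)
    rw [hε, hφ, hε, hφ, wt, wt, h3]
    exact ⟨h1, h2, by abel⟩
  · obtain ⟨h1, h2, h3⟩ := h.f_spec i _ _ ((ho false i x y).1 hxy)
    rw [hε, hφ, hε, hφ, wt, wt, h3]
    exact ⟨h1, h2, by abel⟩
  · exact (ho false i x y).trans ((h.f_iff_e i _ _).trans (ho true i y x).symm)

end CrystalData

theorem isCrystal_rational (mu : GenPartition u) : (rationalCrystal mu).IsCrystal := by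
  obtain ⟨N, hN⟩ := mu.exists_bound
  have hN := fun k => (hN k).1
  -- The shift by N is harmless because the coroots of 𝔤𝔩_u vanish on constant weights.
  exact (isCrystalStar u).of_injective (s := fun _ => (N : ℤ))
    (RationalTableau.matrix_injective hN) (fun j => by simp [glDatum])
    (fun j T => (T.encodes hN).sig_eq) (fun T => (T.encodes hN).wt_eq)
    (fun d j T => (T.encodes hN).op_eq d j)

/-! ### Existence of the equivalent tableaux -/

namespace FockMatrix

open Grid Signature CrystalData

variable {u : ℕ} {p q : ℕ × ℕ} {A B A' : FockMatrix u} {d : Bool} {j : Fin (u - 1)}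

theorem wordWt_rowWord (hp : Within u p A.ent) (c : Fin u) :
    (glLetters u).wordWt (rowWord u p A.ent) c = (crystalStar u).wt A c + p.1 := by
  have hpart : ∀ b : ℤ, (glLetters u).wordWt (rowPart u b (A.ent b)) c = A.ent b c := by
    intro b
    rw [rowPart, wordWt_multWord, list_sum_apply, List.map_map]
    have hsum : ((List.finRange u).map fun c' : Fin u => if c = c' then (A.ent b c' : ℤ) else 0).sum =
        A.ent b c := by
      rw [sum_finRange]
      simp
    rw [← hsum]
    have hfun : ((fun f : Fin u → ℤ => f c) ∘ fun c' : Fin u => A.ent b c' • (glLetters u).wt c') =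
        fun c' : Fin u => if c = c' then (A.ent b c' : ℤ) else 0 := by
      funext c'
      simp [glLetters, Pi.single_apply]
    rw [hfun]
    split_ifs
    · rfl
    · rw [List.map_reverse, List.sum_reverse]
  rw [rowWord, wordWt_flatMap, list_sum_apply, List.map_map, sum_map_rows, wtStar_eq hp,
    Finset.sum_sub_distrib, sum_vac, sub_add_cancel]
  exact Finset.sum_congr rfl fun b _ => hpart b

theorem op_rowWord (hp : Within u p A.ent) : (glLetters u).words.op d j (rowWord u p A.ent) =
    ((crystalStar u).op d j A).map fun A' => rowWord u p A'.ent := by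
  rw [rowWord_op A.valid_ent]
  have h2 := congrArg (Option.map (rowWord u p)) (opStar_ent d j hp)
  rw [Option.map_map, Option.map_map] at h2
  exact h2.symm

/-- The row word forgets which row a letter comes from. The row sums restore this, since they give
the first word of the biword. -/
theorem eq_of_rowWord (hA : Within u p A.ent) (hB : Within u p B.ent)
    (h : rowWord u p A.ent = rowWord u p B.ent) (hr : ∀ b, pre A.ent b u = pre B.ent b u) :
    A = B := by
  have hfst : (rowBiword p A).1 = (rowBiword p B).1 := by
    rw [rowBiword_fst, rowBiword_fst]
    refine flatMap_congr' fun b _ => ?_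
    have := hr b
    unfold pre at this
    rw [← List.sum_toFinset _ List.nodup_range, ← List.sum_toFinset _ List.nodup_range,
      List.toFinset_range, this]
  have hbi : rowBiword p A = rowBiword p B := Prod.ext hfst (by rw [rowBiword_snd, rowBiword_snd, h])
  ext b c
  by_cases hb : b ∈ window p.1 p.2
  · exact rowBiword_inj hbi hb c
  · rw [mem_window, not_and_or, not_le, not_lt] at hb
    rw [← ent_fin, ← ent_fin]
    rcases hb with hb | hb
    · rw [hA.1 b hb c c.2, hB.1 b hb c c.2]
    · rw [hA.2.1 b hb c, hB.2.1 b hb c]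

/-- Matrices with the same word are equivalent up to a shift of the weight. -/
theorem linked_of_rowWord (hA : Within u p A.ent) (hB : Within u q B.ent)
    (h : rowWord u p A.ent = rowWord u q B.ent) :
    Linked (crystalStar u) (crystalStar u) (fun _ => (q.1 : ℤ) - p.1) A B := by
  -- Row sums are invariant under 𝔤𝔩_u. Fixing them on both sides makes the relation one-to-one.
  let Q : (ℕ × ℕ) → FockMatrix u → FockMatrix u → Prop := fun p A X =>
    Within u p X.ent ∧ ∀ b, pre X.ent b u = pre A.ent b u
  have hQ : ∀ {p : ℕ × ℕ} {A X X' : FockMatrix u} {d j}, Q p A X →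
      (crystalStar u).op d j X = some X' → Q p A X' := fun hX h =>
    ⟨within_opStar hX.1 h, fun b => by rw [pre_opStar h, hX.2]⟩
  have step : ∀ {p q : ℕ × ℕ} {X Y X' : FockMatrix u} {d j}, Within u p X.ent →
      Within u q Y.ent → rowWord u p X.ent = rowWord u q Y.ent →
      (crystalStar u).op d j X = some X' →
      ∃ Y', (crystalStar u).op d j Y = some Y' ∧ rowWord u p X'.ent = rowWord u q Y'.ent := by
    intro p q X Y X' d j hX hY hXY h
    have h1 := op_rowWord (d := d) (j := j) hX
    rw [hXY, op_rowWord hY, h, Option.map_some, Option.map_eq_some_iff] at h1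
    obtain ⟨Y', h2, h3⟩ := h1
    exact ⟨Y', h2, h3.symm⟩
  refine ⟨fun X Y => Q p A X ∧ Q q B Y ∧ rowWord u p X.ent = rowWord u q Y.ent,
    ⟨?_, ?_, ?_, ?_, ?_, ?_⟩, ⟨hA, fun _ => rfl⟩, ⟨hB, fun _ => rfl⟩, h⟩
  · rintro X Y ⟨hX, hY, hXY⟩ i
    rw [sigStar_eq hX.1, sigStar_eq hY.1, ← rowWord_sig, ← rowWord_sig, hXY]
  · rintro X Y ⟨hX, hY, hXY⟩
    funext c
    have h1 := wordWt_rowWord hX.1 c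
    rw [hXY, wordWt_rowWord hY.1] at h1
    simp only [Pi.add_apply]
    omega
  · rintro X Y ⟨hX, hY, hXY⟩ d i X' hX'
    obtain ⟨Y', hY', h'⟩ := step hX.1 hY.1 hXY hX'
    exact ⟨Y', hY', hQ hX hX', hQ hY hY', h'⟩
  · rintro X Y ⟨hX, hY, hXY⟩ d i Y' hY'
    obtain ⟨X', hX', h'⟩ := step hY.1 hX.1 hXY.symm hY'
    exact ⟨X', hX', hQ hX hX', hQ hY hY', h'.symm⟩
  · rintro X X' Y ⟨hX, hY, hXY⟩ ⟨hX', _, hXY'⟩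
    exact eq_of_rowWord hX.1 hX'.1 (hXY.trans hXY'.symm) fun b => by rw [hX.2, hX'.2]
  · rintro X Y Y' ⟨hX, hY, hXY⟩ ⟨_, hY', hXY'⟩
    exact eq_of_rowWord hY.1 hY'.1 (hXY.symm.trans hXY') fun b => by rw [hY.2, hY'.2]

theorem rows_succ (m : ℕ) : rows (m + 1, 0) = rows (m, 0) ++ [-((m : ℤ) + 1)] := by
  rw [rows, rows, window_eq, window_eq]
  simp only [add_zero]
  rw [List.range_succ_eq_map, List.map_cons, List.reverse_cons, List.map_map]
  congr 1
  · congr 1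
    refine List.map_congr_left fun t _ => ?_
    simp

/-- Every word is the word of an even matrix. -/
theorem exists_rowWord (t : ℕ) (W : List (Fin u)) :
    ∃ a, Within u (t + W.length, 0) a ∧ Valid a ∧ rowWord u (t + W.length, 0) a = W := by
  induction W using List.reverseRecOn with
  | nil =>
    -- For the empty word, the t rows of the window are empty and all rows below it are full.
    refine ⟨fun b c => if b < -(t : ℤ) ∧ c < u then 1 else 0, ⟨fun b hb c hc => ?_,
      fun b hb c => ?_, fun b c hc => ?_⟩, fun b hb c => ?_, ?_⟩
    · simp only [List.length_nil, add_zero] at hb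
      exact if_pos ⟨hb, hc⟩
    · simp only [Nat.cast_zero] at hb
      exact if_neg (by omega)
    · exact if_neg (by omega)
    · simp only
      split_ifs <;> omega
    · rw [rowWord, List.flatMap_eq_nil_iff]
      intro b hb
      have hb := (mem_rows.1 hb).1
      simp only [List.length_nil, add_zero] at hb
      have : ¬ b < -(t : ℤ) := by omega
      simp [rowPart, multWord, this]
  | append_singleton W w ih =>
    obtain ⟨a, h1, h2, h3⟩ := ih
    -- The new letter stands alone in the row just below the old window, which is read last and was
    -- full before.
    refine ⟨fun b c => if b = -((t + W.length : ℕ) : ℤ) - 1 then (if c = w then 1 else 0) else a b c,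
      ⟨fun b hb c hc => ?_, fun b hb c => ?_, fun b c hc => ?_⟩, fun b hb c => ?_, ?_⟩
    · simp only [List.length_append, List.length_singleton] at hb
      simp only
      rw [if_neg (by omega)]
      exact h1.1 b (by simp only; omega) c hc
    · simp only [Nat.cast_zero] at hb
      simp only
      rw [if_neg (by omega)]
      exact h1.2.1 b hb c
    · have := w.2
      simp only
      split_ifs
      · omega
      · rfl
      · exact h1.2.2 b c hc
    · simp only
      split_ifs
      · omega
      · omega
      · exact h2 b hb c
    · rw [List.length_append, List.length_singleton, ← add_assoc, rowWord, rows_succ,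
        List.flatMap_append, List.flatMap_singleton]
      congr 1
      · refine Eq.trans (flatMap_congr' fun b hb => ?_) h3
        have hb := (mem_rows.1 hb).1
        simp only at hb
        congr 1
        funext c
        rw [if_neg (by omega)]
      · have hrow : (fun c : ℕ => if -(((t + W.length : ℕ) : ℤ) + 1) = -((t + W.length : ℕ) : ℤ) - 1
            then (if c = w then 1 else 0) else a (-(((t + W.length : ℕ) : ℤ) + 1)) c) =
            fun c : ℕ => if c = w then 1 else 0 := by
          funext c
          rw [if_pos (by ring)]
        rw [hrow, rowPart, if_pos (by omega), multWord_eq_filter _ fun c => by split_ifs <;> omega]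
        have : (List.finRange u).filter (fun c : Fin u => decide ((if (c : ℕ) = w then 1 else 0) = 1)) =
            (List.finRange u).filter (· = w) := by
          refine List.filter_congr fun c _ => ?_
          simp [Fin.ext_iff]
        rw [this, List.filter_eq, List.count_eq_one_of_mem (List.nodup_finRange u)
          (List.mem_finRange w)]
        rfl

/-- Below the window the rows are full, so their prefix sums dominate automatically. -/
theorem isEvenTop_of_killed {m : ℕ} (hp : Within u (m, 0) A.ent)
    (h : ∀ i : ℤ, -(m : ℤ) < i → i < 0 → (crystal u).op true i A = none) : IsEvenTop A := by
  refine ⟨fun b hb c => hp.2.1 b hb c, fun i hi => ?_⟩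
  rcases lt_or_ge (-(m : ℤ)) i with h1 | h1
  · exact h i h1 hi
  · rw [e_eq_none_iff hi]
    intro c hc
    have : pre A.ent (i - 1) c = c := by
      rw [pre, Finset.sum_congr rfl fun c' hc' => hp.1 (i - 1) (by simp only; omega) c'
        (lt_of_lt_of_le (Finset.mem_range.1 hc') hc)]
      simp
    rw [this]
    exact A.pre_le_self hi c

/-- An arbitrary matrix is first replaced by one without letters of degree 1 that has the same row
word. Raising by 𝔤 then keeps the 𝔤𝔩_u-class and ends at a matrix that encodes a rational tableau.
-/
theorem exists_linked_rational (A : FockMatrix u) : ∃ (mu : GenPartition u)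
    (T : RationalTableau mu), Linked (crystalStar u) (rationalCrystal mu) 0 A T := by
  obtain ⟨p, hp⟩ := A.exists_within
  -- With t = `p.1` the two windows differ at the bottom by the length of the word, which is then
  -- the shift of the weight.
  obtain ⟨a, h1, h2, h3⟩ := exists_rowWord p.1 (rowWord u p A.ent)
  obtain ⟨B, rfl⟩ := exists_ent h1 h2
  have l1 := linked_of_rowWord hp h1 h3.symm
  obtain ⟨C, hBC, hC, hkill⟩ := exists_reach_op true (S := {i : ℤ |
    -((p.1 + (rowWord u p A.ent).length : ℕ) : ℤ) < i ∧ i < 0})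
    (fun i hi => ⟨by simp only [Set.mem_ofPred_eq] at hi; simp only; omega, by simpa using hi.2⟩) h1
  have l2 := linkedStar_of_reach hBC
  have hev := isEvenTop_of_killed hC fun i h1 h2 => hkill i ⟨h1, h2⟩
  -- N is the length of the word, so that the shift by N of the tableau undoes the shift of the
  -- weight.
  obtain ⟨mu, hs⟩ := exists_shape hev (rowWord u p A.ent).length
  obtain ⟨T, hT⟩ := exists_encodes hev hs
  have l3 := (l1.trans l2).trans hT.linked.symm
  refine ⟨mu, T, ?_⟩
  convert l3 using 1
  funext c
  simp

end FockMatrix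

/-! ### The decomposition -/

namespace FockMatrix

open Grid Signature CrystalData

variable {u : ℕ} {lam : GenPartition u} {A A' B : FockMatrix u}

theorem op_semiInf (d : Bool) (i : ℤ) (t : semiInfTableaux lam) :
    ((semiInfCrystal lam).op d i t).map (fun t => occEquiv u t.1) =
      (crystal u).op d i (occEquiv u t.1) := by
  have h := comap_op Subtype.val_injective (semiInf_stable lam) d i t
  rw [(op_occEquiv d t.1 i).1, ← h, Option.map_map]
  rfl

theorem semiInf_injective (lam : GenPartition u) :
    Function.Injective fun t : semiInfTableaux lam => occEquiv u t.1 :=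
  (occEquiv u).injective.comp Subtype.val_injective

theorem linked_semiInf (t : semiInfTableaux lam) :
    Linked (semiInfCrystal lam) (crystal u) 0 t (occEquiv u t.1) :=
  Linked.of_injective (semiInf_injective lam) (fun i t => (sig_occEquiv t.1 i).symm)
    (fun t => by rw [add_zero, wt_occEquiv]; rfl) op_semiInf t

theorem isCrystal_semiInf (lam : GenPartition u) : (semiInfCrystal lam).IsCrystal :=
  (isCrystal u).of_injective (s := 0) (semiInf_injective lam) (fun i => map_zero _)
    (fun i t => (sig_occEquiv t.1 i).symm) (fun t => by rw [add_zero, wt_occEquiv]; rfl) op_semiInf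

theorem semiInf_killed (t : semiInfTableaux lam) (j : Fin (u - 1)) :
    (crystalStar u).op false j (occEquiv u t.1) = none := (mem_semiInfTableaux_iff.1 t.2).2 j

theorem semiInf_wtStar (t : semiInfTableaux lam) (c : Fin u) :
    (crystalStar u).wt (occEquiv u t.1) c = -lam.1 c := (mem_semiInfTableaux_iff.1 t.2).1 c

/-- Lowest weight elements for `𝔤𝔩_u` are semi-infinite tableaux. -/
theorem exists_semiInf_of_killed (h : ∀ j, (crystalStar u).op false j A = none) :
    ∃ (lam : GenPartition u) (t : semiInfTableaux lam), occEquiv u t.1 = A := by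
  have hanti : Antitone fun c => -(crystalStar u).wt A c := by
    -- At an element killed by f*_j one has φ = 0, so the value of the coroot is −ε ≤ 0.
    have step : ∀ j : Fin (u - 1), (crystalStar u).wt A (glLo j) ≤ (crystalStar u).wt A (glHi j) := by
      intro j
      have h1 := (isCrystalStar u).even j A (by change ¬ (-1 : SignType) = 0; decide)
      have h2 := opStar_eq_none_iff.1 (h j)
      change (crystalStar u).φ j A = 0 at h2
      change _ = (crystalStar u).wt A (glLo j) - (crystalStar u).wt A (glHi j) at h1
      omega
    intro c c' hcc
    obtain ⟨c, hc⟩ := c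
    obtain ⟨c', hc'⟩ := c'
    rw [Fin.mk_le_mk] at hcc
    simp only [neg_le_neg_iff]
    induction hcc with
    | refl => exact le_rfl
    | @step c' _ ih => exact (ih (by omega)).trans (step ⟨c', by omega⟩)
  refine ⟨⟨_, hanti⟩, ⟨(occEquiv u).symm A, mem_semiInfTableaux_iff.2 ⟨fun c => ?_, fun j => ?_⟩⟩, ?_⟩
  · rw [Equiv.apply_symm_apply, neg_neg]
  · rw [Equiv.apply_symm_apply]
    exact h j
  · exact Equiv.apply_symm_apply _ _

/-- The relation whose graph is the correspondence between matrices and pairs of tableaux. -/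
def Corresponds (A : FockMatrix u) (t : Σ lam : GenPartition u, semiInfTableaux lam)
    (T : Σ mu : GenPartition u, RationalTableau mu) : Prop :=
  Linked (crystal u) (semiInfCrystal t.1) 0 A t.2 ∧
    Linked (crystalStar u) (rationalCrystal T.1) 0 A T.2

variable {t t' : Σ lam : GenPartition u, semiInfTableaux lam}
  {T T' : Σ mu : GenPartition u, RationalTableau mu}

theorem linked_occ (h : Linked (crystal u) (semiInfCrystal t.1) 0 A t.2) :
    Linked (crystal u) (crystal u) 0 A (occEquiv u t.2.1) := by
  simpa using h.trans (linked_semiInf t.2)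

/-- In the matrix model both tableaux are lowest 𝔤𝔩_u-elements of one 𝔤-class, so rigidity makes
them equal; λ is then read off from the 𝔤𝔩_u-weight. -/
theorem semiInf_unique (h : Linked (crystal u) (semiInfCrystal t.1) 0 A t.2)
    (h' : Linked (crystal u) (semiInfCrystal t'.1) 0 A t'.2) : t = t' := by
  have hl : Linked (crystal u) (crystal u) 0 (occEquiv u t.2.1) (occEquiv u t'.2.1) := by
    simpa using (linked_occ h).symm.trans (linked_occ h')
  have heq := eq_of_linked (semiInf_killed t.2) (semiInf_killed t'.2) hl
  obtain ⟨lam, t⟩ := t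
  obtain ⟨lam', t'⟩ := t'
  have hlam : lam = lam' := by
    refine Subtype.ext (funext fun c => ?_)
    have h1 := semiInf_wtStar t c
    have h2 := semiInf_wtStar t' c
    simp only at heq
    rw [heq, h1] at h2
    omega
  subst hlam
  exact congrArg (Sigma.mk lam) (semiInf_injective lam heq).symm

theorem linked_matrix {N : ℕ} (hN : ∀ k, T.1.1 k ≤ N)
    (h : Linked (crystalStar u) (rationalCrystal T.1) 0 A T.2) :
    Linked (crystalStar u) (crystalStar u) (fun _ => (N : ℤ)) A (T.2.matrix N) := by
  simpa using h.trans (T.2.encodes hN).linked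

theorem rational_unique (h : Linked (crystalStar u) (rationalCrystal T.1) 0 A T.2)
    (h' : Linked (crystalStar u) (rationalCrystal T'.1) 0 A T'.2) : T = T' := by
  obtain ⟨N, hN⟩ := T.1.exists_bound
  obtain ⟨N', hN'⟩ := T'.1.exists_bound
  -- A common bound lets both tableaux be encoded with the same shift, so that their matrices become
  -- comparable.
  have b1 : ∀ k, T.1.1 k ≤ ((N + N' : ℕ) : ℤ) := fun k => by have := hN k; omega
  have b2 : ∀ k, T'.1.1 k ≤ ((N + N' : ℕ) : ℤ) := fun k => by have := hN' k; omega
  have hl : Linked (crystalStar u) (crystalStar u) 0 (T.2.matrix (N + N')) (T'.2.matrix (N + N')) := by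
    simpa using (linked_matrix b1 h).symm.trans (linked_matrix b2 h')
  have e1 := T.2.encodes b1
  have e2 := T'.2.encodes b2
  have hmu := e1.hasShape.unique e1.isEvenTop e2.isEvenTop hl e2.hasShape
  have heq := e1.isEvenTop.eq_of_linked e2.isEvenTop hl
  rw [heq] at e2
  obtain ⟨mu, T⟩ := T
  obtain ⟨mu', T'⟩ := T'
  simp only at hmu
  subst hmu
  exact congrArg (Sigma.mk mu) (e1.injective e2)

/-- Lowering by the f*_j does not change the 𝔤-class, and where it stops there is a semi-infinite
tableau. -/
theorem exists_semiInf (A : FockMatrix u) : ∃ t : Σ lam : GenPartition u, semiInfTableaux lam,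
    Linked (crystal u) (semiInfCrystal t.1) 0 A t.2 := by
  obtain ⟨B, hAB, hB⟩ := exists_reach_opStar false A
  obtain ⟨lam, t, rfl⟩ := exists_semiInf_of_killed hB
  exact ⟨⟨lam, t⟩, by simpa using (linked_of_reachStar hAB).trans (linked_semiInf t).symm⟩

theorem evenTop_reach {N : ℕ} {mu : GenPartition u} {d : Bool} {S : Set (Fin (u - 1))}
    (hAB : (crystalStar u).Reach d S A B) (h : IsEvenTop A ∧ HasShape A N mu) :
    IsEvenTop B ∧ HasShape B N mu := hAB.invariant (Q := fun A => IsEvenTop A ∧ HasShape A N mu)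
    (fun _ _ _ _ hX hXY => ⟨hX.1.opStar hXY, hX.2.opStar hXY⟩) h

/-- The weight of the lowest weight element of a component. -/
theorem wtStar_of_killed (hB : ∀ j, (crystalStar u).op false j B = none)
    (h : Linked (crystalStar u) (rationalCrystal T.1) 0 B T.2) (c : Fin u) :
    (crystalStar u).wt B c = T.1.1 c.rev := by
  obtain ⟨N, hN⟩ := T.1.exists_bound
  have b1 := fun k => (hN k).1
  have hl := linked_matrix b1 h
  have e1 := T.2.encodes b1
  have := wtStar_of_bottom e1.isEvenTop e1.hasShape (fun j => hl.op_none.1 (hB j)) c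
  have h2 := congrFun hl.wt_eq c
  simp only [Pi.add_apply] at h2
  omega

/-- The shapes of the two tableaux of a matrix are dual to each other. -/
theorem Corresponds.shape (h : Corresponds A t T) : T.1 = t.1.star := by
  obtain ⟨B, hAB, hB⟩ := exists_reach_opStar false A
  have h1 : Linked (crystal u) (crystal u) 0 B (occEquiv u t.2.1) := by
    simpa using (linked_of_reachStar hAB).symm.trans (linked_occ h.1)
  -- By rigidity the lowest element reached from A is the matrix of the tableau t, of weight −λ. Its
  -- weight computed through T is μ reversed.
  have h2 := eq_of_linked hB (semiInf_killed t.2) h1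
  obtain ⟨T', hT', hBT'⟩ := h.2.reach hAB
  have hw := fun c => wtStar_of_killed (T := ⟨T.1, T'⟩) hB hBT' c
  refine Subtype.ext (funext fun c => ?_)
  have h3 := hw c.rev
  rw [← h2, semiInf_wtStar, Fin.rev_rev] at h3
  exact h3.symm

/-- A matrix is determined by its two tableaux. -/
theorem Corresponds.injective (h : Corresponds A t T) (h' : Corresponds A' t T) : A' = A := by
  have hl : Linked (crystalStar u) (crystalStar u) 0 A A' := by simpa using h.2.trans h'.2.symm
  obtain ⟨B, hAB, hB⟩ := exists_reach_opStar false A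
  refine hl.eq_of_reach (isCrystalStar u).reversible hAB fun B' hAB' hBB' => ?_
  have h1 : Linked (crystal u) (crystal u) 0 B (occEquiv u t.2.1) := by
    simpa using (linked_of_reachStar hAB).symm.trans (linked_occ h.1)
  have h2 : Linked (crystal u) (crystal u) 0 B' (occEquiv u t.2.1) := by
    simpa using (linked_of_reachStar hAB').symm.trans (linked_occ h'.1)
  -- The lowest elements reached from A and from A' are both the matrix of t; the common path leads
  -- back to A and A'.
  rw [← eq_of_linked hB (semiInf_killed t.2) h1,
    ← eq_of_linked (fun j => hBB'.op_none.1 (hB j)) (semiInf_killed t.2) h2]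

theorem IsEvenTop.eq_of_bottom {N : ℕ} {mu : GenPartition u} (h : IsEvenTop A) (h' : IsEvenTop A')
    (hf : ∀ j, (crystalStar u).op false j A = none)
    (hf' : ∀ j, (crystalStar u).op false j A' = none)
    (hs : HasShape A N mu) (hs' : HasShape A' N mu) : A = A' := by
  refine ent_injective (funext fun b => funext fun c => ?_)
  rcases lt_or_ge b 0 with hb | hb
  · rcases lt_or_ge c u with hc | hc
    · have h1 := h.mem_iff_of_up hf hb hc
      have h2 := h'.mem_iff_of_up hf' hb hc
      rw [← hs.pre_eq hs' hb] at h2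
      have := A.ent_le_one_of_neg hb c
      have := A'.ent_le_one_of_neg hb c
      omega
    · rw [A.ent_of_le _ hc, A'.ent_of_le _ hc]
  · rw [h.even b hb, h'.even b hb]

theorem _root_.CrystalData.Reach.reverse {I P X : Type} [AddCommGroup P] {D : CartanDatum I P}
    {C : CrystalData D X} (hC : C.Reversible) {d : Bool} {S : Set I} {x y : X}
    (h : C.Reach d S x y) : C.Reach (!d) S y x := by
  induction h with
  | refl => exact Relation.ReflTransGen.refl
  | tail _ h ih =>
    obtain ⟨i, hi, h⟩ := h
    exact Relation.ReflTransGen.head ⟨i, hi, hC d i _ _ h⟩ ih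

/-- Lower the matrix of T to a lowest element C. The matrix of t is also lowest, and its rational
tableau has shape λ* as well; as lowest even matrices of one shape coincide, C encodes that tableau.
So the matrix of t can be raised by the path that leads from C back to T. -/
theorem exists_corresponds (t : Σ lam : GenPartition u, semiInfTableaux lam)
    (T : RationalTableau t.1.star) : ∃ A, Corresponds A t ⟨t.1.star, T⟩ := by
  obtain ⟨N, hN⟩ := t.1.star.exists_bound
  have hN := fun k => (hN k).1
  have e1 := T.encodes hN
  obtain ⟨C, hC, hCk⟩ := exists_reach_opStar false (T.matrix N)
  have hCs := evenTop_reach hC ⟨e1.isEvenTop, e1.hasShape⟩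
  obtain ⟨mu, T₀, hT₀⟩ := exists_linked_rational (occEquiv u t.2.1)
  have hshape : mu = t.1.star := Corresponds.shape (T := ⟨mu, T₀⟩)
    ⟨by simpa using (linked_semiInf t.2).symm, hT₀⟩
  subst hshape
  have l0 := linked_matrix (T := ⟨_, T₀⟩) hN hT₀
  have e0 := T₀.encodes hN
  have hk0 := fun j => l0.op_none.1 (semiInf_killed t.2 j)
  have hCeq := e0.isEvenTop.eq_of_bottom hCs.1 hk0 hCk e0.hasShape hCs.2
  simp only at l0
  rw [hCeq] at l0
  -- The path down from the matrix of T, reversed and carried over to the matrix of t, ends at the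
  -- required A.
  obtain ⟨A, hA, hTA⟩ := l0.symm.reach (hC.reverse (isCrystalStar u).reversible)
  refine ⟨A, ?_, ?_⟩
  · simpa using (linked_of_reachStar hA).symm.trans (linked_semiInf t.2).symm
  · simpa using hTA.symm.trans e1.linked.symm

/-- `A` corresponds to an element of the direct sum. -/
def CorrespondsSum (A : FockMatrix u) (z : CauchySum u) : Prop :=
  Corresponds A ⟨z.1, z.2.1⟩ ⟨z.1.star, z.2.2⟩

theorem existsUnique_sum (A : FockMatrix u) : ∃! z : CauchySum u, CorrespondsSum A z := by
  obtain ⟨⟨lam, t⟩, ht⟩ := exists_semiInf A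
  obtain ⟨mu, T, hT⟩ := exists_linked_rational A
  have hshape : mu = lam.star := Corresponds.shape (t := ⟨lam, t⟩) (T := ⟨mu, T⟩) ⟨ht, hT⟩
  subst hshape
  refine ⟨⟨lam, t, T⟩, ⟨ht, hT⟩, ?_⟩
  rintro ⟨lam', t', T'⟩ ⟨ht', hT'⟩
  have e1 := semiInf_unique (t := ⟨lam', t'⟩) (t' := ⟨lam, t⟩) ht' ht
  obtain ⟨rfl, e1⟩ := Sigma.mk.inj e1
  obtain rfl := eq_of_heq e1
  have e2 := rational_unique (T := ⟨_, T'⟩) (T' := ⟨_, T⟩) hT' hT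
  obtain ⟨_, e2⟩ := Sigma.mk.inj e2
  obtain rfl := eq_of_heq e2
  rfl

/-- The decomposition of the set of matrices. -/
noncomputable def sumEquiv (u : ℕ) : FockMatrix u ≃ CauchySum u :=
  Equiv.ofBijective (fun A => (existsUnique_sum A).choose) (by
    have hspec := fun A : FockMatrix u => (existsUnique_sum A).choose_spec.1
    refine ⟨fun A A' h => ?_, fun z => ?_⟩
    · have h1 := hspec A
      have h2 := hspec A'
      simp only at h
      rw [h] at h1
      exact h2.injective h1
    · obtain ⟨A, hA⟩ := exists_corresponds ⟨z.1, z.2.1⟩ z.2.2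
      exact ⟨A, (existsUnique_sum A).unique (hspec A) hA⟩)

theorem sumEquiv_spec (A : FockMatrix u) : CorrespondsSum A (sumEquiv u A) :=
  (existsUnique_sum A).choose_spec.1

theorem sumEquiv_eq {z : CauchySum u} (h : CorrespondsSum A z) : sumEquiv u A = z :=
  (existsUnique_sum A).unique (sumEquiv_spec A) h

end FockMatrix

/-! ### The map ϖ and its compatibility with the operators -/

namespace FockMatrix

open Grid Signature CrystalData

variable {u : ℕ} {lam : GenPartition u} {A A' : FockMatrix u}

theorem equivSemiInf_iff {t : Σ lam : GenPartition u, semiInfTableaux lam} :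
    A.EquivSemiInf t ↔ Linked (crystal u) (semiInfCrystal t.1) 0 A t.2 :=
  ⟨fun h => Equivalent.linked h (isCrystal u).reversible (isCrystal_semiInf t.1).reversible,
    fun h => h.equivalent (isCrystal u).reversible (isCrystal_semiInf t.1).reversible⟩

theorem equivRational_iff {T : Σ mu : GenPartition u, RationalTableau mu} :
    A.EquivRational T ↔ Linked (crystalStar u) (rationalCrystal T.1) 0 A T.2 :=
  ⟨fun h => Equivalent.linked h (isCrystalStar u).reversible (isCrystal_rational T.1).reversible,
    fun h => h.equivalent (isCrystalStar u).reversible (isCrystal_rational T.1).reversible⟩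

theorem existsUnique_equivSemiInf (A : FockMatrix u) : ∃! t, A.EquivSemiInf t := by
  obtain ⟨t, ht⟩ := exists_semiInf A
  exact ⟨t, equivSemiInf_iff.2 ht, fun t' ht' => semiInf_unique (equivSemiInf_iff.1 ht') ht⟩

theorem existsUnique_equivRational (A : FockMatrix u) : ∃! T, A.EquivRational T := by
  obtain ⟨mu, T, hT⟩ := exists_linked_rational A
  exact ⟨⟨mu, T⟩, equivRational_iff.2 hT,
    fun T' hT' => rational_unique (T' := ⟨mu, T⟩) (equivRational_iff.1 hT') hT⟩

theorem varpi_eq {t : Σ lam : GenPartition u, semiInfTableaux lam}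
    {T : Σ mu : GenPartition u, RationalTableau mu} (h : Corresponds A t T) : varpi A = (t, T) := by
  refine Prod.ext ?_ ?_
  · exact (existsUnique_equivSemiInf A).unique
      (Classical.epsilon_spec ⟨t, equivSemiInf_iff.2 h.1⟩) (equivSemiInf_iff.2 h.1)
  · exact (existsUnique_equivRational A).unique
      (Classical.epsilon_spec ⟨T, equivRational_iff.2 h.2⟩) (equivRational_iff.2 h.2)

theorem varpi_spec (A : FockMatrix u) : Corresponds A (varpi A).1 (varpi A).2 := by
  have h := sumEquiv_spec A
  rw [varpi_eq h]
  exact h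

theorem varpi_sumEquiv (A : FockMatrix u) : varpi A =
    (⟨(sumEquiv u A).1, (sumEquiv u A).2.1⟩, ⟨(sumEquiv u A).1.star, (sumEquiv u A).2.2⟩) :=
  varpi_eq (sumEquiv_spec A)

theorem Linked.exists_op {I P X Y : Type} [AddCommGroup P] {D : CartanDatum I P}
    {C : CrystalData D X} {C' : CrystalData D Y} {s : P} {x x' : X} {y : Y} {d : Bool} {i : I}
    (h : Linked C C' s x y) (hx : C.op d i x = some x') :
    ∃ y', C'.op d i y = some y' ∧ Linked C C' s x' y' := by
  obtain ⟨R, hR, hxy⟩ := h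
  obtain ⟨y', h1, h2⟩ := hR.fwd x y hxy d i x' hx
  exact ⟨y', h1, R, hR, h2⟩

theorem Linked.sig_eq {I P X Y : Type} [AddCommGroup P] {D : CartanDatum I P}
    {C : CrystalData D X} {C' : CrystalData D Y} {s : P} {x : X} {y : Y}
    (h : Linked C C' s x y) (i : I) : C'.sig i y = C.sig i x := by
  obtain ⟨R, hR, hxy⟩ := h
  exact (hR.sig x y hxy i).symm

theorem op_sum (d : Bool) (i : ℤ) (z : CauchySum u) : (CauchySum.crystal u).op d i z =
    ((semiInfCrystal z.1).op d i z.2.1).map fun t => ⟨z.1, t, z.2.2⟩ := by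
  have : (CauchySum.crystal u).op d i z = (((semiInfCrystal z.1).op d i z.2.1).map
      fun t => (t, z.2.2)).map (Sigma.mk z.1) := by cases d <;> rfl
  rw [this, Option.map_map]
  rfl

theorem opStar_sum (d : Bool) (j : Fin (u - 1)) (z : CauchySum u) :
    (CauchySum.crystalStar u).op d j z =
      ((rationalCrystal z.1.star).op d j z.2.2).map fun T => ⟨z.1, z.2.1, T⟩ := by
  have : (CauchySum.crystalStar u).op d j z = (((rationalCrystal z.1.star).op d j z.2.2).map
      fun T => (z.2.1, T)).map (Sigma.mk z.1) := by cases d <;> rfl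
  rw [this, Option.map_map]
  rfl

/-- The first tableau follows the operator through the link, while the 𝔤𝔩_u-class, and with it the
second tableau, does not change. -/
theorem op_sumEquiv (d : Bool) (i : ℤ) (A : FockMatrix u) :
    (CauchySum.crystal u).op d i (sumEquiv u A) = ((crystal u).op d i A).map (sumEquiv u) := by
  have hA := sumEquiv_spec A
  rw [op_sum]
  cases h : (crystal u).op d i A with
  | none =>
    rw [hA.1.op_none.1 h]
    rfl
  | some A' =>
    obtain ⟨t', h1, h2⟩ := Linked.exists_op hA.1 h
    rw [h1]
    refine congrArg some (sumEquiv_eq (z := ⟨_, t', _⟩) ⟨h2, ?_⟩).symm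
    simpa using (linkedStar_of_op h).symm.trans hA.2

theorem opStar_sumEquiv (d : Bool) (j : Fin (u - 1)) (A : FockMatrix u) :
    (CauchySum.crystalStar u).op d j (sumEquiv u A) =
      ((crystalStar u).op d j A).map (sumEquiv u) := by
  have hA := sumEquiv_spec A
  rw [opStar_sum]
  cases h : (crystalStar u).op d j A with
  | none =>
    rw [hA.2.op_none.1 h]
    rfl
  | some A' =>
    obtain ⟨T', h1, h2⟩ := Linked.exists_op hA.2 h
    rw [h1]
    refine congrArg some (sumEquiv_eq (z := ⟨_, _, T'⟩) ⟨?_, h2⟩).symm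
    simpa using (linked_of_opStar h).symm.trans hA.1

theorem isIso_sumEquiv (u : ℕ) : (crystal u).IsIso (CauchySum.crystal u) (sumEquiv u) where
  wt A := ((sumEquiv_spec A).1.wt_eq.trans (add_zero _)).symm
  ε i A := congrArg Prod.fst (Linked.sig_eq (sumEquiv_spec A).1 i)
  φ i A := congrArg Prod.snd (Linked.sig_eq (sumEquiv_spec A).1 i)
  e := op_sumEquiv true
  f := op_sumEquiv false

theorem isIsoStar_sumEquiv (u : ℕ) :
    (crystalStar u).IsIso (CauchySum.crystalStar u) (sumEquiv u) where
  wt A := ((sumEquiv_spec A).2.wt_eq.trans (add_zero _)).symm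
  ε j A := congrArg Prod.fst (Linked.sig_eq (sumEquiv_spec A).2 j)
  φ j A := congrArg Prod.snd (Linked.sig_eq (sumEquiv_spec A).2 j)
  e := opStar_sumEquiv true
  f := opStar_sumEquiv false

end FockMatrix

/-! ### Transport of bicrystals along isomorphisms -/

namespace CrystalData

variable {I P J Q X Y : Type} [AddCommGroup P] [AddCommGroup Q] {D : CartanDatum I P}
  {D' : CartanDatum J Q} {C : CrystalData D X} {C' : CrystalData D Y} {E : CrystalData D' X}
  {E' : CrystalData D' Y} {ψ : X ≃ Y}

theorem IsIso.op (h : C.IsIso C' ψ) (d : Bool) (i : I) (x : X) :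
    C'.op d i (ψ x) = (C.op d i x).map ψ := by
  cases d
  exacts [h.f i x, h.e i x]

theorem IsIso.isCrystal (h : C.IsIso C' ψ) (hC : C.IsCrystal) : C'.IsCrystal := by
  refine hC.of_injective (r := ψ.symm) (s := 0) ψ.symm.injective (fun i => map_zero _) ?_ ?_ ?_
  · intro i y
    obtain ⟨x, rfl⟩ := ψ.surjective y
    rw [Equiv.symm_apply_apply]
    exact Prod.ext (h.ε i x) (h.φ i x)
  · intro y
    obtain ⟨x, rfl⟩ := ψ.surjective y
    rw [Equiv.symm_apply_apply, add_zero, h.wt]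
  · intro d i y
    obtain ⟨x, rfl⟩ := ψ.surjective y
    rw [Equiv.symm_apply_apply, h.op, Option.map_map, Equiv.symm_comp_self, Option.map_id, id]

theorem _root_.IsBicrystal.of_isIso (h : IsBicrystal C E) (hC : C.IsIso C' ψ) (hE : E.IsIso E' ψ) :
    IsBicrystal C' E' := by
  have key : ∀ d d' i j y, (∀ x, (E.op d' j x).bind (C.op d i) = (C.op d i x).bind (E.op d' j)) →
      (E'.op d' j y).bind (C'.op d i) = (C'.op d i y).bind (E'.op d' j) := by
    intro d d' i j y hx
    obtain ⟨x, rfl⟩ := ψ.surjective y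
    have e1 : (E'.op d' j (ψ x)).bind (C'.op d i) = ((E.op d' j x).bind (C.op d i)).map ψ := by
      rw [hE.op]
      cases E.op d' j x with
      | none => rfl
      | some x' => exact hC.op d i x'
    have e2 : (C'.op d i (ψ x)).bind (E'.op d' j) = ((C.op d i x).bind (E.op d' j)).map ψ := by
      rw [hC.op]
      cases C.op d i x with
      | none => rfl
      | some x' => exact hE.op d' j x'
    rw [e1, e2, hx]
  exact ⟨hC.isCrystal h.left, hE.isCrystal h.right,
    fun i j y => key true true i j y (h.ee i j), fun i j y => key true false i j y (h.ef i j),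
    fun i j y => key false true i j y (h.fe i j), fun i j y => key false false i j y (h.ff i j)⟩

end CrystalData

/-! ### Highest weight elements -/

theorem Finset.sum_Ico_sub_add_one {g : ℤ → ℤ} {a b : ℤ} (h : a ≤ b) :
    ∑ x ∈ Finset.Ico a b, (g x - g (x + 1)) = g a - g b := by
  induction a, h using Int.leInductionDown with
  | base => simp
  | pred a h ih =>
    rw [← Finset.insert_Ico_add_one_left_eq_Ico (by omega : a - 1 < b),
      Finset.sum_insert (by simp), sub_add_cancel, ih]
    ring

theorem Finset.sum_Ico_add_sum_Ico {g : ℤ → ℤ} {a b c : ℤ} (h : a ≤ b) (h' : b ≤ c) :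
    ∑ x ∈ Finset.Ico a b, g x + ∑ x ∈ Finset.Ico b c, g x = ∑ x ∈ Finset.Ico a c, g x := by
  rw [← Finset.Ico_union_Ico_eq_Ico h h',
    Finset.sum_union (Finset.Ico_disjoint_Ico_consecutive _ _ _)]

theorem highestWord_occ {u : ℕ} (lam : GenPartition u) (c : Fin u) (b : ℤ) :
    (highestWord lam c).occ b = if b < 0 then (if b + lam.1 c < 0 then 1 else 0)
      else if b + c + 1 = u then (-lam.1 c).toNat else 0 := by
  have hc := c.2
  have empty : (∀ k, (highestWord lam c).letter k ≠ b) → (highestWord lam c).occ b = 0 := by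
    intro h
    rw [FockWord.occ, Set.eq_empty_of_forall_notMem (s := {k | _}) h, Set.ncard_empty]
  simp only [highestWord] at empty
  split_ifs with h1 h2 h2
  · rw [FockWord.occ, Set.ncard_eq_one]
    refine ⟨(-b - 1 - lam.1 c).toNat, Set.ext fun k => ?_⟩
    rw [Set.mem_ofPred_eq, Set.mem_singleton_iff, highestWord]
    simp only
    split_ifs <;> omega
  · refine empty fun k => ?_
    split_ifs <;> omega
  · have : {k | (highestWord lam c).letter k = b} = Finset.range (-lam.1 c).toNat := by
      ext k
      rw [Set.mem_ofPred_eq, Finset.mem_coe, Finset.mem_range, highestWord]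
      simp only
      split_ifs <;> omega
    rw [FockWord.occ, this, Set.ncard_coe_finset, Finset.card_range]
  · refine empty fun k => ?_
    split_ifs <;> omega

namespace FockMatrix

open Grid Signature CrystalData

variable {u : ℕ} {lam : GenPartition u} {A : FockMatrix u}

theorem muOf_succ (lam : GenPartition u) (x : ℕ) :
    muOf lam (x + 1) = if h : x < u then (-lam.1 (Fin.rev ⟨x, h⟩)).toNat else 0 := by
  have hocc : ∀ c : Fin u, (highestWord lam c).occ (((x + 1 : ℕ) : ℤ) - 1) =
      if (x : ℤ) + c + 1 = u then (-lam.1 c).toNat else 0 := by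
    intro c
    rw [highestWord_occ, if_neg (by omega)]
    push_cast
    rw [add_sub_cancel_right]
  unfold muOf
  split_ifs with h
  · rw [Finset.sum_eq_single (Fin.rev ⟨x, h⟩), hocc, if_pos (by rw [Fin.val_rev]; simp only; omega)]
    · intro c _ hne
      rw [hocc, if_neg]
      intro heq
      exact hne (Fin.ext (by rw [Fin.val_rev]; simp only; omega))
    · simp
  · refine Finset.sum_eq_zero fun c _ => ?_
    have := c.2
    rw [hocc, if_neg (by omega)]

/-- The number of letters `x` in `H^λ`. -/
noncomputable def oddCount (lam : GenPartition u) (x : ℤ) : ℤ := muOf lam (x.toNat + 1)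

theorem oddCount_of_le {x : ℤ} (h : (u : ℤ) ≤ x) : oddCount lam x = 0 := by
  rw [oddCount, muOf_succ, dif_neg (by omega)]
  rfl

theorem highestWord_occ_of_nonneg {b : ℤ} (hb : 0 ≤ b) (c : Fin u) :
    ((highestWord lam c).occ b : ℤ) = if b = u - 1 - c then oddCount lam b else 0 := by
  have := c.2
  rw [highestWord_occ, if_neg (by omega)]
  split_ifs with h1 h2 h2
  · rw [oddCount, muOf_succ, dif_pos (by omega)]
    have : c = Fin.rev ⟨b.toNat, by omega⟩ := Fin.ext (by rw [Fin.val_rev]; simp only; omega)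
    rw [← this]
  all_goals omega

theorem highest_ent_of_neg {b : ℤ} (hb : b < 0) (c : Fin u) :
    (highest lam).ent b c = (highestWord lam c.rev).occ b := by
  rw [ent_fin, highestWord_occ, if_pos hb]
  simp only [highest, if_pos hb]
  congr 1
  refine propext ⟨?_, fun h => ⟨(-b - 1 - lam.1 c.rev).toNat, ?_⟩⟩
  · rintro ⟨k, hk⟩
    have := c.rev.2
    simp only [highestWord] at hk
    split_ifs at hk <;> omega
  · simp only [highestWord]
    rw [if_neg (by omega)]
    omega

/-- Written with `oddCount`, the entry depends on b + c only and is a difference of consecutive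
values. Hence sums along rows and columns telescope. -/
theorem highest_ent_of_nonneg {b : ℤ} (hb : 0 ≤ b) {c : ℕ} (hc : c < u) :
    ((highest lam).ent b c : ℤ) = oddCount lam (b + c) - oddCount lam (b + c + 1) := by
  rw [ent, dif_pos hc]
  simp only [highest, if_neg (not_lt.2 hb)]
  have e1 : (b + c).toNat + 1 = b.toNat + 1 + c := by omega
  have e2 : (b + c + 1).toNat + 1 = b.toNat + 1 + c + 1 := by omega
  rw [oddCount, oddCount, e1, e2]
  split_ifs with h
  · have hmono : muOf lam (b.toNat + 1 + c + 1) ≤ muOf lam (b.toNat + 1 + c) := by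
      rw [← e2, ← e1, muOf_succ, muOf_succ, dif_pos (by omega : (b + c).toNat < u)]
      split_ifs with h1
      · have := lam.2 (Fin.rev_le_rev.2 (Fin.mk_le_mk.2 (by omega) :
          (⟨(b + c).toNat, by omega⟩ : Fin u) ≤ ⟨(b + c + 1).toNat, h1⟩))
        omega
      · omega
    have hzero : nuOf lam (b.toNat + 1 + c) =
        muOf lam (b.toNat + 1 + c) - muOf lam (b.toNat + 1 + c + 1) := by
      unfold nuOf
      split_ifs with h1
      · rw [← e2, muOf_succ, dif_neg (by omega)]
      · rfl
    rw [hzero]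
    omega
  · rw [← e2, ← e1, muOf_succ, muOf_succ, dif_neg (by omega), dif_neg (by omega)]
    rfl

/-- In the rows of degree 0 the matrices differ by reversal of the columns. In a row b of degree 1
the telescoping sum gives the number of corresponding letters in H^λ. -/
theorem wt_highest (lam : GenPartition u) :
    (crystal u).wt (highest lam) = (crystal u).wt (occEquiv u (highestSemiInf lam).1) := by
  refine Prod.ext rfl (Finsupp.ext fun b => ?_)
  rw [wt_snd, wt_snd, Finset.sum_sub_distrib, Finset.sum_sub_distrib, sub_left_inj]
  change _ = ∑ c ∈ Finset.range u, ((occEquiv u (highestWord lam)).ent b c : ℤ)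
  rcases lt_or_ge b 0 with hb | hb
  · rw [Finset.sum_range, Finset.sum_range, ← Equiv.sum_comp Fin.revPerm]
    refine Finset.sum_congr rfl fun c _ => ?_
    rw [highest_ent_of_neg hb, occEquiv_ent, Fin.revPerm_apply, Fin.rev_rev]
  · have h1 : ∑ c ∈ Finset.range u, ((highest lam).ent b c : ℤ) = oddCount lam b := by
      rw [Finset.sum_congr rfl fun c hc => highest_ent_of_nonneg hb (Finset.mem_range.1 hc)]
      have := Finset.sum_range_sub' (fun c => oddCount lam (b + c)) u
      simp only [Nat.cast_add, Nat.cast_one, ← add_assoc] at this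
      rw [this, oddCount_of_le (x := b + u) (by omega)]
      simp
    rw [h1, Finset.sum_range]
    simp only [occEquiv_ent]
    rw [oddCount, muOf]
    push_cast
    refine Finset.sum_congr rfl fun c _ => ?_
    rw [add_sub_cancel_right, Int.toNat_of_nonneg hb]

theorem wtStar_highest (lam : GenPartition u) (c : Fin u) :
    (crystalStar u).wt (highest lam) c = lam.star.1 c := by
  obtain ⟨q, hq⟩ := (highest lam).exists_within
  obtain ⟨q', hq'⟩ := (occEquiv u (highestSemiInf lam).1).exists_within
  have h1 := hq.mono ((le_sup_left (b := q')).trans (le_sup_left (b := (0, u))))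
  have h2 := hq'.mono ((le_sup_right (a := q)).trans (le_sup_left (b := (0, u))))
  -- With at least u rows of degree 1 in the window, the telescoping column sum ends where
  -- `oddCount` vanishes.
  have hu : u ≤ (q ⊔ q' ⊔ (0, u)).2 := le_sup_right
  generalize q ⊔ q' ⊔ (0, u) = p at h1 h2 hu
  have key := semiInf_wtStar (highestSemiInf lam) c.rev
  change _ = -lam.1 c.rev
  rw [← key, wtStar_eq h1, wtStar_eq h2, Finset.sum_sub_distrib, Finset.sum_sub_distrib,
    sub_left_inj, ← Finset.sum_Ico_add_sum_Ico (c := p.2) (by omega : -(p.1 : ℤ) ≤ 0) (by omega),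
    ← Finset.sum_Ico_add_sum_Ico (c := p.2) (by omega : -(p.1 : ℤ) ≤ 0) (by omega)]
  refine congrArg₂ (· + ·) ?_ ?_
  · refine Finset.sum_congr rfl fun b hb => ?_
    rw [highest_ent_of_neg (Finset.mem_Ico.1 hb).2, occEquiv_ent]
    rfl
  · have hc := c.2
    have e1 : ∑ b ∈ Finset.Ico 0 (p.2 : ℤ), ((highest lam).ent b c : ℤ) = oddCount lam c := by
      rw [Finset.sum_congr rfl fun b hb => highest_ent_of_nonneg (Finset.mem_Ico.1 hb).1 hc]
      have := Finset.sum_Ico_sub_add_one (g := fun b => oddCount lam (b + c))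
        (Int.natCast_nonneg p.2)
      simp only [add_right_comm _ (1 : ℤ)] at this
      rw [this, oddCount_of_le (x := p.2 + c) (by omega), zero_add, sub_zero]
    have e2 : (u : ℤ) - 1 - (c.rev : ℕ) = c := by
      rw [Fin.val_rev]
      omega
    simp only [occEquiv_ent]
    change _ = ∑ b ∈ Finset.Ico 0 (p.2 : ℤ), ((highestWord lam c.rev).occ b : ℤ)
    rw [e1, Finset.sum_congr rfl fun b hb =>
      highestWord_occ_of_nonneg (Finset.mem_Ico.1 hb).1 c.rev, e2, Finset.sum_ite_eq',
      if_pos (Finset.mem_Ico.2 ⟨by omega, by omega⟩)]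

/-- A sufficient condition for being a highest weight element for `𝔤𝔩_u`. -/
theorem eStar_eq_none_of_rows {j : Fin (u - 1)}
    (hneg : ∀ b < 0, A.ent b (j + 1) ≤ A.ent b j)
    (hnonneg : ∀ b ≥ 0, A.ent b (j + 1) = A.ent (b + 1) j) :
    (crystalStar u).op true j A = none := by
  obtain ⟨p, hp⟩ := A.exists_within
  rw [opStar_eq_none hp]
  refine tot_rows_fst_eq_zero.2 fun b hb => ?_
  rw [Finset.mem_Ico] at hb
  simp only [rowSig_diff]
  -- The column j + 1 is the column j shifted by one row, so the sum of the differences telescopes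
  -- to a single entry. It exactly absorbs the ε of the row below.
  have tail : ∀ x : ℤ, 0 ≤ x → x ≤ p.2 →
      ∑ b' ∈ Finset.Ico x p.2, ((A.ent b' j : ℤ) - A.ent b' (j + 1)) = A.ent x j := by
    intro x hx hxp
    have h := Finset.sum_Ico_sub_add_one (g := fun b => (A.ent b j : ℤ)) hxp
    rw [hp.2.1 p.2 le_rfl, Nat.cast_zero, sub_zero] at h
    rw [← h]
    refine Finset.sum_congr rfl fun b' hb' => ?_
    rw [hnonneg b' (hx.trans (Finset.mem_Ico.1 hb').1)]
  rw [rowSig_fst]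
  split_ifs with h0
  · rw [Nat.sub_eq_zero_of_le (hneg b h0), Nat.cast_zero,
      ← Finset.sum_Ico_add_sum_Ico (by omega : b + 1 ≤ 0) (by omega), tail 0 le_rfl (by omega)]
    refine add_nonneg (Finset.sum_nonneg fun b' hb' => ?_) (Nat.cast_nonneg _)
    have := hneg b' (Finset.mem_Ico.1 hb').2
    omega
  · rw [tail (b + 1) (by omega) (by omega), hnonneg b (by omega)]

theorem eStar_highest (lam : GenPartition u) (j : Fin (u - 1)) :
    (crystalStar u).op true j (highest lam) = none := by
  have hj := j.2
  refine eStar_eq_none_of_rows (fun b hb => ?_) fun b hb => ?_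
  · have h1 := highest_ent_of_neg (lam := lam) hb ⟨j, by omega⟩
    have h2 := highest_ent_of_neg (lam := lam) hb ⟨j + 1, by omega⟩
    simp only at h1 h2
    rw [h1, h2, highestWord_occ, highestWord_occ, if_pos hb, if_pos hb]
    have := lam.2 (Fin.rev_le_rev.2 (Fin.mk_le_mk.2 (by omega) :
      (⟨j, by omega⟩ : Fin u) ≤ ⟨j + 1, by omega⟩))
    split_ifs <;> omega
  · have h1 := highest_ent_of_nonneg (lam := lam) hb (c := j + 1) (by omega)
    have h2 := highest_ent_of_nonneg (lam := lam) (b := b + 1) (by omega) (c := j) (by omega)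
    have e : b + ((j + 1 : ℕ) : ℤ) = b + 1 + (j : ℕ) := by push_cast; ring
    rw [e, ← h2] at h1
    exact_mod_cast h1

theorem highestRational_letter_of_pos {mu : GenPartition u}
    {p : {p : Fin u × ℤ // InDiagram mu p}} (h : 0 < p.1.2) :
    (highestRational mu).letter p = p.1.1 := by
  simp [RationalTableau.letter, highestRational, h]

theorem highestRational_letter_of_not_pos {mu : GenPartition u}
    {p : {p : Fin u × ℤ // InDiagram mu p}} (h : ¬ 0 < p.1.2) :
    ((highestRational mu).letter p : ℕ) = u - 1 - (p.1.1 + negColLength mu p.1.2 - u) := by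
  simp [RationalTableau.letter, highestRational, h]

/-- Positive columns consist of the smallest letters, and negative ones of the duals of the largest,
so in both cases the row of the matrix is an initial segment. -/
theorem eStar_highestRational {mu : GenPartition u} (N : ℕ) (j : Fin (u - 1)) :
    (crystalStar u).op true j ((highestRational mu).matrix N) = none := by
  have hj := j.2
  refine eStar_eq_none_of_rows (fun b hb => ?_) fun b hb => ?_
  · rw [RationalTableau.matrix_ent]
    unfold RationalTableau.ent
    split_ifs with h1 h2
    · exact le_rfl
    · refine absurd ⟨hb, by omega, ?_⟩ h2
      replace h1 := h1.2.2
      by_cases h0 : 0 ≤ b + N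
      · obtain ⟨⟨⟨k, x⟩, hp⟩, rfl : x = _, hk⟩ := h1.2 h0
        rw [highestRational_letter_of_pos (colIndex_pos.2 h0)] at hk
        simp only at hk
        rw [inDiagram_colIndex, if_pos h0] at hp
        refine iff_of_true ⟨⟨(⟨j, by omega⟩, colIndex N b), ?_⟩, rfl, ?_⟩ h0
        · rw [inDiagram_colIndex, if_pos h0]
          exact lt_of_lt_of_le hp (mu.2 (Fin.le_def.2 (by simp only; omega)))
        · rw [highestRational_letter_of_pos (colIndex_pos.2 h0)]
      · refine iff_of_false ?_ h0
        have hpos : ¬ 0 < colIndex N b := fun h => h0 (colIndex_pos.1 h)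
        rintro ⟨⟨⟨k, x⟩, hp⟩, rfl : x = _, hk⟩
        refine h0 (h1.1 ?_)
        rw [highestRational_letter_of_not_pos hpos] at hk
        have hlen : negColLength mu (colIndex N b) ≤ u := by
          simpa [negColLength] using Finset.card_filter_le (Finset.univ : Finset (Fin u)) _
        simp only at hk
        have hk2 := k.2
        have hdiag : InDiagram mu (⟨k - 1, by omega⟩, colIndex N b) := by
          rw [inDiagram_colIndex, if_neg h0]
          by_contra hne
          have hlt : colIndex N b < mu.1 ⟨k - 1, by omega⟩ := by
            rw [colIndex, if_neg h0]
            omega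
          have := negColLength_lt mu hlt
          simp only at this
          omega
        refine ⟨⟨(⟨k - 1, by omega⟩, colIndex N b), hdiag⟩, rfl, ?_⟩
        rw [highestRational_letter_of_not_pos hpos]
        simp only
        omega
    · exact Nat.zero_le _
    · exact le_rfl
  · rw [RationalTableau.matrix_ent]
    unfold RationalTableau.ent
    rw [if_neg (by omega), if_neg (by omega)]

/-- A rational tableau that is linked with a highest weight element is the highest one. -/
theorem eq_highestRational {T : Σ mu : GenPartition u, RationalTableau mu}
    (hA : ∀ j, (crystalStar u).op true j A = none)
    (h : Linked (crystalStar u) (rationalCrystal T.1) 0 A T.2) :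
    (crystalStar u).wt A = T.1.1 ∧ T.2 = highestRational T.1 := by
  obtain ⟨N, hN⟩ := T.1.exists_bound
  have b1 := fun k => (hN k).1
  have hl := linked_matrix b1 h
  have e1 := T.2.encodes b1
  have e2 := (highestRational T.1).encodes b1
  have hkill := fun j => hl.op_none.1 (hA j)
  constructor
  · funext c
    have h1 := wtStar_of_top e1.isEvenTop e1.hasShape hkill c
    have h2 := congrFun hl.wt_eq c
    simp only [Pi.add_apply] at h2
    omega
  · rw [← e1.isEvenTop.eq_of_top e2.isEvenTop hkill (eStar_highestRational N) e1.hasShape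
      e2.hasShape] at e2
    exact e1.injective e2

end FockMatrix

/-! ### Minimality of H^λ and the highest weight elements -/

namespace FockWord

/-- From a negative letter on, the word decreases strictly, and eventually it coincides with the
vacuum of charge c. So it cannot start below that vacuum. -/
theorem HasCharge.neg_le_letter {w : FockWord} {c : ℤ} (h : w.HasCharge c) {k : ℕ}
    (hk : w.letter k < 0) : -((k : ℤ) + 1 + c) ≤ w.letter k := by
  have step : ∀ n : ℕ, w.letter (k + n) ≤ w.letter k - n := by
    intro n
    induction n with
    | zero => simp
    | succ n ih =>
      have h1 := w.mono (k + n)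
      have h2 := w.degree_of_eq (k + n)
      rw [← add_assoc]
      push_cast
      omega
  obtain ⟨M, hM⟩ := eventually_atTop.1 h
  have h1 := step M
  have h2 := hM (k + M) (by omega)
  push_cast at h2
  omega

end FockWord

namespace FockMatrix

open Grid Signature CrystalData

variable {u : ℕ} {lam : GenPartition u} {A : FockMatrix u}

/-- Induction from the last component to the left. In the last one, a negative letter at such an
index would lie below the vacuum. Each further step to the left gains one, because equality with the
neighbour is forbidden for letters of degree 1. -/
theorem le_letter_of_semiInf (t : semiInfTableaux lam) (n : ℕ) (c : Fin u) (hn : n + c + 1 = u)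
    {k : ℕ} (hk : (k : ℤ) + 1 + lam.1 c ≤ 0) : (n : ℤ) ≤ (t.1 c).letter k := by
  induction n generalizing c k with
  | zero =>
    by_contra hneg
    have := (t.2.1 c).neg_le_letter (k := k) (by omega)
    omega
  | succ n ih =>
    have hle : lam.1 ⟨c + 1, by omega⟩ ≤ lam.1 c := lam.2 (Fin.le_def.2 (by simp))
    have h1 := ih ⟨c + 1, by omega⟩ (by simp only; omega)
      (k := k + (lam.1 c - lam.1 ⟨c + 1, by omega⟩).toNat) (by push_cast; omega)
    have h2 := t.2.2 c ⟨c + 1, by omega⟩ rfl k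
    push_cast
    omega

/-- The letters of `H^λ` are the smallest possible ones. -/
theorem highestWord_letter_le (t : semiInfTableaux lam) (c : Fin u) (k : ℕ) :
    (highestWord lam c).letter k ≤ (t.1 c).letter k := by
  have hc := c.2
  simp only [highestWord]
  split_ifs with h
  · have := le_letter_of_semiInf t (u - 1 - c) c (by omega) h
    omega
  · by_contra hne
    have := (t.2.1 c).neg_le_letter (k := k) (by omega)
    omega

/-- Minimality of the letters makes every tail of H^λ at most that of t. Equal weights make the sums
of the tails over the components equal, so all tails agree. -/
theorem eq_highestSemiInf {t : semiInfTableaux lam}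
    (h : (crystal u).wt (occEquiv u t.1) = (crystal u).wt (occEquiv u (highestSemiInf lam).1)) :
    t = highestSemiInf lam := by
  obtain ⟨q, hq⟩ := (occEquiv u t.1).exists_within
  obtain ⟨q', hq'⟩ := (occEquiv u (highestSemiInf lam).1).exists_within
  have h1 := hq.mono (le_sup_left (b := q'))
  have h2 := hq'.mono (le_sup_right (a := q))
  generalize q ⊔ q' = p at h1 h2
  have c1 : ∀ c, IsColumn p (t.1 c).occ := fun c => by
    simpa only [occEquiv_ent] using isColumn_ent h1 c
  have c2 : ∀ c, IsColumn p (highestWord lam c).occ := fun c => by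
    have := isColumn_ent h2 c
    simp only [occEquiv_ent] at this
    exact this
  have hle : ∀ b c, colTail p.2 (highestWord lam c).occ b ≤ colTail p.2 (t.1 c).occ b := by
    intro b c
    rcases Nat.eq_zero_or_pos (colTail p.2 (highestWord lam c).occ b) with h0 | h0
    · omega
    · have h3 := (FockWord.le_letter_iff (c2 c)).2 (Nat.sub_lt h0 one_pos)
      have h4 := (FockWord.le_letter_iff (c1 c)).1 (h3.trans (highestWord_letter_le t c _))
      omega
  have hrow : ∀ b, ∑ c, (highestWord lam c).occ b = ∑ c, (t.1 c).occ b := by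
    intro b
    have h3 := congrArg (fun x : GWeight => x.2 b) h
    simp only [wt_snd, Finset.sum_sub_distrib, sub_left_inj] at h3
    rw [Finset.sum_range, Finset.sum_range] at h3
    simp only [occEquiv_ent] at h3
    exact_mod_cast h3.symm
  have htail : ∀ b c, colTail p.2 (highestWord lam c).occ b = colTail p.2 (t.1 c).occ b := by
    intro b
    have hsum : ∑ c, colTail p.2 (highestWord lam c).occ b = ∑ c, colTail p.2 (t.1 c).occ b := by
      unfold colTail
      rw [Finset.sum_comm, Finset.sum_comm (s := Finset.univ)]
      exact Finset.sum_congr rfl fun b _ => hrow b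
    exact fun c => (Finset.sum_eq_sum_iff_of_le fun c _ => hle b c).1 hsum c (Finset.mem_univ c)
  refine Subtype.ext (funext fun c => FockWord.occ_injective (funext fun b => ?_))
  have h3 := colTail_eq (c1 c) b
  have h4 := colTail_eq (c2 c) b
  rw [htail, htail, h3] at h4
  exact Nat.add_right_cancel h4

/-- Being killed by the e*_j fixes the rational tableau, with shape given by the 𝔤𝔩_u-weight.
Duality of the shapes gives λ, and the 𝔤-weight identifies the semi-infinite tableau. -/
theorem varpi_highest (lam : GenPartition u) :
    varpi (highest lam) = (⟨lam, highestSemiInf lam⟩, ⟨lam.star, highestRational lam.star⟩) := by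
  have hspec := varpi_spec (highest lam)
  have hshape := hspec.shape
  obtain ⟨hw, hT⟩ := eq_highestRational (eStar_highest lam) hspec.2
  generalize varpi (highest lam) = z at *
  obtain ⟨⟨lam', t⟩, ⟨mu, T⟩⟩ := z
  simp only at hshape hw hT
  have hmu : mu = lam.star :=
    Subtype.ext (funext fun c => (congrFun hw c).symm.trans (wtStar_highest lam c))
  have hlam : lam' = lam := by
    refine Subtype.ext (funext fun c => ?_)
    have := congrFun (congrArg Subtype.val (hshape.symm.trans hmu)) c.rev
    simp only [GenPartition.star, Fin.rev_rev] at this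
    omega
  subst hlam hmu hT
  have ht : t = highestSemiInf lam' := eq_highestSemiInf <| by
    rw [← wt_highest, (linked_occ hspec.1).wt_eq, add_zero]
  rw [ht]

/-- Duality of the shapes leaves only pairs with μ = λ*, and such a pair already belongs to 𝒜_λ; a
matrix is determined by its pair. -/
theorem highestWeightElements_eq (u : ℕ) :
    highestWeightElements u = {A | ∃ lam : GenPartition u, A = highest lam} := by
  ext A
  constructor
  · rintro ⟨lam, mu, hA⟩
    refine ⟨lam, ?_⟩
    have h1 := varpi_spec A
    have h2 := varpi_spec (highest lam)
    have h3 := h1.shape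
    rw [hA] at h1 h3
    simp only at h3
    subst h3
    rw [varpi_highest] at h2
    exact h2.injective h1
  · rintro ⟨lam, rfl⟩
    exact ⟨lam, lam.star, varpi_highest lam⟩

end FockMatrix

theorem theorem5p9 (u : ℕ) (hu : 1 ≤ u) :
    -- `B(λ)` and `B_u(μ)` are stable under the operators of the crystals that contain them
    (∀ lam : GenPartition u, (fockPower u).Stable (Subtype.val : semiInfTableaux lam → _)) ∧
    (∀ mu : GenPartition u,
      (glRationalLetters u).words.Stable (RationalTableau.reading (mu := mu))) ∧
    -- `ℳ^u` is a bicrystal, and a model of `ℱ^{⊗u}`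
    IsBicrystal (FockMatrix.crystal u) (FockMatrix.crystalStar u) ∧
    (∃ ψ : (Fin u → FockWord) ≃ FockMatrix u,
      (∀ w b c, (ψ w).entry b c = (w c).occ b) ∧
      (fockPower u).IsIso (FockMatrix.crystal u) ψ) ∧
    -- `ϖ` is well defined
    (∀ A : FockMatrix u, (∃! t, A.EquivSemiInf t) ∧ ∃! T, A.EquivRational T) ∧
    -- the highest weight elements
    FockMatrix.highestWeightElements u = {A | ∃ lam : GenPartition u, A = FockMatrix.highest lam} ∧
    -- the decomposition
    IsBicrystal (CauchySum.crystal u) (CauchySum.crystalStar u) ∧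
    ∃ Φ : FockMatrix u ≃ CauchySum u,
      (∀ A, FockMatrix.varpi A = (⟨(Φ A).1, (Φ A).2.1⟩, ⟨(Φ A).1.star, (Φ A).2.2⟩)) ∧
      (FockMatrix.crystal u).IsIso (CauchySum.crystal u) Φ ∧
      (FockMatrix.crystalStar u).IsIso (CauchySum.crystalStar u) Φ := by
  exact ⟨FockMatrix.semiInf_stable, rational_stable, FockMatrix.isBicrystal u,
    ⟨FockMatrix.occEquiv u, FockMatrix.occEquiv_entry, FockMatrix.isIso_occEquiv u⟩,
    fun A => ⟨FockMatrix.existsUnique_equivSemiInf A, FockMatrix.existsUnique_equivRational A⟩,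
    FockMatrix.highestWeightElements_eq u,
    (FockMatrix.isBicrystal u).of_isIso (FockMatrix.isIso_sumEquiv u) (FockMatrix.isIsoStar_sumEquiv u),
    ⟨FockMatrix.sumEquiv u, FockMatrix.varpi_sumEquiv, FockMatrix.isIso_sumEquiv u,
      FockMatrix.isIsoStar_sumEquiv u⟩⟩
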